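/- Let $\Bbbk$ be a field of characteristic $\neq 2$. Super-coalgebras are super-cocommutative: a super-coalgebra is a super-vector space $\mathbb D=\mathbb D_0\oplus\mathbb D_1$ with a coalgebra structure that preserves the parity and satisfies $c\circ\Delta=\Delta$, where $c(v\otimes w)=(-1)^{|v||w|}w\otimes v$. Let $\mathbb J$ be a Hopf superalgebra (super-cocommutative, with antipode $S$) over $\Bbbk$, and let $\mathbb K\subset\mathbb J$ be a Hopf sub-superalgebra. Let $$J=\{a\in\mathbb J:\Delta(a)\in\mathbb J_0\otimes\mathbb J_0\},\qquad K=\{a\in\mathbb K:\Delta(a)\in\mathbb K_0\otimes\mathbb K_0\}$$ be the largest purely even Hopf sub-superalgebras of $\mathbb J$ and of $\mathbb K$; they are cocommutative Hopf algebras with $K\subset J$. Let $\mathsf V_{\mathbb J}$ and $\mathsf V_{\mathbb K}$ be the spaces of odd primitive elements ($\Delta(v)=1\otimes v+v\otimes 1$) of $\mathbb J$ and $\mathbb K$, regarded as left $K$-modules by the left adjoint action $a\triangleright v=a_{(1)}vS(a_{(2)})$, and put $\mathsf Q=\mathsf V_{\mathbb J}/\mathsf V_{\mathbb K}$. Let $K$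 act diagonally on the exterior algebra $\wedge(\mathsf Q)$, which is a super-coalgebra in which the elements of $\mathsf Q$ are odd and primitive. Let $J/\!/K=J/JK^+$ with $K^+=\operatorname{Ker}(\varepsilon_K)$, and let $J\otimes_K\mathsf Q$ be given the right $J/\!/K$-coaction $a\otimes q\mapsto(a_{(1)}\otimes q)\otimes\overline{a_{(2)}}$. Let $J\otimes_K\wedge(\mathsf Q)$ be given the coproduct $a\otimes u\mapsto(a_{(1)}\otimes u_{(1)})\otimes(a_{(2)}\otimes u_{(2)})$ and the counit $a\otimes u\mapsto\varepsilon(a)\varepsilon(u)$, the grading with $n$-th component $J\otimes_K\wedge^n(\mathsf Q)$, the parity given by the degree modulo $2$, the projection $\omega:J\otimes_K\wedge(\mathsf Q)\to J/\!/K$ onto the component of degree $0$ and the projection $\pi:J\otimes_K\wedge(\mathsf Q)\to J\otimes_K\mathsf Q$ onto the component of degree $1$. For a cocommutative (purely even) coalgebra $C$ and a purely odd right $C$-comodule $(\mathsf V,\rho)$, a *$C$-super-coalgebra on $\mathsf V$* is a triple $(\mathbb E,\omega_{\mathbb E},\pi_{\mathbb E})$ of a super-coalgebra $\mathbb E$,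 a super-coalgebra map $\omega_{\mathbb E}:\mathbb E\to C$ and a parity-preserving $C$-colinear map $\pi_{\mathbb E}:\mathbb E\to\mathsf V$, where $C$ coacts on $\mathbb E$ by $(\mathrm{id}\otimes\omega_{\mathbb E})\circ\Delta$. Morphisms are the $C$-colinear super-coalgebra maps compatible with the maps to $\mathsf V$, and *co-free* means terminal in the resulting category. Let $\operatorname{coF}^C(\mathsf V)$ be the explicit graded $C$-super-coalgebra on $\mathsf V$ with $\operatorname{coF}^C(\mathsf V)(0)=C$ and, for $n\ge1$, $\operatorname{coF}^C(\mathsf V)(n)=(\mathsf V^{\square_C n})^{\mathfrak S_n}\subset\mathsf V^{\otimes n}$ (so that the component of degree $1$ is $\mathsf V$). Here $\mathsf V^{\square_C n}$ is the cotensor power, that is, the set of tensors on which the $C$-coactions of all $n$ tensor factors agree, and $\mathfrak S_n$ permutes the factors with the sign of the permutation. The coproduct of $\operatorname{coF}^C(\mathsf V)$ has components $(i,j)$ given by deconcatenation $\mathsf V^{\otimes(i+j)}=\mathsf V^{\otimes i}\otimes\mathsf V^{\otimes j}$ if $i,j\ge1$, by the coaction of $C$ if exactly one of $i,j$ is $0$,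 and by $\Delta_C$ if $i=j=0$. Then: 1. $J/\!/K$ is a cocommutative coalgebra, $J\otimes_K\mathsf Q$ is a right $J/\!/K$-comodule, and $J\otimes_K\wedge(\mathsf Q)$ is a graded coalgebra. 2. $(J\otimes_K\wedge(\mathsf Q),\omega,\pi)$ is a $J/\!/K$-super-coalgebra on $J\otimes_K\mathsf Q$, and it is co-free: for every $J/\!/K$-super-coalgebra $(\mathbb E,\omega_{\mathbb E},\pi_{\mathbb E})$ on $J\otimes_K\mathsf Q$ there is a unique morphism $(\mathbb E,\omega_{\mathbb E},\pi_{\mathbb E})\to(J\otimes_K\wedge(\mathsf Q),\omega,\pi)$. 3. The canonical map $$J\otimes_K\wedge(\mathsf Q)\longrightarrow\operatorname{coF}^{J/\!/K}(J\otimes_K\mathsf Q),$$ whose component of degree $0$ is $\omega$ and whose component of degree $n\ge1$ is $x\mapsto\pi(x_{(1)})\otimes\cdots\otimes\pi(x_{(n)})$, is an isomorphism of graded coalgebras. -/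

import Mathlib

open scoped TensorProduct DirectSum

namespace SuperFormal

section Convolution

variable {k C A : Type*} [Field k] [AddCommGroup C] [Module k C] [Coalgebra k C]
  [Ring A] [Algebra k A]

/-- Over a cocommutative coalgebra, linear maps whose values commute up to a scalar commute up to
that scalar for the convolution product. -/
theorem conv_comm [Coalgebra.IsCocomm k C] (f g : WithConv (C →ₗ[k] A)) (s : k)
    (h : ∀ x y, f x * g y = s • (g y * f x)) : f * g = s • (g * f) := by
  ext c
  have key : ∀ t : C ⊗[k] C, LinearMap.mul' k A (TensorProduct.map f.ofConv g.ofConv t) =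
      s • LinearMap.mul' k A (TensorProduct.map g.ofConv f.ofConv (TensorProduct.comm k C C t)) := by
    intro t
    induction t with
    | zero => simp
    | add x y hx hy => simp only [map_add, hx, hy, smul_add]
    | tmul x y => simpa using h x y
  have := key (Coalgebra.comul c)
  rw [Coalgebra.comm_comul] at this
  simpa [LinearMap.convMul_apply] using this

/-- Postcomposition with an algebra map, on convolution algebras. -/
noncomputable def convPost {k : Type*} [Field k] (K : Type*) [AddCommGroup K] [Module k K] [Coalgebra k K]
    {A B : Type*} [Ring A] [Algebra k A] [Ring B] [Algebra k B] (h : A →ₐ[k] B) :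
    WithConv (K →ₗ[k] A) →ₐ[k] WithConv (K →ₗ[k] B) :=
  AlgHom.ofLinearMap
    ((WithConv.linearEquiv k (K →ₗ[k] B)).symm.toLinearMap ∘ₗ
      (LinearMap.llcomp k K A B h.toLinearMap) ∘ₗ
      (WithConv.linearEquiv k (K →ₗ[k] A)).toLinearMap)
    (by
      ext c
      change h (algebraMap k A _) = algebraMap k B _
      simp)
    (fun f g ↦ by
      ext c
      exact LinearMap.congr_fun (LinearMap.algHom_comp_convMul_distrib h f g) c)

theorem convPost_apply {k K : Type*} [Field k] [AddCommGroup K] [Module k K] [Coalgebra k K]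
    {A B : Type*} [Ring A] [Algebra k A] [Ring B] [Algebra k B] (h : A →ₐ[k] B)
    (f : WithConv (K →ₗ[k] A)) (c : K) : convPost K h f c = h (f c) := rfl

end Convolution

section Exterior

variable {k Q : Type*} [Field k] [AddCommGroup Q] [Module k Q]

theorem ι_mem_extPow (q : Q) : ExteriorAlgebra.ι k q ∈ ⋀[k]^1 Q := by
  simpa only [pow_one] using LinearMap.mem_range_self (ExteriorAlgebra.ι k) q

/-- The coproduct of the exterior algebra: the algebra map to the super tensor square with
`q ↦ q ⊗ 1 + 1 ⊗ q`. -/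
noncomputable def extComulHom (k Q : Type*) [Field k] [AddCommGroup Q] [Module k Q] :
    ExteriorAlgebra k Q →ₐ[k]
      GradedTensorProduct k (fun i : ℕ ↦ ⋀[k]^i Q) (fun i : ℕ ↦ ⋀[k]^i Q) :=
  ExteriorAlgebra.lift k
    ⟨(GradedTensorProduct.includeLeft (fun i : ℕ ↦ ⋀[k]^i Q)
          (fun i : ℕ ↦ ⋀[k]^i Q)).toLinearMap ∘ₗ ExteriorAlgebra.ι k +
        (GradedTensorProduct.includeRight (fun i : ℕ ↦ ⋀[k]^i Q)
          (fun i : ℕ ↦ ⋀[k]^i Q)).toLinearMap ∘ₗ ExteriorAlgebra.ι k, by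
      intro q
      have hq : ExteriorAlgebra.ι k q ∈ ⋀[k]^1 Q := ι_mem_extPow q
      have h1 := GradedTensorProduct.tmul_coe_mul_coe_tmul (R := k) (fun i : ℕ ↦ ⋀[k]^i Q)
        (fun i : ℕ ↦ ⋀[k]^i Q) 1 ⟨_, hq⟩ ⟨_, hq⟩ 1
      have h2 := GradedTensorProduct.tmul_one_mul_one_tmul (R := k) (fun i : ℕ ↦ ⋀[k]^i Q)
        (fun i : ℕ ↦ ⋀[k]^i Q) (ExteriorAlgebra.ι k q) (ExteriorAlgebra.ι k q)
      simp only [LinearMap.add_apply, LinearMap.comp_apply, AlgHom.toLinearMap_apply, add_mul,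
        mul_add]
      rw [← map_mul (GradedTensorProduct.includeLeft _ _),
        ← map_mul (GradedTensorProduct.includeRight _ _), ExteriorAlgebra.ι_sq_zero, map_zero,
        map_zero]
      simp only [GradedTensorProduct.includeLeft_apply, GradedTensorProduct.includeRight_apply]
      rw [h1, h2]
      simp⟩

/-- The parity involution of the exterior algebra. -/
noncomputable def extSign (k Q : Type*) [Field k] [AddCommGroup Q] [Module k Q] :
    ExteriorAlgebra k Q →ₐ[k] ExteriorAlgebra k Q :=
  ExteriorAlgebra.map (-LinearMap.id)

theorem extSign_of_mem (n : ℕ) (u : ExteriorAlgebra k Q) (hu : u ∈ ⋀[k]^n Q) :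
    extSign k Q u = (-1 : k) ^ n • u := by
  induction hu using Submodule.pow_induction_on_left' with
  | algebraMap r => simp
  | add x y i _ _ hx hy => simp [hx, hy]
  | mem_mul m hm i x hx ih =>
    obtain ⟨q, rfl⟩ := hm
    rw [map_mul, ih, pow_succ']
    simp [extSign]

/-- The coproduct as a linear map into the underlying tensor square. -/
noncomputable def extComul (k Q : Type*) [Field k] [AddCommGroup Q] [Module k Q] :
    ExteriorAlgebra k Q →ₗ[k] ExteriorAlgebra k Q ⊗[k] ExteriorAlgebra k Q :=
  (GradedTensorProduct.of k (fun i : ℕ ↦ ⋀[k]^i Q) (fun i : ℕ ↦ ⋀[k]^i Q)).symm.toLinearMap ∘ₗ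
    (extComulHom k Q).toLinearMap

/-- Left multiplication by `q ⊗ 1 + 1 ⊗ q` on the super tensor square. -/
noncomputable def extLeft (q : Q) :
    ExteriorAlgebra k Q ⊗[k] ExteriorAlgebra k Q →ₗ[k]
      ExteriorAlgebra k Q ⊗[k] ExteriorAlgebra k Q :=
  TensorProduct.map (LinearMap.mulLeft k (ExteriorAlgebra.ι k q)) LinearMap.id +
    TensorProduct.map (extSign k Q).toLinearMap (LinearMap.mulLeft k (ExteriorAlgebra.ι k q))

theorem of_extLeft (q : Q) (x : ExteriorAlgebra k Q ⊗[k] ExteriorAlgebra k Q) :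
    GradedTensorProduct.of k (fun i : ℕ ↦ ⋀[k]^i Q) (fun i : ℕ ↦ ⋀[k]^i Q) (extLeft q x) =
      extComulHom k Q (ExteriorAlgebra.ι k q) *
        GradedTensorProduct.of k (fun i : ℕ ↦ ⋀[k]^i Q) (fun i : ℕ ↦ ⋀[k]^i Q) x := by
  have hq : ExteriorAlgebra.ι k q ∈ ⋀[k]^1 Q := ι_mem_extPow q
  induction x with
  | zero => simp
  | add x y hx hy => simp only [map_add, hx, hy, mul_add]
  | tmul u v =>
    induction u using DirectSum.Decomposition.inductionOn (fun i : ℕ ↦ ⋀[k]^i Q) with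
    | zero => simp
    | add a b ha hb => simp only [TensorProduct.add_tmul, map_add, ha, hb, mul_add]
    | @homogeneous i u =>
      have h1 := GradedTensorProduct.tmul_coe_mul_coe_tmul (R := k) (fun i : ℕ ↦ ⋀[k]^i Q)
        (fun i : ℕ ↦ ⋀[k]^i Q) 1 ⟨_, hq⟩ u v
      have h2 := GradedTensorProduct.tmul_one_mul_coe_tmul (R := k) (fun i : ℕ ↦ ⋀[k]^i Q)
        (fun i : ℕ ↦ ⋀[k]^i Q) (ExteriorAlgebra.ι k q) u v
      simp only [extComulHom, ExteriorAlgebra.lift_ι_apply, LinearMap.add_apply,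
        LinearMap.comp_apply, AlgHom.toLinearMap_apply, add_mul,
        GradedTensorProduct.includeLeft_apply, GradedTensorProduct.includeRight_apply]
      rw [h1, h2]
      simp only [extLeft, LinearMap.add_apply, TensorProduct.map_tmul, LinearMap.mulLeft_apply,
        LinearMap.id_apply, AlgHom.toLinearMap_apply, map_add, extSign_of_mem i _ u.2, one_mul]
      congr 1
      rw [← TensorProduct.smul_tmul', Units.smul_def, map_smul, ← Int.cast_smul_eq_zsmul k]
      simp

theorem extComul_ι_mul (q : Q) (u : ExteriorAlgebra k Q) :
    extComul k Q (ExteriorAlgebra.ι k q * u) = extLeft q (extComul k Q u) := by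
  apply (GradedTensorProduct.of k (fun i : ℕ ↦ ⋀[k]^i Q) (fun i : ℕ ↦ ⋀[k]^i Q)).injective
  rw [of_extLeft]
  simp [extComul]

theorem extComul_algebraMap (r : k) :
    extComul k Q (algebraMap k _ r) = algebraMap k _ r ⊗ₜ[k] 1 := by
  simp only [extComul, LinearMap.comp_apply, AlgHom.toLinearMap_apply, AlgHom.commutes]
  rfl

theorem extComul_extSign (u : ExteriorAlgebra k Q) :
    extComul k Q (extSign k Q u) =
      TensorProduct.map (extSign k Q).toLinearMap (extSign k Q).toLinearMap (extComul k Q u) := by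
  induction u using CliffordAlgebra.left_induction with
  | algebraMap r =>
    rw [AlgHom.commutes, extComul_algebraMap]; simp
  | add x y hx hy => simp only [map_add, hx, hy]
  | ι_mul u q ih =>
    change extComul k Q (extSign k Q (ExteriorAlgebra.ι k q * u)) = TensorProduct.map _ _
      (extComul k Q (ExteriorAlgebra.ι k q * u))
    have : extSign k Q (ExteriorAlgebra.ι k q) = ExteriorAlgebra.ι k (-q) := by simp [extSign]
    rw [map_mul, this, extComul_ι_mul, extComul_ι_mul, ih]
    generalize extComul k Q u = x
    induction x with
    | zero => simp
    | add x y hx hy => simp only [map_add, hx, hy]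
    | tmul a b => simp [extLeft, this, TensorProduct.neg_tmul, TensorProduct.tmul_neg]

/-- The exterior algebra as a coalgebra: elements of `Q` are primitive. -/
noncomputable instance extCoalgebra : Coalgebra k (ExteriorAlgebra k Q) where
  comul := extComul k Q
  counit := (ExteriorAlgebra.algebraMapInv : ExteriorAlgebra k Q →ₐ[k] k).toLinearMap
  coassoc := by
    refine LinearMap.ext fun u ↦ ?_
    simp only [LinearMap.comp_apply, LinearEquiv.coe_coe]
    induction u using CliffordAlgebra.left_induction with
    | algebraMap r =>
      rw [extComul_algebraMap, LinearMap.rTensor_tmul, LinearMap.lTensor_tmul, extComul_algebraMap]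
      have := extComul_algebraMap (k := k) (Q := Q) 1
      rw [map_one] at this
      rw [this]
      simp
    | add x y hx hy => simp only [map_add, hx, hy]
    | ι_mul u q ih =>
      change TensorProduct.assoc k _ _ _ (LinearMap.rTensor _ _
        (extComul k Q (ExteriorAlgebra.ι k q * u))) = LinearMap.lTensor _ _
        (extComul k Q (ExteriorAlgebra.ι k q * u))
      rw [extComul_ι_mul]
      have h1 : ∀ x, LinearMap.rTensor _ (extComul k Q) (extLeft q x) =
          TensorProduct.map (extLeft q) LinearMap.id (LinearMap.rTensor _ (extComul k Q) x) +
            TensorProduct.map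
              (TensorProduct.map (extSign k Q).toLinearMap (extSign k Q).toLinearMap)
              (LinearMap.mulLeft k (ExteriorAlgebra.ι k q))
              (LinearMap.rTensor _ (extComul k Q) x) := by
        intro x
        induction x with
        | zero => simp
        | add x y hx hy => simp only [map_add, hx, hy]; abel
        | tmul a b =>
          simp only [extLeft, LinearMap.add_apply, TensorProduct.map_tmul, map_add,
            LinearMap.rTensor_tmul, AlgHom.toLinearMap_apply, extComul_extSign,
            LinearMap.mulLeft_apply, extComul_ι_mul, LinearMap.id_apply]
      have h2 : ∀ x, LinearMap.lTensor _ (extComul k Q) (extLeft q x) =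
          TensorProduct.map (LinearMap.mulLeft k (ExteriorAlgebra.ι k q)) LinearMap.id
              (LinearMap.lTensor _ (extComul k Q) x) +
            TensorProduct.map (extSign k Q).toLinearMap (extLeft q)
              (LinearMap.lTensor _ (extComul k Q) x) := by
        intro x
        induction x with
        | zero => simp
        | add x y hx hy => simp only [map_add, hx, hy]; abel
        | tmul a b =>
          simp only [extLeft, LinearMap.add_apply, TensorProduct.map_tmul, map_add,
            LinearMap.lTensor_tmul, LinearMap.mulLeft_apply, LinearMap.id_apply]
          congr 2
          exact extComul_ι_mul q b
      rw [h1, h2, ← ih]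
      generalize LinearMap.rTensor _ (extComul k Q) (extComul k Q u) = x
      induction x with
      | zero => simp
      | add x y hx hy =>
        simp only [map_add] at hx hy ⊢
        rw [← add_add_add_comm, hx, hy]; abel
      | tmul y c =>
        induction y with
        | zero => simp
        | add x y hx hy =>
          simp only [TensorProduct.add_tmul, map_add] at hx hy ⊢
          rw [add_add_add_comm, hx, hy]; abel
        | tmul a b =>
          simp [extLeft, TensorProduct.add_tmul, TensorProduct.tmul_add, add_assoc]
  rTensor_counit_comp_comul := by
    refine LinearMap.ext fun u ↦ ?_
    simp only [LinearMap.comp_apply]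
    apply (TensorProduct.lid k _).injective
    induction u using CliffordAlgebra.left_induction with
    | algebraMap r =>
      rw [extComul_algebraMap]
      simp [ExteriorAlgebra.algebraMapInv, Algebra.algebraMap_eq_smul_one]
    | add x y hx hy => simp only [map_add, hx, hy]
    | ι_mul u q ih =>
      change TensorProduct.lid k _ (LinearMap.rTensor _ _
        (extComul k Q (ExteriorAlgebra.ι k q * u))) = TensorProduct.lid k _ (TensorProduct.mk k _ _
        1 (ExteriorAlgebra.ι k q * u))
      rw [extComul_ι_mul]
      have hs : ∀ a : ExteriorAlgebra k Q, ExteriorAlgebra.algebraMapInv (extSign k Q a) =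
          ExteriorAlgebra.algebraMapInv a := by
        intro a
        have : (ExteriorAlgebra.algebraMapInv : ExteriorAlgebra k Q →ₐ[k] k).comp (extSign k Q) =
            ExteriorAlgebra.algebraMapInv := by
          ext q; simp [extSign, ExteriorAlgebra.algebraMapInv]
        exact DFunLike.congr_fun this a
      have h : ∀ x, TensorProduct.lid k _ (LinearMap.rTensor _
            (ExteriorAlgebra.algebraMapInv : ExteriorAlgebra k Q →ₐ[k] k).toLinearMap
            (extLeft q x)) =
          ExteriorAlgebra.ι k q * TensorProduct.lid k _ (LinearMap.rTensor _
            (ExteriorAlgebra.algebraMapInv : ExteriorAlgebra k Q →ₐ[k] k).toLinearMap x) := by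
        intro x
        induction x with
        | zero => simp
        | add x y hx hy => simp only [map_add, hx, hy, mul_add]
        | tmul a b =>
          simp only [extLeft, LinearMap.add_apply, TensorProduct.map_tmul, map_add,
            LinearMap.rTensor_tmul, AlgHom.toLinearMap_apply, hs, map_mul,
            LinearMap.mulLeft_apply, LinearMap.id_apply, TensorProduct.lid_tmul]
          simp [ExteriorAlgebra.algebraMapInv]
      rw [h, ih]
      simp
  lTensor_counit_comp_comul := by
    refine LinearMap.ext fun u ↦ ?_
    simp only [LinearMap.comp_apply]
    apply (TensorProduct.rid k _).injective
    induction u using CliffordAlgebra.left_induction with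
    | algebraMap r =>
      rw [extComul_algebraMap]
      simp
    | add x y hx hy => simp only [map_add, hx, hy]
    | ι_mul u q ih =>
      change TensorProduct.rid k _ (LinearMap.lTensor _ _
        (extComul k Q (ExteriorAlgebra.ι k q * u))) = TensorProduct.rid k _
          ((TensorProduct.mk k _ _).flip 1 (ExteriorAlgebra.ι k q * u))
      rw [extComul_ι_mul]
      have h : ∀ x, TensorProduct.rid k _ (LinearMap.lTensor _
            (ExteriorAlgebra.algebraMapInv : ExteriorAlgebra k Q →ₐ[k] k).toLinearMap
            (extLeft q x)) =
          ExteriorAlgebra.ι k q * TensorProduct.rid k _ (LinearMap.lTensor _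
            (ExteriorAlgebra.algebraMapInv : ExteriorAlgebra k Q →ₐ[k] k).toLinearMap x) := by
        intro x
        induction x with
        | zero => simp
        | add x y hx hy => simp only [map_add, hx, hy, mul_add]
        | tmul a b =>
          simp only [extLeft, LinearMap.add_apply, TensorProduct.map_tmul, map_add,
            LinearMap.lTensor_tmul, AlgHom.toLinearMap_apply, map_mul,
            LinearMap.mulLeft_apply, LinearMap.id_apply, TensorProduct.rid_tmul]
          simp [ExteriorAlgebra.algebraMapInv]
      rw [h, ih]
      simp

theorem counit_ext (u : ExteriorAlgebra k Q) :
    Coalgebra.counit (R := k) u = ExteriorAlgebra.algebraMapInv u := rfl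

end Exterior

section Action

variable {k K Q : Type*} [Field k] [NeZero (2 : k)] [Ring K] [Bialgebra k K]
  [Coalgebra.IsCocomm k K] [AddCommGroup Q] [Module k Q]

/-- The diagonal action on the exterior algebra, as an algebra map `u ↦ (c ↦ c • u)` to the
convolution algebra. -/
noncomputable def extActHom (act : K →ₗ[k] Q →ₗ[k] Q) :
    ExteriorAlgebra k Q →ₐ[k] WithConv (K →ₗ[k] ExteriorAlgebra k Q) :=
  ExteriorAlgebra.lift k
    ⟨(WithConv.linearEquiv k (K →ₗ[k] ExteriorAlgebra k Q)).symm.toLinearMap ∘ₗ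
        (act.compr₂ (ExteriorAlgebra.ι k)).flip, by
      intro q
      set f := ((WithConv.linearEquiv k (K →ₗ[k] ExteriorAlgebra k Q)).symm.toLinearMap ∘ₗ
        (act.compr₂ (ExteriorAlgebra.ι k)).flip) q with hf
      have h : f * f = (-1 : k) • (f * f) := by
        refine conv_comm f f (-1) fun x y ↦ ?_
        have := ExteriorAlgebra.ι_add_mul_swap (R := k) (act x q) (act y q)
        rw [neg_one_smul]
        exact eq_neg_of_add_eq_zero_left this
      have h2 : (2 : k) • (f * f) = 0 := by
        rw [two_smul]; nth_rewrite 1 [h]; simp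
      exact (smul_eq_zero.mp h2).resolve_left two_ne_zero⟩

/-- The diagonal action of `K` on the exterior algebra:
`c • (q₁ ∧ ⋯ ∧ qₙ) = (c₍₁₎ • q₁) ∧ ⋯ ∧ (c₍ₙ₎ • qₙ)`. -/
noncomputable def extAct (act : K →ₗ[k] Q →ₗ[k] Q) :
    K →ₗ[k] ExteriorAlgebra k Q →ₗ[k] ExteriorAlgebra k Q :=
  ((WithConv.linearEquiv k (K →ₗ[k] ExteriorAlgebra k Q)).toLinearMap ∘ₗ
    (extActHom act).toLinearMap).flip

theorem extAct_apply (act : K →ₗ[k] Q →ₗ[k] Q) (c : K) (u : ExteriorAlgebra k Q) :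
    extAct act c u = extActHom act u c := rfl

theorem extAct_algebraMap (act : K →ₗ[k] Q →ₗ[k] Q) (c : K) (r : k) :
    extAct act c (algebraMap k _ r) = Coalgebra.counit (R := k) c • algebraMap k _ r := by
  rw [extAct_apply, AlgHom.commutes, LinearMap.convAlgebraMap_apply]
  simp [Algebra.algebraMap_eq_smul_one, smul_smul, mul_comm]

theorem extAct_ι (act : K →ₗ[k] Q →ₗ[k] Q) (c : K) (q : Q) :
    extAct act c (ExteriorAlgebra.ι k q) = ExteriorAlgebra.ι k (act c q) := by
  rw [extAct_apply, extActHom, ExteriorAlgebra.lift_ι_apply]; rfl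

theorem extAct_mem (act : K →ₗ[k] Q →ₗ[k] Q) (n : ℕ) (u : ExteriorAlgebra k Q)
    (hu : u ∈ ⋀[k]^n Q) (c : K) : extAct act c u ∈ ⋀[k]^n Q := by
  induction hu using Submodule.pow_induction_on_left' generalizing c with
  | algebraMap r =>
    rw [extAct_algebraMap]
    exact Submodule.smul_mem _ _ (Submodule.algebraMap_mem r)
  | add x y i _ _ hx hy => rw [map_add]; exact Submodule.add_mem _ (hx c) (hy c)
  | mem_mul m hm i x hx ih =>
    obtain ⟨q, rfl⟩ := hm
    rw [extAct_apply, map_mul, LinearMap.convMul_apply]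
    generalize (Coalgebra.comul c : K ⊗[k] K) = t
    induction t with
    | zero => simp
    | add x y hx hy => rw [map_add, map_add]; exact Submodule.add_mem _ hx hy
    | tmul a b =>
      rw [TensorProduct.map_tmul, LinearMap.mul'_apply, ← extAct_apply, ← extAct_apply, extAct_ι]
      change _ ∈ LinearMap.range (ExteriorAlgebra.ι k) ^ (i + 1)
      rw [pow_succ']
      exact Submodule.mul_mem_mul (LinearMap.mem_range_self _ _) (ih b)

theorem counit_extAct (act : K →ₗ[k] Q →ₗ[k] Q) (c : K) (u : ExteriorAlgebra k Q) :
    Coalgebra.counit (R := k) (extAct act c u) =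
      Coalgebra.counit (R := k) c * Coalgebra.counit (R := k) u := by
  induction u using CliffordAlgebra.left_induction generalizing c with
  | algebraMap r =>
    change Coalgebra.counit (extAct act c (algebraMap k (ExteriorAlgebra k Q) r)) = _ *
      Coalgebra.counit (algebraMap k (ExteriorAlgebra k Q) r)
    rw [extAct_algebraMap, map_smul, smul_eq_mul]
  | add x y hx hy => simp only [map_add, hx, hy, mul_add]
  | ι_mul u q ih =>
    change Coalgebra.counit (extAct act c (ExteriorAlgebra.ι k q * u)) = _ *
      Coalgebra.counit (ExteriorAlgebra.ι k q * u)
    have h0 : ∀ q : Q, ExteriorAlgebra.algebraMapInv (R := k) (ExteriorAlgebra.ι k q) = 0 := by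
      intro q; simp [ExteriorAlgebra.algebraMapInv]
    rw [counit_ext, counit_ext, map_mul ExteriorAlgebra.algebraMapInv, h0, zero_mul, mul_zero,
      extAct_apply, map_mul, LinearMap.convMul_apply]
    generalize (Coalgebra.comul c : K ⊗[k] K) = t
    induction t with
    | zero => simp
    | add x y hx hy => rw [map_add, map_add, map_add, hx, hy, add_zero]
    | tmul a b =>
      rw [TensorProduct.map_tmul, LinearMap.mul'_apply, ← extAct_apply, ← extAct_apply, extAct_ι,
        map_mul, h0, zero_mul]

/-- The diagonal action on the tensor square of the exterior algebra. -/
noncomputable def extAct₂ (act : K →ₗ[k] Q →ₗ[k] Q) :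
    K ⊗[k] K →ₗ[k] ExteriorAlgebra k Q ⊗[k] ExteriorAlgebra k Q →ₗ[k]
      ExteriorAlgebra k Q ⊗[k] ExteriorAlgebra k Q :=
  TensorProduct.homTensorHomMap (RingHom.id k) (ExteriorAlgebra k Q) (ExteriorAlgebra k Q)
      (ExteriorAlgebra k Q) (ExteriorAlgebra k Q) ∘ₗ TensorProduct.map (extAct act) (extAct act)

/-- The diagonal action is compatible with the coproduct. -/
theorem comul_extAct (act : K →ₗ[k] Q →ₗ[k] Q) (c : K) (u : ExteriorAlgebra k Q) :
    Coalgebra.comul (R := k) (extAct act c u) =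
      extAct₂ act (Coalgebra.comul (R := k) c) (Coalgebra.comul (R := k) u) := by
  let G : ℕ → Submodule k (ExteriorAlgebra k Q) := fun i ↦ ⋀[k]^i Q
  let F₁ := (convPost K (extComulHom k Q)).comp (extActHom act)
  let L := (GradedTensorProduct.lift G G
    ((convPost K (GradedTensorProduct.includeLeft G G)).comp (extActHom act))
    ((convPost K (GradedTensorProduct.includeRight G G)).comp (extActHom act)) (by
      intro i j a b
      have := conv_comm (((convPost K (GradedTensorProduct.includeLeft G G)).comp
        (extActHom act)) a) (((convPost K (GradedTensorProduct.includeRight G G)).comp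
        (extActHom act)) b) ((-1) ^ (j * i)) (by
          intro x y
          change GradedTensorProduct.includeLeft G G (extAct act x a) *
            GradedTensorProduct.includeRight G G (extAct act y b) = (-1 : k) ^ (j * i) •
            (GradedTensorProduct.includeRight G G (extAct act y b) *
              GradedTensorProduct.includeLeft G G (extAct act x a))
          have h1 := GradedTensorProduct.tmul_coe_mul_coe_tmul (R := k) G G 1
            ⟨_, extAct_mem act j b b.2 y⟩ ⟨_, extAct_mem act i a a.2 x⟩ 1
          have h2 := GradedTensorProduct.tmul_one_mul_one_tmul (R := k) G G (extAct act x a)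
            (extAct act y b)
          rw [GradedTensorProduct.includeLeft_apply, GradedTensorProduct.includeRight_apply, h1,
            h2, Units.smul_def, ← Int.cast_smul_eq_zsmul k, smul_smul]
          simp [← mul_pow])
      rw [this, Units.smul_def, ← Int.cast_smul_eq_zsmul k]
      simp))
  let F₂ := L.comp (extComulHom k Q)
  have hF : F₁ = F₂ := by
    refine ExteriorAlgebra.hom_ext (LinearMap.ext fun q ↦ ?_)
    ext c
    change extComulHom k Q (extAct act c (ExteriorAlgebra.ι k q)) =
      (F₂ (ExteriorAlgebra.ι k q)) c
    have e : ∀ q, extComulHom k Q (ExteriorAlgebra.ι k q) =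
        GradedTensorProduct.tmul k (ExteriorAlgebra.ι k q) 1 +
        GradedTensorProduct.tmul k 1 (ExteriorAlgebra.ι k q) := by
      intro q; simp [extComulHom]
    simp only [F₂, AlgHom.comp_apply, e, map_add, L]
    rw [GradedTensorProduct.lift_tmul, GradedTensorProduct.lift_tmul, map_one, mul_one, map_one,
      one_mul, extAct_ι, e, ← extAct_ι]
    rfl
  have := congrArg (fun F : _ →ₐ[k] WithConv (K →ₗ[k] _) ↦ F u c) hF
  refine this.trans ?_
  change (L (GradedTensorProduct.of k G G (extComul k Q u))) c =
    extAct₂ act (Coalgebra.comul (R := k) c) (extComul k Q u)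
  generalize extComul k Q u = x
  induction x with
  | zero => simp only [map_zero]; rfl
  | add x y hx hy => rw [map_add, map_add, map_add, ← hx, ← hy]; rfl
  | tmul x y =>
    simp only [L]
    rw [GradedTensorProduct.lift_tmul, LinearMap.convMul_apply]
    generalize (Coalgebra.comul c : K ⊗[k] K) = t
    induction t with
    | zero => simp; rfl
    | add a b ha hb => rw [map_add, map_add, map_add, LinearMap.add_apply, ha, hb]; rfl
    | tmul a b =>
      rw [TensorProduct.map_tmul, LinearMap.mul'_apply]
      exact GradedTensorProduct.tmul_one_mul_one_tmul (R := k) G G (extAct act a x)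
            (extAct act b y)

end Action

section Parity

variable {k Q : Type*} [Field k] [AddCommGroup Q] [Module k Q]

/-- The parity of a grading: even and odd degrees. -/
def parityPart {D : Type*} [AddCommGroup D] [Module k D] (𝒟 : ℕ → Submodule k D) (i : ZMod 2) :
    Submodule k D :=
  ⨆ n : {n : ℕ // (n : ZMod 2) = i}, 𝒟 n

theorem ιInv_of_mem (n : ℕ) (hn : n ≠ 1) (u : ExteriorAlgebra k Q) (hu : u ∈ ⋀[k]^n Q) :
    ExteriorAlgebra.ιInv u = 0 := by
  let _ : Module kᵐᵒᵖ Q := Module.compHom _ ((RingHom.id k).fromOpposite mul_comm)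
  have : IsCentralScalar k Q := ⟨fun r m ↦ rfl⟩
  change (ExteriorAlgebra.toTrivSqZeroExt u).snd = 0
  have h0 : ∀ n : ℕ, ∀ u ∈ ⋀[k]^n Q, n ≠ 0 →
      (ExteriorAlgebra.toTrivSqZeroExt (R := k) (M := Q) u).fst = 0 := by
    intro n u hu
    induction hu using Submodule.pow_induction_on_left' with
    | algebraMap r => simp
    | add x y i _ _ hx hy => intro h; rw [map_add, TrivSqZeroExt.fst_add, hx h, hy h, add_zero]
    | mem_mul m hm i x hx ih =>
      obtain ⟨q, rfl⟩ := hm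
      intro _
      simp
  induction hu using Submodule.pow_induction_on_left' with
  | algebraMap r => simp [TrivSqZeroExt.algebraMap_eq_inl]
  | add x y i _ _ hx hy => rw [map_add, TrivSqZeroExt.snd_add, hx hn, hy hn, add_zero]
  | mem_mul m hm i x hx ih =>
    obtain ⟨q, rfl⟩ := hm
    have := h0 i x hx (by omega)
    simp [this]

/-- The projection of the exterior algebra onto its even part. -/
noncomputable def extEven (k Q : Type*) [Field k] [AddCommGroup Q] [Module k Q] :
    ExteriorAlgebra k Q →ₗ[k] ExteriorAlgebra k Q :=
  (CliffordAlgebra.evenOdd (0 : QuadraticForm k Q) 0).subtype ∘ₗ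
    DirectSum.component k (ZMod 2)
      (fun i ↦ CliffordAlgebra.evenOdd (0 : QuadraticForm k Q) i) 0 ∘ₗ
    (DirectSum.decomposeLinearEquiv
      (CliffordAlgebra.evenOdd (0 : QuadraticForm k Q))).toLinearMap

theorem extEven_of_mem (n : ℕ) (u : ExteriorAlgebra k Q) (hu : u ∈ ⋀[k]^n Q) :
    extEven k Q u = if Even n then u else 0 := by
  have hu' : u ∈ CliffordAlgebra.evenOdd (0 : QuadraticForm k Q) (n : ZMod 2) :=
    Submodule.mem_iSup_of_mem ⟨n, rfl⟩ hu
  split_ifs with h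
  · rw [(ZMod.natCast_eq_zero_iff_even).mpr h] at hu'
    exact DirectSum.decompose_of_mem_same _ hu'
  · refine DirectSum.decompose_of_mem_ne _ hu' ?_
    rwa [Ne, ZMod.natCast_eq_zero_iff_even]

/-- A projection onto the even part gives a decomposition into even and odd parts. -/
noncomputable abbrev decompositionOfProj {D : Type*} [AddCommGroup D] [Module k D]
    (𝒟 : ZMod 2 → Submodule k D) (P : D →ₗ[k] D) (h0 : ∀ x ∈ 𝒟 0, P x = x)
    (h1 : ∀ x ∈ 𝒟 1, P x = 0) (m0 : ∀ x, P x ∈ 𝒟 0) (m1 : ∀ x, x - P x ∈ 𝒟 1) :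
    DirectSum.Decomposition 𝒟 :=
  DirectSum.Decomposition.ofLinearMap 𝒟
    (DirectSum.lof k (ZMod 2) (fun i ↦ 𝒟 i) 0 ∘ₗ P.codRestrict (𝒟 0) m0 +
      DirectSum.lof k (ZMod 2) (fun i ↦ 𝒟 i) 1 ∘ₗ
        (LinearMap.id - P).codRestrict (𝒟 1) m1)
    (by ext x; simp)
    (by
      refine DirectSum.linearMap_ext _ fun i ↦ LinearMap.ext fun x ↦ ?_
      fin_cases i
      · have hx := h0 x.1 x.2
        have e1 : P.codRestrict (𝒟 0) m0 x.1 = x := Subtype.ext hx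
        have e2 : (LinearMap.id - P).codRestrict (𝒟 1) m1 x.1 = 0 := Subtype.ext (by simp [hx])
        simp only [LinearMap.comp_apply, LinearMap.add_apply]
        erw [DirectSum.coeLinearMap_lof, e1, e2]
        simp; rfl
      · have hx := h1 x.1 x.2
        have e1 : P.codRestrict (𝒟 0) m0 x.1 = 0 := Subtype.ext hx
        have e2 : (LinearMap.id - P).codRestrict (𝒟 1) m1 x.1 = x := Subtype.ext (by simp [hx])
        simp only [LinearMap.comp_apply, LinearMap.add_apply]
        erw [DirectSum.coeLinearMap_lof, e1, e2]
        simp; rfl)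

end Parity

section TensorOver

variable {k J K M Q : Type*} [Field k] [Ring J] [Bialgebra k J] [Ring K] [Bialgebra k K]
  [AddCommGroup M] [Module k M] [AddCommGroup Q] [Module k Q]

/-- The relations `a c ⊗ m = a ⊗ c m` defining `J ⊗_K M`. -/
def balanced (j : K →ₐc[k] J) (act : K →ₗ[k] M →ₗ[k] M) : Submodule k (J ⊗[k] M) :=
  Submodule.span k {x | ∃ (a : J) (c : K) (m : M), x = (a * j c) ⊗ₜ[k] m - a ⊗ₜ[k] act c m}

/-- The tensor product `J ⊗_K M` over the (noncommutative) algebra `K`. -/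
abbrev TensorOver (j : K →ₐc[k] J) (act : K →ₗ[k] M →ₗ[k] M) : Type _ :=
  (J ⊗[k] M) ⧸ balanced j act

/-- The left ideal `J K⁺` of `J` generated by the augmentation ideal of `K`. -/
def augIdeal (j : K →ₐc[k] J) : Submodule k J :=
  Submodule.span k {x | ∃ (a : J) (c : K), Coalgebra.counit (R := k) c = 0 ∧ x = a * j c}

/-- The quotient `J // K = J / J K⁺`. -/
abbrev HopfQuotient (j : K →ₐc[k] J) : Type _ := J ⧸ augIdeal j

theorem mk_balanced (j : K →ₐc[k] J) (act : K →ₗ[k] M →ₗ[k] M) (a : J) (c : K) (m : M) :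
    (balanced j act).mkQ ((a * j c) ⊗ₜ[k] m) = (balanced j act).mkQ (a ⊗ₜ[k] act c m) := by
  rw [← sub_eq_zero, ← map_sub, ← LinearMap.mem_ker, Submodule.ker_mkQ]
  exact Submodule.subset_span ⟨a, c, m, rfl⟩

theorem mk_aug (j : K →ₐc[k] J) (a : J) (c : K) :
    (augIdeal j).mkQ (a * j c) = Coalgebra.counit (R := k) c • (augIdeal j).mkQ a := by
  rw [← map_smul, ← sub_eq_zero, ← map_sub, ← LinearMap.mem_ker, Submodule.ker_mkQ]
  refine Submodule.subset_span ⟨a, c - algebraMap k K (Coalgebra.counit (R := k) c), ?_, ?_⟩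
  · simp
  · rw [map_sub, mul_sub]
    congr 1
    rw [AlgHomClass.commutes, Algebra.smul_def, Algebra.commutes]

theorem comul_mul_map (j : K →ₐc[k] J) (a : J) (c : K) :
    Coalgebra.comul (R := k) (a * j c) = Coalgebra.comul (R := k) a *
      TensorProduct.map (j : K →ₗ[k] J) (j : K →ₗ[k] J) (Coalgebra.comul (R := k) c) := by
  rw [Bialgebra.comul_mul]
  congr 1
  exact (CoalgHomClass.map_comp_comul_apply j c).symm

instance augIdeal_isCoideal (j : K →ₐc[k] J) : (augIdeal j).IsCoideal where
  counit_eq_zero x hx := by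
    induction hx using Submodule.span_induction with
    | zero => simp
    | add x y _ _ hx hy => rw [map_add, hx, hy, add_zero]
    | smul r x _ hx => rw [map_smul, hx, smul_zero]
    | mem x hx =>
      obtain ⟨a, c, hc, rfl⟩ := hx
      rw [Bialgebra.counit_mul, CoalgHomClass.counit_comp_apply j c, hc, mul_zero]
  map_mkQ_comul_eq_zero x hx := by
    induction hx using Submodule.span_induction with
    | zero => simp
    | add x y _ _ hx hy => rw [map_add, map_add, hx, hy, add_zero]
    | smul r x _ hx => rw [map_smul, map_smul, hx, smul_zero]
    | mem x hx =>
      obtain ⟨a, c, hc, rfl⟩ := hx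
      rw [comul_mul_map]
      have key : ∀ (s : J ⊗[k] J) (t : K ⊗[k] K),
          TensorProduct.map (augIdeal j).mkQ (augIdeal j).mkQ
            (s * TensorProduct.map (j : K →ₗ[k] J) (j : K →ₗ[k] J) t) =
          TensorProduct.lid k k (TensorProduct.map (Coalgebra.counit (R := k))
            (Coalgebra.counit (R := k)) t) •
            TensorProduct.map (augIdeal j).mkQ (augIdeal j).mkQ s := by
        intro s t
        induction t with
        | zero => simp
        | add x y hx hy => simp only [map_add, mul_add, hx, hy, add_smul]
        | tmul c c' =>
          induction s with
          | zero => simp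
          | add x y hx hy => simp only [map_add, add_mul, hx, hy, smul_add]
          | tmul a a' =>
            simp only [TensorProduct.map_tmul, Algebra.TensorProduct.tmul_mul_tmul,
              TensorProduct.lid_tmul, smul_eq_mul]
            change (augIdeal j).mkQ (a * j c) ⊗ₜ[k] (augIdeal j).mkQ (a' * j c') = _
            rw [mk_aug, mk_aug, TensorProduct.smul_tmul_smul]
      have h2 : TensorProduct.lid k k (TensorProduct.map (Coalgebra.counit (R := k))
            (Coalgebra.counit (R := k)) (Coalgebra.comul (R := k) c)) =
            Coalgebra.counit (R := k) c := by
        rw [← LinearMap.lTensor_comp_rTensor, LinearMap.comp_apply,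
          Coalgebra.rTensor_counit_comul, LinearMap.lTensor_tmul, TensorProduct.lid_tmul, one_smul]
      rw [key, h2, hc, zero_smul]

theorem coaction_key (j : K →ₐc[k] J) (act : K →ₗ[k] M →ₗ[k] M) (s : J ⊗[k] J) (t : K ⊗[k] K)
    (m : M) :
    TensorProduct.map (balanced j act).mkQ (augIdeal j).mkQ
      (TensorProduct.rightComm k J J M
        ((s * TensorProduct.map (j : K →ₗ[k] J) (j : K →ₗ[k] J) t) ⊗ₜ[k] m)) =
    TensorProduct.map (balanced j act).mkQ (augIdeal j).mkQ
      (TensorProduct.rightComm k J J M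
        (s ⊗ₜ[k] act (TensorProduct.rid k K (LinearMap.lTensor K
          (Coalgebra.counit (R := k)) t)) m)) := by
  induction t with
  | zero => simp
  | add x y hx hy =>
    simp only [map_add, mul_add, hx, hy, LinearMap.add_apply, TensorProduct.tmul_add,
      TensorProduct.add_tmul]
  | tmul c c' =>
    induction s with
    | zero => simp
    | add x y hx hy => simp only [map_add, add_mul, hx, hy, TensorProduct.add_tmul]
    | tmul a a' =>
      simp only [TensorProduct.map_tmul, Algebra.TensorProduct.tmul_mul_tmul,
        LinearMap.lTensor_tmul, TensorProduct.rid_tmul, TensorProduct.rightComm_tmul]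
      change (balanced j act).mkQ ((a * j c) ⊗ₜ[k] m) ⊗ₜ[k] (augIdeal j).mkQ (a' * j c') = _
      rw [mk_aug, mk_balanced, map_smul, LinearMap.smul_apply, TensorProduct.tmul_smul, TensorProduct.tmul_smul,
        map_smul, TensorProduct.smul_tmul']

/-- The right `J // K`-coaction on `J ⊗_K M`: `a ⊗ m ↦ (a₍₁₎ ⊗ m) ⊗ a₍₂₎`. -/
noncomputable def coaction (j : K →ₐc[k] J) (act : K →ₗ[k] M →ₗ[k] M) :
    TensorOver j act →ₗ[k] TensorOver j act ⊗[k] HopfQuotient j :=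
  (balanced j act).liftQ
    (TensorProduct.map (balanced j act).mkQ (augIdeal j).mkQ ∘ₗ
      (TensorProduct.rightComm k J J M).toLinearMap ∘ₗ
      LinearMap.rTensor M (Coalgebra.comul (R := k))) (by
    refine Submodule.span_le.mpr ?_
    rintro x ⟨a, c, m, rfl⟩
    rw [SetLike.mem_coe, LinearMap.mem_ker, map_sub, sub_eq_zero]
    simp only [LinearMap.comp_apply, LinearMap.rTensor_tmul, LinearEquiv.coe_coe]
    rw [comul_mul_map]
    refine (coaction_key j act _ _ m).trans ?_
    rw [Coalgebra.lTensor_counit_comul, TensorProduct.rid_tmul, one_smul])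

theorem coaction_mk (j : K →ₐc[k] J) (act : K →ₗ[k] M →ₗ[k] M) (a : J) (m : M) :
    coaction j act ((balanced j act).mkQ (a ⊗ₜ[k] m)) =
      TensorProduct.map (balanced j act).mkQ (augIdeal j).mkQ
        (TensorProduct.rightComm k J J M (Coalgebra.comul (R := k) a ⊗ₜ[k] m)) := rfl

variable [NeZero (2 : k)] [Coalgebra.IsCocomm k K]

theorem tensorComul_mem (j : K →ₐc[k] J) (act : K →ₗ[k] Q →ₗ[k] Q)
    (s : J ⊗[k] J) (t : K ⊗[k] K) (x : ExteriorAlgebra k Q ⊗[k] ExteriorAlgebra k Q) :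
    TensorProduct.map (balanced j (extAct act)).mkQ (balanced j (extAct act)).mkQ
      (TensorProduct.tensorTensorTensorComm k _ _ _ _
        ((s * TensorProduct.map (j : K →ₗ[k] J) (j : K →ₗ[k] J) t) ⊗ₜ[k] x)) =
    TensorProduct.map (balanced j (extAct act)).mkQ (balanced j (extAct act)).mkQ
      (TensorProduct.tensorTensorTensorComm k _ _ _ _ (s ⊗ₜ[k] extAct₂ act t x)) := by
  induction t with
  | zero => simp
  | add t t' h h' =>
    simp only [map_add, mul_add, TensorProduct.add_tmul, h, h', LinearMap.add_apply,
      TensorProduct.tmul_add]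
  | tmul c c' =>
    induction s with
    | zero => simp
    | add s s' h h' => simp only [add_mul, TensorProduct.add_tmul, map_add, h, h']
    | tmul a a' =>
      induction x with
      | zero => simp
      | add x x' h h' => simp only [TensorProduct.tmul_add, map_add, h, h']
      | tmul u v =>
        simp only [TensorProduct.map_tmul, Algebra.TensorProduct.tmul_mul_tmul,
          TensorProduct.tensorTensorTensorComm_tmul]
        change (balanced j (extAct act)).mkQ ((a * j c) ⊗ₜ[k] u) ⊗ₜ[k]
          (balanced j (extAct act)).mkQ ((a' * j c') ⊗ₜ[k] v) = _
        rw [mk_balanced, mk_balanced]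
        rfl

instance balanced_isCoideal (j : K →ₐc[k] J) (act : K →ₗ[k] Q →ₗ[k] Q) :
    (balanced j (extAct act)).IsCoideal where
  counit_eq_zero x hx := by
    induction hx using Submodule.span_induction with
    | zero => simp
    | add x y _ _ hx hy => rw [map_add, hx, hy, add_zero]
    | smul r x _ hx => rw [map_smul, hx, smul_zero]
    | mem x hx =>
      obtain ⟨a, c, u, rfl⟩ := hx
      rw [map_sub, TensorProduct.counit_tmul, TensorProduct.counit_tmul, counit_extAct,
        Bialgebra.counit_mul, CoalgHomClass.counit_comp_apply j c]
      simp only [smul_eq_mul]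
      ring
  map_mkQ_comul_eq_zero x hx := by
    induction hx using Submodule.span_induction with
    | zero => simp
    | add x y _ _ hx hy => rw [map_add, map_add, hx, hy, add_zero]
    | smul r x _ hx => rw [map_smul, map_smul, hx, smul_zero]
    | mem x hx =>
      obtain ⟨a, c, u, rfl⟩ := hx
      rw [map_sub, map_sub, sub_eq_zero, TensorProduct.comul_tmul, TensorProduct.comul_tmul,
        comul_mul_map, comul_extAct]
      exact tensorComul_mem j act _ _ _

/-- The graded coalgebra `J ⊗_K ∧(Q)`, with coproduct
`a ⊗ u ↦ (a₍₁₎ ⊗ u₍₁₎) ⊗ (a₍₂₎ ⊗ u₍₂₎)`. -/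
abbrev TensorExt (j : K →ₐc[k] J) (act : K →ₗ[k] Q →ₗ[k] Q) : Type _ :=
  TensorOver j (extAct act)

/-- The component `J ⊗_K ∧ⁿ(Q)` of degree `n`. -/
noncomputable def degreePart (j : K →ₐc[k] J) (act : K →ₗ[k] Q →ₗ[k] Q) (n : ℕ) :
    Submodule k (TensorExt j act) :=
  (LinearMap.range (LinearMap.lTensor J (⋀[k]^n Q).subtype)).map (balanced j (extAct act)).mkQ

/-- The projection onto the neutral component, `J ⊗_K ∧(Q) → J // K`. -/
noncomputable def projZero (j : K →ₐc[k] J) (act : K →ₗ[k] Q →ₗ[k] Q) :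
    TensorExt j act →ₗ[k] HopfQuotient j :=
  (balanced j (extAct act)).liftQ
    ((augIdeal j).mkQ ∘ₗ (TensorProduct.rid k J).toLinearMap ∘ₗ
      LinearMap.lTensor J (Coalgebra.counit (R := k))) (by
    refine Submodule.span_le.mpr ?_
    rintro x ⟨a, c, u, rfl⟩
    rw [SetLike.mem_coe, LinearMap.mem_ker, map_sub, sub_eq_zero]
    simp only [LinearMap.comp_apply, LinearMap.lTensor_tmul, LinearEquiv.coe_coe,
      TensorProduct.rid_tmul, map_smul, counit_extAct, mk_aug, smul_smul, mul_comm])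

theorem ιInv_extAct (act : K →ₗ[k] Q →ₗ[k] Q) (c : K) (u : ExteriorAlgebra k Q) :
    ExteriorAlgebra.ιInv (extAct act c u) = act c (ExteriorAlgebra.ιInv u) := by
  induction u using DirectSum.Decomposition.inductionOn (fun i : ℕ ↦ ⋀[k]^i Q) with
  | zero => simp
  | add a b ha hb => simp only [map_add, ha, hb]
  | @homogeneous i u =>
    by_cases hi : i = 1
    · subst hi
      obtain ⟨u, hu⟩ := u
      obtain ⟨q, rfl⟩ : u ∈ LinearMap.range (ExteriorAlgebra.ι k) := by simpa using hu
      simp only [extAct_ι, ExteriorAlgebra.ι_leftInverse _]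
    · rw [ιInv_of_mem i hi (u : ExteriorAlgebra k Q) u.2, ιInv_of_mem i hi _ (extAct_mem act i (u : ExteriorAlgebra k Q) u.2 c), map_zero]

/-- The projection onto the first component, `J ⊗_K ∧(Q) → J ⊗_K Q`. -/
noncomputable def projOne (j : K →ₐc[k] J) (act : K →ₗ[k] Q →ₗ[k] Q) :
    TensorExt j act →ₗ[k] TensorOver j act :=
  (balanced j (extAct act)).liftQ
    ((balanced j act).mkQ ∘ₗ LinearMap.lTensor J ExteriorAlgebra.ιInv) (by
    refine Submodule.span_le.mpr ?_
    rintro x ⟨a, c, u, rfl⟩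
    rw [SetLike.mem_coe, LinearMap.mem_ker, map_sub, sub_eq_zero]
    simp only [LinearMap.comp_apply, LinearMap.lTensor_tmul, mk_balanced, ιInv_extAct])

theorem extEven_extAct (act : K →ₗ[k] Q →ₗ[k] Q) (c : K) (u : ExteriorAlgebra k Q) :
    extEven k Q (extAct act c u) = extAct act c (extEven k Q u) := by
  induction u using DirectSum.Decomposition.inductionOn (fun i : ℕ ↦ ⋀[k]^i Q) with
  | zero => simp
  | add a b ha hb => simp only [map_add, ha, hb]
  | @homogeneous i u =>
    rw [extEven_of_mem i (u : ExteriorAlgebra k Q) u.2, extEven_of_mem i _ (extAct_mem act i (u : ExteriorAlgebra k Q) u.2 c)]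
    split_ifs <;> simp

/-- The projection of `J ⊗_K ∧(Q)` onto its even part. -/
noncomputable def evenProj (j : K →ₐc[k] J) (act : K →ₗ[k] Q →ₗ[k] Q) :
    TensorExt j act →ₗ[k] TensorExt j act :=
  (balanced j (extAct act)).liftQ
    ((balanced j (extAct act)).mkQ ∘ₗ LinearMap.lTensor J (extEven k Q)) (by
    refine Submodule.span_le.mpr ?_
    rintro x ⟨a, c, u, rfl⟩
    rw [SetLike.mem_coe, LinearMap.mem_ker, map_sub, sub_eq_zero]
    simp only [LinearMap.comp_apply, LinearMap.lTensor_tmul, mk_balanced, extEven_extAct])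

theorem evenProj_of_mem (j : K →ₐc[k] J) (act : K →ₗ[k] Q →ₗ[k] Q) (n : ℕ) (x : TensorExt j act)
    (hx : x ∈ degreePart j act n) : evenProj j act x = if Even n then x else 0 := by
  obtain ⟨_, ⟨y, rfl⟩, rfl⟩ := hx
  induction y with
  | zero => simp
  | add y z hy hz => rw [map_add, map_add, map_add, hy, hz]; split_ifs <;> simp
  | tmul a u =>
    change (balanced j (extAct act)).mkQ (a ⊗ₜ[k] extEven k Q u) = _
    rw [extEven_of_mem n (u : ExteriorAlgebra k Q) u.2]
    split_ifs
    · rfl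
    · simp

theorem mk_mem_degreePart (j : K →ₐc[k] J) (act : K →ₗ[k] Q →ₗ[k] Q) (n : ℕ) (a : J)
    (u : ExteriorAlgebra k Q) (hu : u ∈ ⋀[k]^n Q) :
    (balanced j (extAct act)).mkQ (a ⊗ₜ[k] u) ∈ degreePart j act n :=
  ⟨_, ⟨a ⊗ₜ[k] ⟨u, hu⟩, rfl⟩, rfl⟩

theorem iSup_degreePart (j : K →ₐc[k] J) (act : K →ₗ[k] Q →ₗ[k] Q) :
    ⨆ n, degreePart j act n = ⊤ := by
  rw [eq_top_iff]
  rintro x -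
  obtain ⟨y, rfl⟩ := (balanced j (extAct act)).mkQ_surjective x
  induction y with
  | zero => simp
  | add y z hy hz => rw [map_add]; exact add_mem hy hz
  | tmul a u =>
    induction u using DirectSum.Decomposition.inductionOn (fun i : ℕ ↦ ⋀[k]^i Q) with
    | zero => simp
    | add u v hu hv => rw [TensorProduct.tmul_add, map_add]; exact add_mem hu hv
    | @homogeneous i u => exact Submodule.mem_iSup_of_mem i (mk_mem_degreePart j act i a (u : ExteriorAlgebra k Q) u.2)

theorem evenProj_of_mem_zero (j : K →ₐc[k] J) (act : K →ₗ[k] Q →ₗ[k] Q) (x : TensorExt j act)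
    (hx : x ∈ parityPart (degreePart j act) 0) : evenProj j act x = x := by
  have : parityPart (degreePart j act) 0 ≤ LinearMap.ker (evenProj j act - LinearMap.id) := by
    refine iSup_le fun n y hy ↦ ?_
    rw [LinearMap.mem_ker, LinearMap.sub_apply, evenProj_of_mem j act n y hy,
      if_pos ((ZMod.natCast_eq_zero_iff_even).mp n.2)]
    simp
  simpa [sub_eq_zero] using this hx

theorem evenProj_of_mem_one (j : K →ₐc[k] J) (act : K →ₗ[k] Q →ₗ[k] Q) (x : TensorExt j act)
    (hx : x ∈ parityPart (degreePart j act) 1) : evenProj j act x = 0 := by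
  have : parityPart (degreePart j act) 1 ≤ LinearMap.ker (evenProj j act) := by
    refine iSup_le fun n y hy ↦ ?_
    rw [LinearMap.mem_ker, evenProj_of_mem j act n y hy, if_neg]
    rw [Nat.not_even_iff_odd]
    exact (ZMod.natCast_eq_one_iff_odd).mp n.2
  exact this hx

theorem evenProj_mem (j : K →ₐc[k] J) (act : K →ₗ[k] Q →ₗ[k] Q) (x : TensorExt j act) :
    evenProj j act x ∈ parityPart (degreePart j act) 0 ∧
      x - evenProj j act x ∈ parityPart (degreePart j act) 1 := by
  have hx : x ∈ ⨆ n, degreePart j act n := iSup_degreePart j act ▸ Submodule.mem_top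
  induction hx using Submodule.iSup_induction' with
  | zero => simp
  | add x y _ _ hx hy =>
    rw [map_add, add_sub_add_comm]
    exact ⟨add_mem hx.1 hy.1, add_mem hx.2 hy.2⟩
  | mem n x hx =>
    rw [evenProj_of_mem j act n x hx]
    split_ifs with h
    · rw [sub_self]
      exact ⟨Submodule.mem_iSup_of_mem (⟨n, (ZMod.natCast_eq_zero_iff_even).mpr h⟩ :
        {n : ℕ // (n : ZMod 2) = 0}) hx, zero_mem _⟩
    · rw [sub_zero]
      exact ⟨zero_mem _, Submodule.mem_iSup_of_mem (⟨n, (ZMod.natCast_eq_one_iff_odd).mpr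
        (Nat.not_even_iff_odd.mp h)⟩ : {n : ℕ // (n : ZMod 2) = 1}) hx⟩

noncomputable instance tensorExtDecomposition (j : K →ₐc[k] J) (act : K →ₗ[k] Q →ₗ[k] Q) :
    DirectSum.Decomposition (parityPart (degreePart j act)) :=
  decompositionOfProj _ (evenProj j act) (evenProj_of_mem_zero j act) (evenProj_of_mem_one j act)
    (fun x ↦ (evenProj_mem j act x).1) (fun x ↦ (evenProj_mem j act x).2)

end TensorOver

section Super

variable {k D : Type*} [Field k] [AddCommGroup D] [Module k D]

/-- The supersymmetry `v ⊗ w ↦ (-1)^{|v||w|} w ⊗ v` of a super-vector space `D = D₀ ⊕ D₁`. -/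
noncomputable def superSwap (𝒟 : ZMod 2 → Submodule k D) [DirectSum.Decomposition 𝒟] :
    D ⊗[k] D ≃ₗ[k] D ⊗[k] D :=
  (TensorProduct.congr (DirectSum.decomposeLinearEquiv 𝒟) (DirectSum.decomposeLinearEquiv 𝒟)).trans
    ((TensorProduct.gradedComm k (fun i ↦ 𝒟 i) (fun i ↦ 𝒟 i)).trans
      (TensorProduct.congr (DirectSum.decomposeLinearEquiv 𝒟)
        (DirectSum.decomposeLinearEquiv 𝒟)).symm)

theorem superSwap_tmul (𝒟 : ZMod 2 → Submodule k D) [DirectSum.Decomposition 𝒟] (i j : ZMod 2)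
    (v w : D) (hv : v ∈ 𝒟 i) (hw : w ∈ 𝒟 j) :
    superSwap 𝒟 (v ⊗ₜ[k] w) = (-1 : ℤˣ) ^ (j * i) • (w ⊗ₜ[k] v) := by
  have h1 : DirectSum.decomposeLinearEquiv 𝒟 v = DirectSum.lof k _ (fun i ↦ 𝒟 i) i ⟨v, hv⟩ :=
    DirectSum.decompose_of_mem 𝒟 hv
  have h2 : DirectSum.decomposeLinearEquiv 𝒟 w = DirectSum.lof k _ (fun i ↦ 𝒟 i) j ⟨w, hw⟩ :=
    DirectSum.decompose_of_mem 𝒟 hw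
  simp only [superSwap, LinearEquiv.trans_apply, TensorProduct.congr_tmul, h1, h2]
  rw [TensorProduct.gradedComm_of_tmul_of, ← h1, ← h2, Units.smul_def, Units.smul_def,
    map_zsmul, TensorProduct.congr_symm_tmul, LinearEquiv.symm_apply_apply,
    LinearEquiv.symm_apply_apply]

/-- The component `⨁_{i + j = n} 𝒟 i ⊗ 𝒟 j` of degree `n` of the tensor square. -/
def tensorPart {ι : Type*} [Add ι] (𝒟 : ι → Submodule k D) (n : ι) : Submodule k (D ⊗[k] D) :=
  ⨆ p : {p : ι × ι // p.1 + p.2 = n},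
    LinearMap.range (TensorProduct.mapIncl (𝒟 p.1.1) (𝒟 p.1.2))

/-- A super-coalgebra (always super-cocommutative): a super-vector space `D = D₀ ⊕ D₁` with a
coalgebra structure that respects the parity and is super-cocommutative. -/
class SuperCoalgebra (𝒟 : ZMod 2 → Submodule k D) [DirectSum.Decomposition 𝒟] [Coalgebra k D] :
    Prop where
  comul_mem : ∀ i, ∀ x ∈ 𝒟 i, Coalgebra.comul (R := k) x ∈ tensorPart 𝒟 i
  counit_odd : ∀ x ∈ 𝒟 1, Coalgebra.counit (R := k) x = 0
  superSwap_comul : ∀ x, superSwap 𝒟 (Coalgebra.comul (R := k) x) = Coalgebra.comul (R := k) x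

/-- A (super-cocommutative) Hopf superalgebra: a superalgebra and super-coalgebra whose coproduct
and counit are superalgebra maps (the product of the tensor square involves the sign
`(-1)^{|b||c|}` in `(a ⊗ b)(c ⊗ d)`), with an antipode. -/
class HopfSuperalgebra {A : Type*} [Ring A] [Algebra k A] [Coalgebra k A]
    (𝒜 : ZMod 2 → Submodule k A) [GradedAlgebra 𝒜] extends SuperCoalgebra 𝒜 where
  counit_one : Coalgebra.counit (R := k) (1 : A) = 1
  counit_mul : ∀ a b : A, Coalgebra.counit (R := k) (a * b) =
    Coalgebra.counit (R := k) a * Coalgebra.counit (R := k) b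
  comul_one : Coalgebra.comul (R := k) (1 : A) = 1 ⊗ₜ[k] 1
  comul_mul : ∀ a b : A,
    GradedTensorProduct.of k 𝒜 𝒜 (Coalgebra.comul (R := k) (a * b)) =
      GradedTensorProduct.of k 𝒜 𝒜 (Coalgebra.comul (R := k) a) *
        GradedTensorProduct.of k 𝒜 𝒜 (Coalgebra.comul (R := k) b)
  antipode : A →ₗ[k] A
  antipode_mem : ∀ i, ∀ a ∈ 𝒜 i, antipode a ∈ 𝒜 i
  mul_antipode_rTensor_comul : ∀ a : A,
    LinearMap.mul' k A (LinearMap.rTensor A antipode (Coalgebra.comul (R := k) a)) =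
      algebraMap k A (Coalgebra.counit (R := k) a)
  mul_antipode_lTensor_comul : ∀ a : A,
    LinearMap.mul' k A (LinearMap.lTensor A antipode (Coalgebra.comul (R := k) a)) =
      algebraMap k A (Coalgebra.counit (R := k) a)

end Super

section Sub

variable {k A : Type*} [Field k] [Ring A] [Algebra k A] [Coalgebra k A]

/-- A Hopf sub-superalgebra: a graded subalgebra closed under the coproduct and the antipode. -/
structure HopfSubSuperalgebra (𝒜 : ZMod 2 → Submodule k A) [GradedAlgebra 𝒜]
    [HopfSuperalgebra 𝒜] extends Subalgebra k A where
  decompose_mem : ∀ a ∈ toSubalgebra, ∀ i, (DirectSum.decompose 𝒜 a i : A) ∈ toSubalgebra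
  comul_mem : ∀ a ∈ toSubalgebra, Coalgebra.comul (R := k) a ∈
    LinearMap.range (TensorProduct.mapIncl (Subalgebra.toSubmodule toSubalgebra)
      (Subalgebra.toSubmodule toSubalgebra))
  antipode_mem : ∀ a ∈ toSubalgebra, HopfSuperalgebra.antipode 𝒜 a ∈ toSubalgebra

variable (𝒜 : ZMod 2 → Submodule k A) [GradedAlgebra 𝒜] [HopfSuperalgebra 𝒜]

/-- The Hopf superalgebra itself as a Hopf sub-superalgebra. -/
def fullSub : HopfSubSuperalgebra 𝒜 where
  toSubalgebra := ⊤
  decompose_mem _ _ _ := Algebra.mem_top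
  comul_mem a _ := by
    rw [TensorProduct.range_mapIncl]
    simp only [Algebra.top_toSubmodule]
    rw [← TensorProduct.range_mapIncl]
    have : Function.Surjective (TensorProduct.mapIncl (⊤ : Submodule k A) (⊤ : Submodule k A)) :=
      TensorProduct.map_surjective (fun x ↦ ⟨⟨x, trivial⟩, rfl⟩) (fun x ↦ ⟨⟨x, trivial⟩, rfl⟩)
    exact this _
  antipode_mem _ _ := Algebra.mem_top

variable {𝒜}

/-- The even component `H₀` of a Hopf sub-superalgebra `H`. -/
def HopfSubSuperalgebra.zeroPart (H : HopfSubSuperalgebra 𝒜) : Submodule k A :=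
  Subalgebra.toSubmodule H.toSubalgebra ⊓ 𝒜 0

theorem of_mul_of_even (H : HopfSubSuperalgebra 𝒜) (s t : A ⊗[k] A)
    (hs : s ∈ LinearMap.range (TensorProduct.mapIncl H.zeroPart H.zeroPart))
    (ht : t ∈ LinearMap.range (TensorProduct.mapIncl H.zeroPart H.zeroPart)) :
    GradedTensorProduct.of k 𝒜 𝒜 s * GradedTensorProduct.of k 𝒜 𝒜 t =
        GradedTensorProduct.of k 𝒜 𝒜 (s * t) ∧
      s * t ∈ LinearMap.range (TensorProduct.mapIncl H.zeroPart H.zeroPart) := by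
  obtain ⟨s, rfl⟩ := hs
  obtain ⟨t, rfl⟩ := ht
  induction s with
  | zero => simp
  | add x y hx hy =>
    simp only [map_add, add_mul, hx.1, hy.1]
    exact ⟨trivial, add_mem hx.2 hy.2⟩
  | tmul a b =>
    induction t with
    | zero => simp
    | add x y hx hy =>
      simp only [map_add, mul_add, hx.1, hy.1]
      exact ⟨trivial, add_mem hx.2 hy.2⟩
    | tmul c d =>
      refine ⟨?_, ⟨⟨a.1 * c.1, H.toSubalgebra.mul_mem a.2.1 c.2.1, ?_⟩ ⊗ₜ[k]
          ⟨b.1 * d.1, H.toSubalgebra.mul_mem b.2.1 d.2.1, ?_⟩, ?_⟩⟩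
      · simp only [TensorProduct.mapIncl, TensorProduct.map_tmul, Submodule.subtype_apply,
          Algebra.TensorProduct.tmul_mul_tmul]
        exact GradedTensorProduct.tmul_coe_mul_zero_coe_tmul (R := k) 𝒜 𝒜 (a : A) ⟨b.1, b.2.2⟩
          ⟨c.1, c.2.2⟩ (d : A)
      · simpa using SetLike.mul_mem_graded a.2.2 c.2.2
      · simpa using SetLike.mul_mem_graded b.2.2 d.2.2
      · simp

/-- The largest purely even Hopf subalgebra `Δ⁻¹(H₀ ⊗ H₀)` of a Hopf sub-superalgebra `H`. -/
def HopfSubSuperalgebra.evenPart (H : HopfSubSuperalgebra 𝒜) : Subalgebra k A where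
  carrier := {a | a ∈ H.toSubalgebra ∧ Coalgebra.comul (R := k) a ∈
    LinearMap.range (TensorProduct.mapIncl H.zeroPart H.zeroPart)}
  mul_mem' := by
    rintro a b ⟨ha, ha'⟩ ⟨hb, hb'⟩
    obtain ⟨h1, h2⟩ := of_mul_of_even H _ _ ha' hb'
    refine ⟨H.toSubalgebra.mul_mem ha hb, ?_⟩
    have := HopfSuperalgebra.comul_mul (𝒜 := 𝒜) a b
    rw [h1] at this
    rwa [(GradedTensorProduct.of k 𝒜 𝒜).injective this]
  add_mem' := by
    rintro a b ⟨ha, ha'⟩ ⟨hb, hb'⟩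
    exact ⟨H.toSubalgebra.add_mem ha hb, by rw [map_add]; exact add_mem ha' hb'⟩
  algebraMap_mem' r := by
    refine ⟨H.toSubalgebra.algebraMap_mem r, ?_⟩
    rw [Algebra.algebraMap_eq_smul_one, map_smul, HopfSuperalgebra.comul_one (𝒜 := 𝒜)]
    exact Submodule.smul_mem _ _ ⟨⟨1, H.toSubalgebra.one_mem, SetLike.one_mem_graded 𝒜⟩ ⊗ₜ[k]
      ⟨1, H.toSubalgebra.one_mem, SetLike.one_mem_graded 𝒜⟩, rfl⟩

end Sub

section Restrict

variable {k M N : Type*} [Field k] [AddCommGroup M] [Module k M] [AddCommGroup N] [Module k N]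

theorem mem_range_rTensor (W : Submodule k M) (t : M ⊗[k] N)
    (h : ∀ φ : N →ₗ[k] k, TensorProduct.rid k M (LinearMap.lTensor M φ t) ∈ W) :
    t ∈ LinearMap.range (LinearMap.rTensor N W.subtype) := by
  obtain ⟨ι, ⟨b⟩⟩ : ∃ ι : Type _, Nonempty (Module.Basis ι k N) :=
    ⟨_, ⟨Module.Basis.ofVectorSpace k N⟩⟩
  obtain ⟨c, rfl⟩ := TensorProduct.eq_repr_basis_right b t
  refine Submodule.sum_mem _ fun i hi ↦ ?_
  have := h (b.coord i)
  rw [Finsupp.sum, map_sum, map_sum, Finset.sum_eq_single i] at this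
  · refine ⟨⟨c i, by simpa using this⟩ ⊗ₜ[k] _, rfl⟩
  · intro j _ hj
    simp [hj]
  · intro hi'; exact absurd hi hi'

theorem mem_range_mapIncl (W : Submodule k M) (t : M ⊗[k] M)
    (h : ∀ φ : M →ₗ[k] k, TensorProduct.rid k M (LinearMap.lTensor M φ t) ∈ W)
    (hc : TensorProduct.comm k M M t = t) :
    t ∈ LinearMap.range (TensorProduct.mapIncl W W) := by
  obtain ⟨s, hs⟩ := mem_range_rTensor W t h
  have hs' : TensorProduct.comm k W M s ∈ LinearMap.range (LinearMap.rTensor W W.subtype) := by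
    refine mem_range_rTensor W _ fun φ ↦ ?_
    obtain ⟨ψ, hψ⟩ := LinearMap.exists_extend φ
    convert h ψ
    rw [← hc, ← hs, ← hψ]
    clear hs
    induction s with
    | zero => simp
    | add x y hx hy => simp only [map_add, hx, hy]
    | tmul a b => simp
  obtain ⟨r, hr⟩ := hs'
  refine ⟨r, ?_⟩
  rw [← hc, ← hs]
  have e : s = TensorProduct.comm k M W (LinearMap.rTensor W W.subtype r) := by
    rw [hr]; simp
  rw [e]
  clear e hr hs
  induction r with
  | zero => simp
  | add x y hx hy => simp only [map_add, hx, hy]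
  | tmul a b => simp

end Restrict

section SubCoalgebra

variable {k M : Type*} [Field k] [AddCommGroup M] [Module k M] [Coalgebra k M]

/-- The restriction of the coproduct to a subspace `W` with `Δ(W) ⊆ W ⊗ W`. -/
noncomputable def subComul (W : Submodule k M)
    (hW : ∀ x ∈ W, Coalgebra.comul (R := k) x ∈ LinearMap.range (TensorProduct.mapIncl W W)) :
    W →ₗ[k] W ⊗[k] W :=
  (LinearEquiv.ofInjective (TensorProduct.mapIncl W W)
      (Module.Flat.tensorProduct_mapIncl_injective_of_right W W)).symm.toLinearMap ∘ₗ
    (Coalgebra.comul.restrict hW)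

theorem mapIncl_subComul (W : Submodule k M)
    (hW : ∀ x ∈ W, Coalgebra.comul (R := k) x ∈ LinearMap.range (TensorProduct.mapIncl W W))
    (x : W) : TensorProduct.mapIncl W W (subComul W hW x) = Coalgebra.comul (R := k) (x : M) := by
  have := LinearEquiv.apply_symm_apply (LinearEquiv.ofInjective (TensorProduct.mapIncl W W)
      (Module.Flat.tensorProduct_mapIncl_injective_of_right W W))
      (Coalgebra.comul.restrict hW x)
  exact congrArg Subtype.val this

/-- A subspace `W` with `Δ(W) ⊆ W ⊗ W` is a coalgebra. -/
noncomputable abbrev subCoalgebra (W : Submodule k M)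
    (hW : ∀ x ∈ W, Coalgebra.comul (R := k) x ∈ LinearMap.range (TensorProduct.mapIncl W W)) :
    Coalgebra k W where
  comul := subComul W hW
  counit := Coalgebra.counit ∘ₗ W.subtype
  coassoc := by
    refine LinearMap.ext fun x ↦ ?_
    have inj : Function.Injective (TensorProduct.map W.subtype (TensorProduct.mapIncl W W)) :=
      TensorProduct.map_injective_of_flat_flat _ _ W.subtype_injective
        (Module.Flat.tensorProduct_mapIncl_injective_of_right W W)
    apply inj
    have h1 : ∀ t : W ⊗[k] W, TensorProduct.map W.subtype (TensorProduct.mapIncl W W)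
        (TensorProduct.assoc k W W W (LinearMap.rTensor W (subComul W hW) t)) =
        TensorProduct.assoc k M M M (LinearMap.rTensor M Coalgebra.comul
          (TensorProduct.mapIncl W W t)) := by
      intro t
      induction t with
      | zero => simp
      | add a b ha hb => simp only [map_add, ha, hb]
      | tmul a b =>
        rw [TensorProduct.mapIncl, TensorProduct.map_tmul, LinearMap.rTensor_tmul,
          LinearMap.rTensor_tmul, Submodule.subtype_apply, ← mapIncl_subComul W hW]
        generalize subComul W hW a = s
        induction s with
        | zero => simp
        | add a b ha hb => simp only [map_add, TensorProduct.add_tmul, ha, hb]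
        | tmul c d => simp [TensorProduct.mapIncl]
    have h2 : ∀ t : W ⊗[k] W, TensorProduct.map W.subtype (TensorProduct.mapIncl W W)
        (LinearMap.lTensor W (subComul W hW) t) =
        LinearMap.lTensor M Coalgebra.comul (TensorProduct.mapIncl W W t) := by
      intro t
      induction t with
      | zero => simp
      | add a b ha hb => simp only [map_add, ha, hb]
      | tmul a b =>
        rw [LinearMap.lTensor_tmul, TensorProduct.map_tmul, mapIncl_subComul]
        simp [TensorProduct.mapIncl]
    simp only [LinearMap.comp_apply, LinearEquiv.coe_coe, h1, h2, mapIncl_subComul]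
    exact Coalgebra.coassoc_apply _
  rTensor_counit_comp_comul := by
    refine LinearMap.ext fun x ↦ ?_
    have inj : Function.Injective (LinearMap.lTensor k W.subtype) :=
      Module.Flat.lTensor_preserves_injective_linearMap _ W.subtype_injective
    apply inj
    have h1 : ∀ t : W ⊗[k] W, LinearMap.lTensor k W.subtype
        (LinearMap.rTensor W (Coalgebra.counit ∘ₗ W.subtype) t) =
        LinearMap.rTensor M Coalgebra.counit (TensorProduct.mapIncl W W t) := by
      intro t
      induction t with
      | zero => simp
      | add a b ha hb => simp only [map_add, ha, hb]
      | tmul a b => simp [TensorProduct.mapIncl]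
    simp only [LinearMap.comp_apply, h1, mapIncl_subComul, Coalgebra.rTensor_counit_comul]
    simp
  lTensor_counit_comp_comul := by
    refine LinearMap.ext fun x ↦ ?_
    have inj : Function.Injective (LinearMap.rTensor k W.subtype) :=
      Module.Flat.rTensor_preserves_injective_linearMap _ W.subtype_injective
    apply inj
    have h1 : ∀ t : W ⊗[k] W, LinearMap.rTensor k W.subtype
        (LinearMap.lTensor W (Coalgebra.counit ∘ₗ W.subtype) t) =
        LinearMap.lTensor M Coalgebra.counit (TensorProduct.mapIncl W W t) := by
      intro t
      induction t with
      | zero => simp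
      | add a b ha hb => simp only [map_add, ha, hb]
      | tmul a b => simp [TensorProduct.mapIncl]
    simp only [LinearMap.comp_apply, h1, mapIncl_subComul, Coalgebra.lTensor_counit_comul]
    simp

end SubCoalgebra

section Even

variable {k A : Type*} [Field k] [Ring A] [Algebra k A] [Coalgebra k A]
  {𝒜 : ZMod 2 → Submodule k A} [GradedAlgebra 𝒜] [HopfSuperalgebra 𝒜]

theorem superSwap_of_even {D : Type*} [AddCommGroup D] [Module k D]
    (𝒟 : ZMod 2 → Submodule k D) [DirectSum.Decomposition 𝒟] (W : Submodule k D) (hW : W ≤ 𝒟 0)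
    (t : D ⊗[k] D) (ht : t ∈ LinearMap.range (LinearMap.rTensor D W.subtype)) :
    superSwap 𝒟 t = TensorProduct.comm k D D t := by
  obtain ⟨t, rfl⟩ := ht
  induction t with
  | zero => simp
  | add x y hx hy => simp only [map_add, hx, hy]
  | tmul a b =>
    induction b using DirectSum.Decomposition.inductionOn 𝒟 with
    | zero => simp
    | add x y hx hy => simp only [TensorProduct.tmul_add, map_add, hx, hy]
    | @homogeneous i b =>
      rw [LinearMap.rTensor_tmul, Submodule.subtype_apply, superSwap_tmul 𝒟 0 i _ _ (hW a.2) b.2]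
      simp

theorem mapIncl_le_rTensor {A : Type*} [AddCommGroup A] [Module k A] (W W' : Submodule k A)
    (t : A ⊗[k] A)
    (ht : t ∈ LinearMap.range (TensorProduct.mapIncl W W')) :
    t ∈ LinearMap.range (LinearMap.rTensor A W.subtype) := by
  obtain ⟨t, rfl⟩ := ht
  refine ⟨LinearMap.lTensor W W'.subtype t, ?_⟩
  rw [← LinearMap.comp_apply, LinearMap.rTensor_comp_lTensor]

theorem rid_lTensor_mem {A : Type*} [AddCommGroup A] [Module k A] (W : Submodule k A) (φ : A →ₗ[k] k) (t : A ⊗[k] A)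
    (ht : t ∈ LinearMap.range (LinearMap.rTensor A W.subtype)) :
    TensorProduct.rid k A (LinearMap.lTensor A φ t) ∈ W := by
  obtain ⟨t, rfl⟩ := ht
  induction t with
  | zero => simp
  | add x y hx hy => simp only [map_add]; exact add_mem hx hy
  | tmul a b => simpa using W.smul_mem _ a.2

theorem HopfSubSuperalgebra.comm_comul (H : HopfSubSuperalgebra 𝒜) (x : A) (hx : x ∈ H.evenPart) :
    TensorProduct.comm k A A (Coalgebra.comul (R := k) x) = Coalgebra.comul (R := k) x := by
  rw [← superSwap_of_even 𝒜 H.zeroPart inf_le_right _ (mapIncl_le_rTensor _ _ _ hx.2)]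
  exact SuperCoalgebra.superSwap_comul x

theorem HopfSubSuperalgebra.comul_mem_evenPart (H : HopfSubSuperalgebra 𝒜) (x : A)
    (hx : x ∈ Subalgebra.toSubmodule H.evenPart) :
    Coalgebra.comul (R := k) x ∈ LinearMap.range (TensorProduct.mapIncl
      (Subalgebra.toSubmodule H.evenPart) (Subalgebra.toSubmodule H.evenPart)) := by
  refine mem_range_mapIncl _ _ (fun φ ↦ ?_) (H.comm_comul x hx)
  have hx' := mapIncl_le_rTensor _ _ _ hx.2
  set y := TensorProduct.rid k A (LinearMap.lTensor A φ (Coalgebra.comul (R := k) x)) with hy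
  have hyH : y ∈ H.zeroPart := rid_lTensor_mem _ φ _ hx'
  have hΔ : Coalgebra.comul (R := k) y = LinearMap.lTensor A
      ((TensorProduct.rid k A).toLinearMap ∘ₗ LinearMap.lTensor A φ ∘ₗ Coalgebra.comul (R := k))
      (Coalgebra.comul (R := k) x) := by
    have e1 : ∀ t : A ⊗[k] A, Coalgebra.comul (R := k)
        (TensorProduct.rid k A (LinearMap.lTensor A φ t)) =
        LinearMap.lTensor A ((TensorProduct.rid k A).toLinearMap ∘ₗ LinearMap.lTensor A φ)
          (TensorProduct.assoc k A A A (LinearMap.rTensor A (Coalgebra.comul (R := k)) t)) := by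
      intro t
      induction t with
      | zero => simp
      | add x y hx hy => simp only [map_add, hx, hy]
      | tmul a b =>
        rw [LinearMap.rTensor_tmul, LinearMap.lTensor_tmul, TensorProduct.rid_tmul, map_smul]
        generalize Coalgebra.comul (R := k) a = s
        induction s with
        | zero => simp
        | add x y hx hy => simp only [map_add, TensorProduct.add_tmul, smul_add, hx, hy]
        | tmul c d => simp
    rw [hy, e1, Coalgebra.coassoc_apply, ← LinearMap.comp_apply, ← LinearMap.lTensor_comp]
    rfl
  have hΔ' : Coalgebra.comul (R := k) y ∈
      LinearMap.range (LinearMap.rTensor A H.zeroPart.subtype) := by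
    rw [hΔ]
    obtain ⟨s, hs⟩ := hx'
    refine ⟨LinearMap.lTensor _ ((TensorProduct.rid k A).toLinearMap ∘ₗ LinearMap.lTensor A φ ∘ₗ
      Coalgebra.comul (R := k)) s, ?_⟩
    rw [← hs, ← LinearMap.comp_apply, ← LinearMap.comp_apply, LinearMap.rTensor_comp_lTensor,
      LinearMap.lTensor_comp_rTensor]
  refine ⟨hyH.1, mem_range_mapIncl _ _ (fun ψ ↦ rid_lTensor_mem _ ψ _ hΔ') ?_⟩
  rw [← superSwap_of_even 𝒜 H.zeroPart inf_le_right _ hΔ']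
  exact SuperCoalgebra.superSwap_comul y

noncomputable instance evenPartCoalgebra (H : HopfSubSuperalgebra 𝒜) : Coalgebra k H.evenPart :=
  subCoalgebra (Subalgebra.toSubmodule H.evenPart) H.comul_mem_evenPart

theorem HopfSubSuperalgebra.val_counit (H : HopfSubSuperalgebra 𝒜) (a : H.evenPart) :
    Coalgebra.counit (R := k) a = Coalgebra.counit (R := k) (a : A) := rfl

theorem HopfSubSuperalgebra.map_val_comul (H : HopfSubSuperalgebra 𝒜) (a : H.evenPart) :
    TensorProduct.map H.evenPart.val.toLinearMap H.evenPart.val.toLinearMap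
      (Coalgebra.comul (R := k) a) = Coalgebra.comul (R := k) (a : A) :=
  mapIncl_subComul (Subalgebra.toSubmodule H.evenPart) H.comul_mem_evenPart a

theorem HopfSubSuperalgebra.map_val_injective (H : HopfSubSuperalgebra 𝒜) :
    Function.Injective (TensorProduct.map H.evenPart.val.toLinearMap
      H.evenPart.val.toLinearMap) :=
  TensorProduct.map_injective_of_flat_flat _ _ Subtype.val_injective Subtype.val_injective

/-- The largest purely even Hopf subalgebra of a Hopf sub-superalgebra, as a bialgebra. -/
noncomputable instance evenPartBialgebra (H : HopfSubSuperalgebra 𝒜) : Bialgebra k H.evenPart :=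
  Bialgebra.mk' k H.evenPart
    (by rw [H.val_counit]; exact HopfSuperalgebra.counit_one (𝒜 := 𝒜))
    (fun {a b} ↦ by
      simp only [H.val_counit]; exact HopfSuperalgebra.counit_mul (𝒜 := 𝒜) (a : A) b)
    (by
      apply H.map_val_injective
      rw [H.map_val_comul]
      exact HopfSuperalgebra.comul_one (𝒜 := 𝒜))
    (fun {a b} ↦ by
      apply H.map_val_injective
      change _ = Algebra.TensorProduct.map H.evenPart.val H.evenPart.val _
      rw [H.map_val_comul, map_mul]
      change _ = TensorProduct.map H.evenPart.val.toLinearMap H.evenPart.val.toLinearMap _ *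
        TensorProduct.map H.evenPart.val.toLinearMap H.evenPart.val.toLinearMap _
      rw [H.map_val_comul, H.map_val_comul]
      have := HopfSuperalgebra.comul_mul (𝒜 := 𝒜) (a : A) b
      rw [(of_mul_of_even H _ _ a.2.2 b.2.2).1] at this
      exact (GradedTensorProduct.of k 𝒜 𝒜).injective this)

instance evenPart_isCocomm (H : HopfSubSuperalgebra 𝒜) : Coalgebra.IsCocomm k H.evenPart where
  comm_comp_comul := by
    refine LinearMap.ext fun x ↦ ?_
    apply H.map_val_injective
    rw [H.map_val_comul, ← H.comm_comul x x.2, ← H.map_val_comul]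
    simp only [LinearMap.comp_apply, LinearEquiv.coe_coe]
    generalize Coalgebra.comul (R := k) x = t
    induction t with
    | zero => simp
    | add x y hx hy => simp only [map_add, hx, hy]
    | tmul a b => simp

theorem HopfSubSuperalgebra.evenPart_le (H : HopfSubSuperalgebra 𝒜) :
    H.evenPart ≤ (fullSub 𝒜).evenPart := by
  rintro a ⟨_, ha⟩
  refine ⟨Algebra.mem_top, ?_⟩
  obtain ⟨t, ht⟩ := ha
  have hle : H.zeroPart ≤ (fullSub 𝒜).zeroPart :=
    fun x hx ↦ ⟨Algebra.mem_top (R := k) (A := A), hx.2⟩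
  refine ⟨TensorProduct.map (Submodule.inclusion hle) (Submodule.inclusion hle) t, ?_⟩
  rw [← ht]
  clear ht
  induction t with
  | zero => simp
  | add x y hx hy => simp only [map_add, hx, hy]
  | tmul a b => rfl

/-- The inclusion of the largest purely even Hopf subalgebras. -/
noncomputable def HopfSubSuperalgebra.evenIncl (H : HopfSubSuperalgebra 𝒜) :
    H.evenPart →ₐc[k] (fullSub 𝒜).evenPart :=
  BialgHom.ofAlgHom (Subalgebra.inclusion H.evenPart_le) (by ext a; rfl) (by
    refine AlgHom.ext fun x ↦ ?_
    apply (fullSub 𝒜).map_val_injective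
    have : ∀ t : H.evenPart ⊗[k] H.evenPart,
        TensorProduct.map (fullSub 𝒜).evenPart.val.toLinearMap
          (fullSub 𝒜).evenPart.val.toLinearMap
          (Algebra.TensorProduct.map (Subalgebra.inclusion H.evenPart_le)
            (Subalgebra.inclusion H.evenPart_le) t) =
        TensorProduct.map H.evenPart.val.toLinearMap H.evenPart.val.toLinearMap t := by
      intro t
      induction t with
      | zero => simp
      | add x y hx hy => simp only [map_add, hx, hy]
      | tmul a b => rfl
    refine (this _).trans ?_
    refine (H.map_val_comul x).trans ?_
    exact ((fullSub 𝒜).map_val_comul (Subalgebra.inclusion H.evenPart_le x)).symm)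

end Even

section Adjoint

variable {k A : Type*} [Field k] [Ring A] [Algebra k A] [Coalgebra k A]

/-- The left adjoint action `a ▷ v = a₍₁₎ v S(a₍₂₎)`, for `a` in the even part. -/
noncomputable def adjoint (𝒜 : ZMod 2 → Submodule k A) [GradedAlgebra 𝒜] [HopfSuperalgebra 𝒜] :
    A →ₗ[k] A →ₗ[k] A :=
  TensorProduct.lift ((LinearMap.mul k (Module.End k A)).compl₁₂ (LinearMap.mul k A)
    ((LinearMap.mul k A).flip ∘ₗ HopfSuperalgebra.antipode 𝒜)) ∘ₗ Coalgebra.comul (R := k)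

variable {𝒜 : ZMod 2 → Submodule k A} [GradedAlgebra 𝒜] [HopfSuperalgebra 𝒜]

theorem adjoint_apply (a v : A) : adjoint 𝒜 a v = LinearMap.mul' k A (TensorProduct.map
    (LinearMap.mulRight k v) (HopfSuperalgebra.antipode 𝒜) (Coalgebra.comul (R := k) a)) := by
  rw [adjoint, LinearMap.comp_apply]
  generalize Coalgebra.comul (R := k) a = t
  induction t with
  | zero => simp
  | add x y hx hy => simp only [map_add, LinearMap.add_apply, hx, hy]
  | tmul a b => simp [mul_assoc]

/-- The space of odd primitive elements of a Hopf sub-superalgebra. -/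
def HopfSubSuperalgebra.oddPrim (H : HopfSubSuperalgebra 𝒜) : Submodule k A where
  carrier := {v | v ∈ H.toSubalgebra ∧ v ∈ 𝒜 1 ∧
    Coalgebra.comul (R := k) v = 1 ⊗ₜ[k] v + v ⊗ₜ[k] 1}
  zero_mem' := ⟨H.toSubalgebra.zero_mem, zero_mem _, by simp⟩
  add_mem' := by
    rintro v w ⟨h1, h2, h3⟩ ⟨h1', h2', h3'⟩
    refine ⟨H.toSubalgebra.add_mem h1 h1', add_mem h2 h2', ?_⟩
    rw [map_add, h3, h3', TensorProduct.tmul_add, TensorProduct.add_tmul]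
    abel
  smul_mem' := by
    rintro r v ⟨h1, h2, h3⟩
    refine ⟨H.toSubalgebra.smul_mem h1 r, Submodule.smul_mem _ _ h2, ?_⟩
    rw [map_smul, h3, smul_add, TensorProduct.tmul_smul, TensorProduct.smul_tmul' r v (1 : A)]

theorem HopfSubSuperalgebra.evenPart_le_zero (H : HopfSubSuperalgebra 𝒜) (a : A)
    (ha : a ∈ H.evenPart) : a ∈ 𝒜 0 := by
  have := rid_lTensor_mem _ (Coalgebra.counit (R := k)) _ (mapIncl_le_rTensor _ _ _ ha.2)
  rw [Coalgebra.lTensor_counit_comul] at this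
  simpa using this.2

theorem adjoint_mem_one (H : HopfSubSuperalgebra 𝒜) (a v : A) (ha : a ∈ H.evenPart)
    (hv : v ∈ H.toSubalgebra) (hv' : v ∈ 𝒜 1) :
    adjoint 𝒜 a v ∈ H.toSubalgebra ∧ adjoint 𝒜 a v ∈ 𝒜 1 := by
  rw [adjoint_apply]
  obtain ⟨t, ht⟩ := ha.2
  rw [← ht]
  clear ht
  induction t with
  | zero => simp
  | add x y hx hy =>
    simp only [map_add]
    exact ⟨H.toSubalgebra.add_mem hx.1 hy.1, add_mem hx.2 hy.2⟩
  | tmul a b =>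
    simp only [TensorProduct.mapIncl, TensorProduct.map_tmul, Submodule.subtype_apply,
      LinearMap.mul'_apply, LinearMap.mulRight_apply]
    refine ⟨H.toSubalgebra.mul_mem (H.toSubalgebra.mul_mem a.2.1 hv) (H.antipode_mem _ b.2.1), ?_⟩
    simpa using SetLike.mul_mem_graded (SetLike.mul_mem_graded a.2.2 hv')
      (HopfSuperalgebra.antipode_mem _ _ b.2.2)

theorem include_comm {k A : Type*} [Field k] [Ring A] [Algebra k A]
    (𝒜 : ZMod 2 → Submodule k A) [GradedAlgebra 𝒜] (i j : ZMod 2) (hij : j * i = 0) (a b : A) (ha : a ∈ 𝒜 i) (hb : b ∈ 𝒜 j) :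
    GradedTensorProduct.includeLeft 𝒜 𝒜 a * GradedTensorProduct.includeRight 𝒜 𝒜 b =
      (1 : k) • (GradedTensorProduct.includeRight 𝒜 𝒜 b *
        GradedTensorProduct.includeLeft 𝒜 𝒜 a) := by
  have h1 := GradedTensorProduct.tmul_coe_mul_coe_tmul (R := k) 𝒜 𝒜 1 ⟨b, hb⟩ ⟨a, ha⟩ 1
  have h2 := GradedTensorProduct.tmul_one_mul_one_tmul (R := k) 𝒜 𝒜 a b
  rw [hij, uzpow_zero, one_smul] at h1
  rw [GradedTensorProduct.includeLeft_apply, GradedTensorProduct.includeRight_apply, h1, h2,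
    one_smul, one_mul, mul_one]

theorem comul_adjoint (H : HopfSubSuperalgebra 𝒜) (a v : A) (ha : a ∈ H.evenPart)
    (hv : v ∈ H.toSubalgebra) (hv' : v ∈ 𝒜 1)
    (hp : Coalgebra.comul (R := k) v = 1 ⊗ₜ[k] v + v ⊗ₜ[k] 1) :
    Coalgebra.comul (R := k) (adjoint 𝒜 a v) =
      1 ⊗ₜ[k] adjoint 𝒜 a v + adjoint 𝒜 a v ⊗ₜ[k] 1 := by
  let E := H.evenPart
  let Δ : A →ₐ[k] GradedTensorProduct k 𝒜 𝒜 := AlgHom.ofLinearMap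
    ((GradedTensorProduct.of k 𝒜 𝒜).toLinearMap ∘ₗ Coalgebra.comul (R := k))
    (congrArg (GradedTensorProduct.of k 𝒜 𝒜) (HopfSuperalgebra.comul_one (𝒜 := 𝒜)))
    (HopfSuperalgebra.comul_mul (𝒜 := 𝒜))
  let L := convPost E (GradedTensorProduct.includeLeft 𝒜 𝒜)
  let R := convPost E (GradedTensorProduct.includeRight 𝒜 𝒜)
  let D := convPost E Δ
  let i : WithConv (E →ₗ[k] A) := .toConv E.val.toLinearMap
  let S : WithConv (E →ₗ[k] A) := .toConv (HopfSuperalgebra.antipode 𝒜 ∘ₗ E.val.toLinearMap)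
  let f : WithConv (E →ₗ[k] A) := .toConv (LinearMap.mulRight k v ∘ₗ E.val.toLinearMap)
  have hi0 : ∀ x : E, i x ∈ 𝒜 0 := fun x ↦ H.evenPart_le_zero x x.2
  have hS0 : ∀ x : E, S x ∈ 𝒜 0 := fun x ↦ HopfSuperalgebra.antipode_mem 0 _ (hi0 x)
  have conv (x : E) (g h : A →ₗ[k] A) : (WithConv.toConv (g ∘ₗ E.val.toLinearMap) *
      WithConv.toConv (h ∘ₗ E.val.toLinearMap) : WithConv (E →ₗ[k] A)) x =
      LinearMap.mul' k A (TensorProduct.map g h (Coalgebra.comul (R := k) (x : A))) := by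
    rw [LinearMap.convMul_apply, ← H.map_val_comul, ← LinearMap.comp_apply (TensorProduct.map g h),
      ← TensorProduct.map_comp]
  have hw : ∀ x : E, (f * S) x = adjoint 𝒜 (x : A) v := fun x ↦ by
    rw [adjoint_apply]; exact conv x _ _
  have hiS : i * S = 1 := by
    ext x
    refine (conv x LinearMap.id _).trans ?_
    refine (HopfSuperalgebra.mul_antipode_lTensor_comul (𝒜 := 𝒜) (x : A)).trans ?_
    rw [LinearMap.convOne_apply]; rfl
  have hSi : S * i = 1 := by
    ext x
    refine (conv x _ LinearMap.id).trans ?_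
    refine (HopfSuperalgebra.mul_antipode_rTensor_comul (𝒜 := 𝒜) (x : A)).trans ?_
    rw [LinearMap.convOne_apply]; rfl
  have hw1 : ∀ x : E, (f * S) x ∈ 𝒜 1 := fun x ↦ by
    rw [hw]; exact (adjoint_mem_one H x v x.2 hv hv').2
  have hDi : D i = L i * R i := by
    ext x
    rw [LinearMap.convMul_apply]
    change GradedTensorProduct.of k 𝒜 𝒜 (Coalgebra.comul (R := k) (x : A)) = _
    rw [← H.map_val_comul]
    generalize Coalgebra.comul (R := k) x = t
    induction t with
    | zero => simp
    | add x y hx hy => simp only [map_add, hx, hy]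
    | tmul a b =>
      exact (GradedTensorProduct.tmul_one_mul_one_tmul (R := k) 𝒜 𝒜 (a : A) (b : A)).symm
  have c1 : ∀ g h : WithConv (E →ₗ[k] A), ∀ i j : ZMod 2, j * i = 0 → (∀ x, g x ∈ 𝒜 i) →
      (∀ x, h x ∈ 𝒜 j) → L g * R h = R h * L g := by
    intro g h i j hij hg hh
    have := conv_comm (L g) (R h) (1 : k)
      (fun x y ↦ include_comm 𝒜 i j hij (g x) (h y) (hg x) (hh y))
    rwa [one_smul] at this
  have hDS : D S = L S * R S := by
    have e1 : D S * D i = 1 := by rw [← map_mul, hSi, map_one]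
    have e2 : D i * (L S * R S) = 1 := by
      rw [hDi, c1 S S 0 0 rfl hS0 hS0, mul_assoc, ← mul_assoc (R i), ← map_mul R, hiS, map_one,
        one_mul, ← map_mul, hiS, map_one]
    calc D S = D S * (D i * (L S * R S)) := by rw [e2, mul_one]
      _ = L S * R S := by rw [← mul_assoc, e1, one_mul]
  have hΔv : Δ v = GradedTensorProduct.includeLeft 𝒜 𝒜 v +
      GradedTensorProduct.includeRight 𝒜 𝒜 v := by
    change GradedTensorProduct.of k 𝒜 𝒜 (Coalgebra.comul (R := k) v) = _
    rw [hp, map_add, add_comm]; rfl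
  have rm : ∀ (g h : WithConv (E →ₗ[k] GradedTensorProduct k 𝒜 𝒜))
      (b : GradedTensorProduct k 𝒜 𝒜) (x : E), (g * h) x * b =
      (g * .toConv (LinearMap.mulRight k b ∘ₗ h.ofConv)) x := by
    intro g h b x
    rw [LinearMap.convMul_apply, LinearMap.convMul_apply]
    generalize Coalgebra.comul (R := k) x = t
    induction t with
    | zero => simp
    | add x y hx hy => simp only [map_add, add_mul, hx, hy]
    | tmul a c => simp [mul_assoc]
  have hDf : D f = R i * L f + L i * R f := by
    ext x
    change Δ ((x : A) * v) = (R i * L f) x + (L i * R f) x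
    rw [map_mul, hΔv, mul_add]
    congr 1
    · change D i x * _ = _
      rw [hDi, c1 i i 0 0 rfl hi0 hi0, rm]
      refine congrArg (fun g ↦ (_ * g : WithConv (E →ₗ[k] GradedTensorProduct k 𝒜 𝒜)) x) ?_
      ext y
      exact (map_mul (GradedTensorProduct.includeLeft 𝒜 𝒜) (y : A) v).symm
    · change D i x * _ = _
      rw [hDi, rm]
      refine congrArg (fun g ↦ (_ * g : WithConv (E →ₗ[k] GradedTensorProduct k 𝒜 𝒜)) x) ?_
      ext y
      exact (map_mul (GradedTensorProduct.includeRight 𝒜 𝒜) (y : A) v).symm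
  have main : D (f * S) = L (f * S) + R (f * S) := by
    rw [map_mul, hDf, add_mul]
    congr 1
    · rw [hDS, mul_assoc, ← mul_assoc (L f), ← map_mul L, c1 _ S 1 0 rfl hw1 hS0, ← mul_assoc,
        ← map_mul, hiS, map_one, one_mul]
    · rw [hDS, c1 S S 0 0 rfl hS0 hS0, mul_assoc, ← mul_assoc (R f), ← map_mul R,
        ← c1 S _ 0 1 rfl hS0 hw1, ← mul_assoc, ← map_mul, hiS, map_one, one_mul]
  have h := congrArg (fun g : WithConv (E →ₗ[k] GradedTensorProduct k 𝒜 𝒜) ↦ g ⟨a, ha⟩) main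
  have h' : Δ ((f * S) ⟨a, ha⟩) = GradedTensorProduct.includeLeft 𝒜 𝒜 ((f * S) ⟨a, ha⟩) +
      GradedTensorProduct.includeRight 𝒜 𝒜 ((f * S) ⟨a, ha⟩) := h
  rw [hw] at h'
  apply (GradedTensorProduct.of k 𝒜 𝒜).injective
  refine Eq.trans h' ?_
  rw [map_add, add_comm]
  rfl

theorem HopfSubSuperalgebra.adjoint_mem (H : HopfSubSuperalgebra 𝒜) (a v : A)
    (ha : a ∈ H.evenPart) (hv : v ∈ H.oddPrim) : adjoint 𝒜 a v ∈ H.oddPrim :=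
  ⟨(adjoint_mem_one H a v ha hv.1 hv.2.1).1, (adjoint_mem_one H a v ha hv.1 hv.2.1).2,
    comul_adjoint H a v ha hv.1 hv.2.1 hv.2.2⟩

/-- The quotient `Q = V_A / V_H` of the spaces of odd primitive elements. -/
abbrev HopfSubSuperalgebra.OddQuotient (H : HopfSubSuperalgebra 𝒜) : Type _ :=
  (fullSub 𝒜).oddPrim ⧸ H.oddPrim.submoduleOf (fullSub 𝒜).oddPrim

/-- The left adjoint action of the even part `K` of `H` on `V_A`. -/
noncomputable def HopfSubSuperalgebra.adjointOddPrim (H : HopfSubSuperalgebra 𝒜) :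
    H.evenPart →ₗ[k] (fullSub 𝒜).oddPrim →ₗ[k] (fullSub 𝒜).oddPrim :=
  LinearMap.mk₂ k (fun a v ↦ ⟨adjoint 𝒜 (a : A) (v : A),
      (fullSub 𝒜).adjoint_mem a v (H.evenPart_le a.2) v.2⟩)
    (fun a b v ↦ Subtype.ext (by simp)) (fun r a v ↦ Subtype.ext (by simp))
    (fun a v w ↦ Subtype.ext (by simp)) (fun r a v ↦ Subtype.ext (by simp))

/-- The left `K`-action on `Q` induced by the left adjoint action. -/
noncomputable def HopfSubSuperalgebra.oddAct (H : HopfSubSuperalgebra 𝒜) :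
    H.evenPart →ₗ[k] H.OddQuotient →ₗ[k] H.OddQuotient where
  toFun a := Submodule.mapQ _ _ (H.adjointOddPrim a)
    (fun v hv ↦ H.adjoint_mem a (v : A) a.2 hv)
  map_add' a b := by
    refine Submodule.linearMap_qext _ (LinearMap.ext fun v ↦ ?_)
    simp only [LinearMap.comp_apply, LinearMap.add_apply, Submodule.mapQ_apply,
      Submodule.mkQ_apply, map_add, Submodule.Quotient.mk_add]
    rfl
  map_smul' r a := by
    refine Submodule.linearMap_qext _ (LinearMap.ext fun v ↦ ?_)
    simp only [LinearMap.comp_apply, LinearMap.smul_apply, Submodule.mapQ_apply,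
      Submodule.mkQ_apply, map_smul, Submodule.Quotient.mk_smul, RingHom.id_apply]
    rfl

theorem HopfSubSuperalgebra.oddAct_mk (H : HopfSubSuperalgebra 𝒜) (a : H.evenPart)
    (v : (fullSub 𝒜).oddPrim) :
    H.oddAct a (Submodule.Quotient.mk v) = Submodule.Quotient.mk (H.adjointOddPrim a v) := rfl

end Adjoint

section Cofree

variable {k C V D E : Type*} [Field k] [AddCommGroup C] [Module k C] [Coalgebra k C]
  [AddCommGroup V] [Module k V] [AddCommGroup D] [Module k D] [Coalgebra k D]
  [AddCommGroup E] [Module k E] [Coalgebra k E]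

/-- `ρ : V → V ⊗ C` is a right `C`-comodule structure. -/
structure IsRightComodule (ρ : V →ₗ[k] V ⊗[k] C) : Prop where
  coassoc : (TensorProduct.assoc k V C C).toLinearMap ∘ₗ LinearMap.rTensor C ρ ∘ₗ ρ =
    LinearMap.lTensor V Coalgebra.comul ∘ₗ ρ
  counit : (TensorProduct.rid k V).toLinearMap ∘ₗ LinearMap.lTensor V Coalgebra.counit ∘ₗ ρ =
    LinearMap.id

/-- The right `C`-coaction `(id ⊗ ω) ∘ Δ` on a coalgebra `D` given by `ω : D → C`. -/
noncomputable def coactionVia (ω : D →ₗ[k] C) : D →ₗ[k] D ⊗[k] C :=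
  LinearMap.lTensor D ω ∘ₗ Coalgebra.comul

/-- `(D, ω, π)` is a `C`-super-coalgebra on the purely odd comodule `(V, ρ)`: `D` is a
super-coalgebra, `ω : D → C` is a super-coalgebra map to the purely even `C`, and `π : D → V` is
`C`-colinear and preserves the parity. -/
structure IsSuperCoalgebraOn (ρ : V →ₗ[k] V ⊗[k] C) (𝒟 : ZMod 2 → Submodule k D)
    [DirectSum.Decomposition 𝒟] (ω : D →ₗ[k] C) (π : D →ₗ[k] V) : Prop where
  superCoalgebra : SuperCoalgebra 𝒟
  counit_comp : Coalgebra.counit ∘ₗ ω = (Coalgebra.counit : D →ₗ[k] k)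
  map_comp_comul : TensorProduct.map ω ω ∘ₗ Coalgebra.comul = Coalgebra.comul ∘ₗ ω
  map_odd : ∀ x ∈ 𝒟 1, ω x = 0
  colinear : ρ ∘ₗ π = LinearMap.rTensor C π ∘ₗ coactionVia ω
  proj_even : ∀ x ∈ 𝒟 0, π x = 0

/-- Morphisms `(E, ωE, πE) → (D, ωD, πD)` of `C`-super-coalgebras on `V`: the `C`-colinear
super-coalgebra maps compatible with the maps to `V`. -/
structure IsMorphismOn (ℰ : ZMod 2 → Submodule k E) (ωE : E →ₗ[k] C) (πE : E →ₗ[k] V)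
    (𝒟 : ZMod 2 → Submodule k D) (ωD : D →ₗ[k] C) (πD : D →ₗ[k] V) (f : E →ₗc[k] D) : Prop where
  parity : ∀ i, ∀ x ∈ ℰ i, f x ∈ 𝒟 i
  colinear : coactionVia ωD ∘ₗ f.toLinearMap =
    LinearMap.rTensor C f.toLinearMap ∘ₗ coactionVia ωE
  proj_comp : πD ∘ₗ f.toLinearMap = πE

end Cofree

universe w u v₁ v₂ v₃

/-- `(D, ω, π)` is the co-free `C`-super-coalgebra on `(V, ρ)`: a terminal object among the
`C`-super-coalgebras on `(V, ρ)`. -/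
def IsCofree {k : Type u} {C : Type v₁} {V : Type v₂} {D : Type v₃} [Field k] [AddCommGroup C]
    [Module k C] [Coalgebra k C] [AddCommGroup V] [Module k V] [AddCommGroup D] [Module k D]
    [Coalgebra k D] (ρ : V →ₗ[k] V ⊗[k] C) (𝒟 : ZMod 2 → Submodule k D)
    [DirectSum.Decomposition 𝒟] (ω : D →ₗ[k] C) (π : D →ₗ[k] V) : Prop :=
  IsSuperCoalgebraOn ρ 𝒟 ω π ∧
    ∀ (E : Type w) [AddCommGroup E] [Module k E] [Coalgebra k E] (ℰ : ZMod 2 → Submodule k E)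
      [DirectSum.Decomposition ℰ] (ωE : E →ₗ[k] C) (πE : E →ₗ[k] V),
      IsSuperCoalgebraOn ρ ℰ ωE πE → ∃! f : E →ₗc[k] D, IsMorphismOn ℰ ωE πE 𝒟 ω π f

/-- A graded coalgebra `D = ⨁ₙ D(n)`. -/
structure IsGradedCoalgebra {k D : Type*} [Field k] [AddCommGroup D] [Module k D] [Coalgebra k D]
    (𝒟 : ℕ → Submodule k D) : Prop where
  isInternal : DirectSum.IsInternal 𝒟
  comul_mem : ∀ n, ∀ x ∈ 𝒟 n, Coalgebra.comul (R := k) x ∈ tensorPart 𝒟 n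
  counit_eq_zero : ∀ n, n ≠ 0 → ∀ x ∈ 𝒟 n, Coalgebra.counit (R := k) x = 0

section Explicit

variable {k C V D : Type*} [Field k] [AddCommGroup C] [Module k C]
  [AddCommGroup V] [Module k V] [AddCommGroup D] [Module k D] [Coalgebra k D]

/-- The coaction on the `i`-th tensor factor, with `C` moved to the right:
`v₁ ⊗ ⋯ ⊗ vₙ ↦ (v₁ ⊗ ⋯ ⊗ vᵢ₍₀₎ ⊗ ⋯ ⊗ vₙ) ⊗ vᵢ₍₁₎`. As `C` is purely even, moving it needs no
sign. -/
noncomputable def coactAt (ρ : V →ₗ[k] V ⊗[k] C) {n : ℕ} (i : Fin n) :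
    ⨂[k]^n V →ₗ[k] (⨂[k]^n V) ⊗[k] C :=
  PiTensorProduct.lift
    { toFun := fun v ↦ LinearMap.rTensor C ((PiTensorProduct.tprod k).toLinearMap v i) (ρ (v i))
      map_update_add' := fun {inst} v l x y ↦ by
        obtain rfl : inst = instDecidableEqFin n := Subsingleton.elim _ _
        by_cases h : l = i
        · subst h
          have e : ∀ z, (PiTensorProduct.tprod k).toLinearMap (Function.update v l z) l =
              (PiTensorProduct.tprod k (s := fun _ : Fin n ↦ V)).toLinearMap v l := by
            intro z; ext a; simp
          simp only [e, Function.update_self, map_add]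
        · have e : (PiTensorProduct.tprod k).toLinearMap (Function.update v l (x + y)) i =
              (PiTensorProduct.tprod k (s := fun _ : Fin n ↦ V)).toLinearMap
                (Function.update v l x) i +
              (PiTensorProduct.tprod k (s := fun _ : Fin n ↦ V)).toLinearMap
                (Function.update v l y) i := by
            ext a
            simp [MultilinearMap.toLinearMap_apply, Function.update_comm h]
          rw [e, LinearMap.rTensor_add, Function.update_of_ne (Ne.symm h),
            Function.update_of_ne (Ne.symm h), Function.update_of_ne (Ne.symm h),
            LinearMap.add_apply]
      map_update_smul' := fun {inst} v l r x ↦ by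
        obtain rfl : inst = instDecidableEqFin n := Subsingleton.elim _ _
        by_cases h : l = i
        · subst h
          have e : ∀ z, (PiTensorProduct.tprod k).toLinearMap (Function.update v l z) l =
              (PiTensorProduct.tprod k (s := fun _ : Fin n ↦ V)).toLinearMap v l := by
            intro z; ext a; simp
          simp only [e, Function.update_self, map_smul]
        · have e : (PiTensorProduct.tprod k).toLinearMap (Function.update v l (r • x)) i =
              r • (PiTensorProduct.tprod k (s := fun _ : Fin n ↦ V)).toLinearMap
                (Function.update v l x) i := by
            ext a
            simp [MultilinearMap.toLinearMap_apply, Function.update_comm h]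
          rw [e, LinearMap.rTensor_smul, Function.update_of_ne (Ne.symm h),
            Function.update_of_ne (Ne.symm h), LinearMap.smul_apply] }

theorem coactAt_tprod (ρ : V →ₗ[k] V ⊗[k] C) {n : ℕ} (i : Fin n) (v : Fin n → V) :
    coactAt ρ i (PiTensorProduct.tprod k v) =
      LinearMap.rTensor C ((PiTensorProduct.tprod k).toLinearMap v i) (ρ (v i)) := by
  simp [coactAt]

/-- The component of degree `n ≥ 1` of the explicit co-free super-coalgebra on `V`: the tensors in
`V ⊗ ⋯ ⊗ V` that lie in the cotensor power `V □ ⋯ □ V` (the coactions on all the tensor factors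
agree) and are invariant under the symmetric group, acting by the supersymmetry (with the sign,
as `V` is purely odd). -/
def cofreePart (ρ : V →ₗ[k] V ⊗[k] C) (n : ℕ) : Submodule k (⨂[k]^n V) where
  carrier := {t | (∀ i j : Fin n, coactAt ρ i t = coactAt ρ j t) ∧
    ∀ σ : Equiv.Perm (Fin n),
      ((Equiv.Perm.sign σ : ℤ) : k) • PiTensorProduct.reindex k (fun _ ↦ V) σ t = t}
  zero_mem' := by simp
  add_mem' := by
    rintro s t ⟨h1, h2⟩ ⟨h1', h2'⟩
    refine ⟨fun i j ↦ by rw [map_add, map_add, h1 i j, h1' i j], fun σ ↦ ?_⟩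
    conv_rhs => rw [← h2 σ, ← h2' σ]
    rw [map_add, smul_add]
  smul_mem' := by
    rintro r t ⟨h1, h2⟩
    refine ⟨fun i j ↦ by rw [map_smul, map_smul, h1 i j], fun σ ↦ ?_⟩
    conv_rhs => rw [← h2 σ]
    rw [map_smul, smul_comm]

/-- The `n`-th tensor power of `π : D → V` composed with the iterated coproduct,
`x ↦ π(x₍₁₎) ⊗ ⋯ ⊗ π(x₍ₙ₎)`. -/
noncomputable def canonicalMap (π : D →ₗ[k] V) : (n : ℕ) → D →ₗ[k] ⨂[k]^n V
  | 0 => Coalgebra.counit.smulRight (PiTensorProduct.tprod k Fin.elim0)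
  | n + 1 => TensorPower.mulEquiv.toLinearMap ∘ₗ
      TensorProduct.map (canonicalMap π n)
        ((PiTensorProduct.subsingletonEquiv (0 : Fin 1)).symm.toLinearMap ∘ₗ π) ∘ₗ
      Coalgebra.comul

/-- The canonical map from a graded `C`-super-coalgebra `D` on `V` to the explicit co-free graded
`C`-super-coalgebra on `V`, whose components are `ω` in degree `0` and
`x ↦ π(x₍₁₎) ⊗ ⋯ ⊗ π(x₍ₙ₎)` in degree `n ≥ 1`, is an isomorphism of graded coalgebras. The
coproduct of the target is given by deconcatenation and by the coaction. -/
structure IsCanonicalIso [Coalgebra k C] (ρ : V →ₗ[k] V ⊗[k] C) (𝒟 : ℕ → Submodule k D) (ω : D →ₗ[k] C)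
    (π : D →ₗ[k] V) : Prop where
  bijOn_zero : Set.BijOn ω (𝒟 0) Set.univ
  zero_of_ne : ∀ n, n ≠ 0 → ∀ x ∈ 𝒟 n, ω x = 0
  bijOn : ∀ n, n ≠ 0 → Set.BijOn (canonicalMap π n) (𝒟 n) (cofreePart ρ n)
  canonicalMap_of_ne : ∀ n, n ≠ 0 → ∀ m, m ≠ n → ∀ x ∈ 𝒟 m, canonicalMap π n x = 0
  counit_zero : ∀ x, Coalgebra.counit (R := k) (ω x) = Coalgebra.counit (R := k) x
  comul_zero_zero : ∀ x, TensorProduct.map ω ω (Coalgebra.comul (R := k) x) =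
    Coalgebra.comul (R := k) (ω x)
  comul : ∀ m n, m ≠ 0 → n ≠ 0 → ∀ x, TensorPower.mulEquiv (TensorProduct.map (canonicalMap π m)
    (canonicalMap π n) (Coalgebra.comul (R := k) x)) = canonicalMap π (m + n) x
  comul_right : ∀ n, ∀ i : Fin n, ∀ x, TensorProduct.map (canonicalMap π n) ω
    (Coalgebra.comul (R := k) x) = coactAt ρ i (canonicalMap π n x)
  comul_left : ∀ n, ∀ i : Fin n, ∀ x, TensorProduct.map ω (canonicalMap π n)
    (Coalgebra.comul (R := k) x) =
      TensorProduct.comm k _ _ (coactAt ρ i (canonicalMap π n x))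

end Explicit

end SuperFormal

universe w u v

/-!
The statement is about the canonical map from `J ⊗_K ∧(Q)` to `coF(J ⊗_K Q)`: once it is known to
be bijective in each degree, cofreeness follows formally. Two facts make it bijective, a structure
theorem for Hopf modules and the description of exterior powers by antisymmetric tensors.

*Faithful flatness.* A cocommutative Hopf algebra `J` is faithfully flat over a Hopf subalgebra
`K` (`mem_ker_tensorOverMap`, `mem_range_of_one_tmul_mem`). Over an algebraically closed field
even more holds: the functionals on a cocommutative coalgebra form a commutative algebra, so that
every nonzero comodule contains a common eigenvector, on which the coaction is by a group-like
element (`exists_grouplike_eigenvector`). Such a vector in a quotient of `J` by a sub-Hopf-module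
generates a free `K`-module (`eq_zero_of_mul_mem`), and Zorn's lemma gives a `K`-basis of `J` that
contains `1` (`exists_right_coordinates`). Faithful flatness over `k` descends from the algebraic
closure.

*Hopf modules.* For a left `J`-module `M` the Galois map `J ⊗_K M → M ⊗ J // K`, `a ⊗ m ↦ a₁ m ⊗
a₂`, is bijective. Together with flatness, this shows that a module with a compatible `J //
K`-coaction is generated by its coinvariants (`exists_eq_lift_coinvariants`), and freely so: a
`K`-submodule `R` of coinvariants generates `J ⊗_K R` (`inducedMap_injective`). By faithful
flatness the coinvariants of `J ⊗_K M` are the elements `1 ⊗ m`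
(`exists_one_tmul_of_coinvariant`).

*The canonical map.* In degree `n ≥ 1`, both `J ⊗_K ∧ⁿ(Q)` and the antisymmetric part of the
cotensor power of `J ⊗_K Q` are such Hopf modules, and the canonical map is linear over `J`. It is
therefore enough to see that it is bijective on coinvariants. A tensor that is coinvariant in
every factor is a tensor in `Q` (`map_eq_of_coinvariant`), and the canonical map of `∧(Q)`
identifies `∧ⁿ(Q)` with the antisymmetric tensors (`canonicalMap_ext_injective`,
`exists_canonicalMap_ext`). This last point needs no division by `n!`: the coordinates of the
canonical map are minors, so that it carries the standard basis of `∧ⁿ(Q)` to that of the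
antisymmetric tensors as soon as `2` is invertible.

*Cofreeness.* For a super-coalgebra `E` on `J ⊗_K Q`, the coordinates of its canonical map are
products in the convolution algebra of linear forms on `E`. There odd forms anticommute, so that
each component of the map takes values in `coF` (`canonicalMap_mem_cofreePart`) and at a given
element only finitely many components are nonzero (`exists_canonicalMap_eq_zero`). The components
thus lift to `J ⊗_K ∧(Q)` degree by degree, and their sum is the required map. The components of
the canonical map separate the points, which makes this map comultiplicative and unique
(`IsCanonicalIso.map_comul`, `IsCanonicalIso.existsUnique_morphism`).
-/

namespace SuperFormal

/-! ### Linear forms and common eigenvectors -/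

section Separation

variable {k M N P : Type*} [Field k] [AddCommGroup M] [Module k M] [AddCommGroup N] [Module k N]
  [AddCommGroup P] [Module k P]

/-- The linear forms on the second factor separate the elements of a tensor product. -/
theorem eq_zero_of_forall_lTensor (t : M ⊗[k] N)
    (h : ∀ φ : N →ₗ[k] k, TensorProduct.rid k M (LinearMap.lTensor M φ t) = 0) : t = 0 := by
  obtain ⟨s, rfl⟩ := mem_range_rTensor (⊥ : Submodule k M) t (by simpa using h)
  induction s with
  | zero => simp
  | add x y hx hy =>
    have e : ∀ z : (⊥ : Submodule k M) ⊗[k] N, z = 0 := fun z ↦ by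
      induction z with
      | zero => rfl
      | add a b ha hb => rw [ha, hb, add_zero]
      | tmul a b => rw [Subsingleton.elim a 0, TensorProduct.zero_tmul]
    rw [e (x + y), map_zero]
  | tmul a b => rw [Subsingleton.elim a 0, TensorProduct.zero_tmul, map_zero]

theorem exists_dual_eq_one {n : N} (hn : n ≠ 0) : ∃ ψ : N →ₗ[k] k, ψ n = 1 := by
  obtain ⟨f, hf⟩ := Module.Projective.exists_dual_ne_zero k hn
  exact ⟨(f n)⁻¹ • f, by simp [hf]⟩

theorem tmul_left_cancel {n : N} (hn : n ≠ 0) {x y : P} (h : n ⊗ₜ[k] x = n ⊗ₜ[k] y) : x = y := by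
  obtain ⟨ψ, hψ⟩ := exists_dual_eq_one (k := k) hn
  simpa [hψ] using congrArg (fun t ↦ TensorProduct.lid k P (LinearMap.rTensor P ψ t)) h

theorem mem_range_rTensor_ker (f : M →ₗ[k] N) (t : M ⊗[k] P) (h : LinearMap.rTensor P f t = 0) :
    t ∈ LinearMap.range (LinearMap.rTensor P (LinearMap.ker f).subtype) := by
  refine mem_range_rTensor _ t fun φ ↦ ?_
  rw [LinearMap.mem_ker]
  have : ∀ s : M ⊗[k] P, f (TensorProduct.rid k M (LinearMap.lTensor M φ s)) =
      TensorProduct.rid k N (LinearMap.lTensor N φ (LinearMap.rTensor P f s)) := fun s ↦ by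
    induction s with
    | zero => simp
    | add x y hx hy => simp only [map_add, hx, hy]
    | tmul a b => simp
  rw [this, h]; simp

end Separation

/-- Commuting endomorphisms of a nonzero finite-dimensional space over an algebraically closed
field have a common eigenvector. -/
theorem exists_common_eigenvector {F N ι : Type*} [Field F] [IsAlgClosed F] [AddCommGroup N]
    [Module F N] (T : ι → Module.End F N) (hT : ∀ i l, T i ∘ₗ T l = T l ∘ₗ T i) (n : ℕ) :
    ∀ W : Submodule F N, W ≠ ⊥ → FiniteDimensional F W → (∀ i, ∀ x ∈ W, T i x ∈ W) →
      Module.finrank F W = n → ∃ x ∈ W, x ≠ 0 ∧ ∀ i, ∃ c : F, T i x = c • x := by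
  induction n using Nat.strong_induction_on with
  | _ n ih =>
    intro W hW _ hs hn
    have : Nontrivial W := Submodule.nontrivial_iff_ne_bot.mpr hW
    by_cases h : ∀ i, ∃ c : F, ∀ x ∈ W, T i x = c • x
    · obtain ⟨x, hx, hx0⟩ := Submodule.exists_mem_ne_zero_of_ne_bot hW
      exact ⟨x, hx, hx0, fun i ↦ (h i).imp fun c hc ↦ hc x hx⟩
    · push Not at h
      obtain ⟨i, hi⟩ := h
      obtain ⟨c, hc⟩ := Module.End.exists_eigenvalue ((T i).restrict (hs i))
      obtain ⟨v, hv⟩ := hc.exists_hasEigenvector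
      have hv' : T i v = c • (v : N) := congrArg Subtype.val hv.apply_eq_smul
      obtain ⟨y, hyW, hy⟩ := hi c
      -- an eigenspace of an endomorphism that is not scalar is stable under the others, and smaller
      let W' : Submodule F N := W ⊓ LinearMap.ker (T i - c • LinearMap.id)
      have hW' : ∀ x, x ∈ W' ↔ x ∈ W ∧ T i x = c • x := fun x ↦ by
        simp [W', sub_eq_zero]
      have hlt : W' < W := lt_of_le_of_ne inf_le_left fun e ↦
        hy ((hW' y).mp (e.symm ▸ hyW)).2
      obtain ⟨x, hx, h⟩ := ih _ (hn ▸ Submodule.finrank_lt_finrank_of_lt hlt) W'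
        (fun e ↦ hv.2 (by
          have : (v : N) ∈ W' := (hW' _).mpr ⟨v.2, hv'⟩
          rw [e] at this
          exact Subtype.ext (by simpa using this)))
        (Submodule.finiteDimensional_of_le hlt.le)
        (fun l x hx ↦ by
          rw [hW'] at hx ⊢
          refine ⟨hs l x hx.1, ?_⟩
          rw [← LinearMap.comp_apply, hT, LinearMap.comp_apply, hx.2, map_smul]) rfl
      exact ⟨x, hlt.le hx, h⟩

section Comodule

variable {F N J : Type*} [Field F] [AddCommGroup N] [Module F N] [AddCommGroup J] [Module F J]
  [Coalgebra F J]

/-- The action of a functional on the coalgebra on a right comodule. -/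
noncomputable def dualAct (ρ : N →ₗ[F] N ⊗[F] J) (f : J →ₗ[F] F) : N →ₗ[F] N :=
  (TensorProduct.rid F N).toLinearMap ∘ₗ LinearMap.lTensor N f ∘ₗ ρ

theorem dualAct_comp {ρ : N →ₗ[F] N ⊗[F] J} (hρ : IsRightComodule ρ) (f g : J →ₗ[F] F) :
    dualAct ρ f ∘ₗ dualAct ρ g =
      dualAct ρ (WithConv.toConv f * WithConv.toConv g : WithConv (J →ₗ[F] F)).ofConv := by
  have key : ∀ t : N ⊗[F] J, dualAct ρ f (TensorProduct.rid F N (LinearMap.lTensor N g t)) =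
      TensorProduct.rid F N (LinearMap.lTensor N (LinearMap.mul' F F ∘ₗ TensorProduct.map f g)
        (TensorProduct.assoc F N J J (LinearMap.rTensor J ρ t))) := fun t ↦ by
    induction t with
    | zero => simp
    | add x y hx hy => simp only [map_add, hx, hy]
    | tmul n a =>
      simp only [LinearMap.lTensor_tmul, TensorProduct.rid_tmul, map_smul, dualAct,
        LinearMap.comp_apply, LinearEquiv.coe_coe, LinearMap.rTensor_tmul]
      generalize ρ n = s
      induction s with
      | zero => simp
      | add x y hx hy => simp only [map_add, smul_add, hx, hy, TensorProduct.add_tmul]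
      | tmul m b => simp [smul_smul, mul_comm]
  refine LinearMap.ext fun n ↦ ?_
  have h := LinearMap.congr_fun hρ.coassoc n
  simp only [LinearMap.comp_apply, LinearEquiv.coe_coe] at h
  rw [LinearMap.comp_apply]
  refine (key (ρ n)).trans ?_
  rw [h, ← LinearMap.comp_apply (LinearMap.lTensor _ _), ← LinearMap.lTensor_comp]
  rfl

/-- Over an algebraically closed field, a nonzero comodule over a cocommutative coalgebra contains
a one-dimensional subcomodule, on which the coaction is given by a group-like element. -/
theorem exists_grouplike_eigenvector [IsAlgClosed F] [Coalgebra.IsCocomm F J] [Nontrivial N]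
    {ρ : N →ₗ[F] N ⊗[F] J} (hρ : IsRightComodule ρ) :
    ∃ n : N, n ≠ 0 ∧ ∃ g : J, ρ n = n ⊗ₜ g ∧ Coalgebra.counit (R := F) g = 1 ∧
      Coalgebra.comul (R := F) g = g ⊗ₜ g := by
  obtain ⟨x, hx⟩ := exists_ne (0 : N)
  -- the subcomodule generated by `x` is finite-dimensional, and the functionals on `J` act on it by
  -- commuting endomorphisms
  let E : (J →ₗ[F] F) →ₗ[F] N :=
    { toFun := fun f ↦ dualAct ρ f x
      map_add' := fun f g ↦ by simp [dualAct, LinearMap.lTensor_add]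
      map_smul' := fun r f ↦ by simp [dualAct, LinearMap.lTensor_smul] }
  have hcounit : dualAct ρ Coalgebra.counit = LinearMap.id := hρ.counit
  have hfin : FiniteDimensional F (LinearMap.range E) := by
    obtain ⟨S, hS⟩ := TensorProduct.exists_finset (R := F) (ρ x)
    have := FiniteDimensional.span_of_finite F (S.finite_toSet.image (Prod.fst : N × J → N))
    refine Submodule.finiteDimensional_of_le (S₂ := Submodule.span F
      (Prod.fst '' (S : Set (N × J)))) ?_
    rintro _ ⟨f, rfl⟩
    change TensorProduct.rid F N (LinearMap.lTensor N f (ρ x)) ∈ _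
    rw [hS, map_sum, map_sum]
    refine Submodule.sum_mem _ fun i hi ↦ ?_
    rw [LinearMap.lTensor_tmul, TensorProduct.rid_tmul]
    exact Submodule.smul_mem _ _ (Submodule.subset_span ⟨i, hi, rfl⟩)
  obtain ⟨n, -, hn, h⟩ := exists_common_eigenvector (dualAct ρ) (fun f g ↦ by
      rw [dualAct_comp hρ, dualAct_comp hρ, mul_comm]) _ (LinearMap.range E)
    (fun e ↦ hx (by
      have : x ∈ LinearMap.range E := ⟨Coalgebra.counit, by
        change dualAct ρ Coalgebra.counit x = x; rw [hcounit]; rfl⟩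
      rwa [e, Submodule.mem_bot] at this)) hfin
    (by
      rintro f _ ⟨g, rfl⟩
      exact ⟨_, (LinearMap.congr_fun (dualAct_comp hρ f g) x).symm⟩) rfl
  obtain ⟨ψ, hψ⟩ := exists_dual_eq_one (k := F) hn
  let g : J := TensorProduct.lid F J (LinearMap.rTensor J ψ (ρ n))
  have hg : ρ n = n ⊗ₜ g := by
    rw [← sub_eq_zero]
    refine eq_zero_of_forall_lTensor _ fun φ ↦ ?_
    obtain ⟨c, hc⟩ := h φ
    have h1 : ∀ t : N ⊗[F] J, φ (TensorProduct.lid F J (LinearMap.rTensor J ψ t)) =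
        ψ (TensorProduct.rid F N (LinearMap.lTensor N φ t)) := fun t ↦ by
      induction t with
      | zero => simp
      | add x y hx hy => simp only [map_add, hx, hy]
      | tmul a b => simp [mul_comm]
    have h2 : φ g = c := by
      change φ (TensorProduct.lid F J (LinearMap.rTensor J ψ (ρ n))) = c
      rw [h1]
      change ψ (dualAct ρ φ n) = c
      rw [hc, map_smul, hψ, smul_eq_mul, mul_one]
    rw [map_sub, map_sub, sub_eq_zero, LinearMap.lTensor_tmul, TensorProduct.rid_tmul, h2]
    exact hc
  refine ⟨n, hn, g, hg, ?_, ?_⟩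
  · have := LinearMap.congr_fun hcounit n
    simp only [dualAct, LinearMap.comp_apply, hg, LinearMap.lTensor_tmul, LinearEquiv.coe_coe,
      TensorProduct.rid_tmul, LinearMap.id_apply] at this
    have h2 := congrArg ψ this
    simpa [hψ] using h2
  · have h := LinearMap.congr_fun hρ.coassoc n
    simp only [LinearMap.comp_apply, LinearEquiv.coe_coe, hg, LinearMap.rTensor_tmul,
      TensorProduct.assoc_tmul, LinearMap.lTensor_tmul] at h
    exact (tmul_left_cancel hn h).symm

end Comodule

/-! ### Right coordinates over a Hopf subalgebra -/

section Free

variable {F J K : Type*} [Field F] [Ring J] [HopfAlgebra F J] [Ring K] [HopfAlgebra F K]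

/-- The map `(c_s) ↦ ∑ s c_s` from the right `K`-module freely generated by the elements of `J`. -/
noncomputable def rightComb (j : K →ₐc[F] J) : (J →₀ K) →ₗ[F] J :=
  Finsupp.lsum F fun s ↦ LinearMap.mulLeft F s ∘ₗ (j : K →ₗ[F] J)

theorem rightComb_single (j : K →ₐc[F] J) (s : J) (c : K) :
    rightComb j (Finsupp.single s c) = s * j c := by
  simp [rightComb]

/-- Right multiplication by `c` on the free right `K`-module. -/
noncomputable def finsuppMulRight (F : Type*) {J K : Type*} [Field F] [Ring K] [Algebra F K]
    (c : K) : (J →₀ K) →ₗ[F] (J →₀ K) :=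
  Finsupp.mapRange.linearMap (LinearMap.mulRight F c)

theorem rightComb_mulRight (j : K →ₐc[F] J) (c : K) (x : J →₀ K) :
    rightComb j (finsuppMulRight F c x) = rightComb j x * j c := by
  induction x using Finsupp.induction_linear with
  | zero => simp
  | add x y hx hy => simp only [map_add, hx, hy, add_mul]
  | single s d =>
    rw [finsuppMulRight, Finsupp.mapRange.linearMap_apply, Finsupp.mapRange_single,
      rightComb_single, rightComb_single, LinearMap.mulRight_apply, map_mul, mul_assoc]

theorem finsuppMulRight_mem {F J K : Type*} [Field F] [Ring K] [Algebra F K] (c : K)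
    (S : Set J) (x : J →₀ K) (hx : x ∈ Finsupp.supported K F S) :
    finsuppMulRight F c x ∈ Finsupp.supported K F S := by
  rw [Finsupp.mem_supported] at hx ⊢
  exact (Finset.coe_subset.mpr (Finsupp.support_mapRange
    (hf := map_zero (LinearMap.mulRight F c)))).trans hx

/-- The right `K`-submodule `∑ s K` of `J` generated by `S`. -/
noncomputable def rightSpan (j : K →ₐc[F] J) (S : Set J) : Submodule F J :=
  (Finsupp.supported K F S).map (rightComb j)

theorem mul_mem_rightSpan (j : K →ₐc[F] J) {S : Set J} {x : J} (hx : x ∈ rightSpan j S) (c : K) :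
    x * j c ∈ rightSpan j S := by
  obtain ⟨x, hx, rfl⟩ := hx
  exact ⟨_, finsuppMulRight_mem c S x hx, rightComb_mulRight j c x⟩

theorem rightSpan_mono (j : K →ₐc[F] J) {S T : Set J} (h : S ⊆ T) :
    rightSpan j S ≤ rightSpan j T :=
  Submodule.map_mono (Finsupp.supported_mono h)

theorem subset_rightSpan (j : K →ₐc[F] J) {S : Set J} {s : J} (hs : s ∈ S) :
    s ∈ rightSpan j S :=
  ⟨Finsupp.single s 1, Finsupp.single_mem_supported F _ hs, by rw [rightComb_single]; simp⟩

theorem range_rTensor_mono {N : Type*} [AddCommGroup N] [Module F N] {X Y : Submodule F J}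
    (h : X ≤ Y) : LinearMap.range (LinearMap.rTensor N X.subtype) ≤
      LinearMap.range (LinearMap.rTensor N Y.subtype) := by
  have : X.subtype = Y.subtype ∘ₗ Submodule.inclusion h := rfl
  rw [this, LinearMap.rTensor_comp]
  exact LinearMap.range_comp_le_range _ _

/-- `J` is a Hopf module: a right `K`-submodule whose generators have coproducts in `X ⊗ J` is
a right coideal. -/
theorem comul_mem_rightSpan (j : K →ₐc[F] J) {S : Set J}
    (hS : ∀ s ∈ S, Coalgebra.comul (R := F) s ∈
      LinearMap.range (LinearMap.rTensor J (rightSpan j S).subtype)) {x : J}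
    (hx : x ∈ rightSpan j S) : Coalgebra.comul (R := F) x ∈
      LinearMap.range (LinearMap.rTensor J (rightSpan j S).subtype) := by
  obtain ⟨x, hx, rfl⟩ := hx
  have key : ∀ t : K ⊗[F] K, ∀ u ∈ LinearMap.range (LinearMap.rTensor J (rightSpan j S).subtype),
      u * TensorProduct.map (j : K →ₗ[F] J) (j : K →ₗ[F] J) t ∈
        LinearMap.range (LinearMap.rTensor J (rightSpan j S).subtype) := by
    rintro t _ ⟨u, rfl⟩
    induction t with
    | zero => simp
    | add x y hx hy => rw [map_add, mul_add]; exact add_mem hx hy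
    | tmul c d =>
      induction u with
      | zero => simp
      | add x y hx hy => rw [map_add, add_mul]; exact add_mem hx hy
      | tmul a b => exact ⟨⟨a.1 * j c, mul_mem_rightSpan j a.2 c⟩ ⊗ₜ (b * j d), by simp⟩
  have hx' : x = ∑ s ∈ x.support, Finsupp.single s (x s) := (Finsupp.sum_single x).symm
  rw [hx', map_sum, map_sum]
  refine Submodule.sum_mem _ fun s hs ↦ ?_
  rw [rightComb_single, comul_mul_map]
  exact key _ _ (hS s (hx hs))

/-- The coaction of `J` on the quotient of `J` by a right coideal. -/
noncomputable def quotCoaction (X : Submodule F J) (hX : ∀ x ∈ X, Coalgebra.comul (R := F) x ∈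
      LinearMap.range (LinearMap.rTensor J X.subtype)) : (J ⧸ X) →ₗ[F] (J ⧸ X) ⊗[F] J :=
  X.liftQ (LinearMap.rTensor J X.mkQ ∘ₗ Coalgebra.comul) (by
    intro x hx
    obtain ⟨t, ht⟩ := hX x hx
    rw [LinearMap.mem_ker, LinearMap.comp_apply, ← ht, ← LinearMap.comp_apply,
      ← LinearMap.rTensor_comp]
    have : X.mkQ ∘ₗ X.subtype = 0 := by ext x; simp
    rw [this]; simp)

theorem quotCoaction_mk (X : Submodule F J) (hX) (x : J) :
    quotCoaction X hX (X.mkQ x) = LinearMap.rTensor J X.mkQ (Coalgebra.comul (R := F) x) := rfl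

theorem isRightComodule_quotCoaction (X : Submodule F J) (hX) :
    IsRightComodule (quotCoaction X hX) where
  coassoc := by
    refine Submodule.linearMap_qext _ (LinearMap.ext fun x ↦ ?_)
    simp only [LinearMap.comp_apply, LinearEquiv.coe_coe, quotCoaction_mk]
    have h1 : ∀ t : J ⊗[F] J, TensorProduct.assoc F (J ⧸ X) J J (LinearMap.rTensor J
        (quotCoaction X hX) (LinearMap.rTensor J X.mkQ t)) = LinearMap.rTensor (J ⊗[F] J) X.mkQ
        (TensorProduct.assoc F J J J (LinearMap.rTensor J Coalgebra.comul t)) := fun t ↦ by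
      induction t with
      | zero => simp
      | add x y hx hy => simp only [map_add, hx, hy]
      | tmul a b =>
        rw [LinearMap.rTensor_tmul, LinearMap.rTensor_tmul, LinearMap.rTensor_tmul,
          quotCoaction_mk]
        generalize Coalgebra.comul (R := F) a = s
        induction s with
        | zero => simp
        | add x y hx hy => simp only [map_add, TensorProduct.add_tmul, hx, hy]
        | tmul c d => simp
    rw [h1, Coalgebra.coassoc_apply, ← LinearMap.comp_apply, LinearMap.rTensor_comp_lTensor,
      ← LinearMap.lTensor_comp_rTensor, LinearMap.comp_apply]
  counit := by
    refine Submodule.linearMap_qext _ (LinearMap.ext fun x ↦ ?_)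
    simp only [LinearMap.comp_apply, LinearEquiv.coe_coe, quotCoaction_mk, LinearMap.id_apply]
    rw [← LinearMap.comp_apply (LinearMap.lTensor _ _), LinearMap.lTensor_comp_rTensor,
      ← LinearMap.rTensor_comp_lTensor, LinearMap.comp_apply, Coalgebra.lTensor_counit_comul]
    simp

theorem antipode_mul_of_grouplike {g : J} (h1 : Coalgebra.counit (R := F) g = 1)
    (h2 : Coalgebra.comul (R := F) g = g ⊗ₜ g) : HopfAlgebra.antipode F g * g = 1 := by
  have := HopfAlgebra.mul_antipode_rTensor_comul_apply (R := F) g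
  rw [h2, h1] at this
  simpa using this

/-- A nonzero cyclic Hopf module generated by a semi-invariant is free: if `Δ(n) = n ⊗ g` modulo a
sub-Hopf-module `X` not containing `n`, then `n c ∈ X` only for `c = 0`. -/
theorem eq_zero_of_mul_mem (j : K →ₐc[F] J) {X : Submodule F J}
    (hX : ∀ x ∈ X, Coalgebra.comul (R := F) x ∈ LinearMap.range (LinearMap.rTensor J X.subtype))
    (hXK : ∀ x ∈ X, ∀ c, x * j c ∈ X) (hj : Function.Injective j) {n g : J} (hn : n ∉ X)
    (hg : LinearMap.rTensor J X.mkQ (Coalgebra.comul (R := F) n) = X.mkQ n ⊗ₜ g)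
    (h1 : Coalgebra.counit (R := F) g = 1) (h2 : Coalgebra.comul (R := F) g = g ⊗ₜ g) {c : K}
    (hc : n * j c ∈ X) : c = 0 := by
  let l : K →ₗ[F] J ⧸ X := X.mkQ ∘ₗ LinearMap.mulLeft F n ∘ₗ (j : K →ₗ[F] J)
  let r : K →ₗ[F] J := LinearMap.mulLeft F g ∘ₗ (j : K →ₗ[F] J)
  have hl : ∀ c, l c = X.mkQ (n * j c) := fun c ↦ rfl
  have hr : Function.Injective r := fun a b hab ↦ hj (by
    have := congrArg (fun x ↦ HopfAlgebra.antipode F g * x) hab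
    simpa [r, ← mul_assoc, antipode_mul_of_grouplike h1 h2] using this)
  -- the kernel `I` of `c ↦ n c mod X` satisfies `Δ(I) ⊆ I ⊗ K`: the coaction of `n c` is the image
  -- of `Δ(c)` under `l ⊗ r`, and `r` is injective because `g` is invertible
  have hlI : ∀ c, l c = 0 → LinearMap.rTensor K l (Coalgebra.comul (R := F) c) = 0 := by
    intro c hc
    have inj := Module.Flat.lTensor_preserves_injective_linearMap (M := J ⧸ X) r hr
    apply inj
    rw [map_zero, ← LinearMap.comp_apply, LinearMap.lTensor_comp_rTensor]
    have e : quotCoaction X hX (l c) = TensorProduct.map l r (Coalgebra.comul (R := F) c) := by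
      rw [hl, quotCoaction_mk, comul_mul_map]
      generalize Coalgebra.comul (R := F) c = t
      induction t with
      | zero => simp
      | add x y hx hy => simp only [map_add, mul_add, hx, hy]
      | tmul a b =>
        -- right multiplication by `j a` descends to the quotient by `X`
        let q : (J ⧸ X) →ₗ[F] J ⧸ X := X.mapQ X (LinearMap.mulRight F (j a))
          (fun x hx ↦ hXK x hx a)
        have h : ∀ u : J ⊗[F] J, LinearMap.rTensor J X.mkQ (u * TensorProduct.map
            (j : K →ₗ[F] J) (j : K →ₗ[F] J) (a ⊗ₜ b)) =
            TensorProduct.map q (LinearMap.mulRight F (j b)) (LinearMap.rTensor J X.mkQ u) := by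
          intro u
          induction u with
          | zero => simp
          | add x y hx hy => simp only [map_add, add_mul, hx, hy]
          | tmul x y =>
            simp only [TensorProduct.map_tmul, Algebra.TensorProduct.tmul_mul_tmul,
              LinearMap.rTensor_tmul]
            rfl
        rw [h, hg]
        rfl
    rw [← e, hc, map_zero]
  -- `ε(I) = 0`: `n ε(c) = n c₁ S(c₂)` lies in `X`, which does not contain `n`
  have heps : ∀ c, l c = 0 → Coalgebra.counit (R := F) c = 0 := by
    intro c hc
    obtain ⟨t, ht⟩ := mem_range_rTensor_ker l _ (hlI c hc)
    have key : ∀ t, l (LinearMap.mul' F K (LinearMap.lTensor K (HopfAlgebra.antipode F)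
        (LinearMap.rTensor K (LinearMap.ker l).subtype t))) = 0 := by
      intro t
      induction t with
      | zero => simp
      | add x y hx hy => simp only [map_add, hx, hy, add_zero]
      | tmul a b =>
        have ha : n * j (a : K) ∈ X := by
          rw [← Submodule.Quotient.mk_eq_zero]; exact a.2
        simp only [LinearMap.rTensor_tmul, LinearMap.lTensor_tmul, LinearMap.mul'_apply, hl,
          Submodule.subtype_apply, map_mul, ← mul_assoc]
        exact (Submodule.Quotient.mk_eq_zero X).mpr (hXK _ ha _)
    have h := key t
    rw [ht, HopfAlgebra.mul_antipode_lTensor_comul_apply, Algebra.algebraMap_eq_smul_one,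
      map_smul, hl, map_one, mul_one] at h
    exact (smul_eq_zero.mp h).resolve_right (by simpa using hn)
  -- now `c = ε(c₁) c₂` vanishes
  have hc' : l c = 0 := (Submodule.Quotient.mk_eq_zero X).mpr hc
  obtain ⟨t, ht⟩ := mem_range_rTensor_ker l _ (hlI c hc')
  have h := Coalgebra.rTensor_counit_comul (R := F) c
  rw [← ht, ← LinearMap.comp_apply, ← LinearMap.rTensor_comp] at h
  have h0 : (Coalgebra.counit : K →ₗ[F] F) ∘ₗ (LinearMap.ker l).subtype = 0 :=
    LinearMap.ext fun a ↦ heps a a.2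
  rw [h0] at h
  have := congrArg (TensorProduct.lid F K) h
  simpa using this.symm

/-- Over an algebraically closed field, a cocommutative Hopf algebra `J` is a free right module
over a Hopf subalgebra `K`, with a basis that contains `1`; `θ` gives the coordinates. -/
theorem exists_right_coordinates [IsAlgClosed F] [Coalgebra.IsCocomm F J] (j : K →ₐc[F] J)
    (hj : Function.Injective j) :
    ∃ θ : J →ₗ[F] (J →₀ K), (∀ a, rightComb j (θ a) = a) ∧
      (∀ a c, θ (a * j c) = finsuppMulRight F c (θ a)) ∧ ∀ c, θ (j c) = Finsupp.single 1 c := by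
  -- a maximal `K`-independent set that contains `1` and spans a right coideal
  let 𝒮 : Set (Set J) := {S | 1 ∈ S ∧
    (∀ x ∈ Finsupp.supported K F S, rightComb j x = 0 → x = 0) ∧
    ∀ s ∈ S, Coalgebra.comul (R := F) s ∈
      LinearMap.range (LinearMap.rTensor J (rightSpan j S).subtype)}
  have h1 : ({1} : Set J) ∈ 𝒮 := by
    refine ⟨rfl, fun x hx h ↦ ?_, ?_⟩
    · have : x = Finsupp.single 1 (x 1) := by
        ext s
        by_cases hs : s = 1
        · subst hs; simp
        · rw [Finsupp.single_eq_of_ne hs]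
          by_contra h'
          exact hs (hx (Finsupp.mem_support_iff.mpr h'))
      rw [this, rightComb_single, one_mul] at h
      rw [this, (map_eq_zero_iff j hj).mp h, Finsupp.single_zero]
    · rintro _ rfl
      rw [Bialgebra.comul_one]
      exact ⟨⟨1, subset_rightSpan j rfl⟩ ⊗ₜ 1, rfl⟩
  obtain ⟨S, hS1, hS⟩ := zorn_subset_nonempty 𝒮 (fun c hc hchain hne ↦ by
    refine ⟨⋃₀ c, ⟨?_, fun x hx h ↦ ?_, ?_⟩, fun s hs ↦ Set.subset_sUnion_of_mem hs⟩
    · obtain ⟨s, hs⟩ := hne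
      exact ⟨s, hs, (hc hs).1⟩
    · obtain ⟨s, hs, hxs⟩ := hchain.directedOn.exists_mem_subset_of_finite_of_subset_sUnion hne
        x.support.finite_toSet hx
      exact (hc hs).2.1 x hxs h
    · rintro x ⟨s, hs, hx⟩
      exact range_rTensor_mono (rightSpan_mono j (Set.subset_sUnion_of_mem hs)) ((hc hs).2.2 x hx))
    _ h1
  have hX := fun x hx ↦ comul_mem_rightSpan j hS.prop.2.2 (x := x) hx
  -- otherwise a semi-invariant of the quotient could be added to `S`
  have htop : rightSpan j S = ⊤ := by
    by_contra hne
    have : Nontrivial (J ⧸ rightSpan j S) := Submodule.Quotient.nontrivial_iff.mpr hne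
    obtain ⟨n', hn', g, hg, hg1, hg2⟩ :=
      exists_grouplike_eigenvector (isRightComodule_quotCoaction _ hX)
    obtain ⟨n, rfl⟩ := Submodule.mkQ_surjective _ n'
    have hn : n ∉ rightSpan j S := fun h ↦ hn' ((Submodule.Quotient.mk_eq_zero _).mpr h)
    rw [quotCoaction_mk] at hg
    have hnS : n ∉ S := fun h ↦ hn (subset_rightSpan j h)
    refine hnS (hS.le_of_ge (y := insert n S) ⟨Or.inr hS.prop.1, fun x hx h ↦ ?_, ?_⟩
      (Set.subset_insert n S) (Set.mem_insert n S))
    · have hx' : x.erase n ∈ Finsupp.supported K F S := by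
        intro s hs
        classical
        rw [Finset.mem_coe, Finsupp.support_erase, Finset.mem_erase] at hs
        exact (hx hs.2).resolve_left hs.1
      have e := Finsupp.single_add_erase n x
      rw [← e, map_add, rightComb_single] at h
      have h0 : x n = 0 := eq_zero_of_mul_mem j hX (fun x hx c ↦ mul_mem_rightSpan j hx c) hj hn
        hg hg1 hg2 (by
          rw [eq_neg_of_add_eq_zero_left h]
          exact neg_mem ⟨_, hx', rfl⟩)
      rw [h0, map_zero, mul_zero, zero_add] at h
      rw [← e, h0, hS.prop.2.1 _ hx' h, Finsupp.single_zero, add_zero]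
    · have hle := rightSpan_mono j (Set.subset_insert n S)
      rintro s (rfl | hs)
      · have hd : Coalgebra.comul (R := F) s - s ⊗ₜ g ∈
            LinearMap.range (LinearMap.rTensor J (rightSpan j S).subtype) := by
          have := mem_range_rTensor_ker (P := J) (rightSpan j S).mkQ
            (Coalgebra.comul (R := F) s - s ⊗ₜ g) (by rw [map_sub, hg]; simp)
          rwa [Submodule.ker_mkQ] at this
        rw [← sub_add_cancel (Coalgebra.comul (R := F) s) (s ⊗ₜ g)]
        exact add_mem (range_rTensor_mono hle hd)
          ⟨⟨s, subset_rightSpan j (Set.mem_insert s S)⟩ ⊗ₜ g, rfl⟩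
      · exact range_rTensor_mono hle (hS.prop.2.2 s hs)
  let e : Finsupp.supported K F S ≃ₗ[F] J := LinearEquiv.ofBijective
    ((rightComb j).domRestrict _) ⟨(injective_iff_map_eq_zero _).mpr fun x hx ↦
        Subtype.ext (hS.prop.2.1 x x.2 hx), fun a ↦ by
      obtain ⟨x, hx, h⟩ := htop.ge (Submodule.mem_top (x := a))
      exact ⟨⟨x, hx⟩, h⟩⟩
  have he : ∀ x (hx : x ∈ Finsupp.supported K F S), (e.symm (rightComb j x) : J →₀ K) = x :=
    fun x hx ↦ congrArg Subtype.val (e.symm_apply_apply ⟨x, hx⟩)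
  have he' : ∀ a, rightComb j (e.symm a : J →₀ K) = a := fun a ↦ e.apply_symm_apply a
  refine ⟨Submodule.subtype _ ∘ₗ e.symm.toLinearMap, he', fun a c ↦ ?_, fun c ↦ ?_⟩
  · have h := he _ (finsuppMulRight_mem c S _ (e.symm a).2)
    rw [rightComb_mulRight, he'] at h
    exact h
  · have h := he _ (Finsupp.single_mem_supported F c hS.prop.1)
    rwa [rightComb_single, one_mul] at h

end Free

/-! ### Exactness of the induction functor -/

section Flat

variable {k J K M N : Type*} [Field k] [Ring J] [HopfAlgebra k J] [Ring K] [HopfAlgebra k K]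
  [AddCommGroup M] [Module k M] [AddCommGroup N] [Module k N]

/-- The axioms of a left `A`-module for a bilinear action. -/
structure IsAction {k A M : Type*} [Field k] [Ring A] [Algebra k A] [AddCommGroup M] [Module k M]
    (act : A →ₗ[k] M →ₗ[k] M) : Prop where
  one : ∀ m, act 1 m = m
  mul : ∀ a b m, act (a * b) m = act a (act b m)

/-- The universal property of `J ⊗_K M`. -/
noncomputable def tensorOverLift (j : K →ₐc[k] J) {act : K →ₗ[k] M →ₗ[k] M}
    (f : J →ₗ[k] M →ₗ[k] N) (hf : ∀ a c m, f (a * j c) m = f a (act c m)) :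
    TensorOver j act →ₗ[k] N :=
  (balanced j act).liftQ (TensorProduct.lift f) (by
    refine Submodule.span_le.mpr ?_
    rintro _ ⟨a, c, m, rfl⟩
    rw [SetLike.mem_coe, LinearMap.mem_ker, map_sub, sub_eq_zero, TensorProduct.lift.tmul,
      TensorProduct.lift.tmul, hf])

theorem tensorOver_hom_ext (j : K →ₐc[k] J) {act : K →ₗ[k] M →ₗ[k] M}
    {f g : TensorOver j act →ₗ[k] N} (h : ∀ a m, f ((balanced j act).mkQ (a ⊗ₜ m)) =
      g ((balanced j act).mkQ (a ⊗ₜ m))) : f = g :=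
  Submodule.linearMap_qext _ (TensorProduct.ext' h)

/-- The map `J ⊗_K M → J ⊗_K N` induced by a `K`-linear map `M → N`. -/
noncomputable def tensorOverMap (j : K →ₐc[k] J) {actM : K →ₗ[k] M →ₗ[k] M}
    {actN : K →ₗ[k] N →ₗ[k] N} (d : M →ₗ[k] N) (hd : ∀ c m, d (actM c m) = actN c (d m)) :
    TensorOver j actM →ₗ[k] TensorOver j actN :=
  Submodule.mapQ _ _ (LinearMap.lTensor J d) (by
    refine Submodule.span_le.mpr ?_
    rintro _ ⟨a, c, m, rfl⟩
    refine Submodule.subset_span ⟨a, c, d m, ?_⟩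
    simp [hd])

theorem tensorOverMap_mk (j : K →ₐc[k] J) {actM : K →ₗ[k] M →ₗ[k] M}
    {actN : K →ₗ[k] N →ₗ[k] N} (d : M →ₗ[k] N) (hd : ∀ c m, d (actM c m) = actN c (d m))
    (t : J ⊗[k] M) : tensorOverMap j d hd ((balanced j actM).mkQ t) =
      (balanced j actN).mkQ (LinearMap.lTensor J d t) := rfl

/-- The action of `F ⊗ K` on `F ⊗ M`. -/
noncomputable def baseAct (F : Type*) [Field F] [Algebra k F] (act : K →ₗ[k] M →ₗ[k] M) :
    F ⊗[k] K →ₗ[k] F ⊗[k] M →ₗ[k] F ⊗[k] M :=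
  TensorProduct.homTensorHomMap (RingHom.id k) F M F M ∘ₗ
    TensorProduct.map (LinearMap.mul k F) act

theorem baseAct_tmul (F : Type*) [Field F] [Algebra k F] (act : K →ₗ[k] M →ₗ[k] M) (s s' : F)
    (c : K) (m : M) : baseAct F act (s ⊗ₜ c) (s' ⊗ₜ m) = (s * s') ⊗ₜ act c m := rfl

theorem baseAct_mul (F : Type*) [Field F] [Algebra k F] {act : K →ₗ[k] M →ₗ[k] M}
    (h : IsAction act) (x y : F ⊗[k] K) (m : F ⊗[k] M) :
    baseAct F act (x * y) m = baseAct F act x (baseAct F act y m) := by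
  induction m with
  | zero => simp
  | add m n hm hn => simp only [map_add, hm, hn]
  | tmul s m =>
    induction x with
    | zero => simp
    | add x x' hx hx' => simp only [add_mul, map_add, LinearMap.add_apply, hx, hx']
    | tmul t c =>
      induction y with
      | zero => simp
      | add x x' hx hx' => simp only [mul_add, map_add, LinearMap.add_apply, hx, hx']
      | tmul t' c' =>
        simp only [Algebra.TensorProduct.tmul_mul_tmul, baseAct_tmul, h.mul, mul_assoc]

theorem baseAct_lTensor (F : Type*) [Field F] [Algebra k F] {actM : K →ₗ[k] M →ₗ[k] M}
    {actN : K →ₗ[k] N →ₗ[k] N} (d : M →ₗ[k] N) (hd : ∀ c m, d (actM c m) = actN c (d m))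
    (x : F ⊗[k] K) (m : F ⊗[k] M) :
    LinearMap.lTensor F d (baseAct F actM x m) = baseAct F actN x (LinearMap.lTensor F d m) := by
  induction m with
  | zero => simp
  | add m n hm hn => simp only [map_add, hm, hn]
  | tmul s m =>
    induction x with
    | zero => simp
    | add x x' hx hx' => simp only [map_add, LinearMap.add_apply, hx, hx']
    | tmul t c => simp only [baseAct_tmul, LinearMap.lTensor_tmul, hd]

/-- The `F`-linear extension of `(a, m) ↦ a ⊗ m`, with values in `F ⊗ (J ⊗_K M)`. -/
noncomputable def baseMk (F : Type*) [Field F] [Algebra k F] (j : K →ₐc[k] J)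
    (act : K →ₗ[k] M →ₗ[k] M) : F ⊗[k] J →ₗ[k] F ⊗[k] M →ₗ[k] F ⊗[k] TensorOver j act :=
  TensorProduct.homTensorHomMap (RingHom.id k) F M F (TensorOver j act) ∘ₗ
    TensorProduct.map (LinearMap.mul k F) ((TensorProduct.mk k J M).compr₂ (balanced j act).mkQ)

theorem baseMk_tmul (F : Type*) [Field F] [Algebra k F] (j : K →ₐc[k] J)
    (act : K →ₗ[k] M →ₗ[k] M) (s s' : F) (a : J) (m : M) :
    baseMk F j act (s ⊗ₜ a) (s' ⊗ₜ m) = (s * s') ⊗ₜ (balanced j act).mkQ (a ⊗ₜ m) := rfl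

/-- The base change of the inclusion `K → J`. -/
noncomputable abbrev baseHom (F : Type*) [Field F] [Algebra k F] (j : K →ₐc[k] J) :
    F ⊗[k] K →ₐc[F] F ⊗[k] J :=
  Bialgebra.TensorProduct.map (BialgHom.id F F) j

/-- The base change of `J ⊗_K M` is balanced over the base change of `K`. -/
theorem baseMk_balanced (F : Type*) [Field F] [Algebra k F] (j : K →ₐc[k] J)
    (act : K →ₗ[k] M →ₗ[k] M) (x : F ⊗[k] J) (c : F ⊗[k] K) (m : F ⊗[k] M) :
    baseMk F j act (x * baseHom F j c) m = baseMk F j act x (baseAct F act c m) := by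
  induction m with
  | zero => simp
  | add m n hm hn => simp only [map_add, hm, hn]
  | tmul s m =>
    induction x with
    | zero => simp
    | add x x' hx hx' => simp only [add_mul, map_add, LinearMap.add_apply, hx, hx']
    | tmul t a =>
      induction c with
      | zero => simp
      | add x x' hx hx' => simp only [mul_add, map_add, LinearMap.add_apply, hx, hx']
      | tmul t' c =>
        rw [Bialgebra.TensorProduct.map_tmul, Algebra.TensorProduct.tmul_mul_tmul, baseAct_tmul,
          baseMk_tmul, baseMk_tmul, mk_balanced, mul_assoc]
        rfl

/-- The coordinate at `s` of `J ⊗_K M` after extension of scalars, from coordinates of `F ⊗ J` over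
`F ⊗ K`. -/
noncomputable def baseCoord {F : Type*} [Field F] [Algebra k F] (j : K →ₐc[k] J)
    {act : K →ₗ[k] M →ₗ[k] M} (h : IsAction act)
    (θ : F ⊗[k] J →ₗ[F] ((F ⊗[k] J) →₀ (F ⊗[k] K)))
    (hθ : ∀ a c, θ (a * baseHom F j c) = finsuppMulRight F c (θ a)) (s : F ⊗[k] J) :
    TensorOver j act →ₗ[k] F ⊗[k] M :=
  tensorOverLift j (LinearMap.mk₂ k
    (fun a m ↦ baseAct F act (θ ((1 : F) ⊗ₜ[k] a) s) ((1 : F) ⊗ₜ[k] m))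
    (fun a b m ↦ by
      rw [TensorProduct.tmul_add, map_add, Finsupp.add_apply, map_add, LinearMap.add_apply])
    (fun r a m ↦ by
      rw [TensorProduct.tmul_smul, ← algebraMap_smul F r ((1 : F) ⊗ₜ[k] a), map_smul,
        Finsupp.smul_apply, algebraMap_smul, map_smul, LinearMap.smul_apply])
    (fun a m n ↦ by rw [TensorProduct.tmul_add, map_add])
    (fun r a m ↦ by rw [TensorProduct.tmul_smul, map_smul])) fun a c m ↦ by
    rw [LinearMap.mk₂_apply, LinearMap.mk₂_apply]
    have e : (1 : F) ⊗ₜ[k] (a * j c) = (1 : F) ⊗ₜ[k] a * baseHom F j ((1 : F) ⊗ₜ[k] c) := by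
      rw [Bialgebra.TensorProduct.map_tmul, Algebra.TensorProduct.tmul_mul_tmul]
      simp
    have e2 : (1 : F) ⊗ₜ[k] act c m = baseAct F act ((1 : F) ⊗ₜ c) ((1 : F) ⊗ₜ m) := by
      rw [baseAct_tmul, mul_one]
    rw [e, hθ, e2, ← baseAct_mul F h]
    simp [finsuppMulRight]

theorem baseCoord_mk {F : Type*} [Field F] [Algebra k F] (j : K →ₐc[k] J)
    {act : K →ₗ[k] M →ₗ[k] M} (h : IsAction act)
    (θ : F ⊗[k] J →ₗ[F] ((F ⊗[k] J) →₀ (F ⊗[k] K)))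
    (hθ : ∀ a c, θ (a * baseHom F j c) = finsuppMulRight F c (θ a)) (s : F ⊗[k] J) (a : J) (m : M) :
    baseCoord j h θ hθ s ((balanced j act).mkQ (a ⊗ₜ m)) =
      baseAct F act (θ ((1 : F) ⊗ₜ[k] a) s) ((1 : F) ⊗ₜ[k] m) := rfl

theorem baseCoord_map {F : Type*} [Field F] [Algebra k F] (j : K →ₐc[k] J)
    {actM : K →ₗ[k] M →ₗ[k] M} (hM : IsAction actM)
    {actN : K →ₗ[k] N →ₗ[k] N} (hN : IsAction actN)
    (d : M →ₗ[k] N) (hd : ∀ c m, d (actM c m) = actN c (d m))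
    (θ : F ⊗[k] J →ₗ[F] ((F ⊗[k] J) →₀ (F ⊗[k] K)))
    (hθ : ∀ a c, θ (a * baseHom F j c) = finsuppMulRight F c (θ a)) (s : F ⊗[k] J)
    (x : TensorOver j actM) :
    baseCoord j hN θ hθ s (tensorOverMap j d hd x) =
      LinearMap.lTensor F d (baseCoord j hM θ hθ s x) := by
  obtain ⟨t, rfl⟩ := (balanced j actM).mkQ_surjective x
  induction t with
  | zero => simp
  | add x y hx hy => simp only [map_add, hx, hy]
  | tmul a m =>
    rw [tensorOverMap_mk, LinearMap.lTensor_tmul, baseCoord_mk, baseCoord_mk,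
      baseAct_lTensor F d hd, LinearMap.lTensor_tmul]

/-- An element is the combination of the basis with its coordinates as coefficients. -/
theorem sum_baseCoord {F : Type*} [Field F] [Algebra k F] (j : K →ₐc[k] J)
    {act : K →ₗ[k] M →ₗ[k] M} (h : IsAction act)
    (θ : F ⊗[k] J →ₗ[F] ((F ⊗[k] J) →₀ (F ⊗[k] K)))
    (hθ : ∀ a c, θ (a * baseHom F j c) = finsuppMulRight F c (θ a))
    (h1 : ∀ a, rightComb (baseHom F j) (θ a) = a) (x : TensorOver j act) :
    ∃ T : Finset (F ⊗[k] J), ∀ T', T ⊆ T' →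
      (1 : F) ⊗ₜ[k] x = ∑ s ∈ T', baseMk F j act s (baseCoord j h θ hθ s x) := by
  classical
  obtain ⟨t, rfl⟩ := (balanced j act).mkQ_surjective x
  induction t with
  | zero => exact ⟨∅, fun _ _ ↦ by simp⟩
  | add x y hx hy =>
    obtain ⟨T, hT⟩ := hx
    obtain ⟨S, hS⟩ := hy
    refine ⟨T ∪ S, fun T' h' ↦ ?_⟩
    simp only [map_add, TensorProduct.tmul_add, Finset.sum_add_distrib,
      ← hT T' (Finset.union_subset_left h'), ← hS T' (Finset.union_subset_right h')]
  | tmul a m =>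
    refine ⟨(θ ((1 : F) ⊗ₜ[k] a)).support, fun T' h' ↦ ?_⟩
    simp only [baseCoord_mk, ← baseMk_balanced]
    rw [← LinearMap.sum_apply, ← map_sum]
    have h2 := h1 ((1 : F) ⊗ₜ[k] a)
    rw [rightComb, Finsupp.lsum_apply, Finsupp.sum_of_support_subset _ h' _ (by simp)] at h2
    have h3 : ∑ s ∈ T', s * baseHom F j (θ ((1 : F) ⊗ₜ[k] a) s) = (1 : F) ⊗ₜ[k] a := h2
    rw [h3, baseMk_tmul, one_mul]

/-- Membership in a subspace descends from an extension of the field. -/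
theorem mem_of_one_tmul_mem {F : Type*} [Field F] [Algebra k F] (W : Submodule k M) (x : M)
    (h : (1 : F) ⊗ₜ[k] x ∈ LinearMap.range (LinearMap.lTensor F W.subtype)) : x ∈ W := by
  obtain ⟨t, ht⟩ := h
  have h1 := congrArg (LinearMap.lTensor F W.mkQ) ht
  rw [← LinearMap.comp_apply, ← LinearMap.lTensor_comp] at h1
  have : W.mkQ ∘ₗ W.subtype = 0 := by ext x; simp
  rw [this, LinearMap.lTensor_zero, LinearMap.zero_apply, LinearMap.lTensor_tmul] at h1
  have h2 := tmul_left_cancel (k := k) (one_ne_zero (α := F))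
    (h1.symm.trans (TensorProduct.tmul_zero _ _).symm)
  simpa using h2

variable (j : K →ₐc[k] J) (hj : Function.Injective j)

theorem baseHom_injective (hj : Function.Injective j) (F : Type*) [Field F] [Algebra k F] :
    Function.Injective (baseHom F j) := by
  have : ∀ x, baseHom F j x = LinearMap.lTensor F (j : K →ₗ[k] J) x := fun x ↦ by
    induction x with
    | zero => simp
    | add x y hx hy => simp only [map_add, hx, hy]
    | tmul s c => simp
  intro x y h
  rw [this, this] at h
  exact Module.Flat.lTensor_preserves_injective_linearMap (M := F) (j : K →ₗ[k] J) hj h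

variable [Coalgebra.IsCocomm k J]

include hj

/-- `J` is flat over `K`: the functor `J ⊗_K -` preserves kernels. -/
theorem mem_ker_tensorOverMap {actM : K →ₗ[k] M →ₗ[k] M} (hM : IsAction actM)
    {actN : K →ₗ[k] N →ₗ[k] N} (hN : IsAction actN)
    (d : M →ₗ[k] N) (hd : ∀ c m, d (actM c m) = actN c (d m)) (x : TensorOver j actM)
    (hx : tensorOverMap j d hd x = 0) :
    ∃ y : J ⊗[k] LinearMap.ker d,
      x = (balanced j actM).mkQ (LinearMap.lTensor J (LinearMap.ker d).subtype y) := by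
  let F := AlgebraicClosure k
  obtain ⟨θ, h1, h2, -⟩ := exists_right_coordinates (baseHom F j) (baseHom_injective j hj F)
  let W : Submodule k (TensorOver j actM) := LinearMap.range
    ((balanced j actM).mkQ ∘ₗ LinearMap.lTensor J (LinearMap.ker d).subtype)
  suffices x ∈ W by obtain ⟨y, rfl⟩ := this; exact ⟨y, rfl⟩
  apply mem_of_one_tmul_mem (F := F)
  obtain ⟨T, hT⟩ := sum_baseCoord j hM θ h2 h1 x
  rw [hT T subset_rfl]
  refine Submodule.sum_mem _ fun s _ ↦ ?_
  have h0 : LinearMap.lTensor F d (baseCoord j hM θ h2 s x) = 0 := by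
    rw [← baseCoord_map j hM hN d hd, hx, map_zero]
  have h0' : baseCoord j hM θ h2 s x ∈
      LinearMap.range (LinearMap.lTensor F (LinearMap.ker d).subtype) :=
    (Module.Flat.lTensor_exact F (LinearMap.exact_subtype_ker_map d) _).mp h0
  obtain ⟨y, hy⟩ := h0'
  rw [← hy]
  change baseMk F j actM s _ ∈ _
  clear hy h0
  rename_i hs
  clear hs
  induction y with
  | zero => simp
  | add x y hx hy => rw [map_add, map_add]; exact add_mem hx hy
  | tmul t m =>
    induction s with
    | zero => simp
    | add x y hx hy => rw [map_add, LinearMap.add_apply]; exact add_mem hx hy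
    | tmul t' a =>
      rw [LinearMap.lTensor_tmul, baseMk_tmul]
      exact ⟨(t' * t) ⊗ₜ ⟨_, a ⊗ₜ m, rfl⟩, rfl⟩

theorem tensorOverMap_injective {actM : K →ₗ[k] M →ₗ[k] M} (hM : IsAction actM)
    {actN : K →ₗ[k] N →ₗ[k] N} (hN : IsAction actN)
    (d : M →ₗ[k] N) (hd : ∀ c m, d (actM c m) = actN c (d m)) (h : Function.Injective d) :
    Function.Injective (tensorOverMap j d hd) := by
  refine (injective_iff_map_eq_zero _).mpr fun x hx ↦ ?_
  obtain ⟨y, rfl⟩ := mem_ker_tensorOverMap j hj hM hN d hd x hx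
  have e : (LinearMap.ker d).subtype = 0 := LinearMap.ext fun z ↦ h (by
    rw [LinearMap.zero_apply, map_zero]; exact z.2)
  rw [e]
  simp

/-- `J` is faithfully flat over `K`. -/
theorem mem_range_of_one_tmul_mem {actM : K →ₗ[k] M →ₗ[k] M} (hM : IsAction actM)
    {actN : K →ₗ[k] N →ₗ[k] N} (hN : IsAction actN)
    (d : M →ₗ[k] N) (hd : ∀ c m, d (actM c m) = actN c (d m)) (x : N)
    (hx : (balanced j actN).mkQ (1 ⊗ₜ x) ∈ LinearMap.range (tensorOverMap j d hd)) :
    x ∈ LinearMap.range d := by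
  let F := AlgebraicClosure k
  obtain ⟨θ, -, h2, h3⟩ := exists_right_coordinates (baseHom F j) (baseHom_injective j hj F)
  obtain ⟨y, hy⟩ := hx
  have h := baseCoord_map j hM hN d hd θ h2 1 y
  have e : θ ((1 : F) ⊗ₜ[k] (1 : J)) = Finsupp.single 1 1 := by
    rw [← h3 1, map_one]; rfl
  rw [hy, baseCoord_mk, e, Finsupp.single_eq_same, Algebra.TensorProduct.one_def, baseAct_tmul,
    mul_one, hN.one] at h
  refine mem_of_one_tmul_mem (F := F) _ _ ?_
  rw [h]
  generalize baseCoord j hM θ h2 1 y = z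
  exact ⟨LinearMap.lTensor F d.rangeRestrict z, by
    rw [← LinearMap.comp_apply, ← LinearMap.lTensor_comp]; rfl⟩

theorem one_tmul_injective {actN : K →ₗ[k] N →ₗ[k] N} (hN : IsAction actN) (x : N)
    (hx : (balanced j actN).mkQ (1 ⊗ₜ x) = 0) : x = 0 := by
  have := mem_range_of_one_tmul_mem j hj hN hN 0 (by simp) x (by rw [hx]; exact zero_mem _)
  simpa using this

end Flat

/-! ### Hopf modules and the Galois map -/

section TensorAct

variable {k J K M N : Type*} [Field k] [Ring J] [HopfAlgebra k J] [Ring K] [HopfAlgebra k K]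
  [AddCommGroup M] [Module k M] [AddCommGroup N] [Module k N]

/-- The action of `J ⊗ J` on `M ⊗ N`. -/
noncomputable def tensorAct (α : J →ₗ[k] M →ₗ[k] M) (β : J →ₗ[k] N →ₗ[k] N) :
    J ⊗[k] J →ₗ[k] M ⊗[k] N →ₗ[k] M ⊗[k] N :=
  TensorProduct.homTensorHomMap (RingHom.id k) M N M N ∘ₗ TensorProduct.map α β

theorem tensorAct_tmul (α : J →ₗ[k] M →ₗ[k] M) (β : J →ₗ[k] N →ₗ[k] N) (a b : J) (m : M) (n : N) :
    tensorAct α β (a ⊗ₜ b) (m ⊗ₜ n) = α a m ⊗ₜ β b n := rfl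

theorem tensorAct_mul {α : J →ₗ[k] M →ₗ[k] M} {β : J →ₗ[k] N →ₗ[k] N} (hα : IsAction α)
    (hβ : IsAction β) (s t : J ⊗[k] J) (x : M ⊗[k] N) :
    tensorAct α β (s * t) x = tensorAct α β s (tensorAct α β t x) := by
  induction s with
  | zero => simp
  | add s s' h h' => simp only [add_mul, map_add, LinearMap.add_apply, h, h']
  | tmul a b =>
    induction t with
    | zero => simp
    | add s s' h h' => simp only [mul_add, map_add, LinearMap.add_apply, h, h']
    | tmul a' b' =>
      induction x with
      | zero => simp
      | add s s' h h' => simp only [map_add, h, h']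
      | tmul m n =>
        simp only [Algebra.TensorProduct.tmul_mul_tmul, tensorAct_tmul, hα.mul, hβ.mul]

/-- The diagonal action of `J` on `M ⊗ N`. -/
noncomputable def diagAct (α : J →ₗ[k] M →ₗ[k] M) (β : J →ₗ[k] N →ₗ[k] N) :
    J →ₗ[k] M ⊗[k] N →ₗ[k] M ⊗[k] N :=
  tensorAct α β ∘ₗ Coalgebra.comul

theorem diagAct_apply (α : J →ₗ[k] M →ₗ[k] M) (β : J →ₗ[k] N →ₗ[k] N) (a : J) (x : M ⊗[k] N) :
    diagAct α β a x = tensorAct α β (Coalgebra.comul (R := k) a) x := rfl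

theorem isAction_diagAct {α : J →ₗ[k] M →ₗ[k] M} {β : J →ₗ[k] N →ₗ[k] N} (hα : IsAction α)
    (hβ : IsAction β) : IsAction (diagAct α β) where
  one x := by
    rw [diagAct_apply, Bialgebra.comul_one, Algebra.TensorProduct.one_def]
    induction x with
    | zero => simp
    | add x y hx hy => rw [map_add, hx, hy]
    | tmul m n => rw [tensorAct_tmul, hα.one, hβ.one]
  mul a b x := by
    rw [diagAct_apply, Bialgebra.comul_mul, tensorAct_mul hα hβ]; rfl

/-- Restriction of an action along `K → J`. -/
noncomputable def resAct (j : K →ₐc[k] J) (α : J →ₗ[k] M →ₗ[k] M) : K →ₗ[k] M →ₗ[k] M :=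
  α ∘ₗ (j : K →ₗ[k] J)

theorem resAct_apply (j : K →ₐc[k] J) (α : J →ₗ[k] M →ₗ[k] M) (c : K) (m : M) :
    resAct j α c m = α (j c) m := rfl

theorem isAction_resAct (j : K →ₐc[k] J) {α : J →ₗ[k] M →ₗ[k] M} (h : IsAction α) :
    IsAction (resAct j α) where
  one m := by rw [resAct_apply, map_one, h.one]
  mul a b m := by simp only [resAct_apply, map_mul, h.mul]

/-- The action of `J` on `J // K` by left multiplication. -/
noncomputable def quotAct (j : K →ₐc[k] J) : J →ₗ[k] HopfQuotient j →ₗ[k] HopfQuotient j :=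
  LinearMap.mk₂ k (fun a x ↦ Submodule.mapQ (augIdeal j) (augIdeal j) (LinearMap.mulLeft k a) (by
      refine Submodule.span_le.mpr ?_
      rintro _ ⟨b, c, hc, rfl⟩
      exact Submodule.subset_span ⟨a * b, c, hc, by simp [mul_assoc]⟩) x)
    (fun a b x ↦ by
      obtain ⟨x, rfl⟩ := Submodule.mkQ_surjective _ x
      change (augIdeal j).mkQ ((a + b) * x) =
        (augIdeal j).mkQ (a * x) + (augIdeal j).mkQ (b * x)
      rw [add_mul, map_add])
    (fun r a x ↦ by
      obtain ⟨x, rfl⟩ := Submodule.mkQ_surjective _ x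
      change (augIdeal j).mkQ ((r • a) * x) = r • (augIdeal j).mkQ (a * x)
      rw [smul_mul_assoc, map_smul])
    (fun a x y ↦ by rw [map_add]) (fun r a x ↦ by rw [map_smul])

theorem quotAct_mk (j : K →ₐc[k] J) (a b : J) :
    quotAct j a ((augIdeal j).mkQ b) = (augIdeal j).mkQ (a * b) := rfl

theorem isAction_quotAct (j : K →ₐc[k] J) : IsAction (quotAct j) where
  one x := by
    obtain ⟨x, rfl⟩ := Submodule.mkQ_surjective _ x
    rw [quotAct_mk, one_mul]
  mul a b x := by
    obtain ⟨x, rfl⟩ := Submodule.mkQ_surjective _ x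
    rw [quotAct_mk, quotAct_mk, quotAct_mk, mul_assoc]

theorem comul_quot_mk (j : K →ₐc[k] J) (a : J) :
    Coalgebra.comul (R := k) ((augIdeal j).mkQ a) =
      TensorProduct.map (augIdeal j).mkQ (augIdeal j).mkQ (Coalgebra.comul (R := k) a) := rfl

theorem counit_quot_mk (j : K →ₐc[k] J) (a : J) :
    Coalgebra.counit (R := k) ((augIdeal j).mkQ a) = Coalgebra.counit (R := k) a := rfl

/-- The unit of `J // K` is invariant under `K`. -/
theorem tensorAct_tmul_one (j : K →ₐc[k] J) (α : J →ₗ[k] M →ₗ[k] M) (c : K) (m : M) :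
    diagAct α (quotAct j) (j c) (m ⊗ₜ (augIdeal j).mkQ 1) =
      α (j c) m ⊗ₜ (augIdeal j).mkQ 1 := by
  have h1 : Coalgebra.comul (R := k) (j c) = TensorProduct.map (j : K →ₗ[k] J) (j : K →ₗ[k] J)
      (Coalgebra.comul (R := k) c) := (CoalgHomClass.map_comp_comul_apply j c).symm
  have h2 := congrArg (TensorProduct.rid k K) (Coalgebra.lTensor_counit_comul (R := k) c)
  rw [diagAct_apply, h1]
  have key : ∀ t : K ⊗[k] K, tensorAct α (quotAct j) (TensorProduct.map (j : K →ₗ[k] J)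
      (j : K →ₗ[k] J) t) (m ⊗ₜ (augIdeal j).mkQ 1) =
      α (j (TensorProduct.rid k K (LinearMap.lTensor K Coalgebra.counit t))) m ⊗ₜ
        (augIdeal j).mkQ 1 := fun t ↦ by
    induction t with
    | zero => simp
    | add x y hx hy => simp only [map_add, LinearMap.add_apply, hx, hy, TensorProduct.add_tmul]
    | tmul a b =>
      have : quotAct j (j b) ((augIdeal j).mkQ 1) =
          Coalgebra.counit (R := k) b • (augIdeal j).mkQ 1 := by
        rw [quotAct_mk, mul_one]
        simpa using mk_aug j 1 b
      rw [TensorProduct.map_tmul, tensorAct_tmul]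
      change α (j a) m ⊗ₜ quotAct j (j b) _ = _
      rw [this]
      simp [TensorProduct.smul_tmul']
  rw [key, h2, TensorProduct.rid_tmul, one_smul]

end TensorAct

section HopfModule

variable {k J K M : Type*} [Field k] [Ring J] [HopfAlgebra k J] [Ring K] [HopfAlgebra k K]
  [AddCommGroup M] [Module k M]

/-- The map `a ⊗ m ↦ a₍₁₎ m ⊗ a₍₂₎` from `J ⊗_K M` to `M ⊗ J // K`. -/
noncomputable def galoisMap (j : K →ₐc[k] J) {α : J →ₗ[k] M →ₗ[k] M} (hα : IsAction α) :
    TensorOver j (resAct j α) →ₗ[k] M ⊗[k] HopfQuotient j :=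
  tensorOverLift j (LinearMap.mk₂ k
      (fun a m ↦ TensorProduct.map (α.flip m) (augIdeal j).mkQ (Coalgebra.comul (R := k) a))
      (fun a b m ↦ by rw [map_add, map_add]) (fun r a m ↦ by rw [map_smul, map_smul])
      (fun a m n ↦ by rw [map_add, TensorProduct.map_add_left, LinearMap.add_apply])
      (fun r a m ↦ by rw [map_smul, TensorProduct.map_smul_left, LinearMap.smul_apply]))
    fun a c m ↦ by
      rw [LinearMap.mk₂_apply, LinearMap.mk₂_apply, comul_mul_map]
      have key : ∀ (s : J ⊗[k] J) (t : K ⊗[k] K),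
          TensorProduct.map (α.flip m) (augIdeal j).mkQ
            (s * TensorProduct.map (j : K →ₗ[k] J) (j : K →ₗ[k] J) t) =
          TensorProduct.map (α.flip (α (j (TensorProduct.rid k K
            (LinearMap.lTensor K Coalgebra.counit t))) m)) (augIdeal j).mkQ s := fun s t ↦ by
        induction t with
        | zero => simp
        | add x y hx hy =>
          simp only [map_add, mul_add, hx, hy, LinearMap.add_apply, TensorProduct.map_add_left]
        | tmul c d =>
          induction s with
          | zero => simp
          | add x y hx hy => simp only [map_add, add_mul, hx, hy]
          | tmul a b =>
            rw [TensorProduct.map_tmul, Algebra.TensorProduct.tmul_mul_tmul,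
              TensorProduct.map_tmul]
            change α (a * j c) m ⊗ₜ (augIdeal j).mkQ (b * j d) = _
            rw [mk_aug, hα.mul]
            simp [TensorProduct.smul_tmul']
      rw [key, Coalgebra.lTensor_counit_comul, TensorProduct.rid_tmul, one_smul]
      rfl

theorem galoisMap_mk (j : K →ₐc[k] J) {α : J →ₗ[k] M →ₗ[k] M} (hα : IsAction α) (a : J) (m : M) :
    galoisMap j hα ((balanced j (resAct j α)).mkQ (a ⊗ₜ m)) =
      TensorProduct.map (α.flip m) (augIdeal j).mkQ (Coalgebra.comul (R := k) a) := rfl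

/-- The inverse of `galoisMap`, given by `m ⊗ a ↦ a₍₁₎ ⊗ S(a₍₂₎) m`. -/
noncomputable def galoisInv (j : K →ₐc[k] J) {α : J →ₗ[k] M →ₗ[k] M} (hα : IsAction α) :
    M ⊗[k] HopfQuotient j →ₗ[k] TensorOver j (resAct j α) :=
  TensorProduct.lift (LinearMap.flip ((augIdeal j).liftQ (LinearMap.mk₂ k
      (fun a m ↦ (balanced j (resAct j α)).mkQ (LinearMap.lTensor J
        (α.flip m ∘ₗ HopfAlgebra.antipode k) (Coalgebra.comul (R := k) a)))
      (fun a b m ↦ by simp only [map_add]) (fun r a m ↦ by simp only [map_smul])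
      (fun a m n ↦ by
        rw [map_add, LinearMap.add_comp, LinearMap.lTensor_add, LinearMap.add_apply, map_add])
      (fun r a m ↦ by
        rw [map_smul, LinearMap.smul_comp, LinearMap.lTensor_smul, LinearMap.smul_apply,
          map_smul])) (by
    refine Submodule.span_le.mpr ?_
    rintro _ ⟨a, c, hc, rfl⟩
    rw [SetLike.mem_coe, LinearMap.mem_ker]
    ext m
    rw [LinearMap.mk₂_apply, comul_mul_map]
    have key : ∀ (s : J ⊗[k] J) (t : K ⊗[k] K),
        (balanced j (resAct j α)).mkQ (LinearMap.lTensor J (α.flip m ∘ₗ HopfAlgebra.antipode k)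
          (s * TensorProduct.map (j : K →ₗ[k] J) (j : K →ₗ[k] J) t)) =
        (balanced j (resAct j α)).mkQ (LinearMap.lTensor J (α.flip m ∘ₗ
          LinearMap.mulLeft k (LinearMap.mul' k J (LinearMap.lTensor J (HopfAlgebra.antipode k)
            (TensorProduct.map (j : K →ₗ[k] J) (j : K →ₗ[k] J) t))) ∘ₗ
          HopfAlgebra.antipode k) s) := fun s t ↦ by
      induction s with
      | zero => simp
      | add x y hx hy => simp only [map_add, add_mul, hx, hy]
      | tmul a b =>
        induction t with
        | zero => simp
        | add x y hx hy =>
          simp only [LinearMap.lTensor_tmul] at hx hy ⊢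
          simp only [map_add, mul_add, hx, hy, LinearMap.comp_apply, LinearMap.mulLeft_apply,
            add_mul, TensorProduct.tmul_add]
        | tmul c d =>
          rw [TensorProduct.map_tmul, Algebra.TensorProduct.tmul_mul_tmul,
            LinearMap.lTensor_tmul]
          change (balanced j (resAct j α)).mkQ ((a * j c) ⊗ₜ
            α (HopfAlgebra.antipode k (b * j d)) m) = _
          rw [mk_balanced, resAct_apply, HopfAlgebra.antipode_mul_antidistrib, ← hα.mul]
          simp
    have h1 : TensorProduct.map (j : K →ₗ[k] J) (j : K →ₗ[k] J)
      (Coalgebra.comul (R := k) c) = Coalgebra.comul (R := k) (j c) :=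
        CoalgHomClass.map_comp_comul_apply j c
    rw [key, h1, HopfAlgebra.mul_antipode_lTensor_comul_apply, CoalgHomClass.counit_comp_apply j c,
      hc]
    simp)))

theorem galoisInv_mk (j : K →ₐc[k] J) {α : J →ₗ[k] M →ₗ[k] M} (hα : IsAction α) (a : J) (m : M) :
    galoisInv j hα (m ⊗ₜ (augIdeal j).mkQ a) =
      (balanced j (resAct j α)).mkQ (LinearMap.lTensor J
        (α.flip m ∘ₗ HopfAlgebra.antipode k) (Coalgebra.comul (R := k) a)) := rfl

variable [Coalgebra.IsCocomm k J]

theorem galoisInv_galoisMap (j : K →ₐc[k] J) {α : J →ₗ[k] M →ₗ[k] M} (hα : IsAction α)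
    (x : TensorOver j (resAct j α)) : galoisInv j hα (galoisMap j hα x) = x := by
  suffices galoisInv j hα ∘ₗ galoisMap j hα = LinearMap.id from LinearMap.congr_fun this x
  refine tensorOver_hom_ext j fun a m ↦ ?_
  rw [LinearMap.comp_apply, galoisMap_mk, LinearMap.id_apply]
  -- `T (y ⊗ z ⊗ x) = y ⊗ S(z) x m`
  let T : J ⊗[k] (J ⊗[k] J) →ₗ[k] J ⊗[k] M := LinearMap.lTensor J (α.flip m ∘ₗ
    LinearMap.mul' k J ∘ₗ LinearMap.rTensor J (HopfAlgebra.antipode k))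
  have key : ∀ t : J ⊗[k] J, galoisInv j hα (TensorProduct.map (α.flip m) (augIdeal j).mkQ
      (TensorProduct.comm k J J t)) = (balanced j (resAct j α)).mkQ (T (TensorProduct.assoc k J J J
        (LinearMap.rTensor J Coalgebra.comul t))) := fun t ↦ by
    induction t with
    | zero => simp
    | add x y hx hy => simp only [map_add, hx, hy]
    | tmul b c =>
      rw [TensorProduct.comm_tmul, TensorProduct.map_tmul, galoisInv_mk, LinearMap.rTensor_tmul]
      congr 1
      generalize Coalgebra.comul (R := k) b = s
      induction s with
      | zero => simp
      | add x y hx hy => simp only [map_add, TensorProduct.add_tmul, hx, hy]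
      | tmul y z => simp [T, hα.mul]
  rw [← Coalgebra.comm_comul (R := k) a, key, Coalgebra.coassoc_apply]
  congr 1
  simp only [T]
  rw [← LinearMap.comp_apply, ← LinearMap.lTensor_comp]
  have e : (α.flip m ∘ₗ LinearMap.mul' k J ∘ₗ LinearMap.rTensor J (HopfAlgebra.antipode k)) ∘ₗ
      Coalgebra.comul = (LinearMap.toSpanSingleton k M m) ∘ₗ Coalgebra.counit := by
    ext b
    simp only [LinearMap.comp_apply, HopfAlgebra.mul_antipode_rTensor_comul_apply,
      Algebra.algebraMap_eq_smul_one, map_smul, LinearMap.flip_apply, hα.one,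
      LinearMap.toSpanSingleton_apply]
  rw [e, LinearMap.lTensor_comp, LinearMap.comp_apply, Coalgebra.lTensor_counit_comul]
  simp

theorem galoisMap_galoisInv (j : K →ₐc[k] J) {α : J →ₗ[k] M →ₗ[k] M} (hα : IsAction α)
    (x : M ⊗[k] HopfQuotient j) : galoisMap j hα (galoisInv j hα x) = x := by
  induction x with
  | zero => simp
  | add x y hx hy => simp only [map_add, hx, hy]
  | tmul m a =>
    obtain ⟨a, rfl⟩ := Submodule.mkQ_surjective _ a
    rw [galoisInv_mk]
    -- `T (y ⊗ z ⊗ x) = z S(x) m ⊗ y`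
    let T : J ⊗[k] (J ⊗[k] J) →ₗ[k] M ⊗[k] HopfQuotient j := TensorProduct.map (α.flip m ∘ₗ
      LinearMap.mul' k J ∘ₗ LinearMap.lTensor J (HopfAlgebra.antipode k)) (augIdeal j).mkQ ∘ₗ
      (TensorProduct.comm k J (J ⊗[k] J)).toLinearMap
    have key : ∀ t : J ⊗[k] J, galoisMap j hα ((balanced j (resAct j α)).mkQ (LinearMap.lTensor J
        (α.flip m ∘ₗ HopfAlgebra.antipode k) t)) = T (TensorProduct.assoc k J J J
        (LinearMap.rTensor J Coalgebra.comul t)) := fun t ↦ by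
      induction t with
      | zero => simp
      | add x y hx hy => simp only [map_add, hx, hy]
      | tmul b c =>
        have hs : ∀ s : J ⊗[k] J, TensorProduct.map (α.flip (α (HopfAlgebra.antipode k c) m))
            (augIdeal j).mkQ (TensorProduct.comm k J J s) =
            T (TensorProduct.assoc k J J J (s ⊗ₜ c)) := fun s ↦ by
          induction s with
          | zero => simp
          | add x y hx hy => simp only [map_add, TensorProduct.add_tmul, hx, hy]
          | tmul y z => simp [T, hα.mul]
        have h := hs (Coalgebra.comul (R := k) b)
        rwa [Coalgebra.comm_comul] at h
    have key2 : ∀ t : J ⊗[k] J, T (LinearMap.lTensor J Coalgebra.comul t) =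
        m ⊗ₜ (augIdeal j).mkQ (TensorProduct.rid k J (LinearMap.lTensor J Coalgebra.counit t)) :=
      fun t ↦ by
      induction t with
      | zero => simp
      | add x y hx hy => simp only [map_add, hx, hy, TensorProduct.tmul_add]
      | tmul y b =>
        rw [LinearMap.lTensor_tmul, LinearMap.lTensor_tmul, TensorProduct.rid_tmul]
        simp only [T, LinearMap.comp_apply, LinearEquiv.coe_coe, TensorProduct.comm_tmul,
          TensorProduct.map_tmul, HopfAlgebra.mul_antipode_lTensor_comul_apply,
          Algebra.algebraMap_eq_smul_one, map_smul, LinearMap.flip_apply, hα.one,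
          TensorProduct.smul_tmul]
    rw [key, Coalgebra.coassoc_apply, key2, Coalgebra.lTensor_counit_comul, TensorProduct.rid_tmul,
      one_smul]

/-- The action of `J` on `J ⊗_K M` by left multiplication. -/
noncomputable def leftAct (j : K →ₐc[k] J) (act : K →ₗ[k] M →ₗ[k] M) :
    J →ₗ[k] TensorOver j act →ₗ[k] TensorOver j act :=
  LinearMap.mk₂ k (fun a x ↦ Submodule.mapQ (balanced j act) (balanced j act)
      (LinearMap.rTensor M (LinearMap.mulLeft k a)) (by
        refine Submodule.span_le.mpr ?_
        rintro _ ⟨b, c, m, rfl⟩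
        exact Submodule.subset_span ⟨a * b, c, m, by simp [mul_assoc]⟩) x)
    (fun a b x ↦ by
      obtain ⟨x, rfl⟩ := Submodule.mkQ_surjective _ x
      change (balanced j act).mkQ (LinearMap.rTensor M (LinearMap.mulLeft k (a + b)) x) =
        (balanced j act).mkQ (LinearMap.rTensor M (LinearMap.mulLeft k a) x) +
          (balanced j act).mkQ (LinearMap.rTensor M (LinearMap.mulLeft k b) x)
      have : LinearMap.mulLeft k (a + b) = LinearMap.mulLeft k a + LinearMap.mulLeft k b := by
        ext; simp [add_mul]
      rw [this, LinearMap.rTensor_add, LinearMap.add_apply, map_add])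
    (fun r a x ↦ by
      obtain ⟨x, rfl⟩ := Submodule.mkQ_surjective _ x
      change (balanced j act).mkQ (LinearMap.rTensor M (LinearMap.mulLeft k (r • a)) x) =
        r • (balanced j act).mkQ (LinearMap.rTensor M (LinearMap.mulLeft k a) x)
      have : LinearMap.mulLeft k (r • a) = r • LinearMap.mulLeft k a := by
        ext; simp
      rw [this, LinearMap.rTensor_smul, LinearMap.smul_apply, map_smul])
    (fun a x y ↦ by rw [map_add]) (fun r a x ↦ by rw [map_smul])

omit [Coalgebra.IsCocomm k J]

theorem leftAct_mk (j : K →ₐc[k] J) (act : K →ₗ[k] M →ₗ[k] M) (a b : J) (m : M) :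
    leftAct j act a ((balanced j act).mkQ (b ⊗ₜ m)) = (balanced j act).mkQ ((a * b) ⊗ₜ m) := rfl

theorem isAction_leftAct (j : K →ₐc[k] J) (act : K →ₗ[k] M →ₗ[k] M) : IsAction (leftAct j act) where
  one x := by
    suffices leftAct j act 1 = LinearMap.id from LinearMap.congr_fun this x
    exact tensorOver_hom_ext j fun a m ↦ by rw [leftAct_mk, one_mul, LinearMap.id_apply]
  mul a b x := by
    suffices leftAct j act (a * b) = leftAct j act a ∘ₗ leftAct j act b from
      LinearMap.congr_fun this x
    exact tensorOver_hom_ext j fun a m ↦ by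
      rw [LinearMap.comp_apply, leftAct_mk, leftAct_mk, leftAct_mk, mul_assoc]

/-- `J ⊗_K M` is a Hopf module: the coaction is `J`-linear for the diagonal action. -/
theorem coaction_leftAct (j : K →ₐc[k] J) (act : K →ₗ[k] M →ₗ[k] M) (a : J)
    (x : TensorOver j act) : coaction j act (leftAct j act a x) =
      diagAct (leftAct j act) (quotAct j) a (coaction j act x) := by
  suffices coaction j act ∘ₗ leftAct j act a =
      diagAct (leftAct j act) (quotAct j) a ∘ₗ coaction j act from LinearMap.congr_fun this x
  refine tensorOver_hom_ext j fun b m ↦ ?_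
  rw [LinearMap.comp_apply, leftAct_mk, coaction_mk, LinearMap.comp_apply, coaction_mk,
    diagAct_apply, Bialgebra.comul_mul]
  generalize Coalgebra.comul (R := k) a = s
  generalize Coalgebra.comul (R := k) b = t
  induction s with
  | zero => simp
  | add x y hx hy =>
    simp only [map_add, add_mul, TensorProduct.add_tmul, hx, hy, LinearMap.add_apply]
  | tmul c d =>
    induction t with
    | zero => simp
    | add x y hx hy => simp only [map_add, mul_add, TensorProduct.add_tmul, hx, hy]
    | tmul c' d' =>
      simp only [Algebra.TensorProduct.tmul_mul_tmul, TensorProduct.rightComm_tmul,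
        TensorProduct.map_tmul, tensorAct_tmul, leftAct_mk, quotAct_mk]

theorem isRightComodule_coaction (j : K →ₐc[k] J) (act : K →ₗ[k] M →ₗ[k] M) :
    IsRightComodule (coaction j act) where
  coassoc := by
    refine tensorOver_hom_ext j fun a m ↦ ?_
    simp only [LinearMap.comp_apply, LinearEquiv.coe_coe, coaction_mk]
    have h1 : ∀ t : J ⊗[k] J, TensorProduct.assoc k _ _ _ (LinearMap.rTensor _ (coaction j act)
        (TensorProduct.map (balanced j act).mkQ (augIdeal j).mkQ
          (TensorProduct.rightComm k J J M (t ⊗ₜ[k] m)))) =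
        TensorProduct.map ((balanced j act).mkQ ∘ₗ (TensorProduct.mk k J M).flip m)
          (TensorProduct.map (augIdeal j).mkQ (augIdeal j).mkQ)
          (TensorProduct.assoc k J J J (LinearMap.rTensor J Coalgebra.comul t)) := fun t ↦ by
      induction t with
      | zero => simp
      | add x y hx hy => simp only [map_add, TensorProduct.add_tmul, hx, hy]
      | tmul b c =>
        rw [TensorProduct.rightComm_tmul, TensorProduct.map_tmul, LinearMap.rTensor_tmul,
          coaction_mk, LinearMap.rTensor_tmul]
        generalize Coalgebra.comul (R := k) b = s
        induction s with
        | zero => simp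
        | add x y hx hy => simp only [map_add, TensorProduct.add_tmul, hx, hy]
        | tmul y z => rfl
    have h2 : ∀ t : J ⊗[k] J, LinearMap.lTensor _ Coalgebra.comul
        (TensorProduct.map (balanced j act).mkQ (augIdeal j).mkQ
          (TensorProduct.rightComm k J J M (t ⊗ₜ[k] m))) =
        TensorProduct.map ((balanced j act).mkQ ∘ₗ (TensorProduct.mk k J M).flip m)
          (TensorProduct.map (augIdeal j).mkQ (augIdeal j).mkQ)
          (LinearMap.lTensor J Coalgebra.comul t) := fun t ↦ by
      induction t with
      | zero => simp
      | add x y hx hy => simp only [map_add, TensorProduct.add_tmul, hx, hy]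
      | tmul b c =>
        rw [TensorProduct.rightComm_tmul, TensorProduct.map_tmul, LinearMap.lTensor_tmul,
          comul_quot_mk]
        rfl
    rw [h1, h2, Coalgebra.coassoc_apply]
  counit := by
    refine tensorOver_hom_ext j fun a m ↦ ?_
    simp only [LinearMap.comp_apply, LinearEquiv.coe_coe, coaction_mk]
    have h1 : ∀ t : J ⊗[k] J, TensorProduct.rid k _ (LinearMap.lTensor _ Coalgebra.counit
        (TensorProduct.map (balanced j act).mkQ (augIdeal j).mkQ
          (TensorProduct.rightComm k J J M (t ⊗ₜ[k] m)))) =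
        (balanced j act).mkQ (TensorProduct.rid k J (LinearMap.lTensor J Coalgebra.counit t) ⊗ₜ m)
        := fun t ↦ by
      induction t with
      | zero => simp
      | add x y hx hy => simp only [map_add, TensorProduct.add_tmul, hx, hy]
      | tmul b c =>
        rw [TensorProduct.rightComm_tmul, TensorProduct.map_tmul, LinearMap.lTensor_tmul,
          counit_quot_mk, LinearMap.lTensor_tmul, TensorProduct.rid_tmul, TensorProduct.rid_tmul,
          ← TensorProduct.smul_tmul', map_smul]
    rw [h1, Coalgebra.lTensor_counit_comul, TensorProduct.rid_tmul, one_smul]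
    rfl

theorem resAct_coaction (j : K →ₐc[k] J) {α : J →ₗ[k] M →ₗ[k] M}
    {ρ : M →ₗ[k] M ⊗[k] HopfQuotient j}
    (hαρ : ∀ a m, ρ (α a m) = diagAct α (quotAct j) a (ρ m)) (c : K) (m : M) :
    ρ (resAct j α c m) = resAct j (diagAct α (quotAct j)) c (ρ m) := hαρ (j c) m

theorem resAct_tmul_one (j : K →ₐc[k] J) (α : J →ₗ[k] M →ₗ[k] M) (c : K) (m : M) :
    (TensorProduct.mk k M (HopfQuotient j)).flip ((augIdeal j).mkQ 1) (resAct j α c m) =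
      resAct j (diagAct α (quotAct j)) c
        ((TensorProduct.mk k M (HopfQuotient j)).flip ((augIdeal j).mkQ 1) m) :=
  (tensorAct_tmul_one j α c m).symm

/-- Evaluation `a ⊗ r ↦ a f(r)`, for a `K`-linear map `f` to a `J`-module. -/
noncomputable def inducedMap {R : Type*} [AddCommGroup R] [Module k R] (j : K →ₐc[k] J)
    {α : J →ₗ[k] M →ₗ[k] M} (hα : IsAction α) {actR : K →ₗ[k] R →ₗ[k] R} (f : R →ₗ[k] M)
    (hf : ∀ c r, f (actR c r) = resAct j α c (f r)) : TensorOver j actR →ₗ[k] M :=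
  tensorOverLift j (α.compl₂ f) fun a c m ↦ by
    rw [LinearMap.compl₂_apply, LinearMap.compl₂_apply, hf, hα.mul, resAct_apply]

theorem inducedMap_mk {R : Type*} [AddCommGroup R] [Module k R] (j : K →ₐc[k] J)
    {α : J →ₗ[k] M →ₗ[k] M} (hα : IsAction α) {actR : K →ₗ[k] R →ₗ[k] R} (f : R →ₗ[k] M)
    (hf : ∀ c r, f (actR c r) = resAct j α c (f r)) (a : J) (r : R) :
    inducedMap j hα f hf ((balanced j actR).mkQ (a ⊗ₜ r)) = α a (f r) := rfl

theorem diagAct_tmul_one (j : K →ₐc[k] J) (α : J →ₗ[k] M →ₗ[k] M) (a : J) (m : M) :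
    diagAct α (quotAct j) a (m ⊗ₜ (augIdeal j).mkQ 1) =
      TensorProduct.map (α.flip m) (augIdeal j).mkQ (Coalgebra.comul (R := k) a) := by
  rw [diagAct_apply]
  generalize Coalgebra.comul (R := k) a = s
  induction s with
  | zero => simp
  | add x y hx hy => simp only [map_add, LinearMap.add_apply, hx, hy]
  | tmul y z => rw [tensorAct_tmul, quotAct_mk, mul_one]; rfl

/-- On the `J`-module generated by a coinvariant `K`-submodule, the coaction is the Galois map. -/
theorem galoisMap_tensorOverMap {R : Type*} [AddCommGroup R] [Module k R] (j : K →ₐc[k] J)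
    {α : J →ₗ[k] M →ₗ[k] M} (hα : IsAction α) {actR : K →ₗ[k] R →ₗ[k] R} (f : R →ₗ[k] M)
    (hf : ∀ c r, f (actR c r) = resAct j α c (f r)) {ρ : M →ₗ[k] M ⊗[k] HopfQuotient j}
    (hαρ : ∀ a m, ρ (α a m) = diagAct α (quotAct j) a (ρ m))
    (hρf : ∀ r, ρ (f r) = f r ⊗ₜ (augIdeal j).mkQ 1) (x : TensorOver j actR) :
    galoisMap j hα (tensorOverMap j (actN := resAct j α) f hf x) =
      ρ (inducedMap j hα f hf x) := by
  suffices galoisMap j hα ∘ₗ tensorOverMap j (actN := resAct j α) f hf =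
      ρ ∘ₗ inducedMap j hα f hf from LinearMap.congr_fun this x
  refine tensorOver_hom_ext j fun b m ↦ ?_
  rw [LinearMap.comp_apply, LinearMap.comp_apply, tensorOverMap_mk, LinearMap.lTensor_tmul,
    galoisMap_mk, inducedMap_mk, hαρ, hρf, diagAct_tmul_one]

/-- The Galois map intertwines `J ⊗_K ρ` with `ρ ⊗ id`. -/
theorem galoisMap_map_coaction (j : K →ₐc[k] J) {α : J →ₗ[k] M →ₗ[k] M} (hα : IsAction α)
    {ρ : M →ₗ[k] M ⊗[k] HopfQuotient j}
    (hαρ : ∀ a m, ρ (α a m) = diagAct α (quotAct j) a (ρ m))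
    (x : TensorOver j (resAct j α)) :
    galoisMap j (isAction_diagAct hα (isAction_quotAct j))
      (tensorOverMap j (actN := resAct j (diagAct α (quotAct j))) ρ (resAct_coaction j hαρ) x) =
      LinearMap.rTensor _ ρ (galoisMap j hα x) := by
  suffices galoisMap j (isAction_diagAct hα (isAction_quotAct j)) ∘ₗ
      tensorOverMap j (actN := resAct j (diagAct α (quotAct j))) ρ (resAct_coaction j hαρ) =
      LinearMap.rTensor _ ρ ∘ₗ galoisMap j hα from LinearMap.congr_fun this x
  refine tensorOver_hom_ext j fun a m ↦ ?_
  rw [LinearMap.comp_apply, LinearMap.comp_apply, tensorOverMap_mk, LinearMap.lTensor_tmul,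
    galoisMap_mk, galoisMap_mk]
  have e : (diagAct α (quotAct j)).flip (ρ m) = ρ ∘ₗ α.flip m := by
    ext b
    exact (hαρ b m).symm
  rw [e, ← LinearMap.rTensor_comp_map, LinearMap.comp_apply]

/-- The Galois map intertwines `J ⊗_K (m ↦ m ⊗ 1)` with `id ⊗ Δ`. -/
theorem galoisMap_map_one (j : K →ₐc[k] J) {α : J →ₗ[k] M →ₗ[k] M} (hα : IsAction α)
    (x : TensorOver j (resAct j α)) :
    galoisMap j (isAction_diagAct hα (isAction_quotAct j))
      (tensorOverMap j (actN := resAct j (diagAct α (quotAct j)))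
        ((TensorProduct.mk k M (HopfQuotient j)).flip ((augIdeal j).mkQ 1))
        (resAct_tmul_one j α) x) =
      (TensorProduct.assoc k _ _ _).symm (LinearMap.lTensor M Coalgebra.comul
        (galoisMap j hα x)) := by
  suffices galoisMap j (isAction_diagAct hα (isAction_quotAct j)) ∘ₗ
      tensorOverMap j (actN := resAct j (diagAct α (quotAct j)))
        ((TensorProduct.mk k M (HopfQuotient j)).flip ((augIdeal j).mkQ 1))
        (resAct_tmul_one j α) =
      (TensorProduct.assoc k _ _ _).symm.toLinearMap ∘ₗ LinearMap.lTensor M Coalgebra.comul ∘ₗ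
        galoisMap j hα from LinearMap.congr_fun this x
  refine tensorOver_hom_ext j fun a m ↦ ?_
  simp only [LinearMap.comp_apply, tensorOverMap_mk, LinearMap.lTensor_tmul, LinearEquiv.coe_coe,
    galoisMap_mk]
  rw [LinearEquiv.eq_symm_apply]
  have e1 : (diagAct α (quotAct j)).flip (((TensorProduct.mk k M (HopfQuotient j)).flip
      ((augIdeal j).mkQ 1)) m) =
      TensorProduct.map (α.flip m) (augIdeal j).mkQ ∘ₗ Coalgebra.comul := by
    ext b
    exact diagAct_tmul_one j α b m
  have h1 : ∀ t : J ⊗[k] J, TensorProduct.assoc k _ _ _ (TensorProduct.map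
      (TensorProduct.map (α.flip m) (augIdeal j).mkQ ∘ₗ Coalgebra.comul) (augIdeal j).mkQ t) =
      TensorProduct.map (α.flip m) (TensorProduct.map (augIdeal j).mkQ (augIdeal j).mkQ)
        (TensorProduct.assoc k J J J (LinearMap.rTensor J Coalgebra.comul t)) := fun t ↦ by
    induction t with
    | zero => simp
    | add x y hx hy => simp only [map_add, hx, hy]
    | tmul b c =>
      rw [TensorProduct.map_tmul, LinearMap.comp_apply, LinearMap.rTensor_tmul]
      generalize Coalgebra.comul (R := k) b = s
      induction s with
      | zero => simp
      | add x y hx hy => simp only [map_add, TensorProduct.add_tmul, hx, hy]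
      | tmul y z => rfl
  have h2 : ∀ t : J ⊗[k] J, LinearMap.lTensor M Coalgebra.comul
      (TensorProduct.map (α.flip m) (augIdeal j).mkQ t) =
      TensorProduct.map (α.flip m) (TensorProduct.map (augIdeal j).mkQ (augIdeal j).mkQ)
        (LinearMap.lTensor J Coalgebra.comul t) := fun t ↦ by
    induction t with
    | zero => simp
    | add x y hx hy => simp only [map_add, hx, hy]
    | tmul b c =>
      rw [TensorProduct.map_tmul, LinearMap.lTensor_tmul, comul_quot_mk]
      rfl
  rw [e1, h1, h2, Coalgebra.coassoc_apply]

/-- The difference of a coaction and the trivial coaction; its kernel is the space of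
coinvariants. -/
noncomputable def coinvDiff (j : K →ₐc[k] J) (ρ : M →ₗ[k] M ⊗[k] HopfQuotient j) :
    M →ₗ[k] M ⊗[k] HopfQuotient j :=
  ρ - (TensorProduct.mk k M (HopfQuotient j)).flip ((augIdeal j).mkQ 1)

theorem mem_ker_coinvDiff (j : K →ₐc[k] J) (ρ : M →ₗ[k] M ⊗[k] HopfQuotient j) (m : M) :
    m ∈ LinearMap.ker (coinvDiff j ρ) ↔ ρ m = m ⊗ₜ (augIdeal j).mkQ 1 := by
  rw [LinearMap.mem_ker, coinvDiff, LinearMap.sub_apply, sub_eq_zero]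
  rfl

variable [Coalgebra.IsCocomm k J]

/-- A coinvariant `K`-submodule `R` of a Hopf module `M` generates `J ⊗_K R`. -/
theorem inducedMap_injective {R : Type*} [AddCommGroup R] [Module k R] (j : K →ₐc[k] J)
    (hj : Function.Injective j)
    {α : J →ₗ[k] M →ₗ[k] M} (hα : IsAction α) {actR : K →ₗ[k] R →ₗ[k] R} (hR : IsAction actR)
    (f : R →ₗ[k] M) (hf : ∀ c r, f (actR c r) = resAct j α c (f r)) (hfi : Function.Injective f)
    {ρ : M →ₗ[k] M ⊗[k] HopfQuotient j}
    (hαρ : ∀ a m, ρ (α a m) = diagAct α (quotAct j) a (ρ m))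
    (hρf : ∀ r, ρ (f r) = f r ⊗ₜ (augIdeal j).mkQ 1) :
    Function.Injective (inducedMap j hα f hf) := by
  intro x y h
  have h1 := congrArg ρ h
  rw [← galoisMap_tensorOverMap j hα f hf hαρ hρf, ← galoisMap_tensorOverMap j hα f hf hαρ hρf] at h1
  have h2 := congrArg (galoisInv j hα) h1
  rw [galoisInv_galoisMap, galoisInv_galoisMap] at h2
  exact tensorOverMap_injective j hj hR (isAction_resAct j hα) f hf hfi h2

/-- The coinvariants of `J ⊗_K M` are the elements `1 ⊗ m`. -/
theorem exists_one_tmul_of_coinvariant (j : K →ₐc[k] J) (hj : Function.Injective j)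
    {act : K →ₗ[k] M →ₗ[k] M} (h : IsAction act) (x : TensorOver j act)
    (hx : coaction j act x = x ⊗ₜ (augIdeal j).mkQ 1) :
    ∃ m, x = (balanced j act).mkQ (1 ⊗ₜ m) := by
  let f : M →ₗ[k] TensorOver j act := (balanced j act).mkQ ∘ₗ TensorProduct.mk k J M 1
  have hf : ∀ c r, f (act c r) = resAct j (leftAct j act) c (f r) := fun c r ↦ by
    change (balanced j act).mkQ (1 ⊗ₜ act c r) =
      leftAct j act (j c) ((balanced j act).mkQ (1 ⊗ₜ r))
    rw [leftAct_mk, ← mk_balanced, one_mul, mul_one]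
  have hρf : ∀ r, coaction j act (f r) = f r ⊗ₜ (augIdeal j).mkQ 1 := fun r ↦ by
    change coaction j act ((balanced j act).mkQ (1 ⊗ₜ r)) = _
    rw [coaction_mk, Bialgebra.comul_one, Algebra.TensorProduct.one_def,
      TensorProduct.rightComm_tmul]
    rfl
  have h1 := galoisMap_tensorOverMap j (isAction_leftAct j act) f hf (coaction_leftAct j act) hρf x
  have h2 : inducedMap j (isAction_leftAct j act) f hf = LinearMap.id :=
    tensorOver_hom_ext j fun a m ↦ by
      rw [inducedMap_mk]
      change leftAct j act a ((balanced j act).mkQ (1 ⊗ₜ m)) = _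
      rw [leftAct_mk, mul_one, LinearMap.id_apply]
  have h3 : galoisMap j (isAction_leftAct j act)
      ((balanced j (resAct j (leftAct j act))).mkQ (1 ⊗ₜ x)) = x ⊗ₜ (augIdeal j).mkQ 1 := by
    rw [galoisMap_mk, Bialgebra.comul_one, Algebra.TensorProduct.one_def, TensorProduct.map_tmul,
      LinearMap.flip_apply, (isAction_leftAct j act).one]
  rw [h2, LinearMap.id_apply, hx, ← h3] at h1
  have h4 := congrArg (galoisInv j (isAction_leftAct j act)) h1
  rw [galoisInv_galoisMap, galoisInv_galoisMap] at h4
  obtain ⟨m, hm⟩ := mem_range_of_one_tmul_mem j hj h (isAction_resAct j (isAction_leftAct j act))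
    f hf x ⟨_, h4⟩
  exact ⟨m, hm.symm⟩

/-- A Hopf module is generated by its coinvariants. -/
theorem exists_eq_lift_coinvariants (j : K →ₐc[k] J) (hj : Function.Injective j)
    {α : J →ₗ[k] M →ₗ[k] M} (hα : IsAction α) {ρ : M →ₗ[k] M ⊗[k] HopfQuotient j}
    (hρ : IsRightComodule ρ) (hαρ : ∀ a m, ρ (α a m) = diagAct α (quotAct j) a (ρ m)) (m : M) :
    ∃ y : J ⊗[k] LinearMap.ker (coinvDiff j ρ),
      m = TensorProduct.lift α (LinearMap.lTensor J (LinearMap.ker (coinvDiff j ρ)).subtype y) := by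
  have hN := isAction_diagAct hα (isAction_quotAct j)
  have hd : ∀ c m, coinvDiff j ρ (resAct j α c m) =
      resAct j (diagAct α (quotAct j)) c (coinvDiff j ρ m) := fun c m ↦ by
    rw [coinvDiff, LinearMap.sub_apply, LinearMap.sub_apply, map_sub, resAct_coaction j hαρ,
      resAct_tmul_one]
  -- by coassociativity the Galois preimage of `ρ m` lies in the kernel of `J ⊗_K (ρ - (· ⊗ 1))`,
  -- which by flatness comes from `J ⊗` the coinvariants
  have h0 : tensorOverMap j (coinvDiff j ρ) hd (galoisInv j hα (ρ m)) = 0 := by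
    have e : tensorOverMap j (coinvDiff j ρ) hd =
        tensorOverMap j (actN := resAct j (diagAct α (quotAct j))) ρ (resAct_coaction j hαρ) -
        tensorOverMap j (actN := resAct j (diagAct α (quotAct j)))
          ((TensorProduct.mk k M (HopfQuotient j)).flip ((augIdeal j).mkQ 1))
          (resAct_tmul_one j α) :=
      tensorOver_hom_ext j fun a m ↦ by
        rw [LinearMap.sub_apply, tensorOverMap_mk, tensorOverMap_mk, tensorOverMap_mk, coinvDiff,
          LinearMap.lTensor_sub, LinearMap.sub_apply, map_sub]
    have h1 : galoisMap j hN (tensorOverMap j (coinvDiff j ρ) hd (galoisInv j hα (ρ m))) = 0 := by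
      rw [e, LinearMap.sub_apply, map_sub, galoisMap_map_coaction j hα hαρ, galoisMap_map_one j hα,
        galoisMap_galoisInv, sub_eq_zero, LinearEquiv.eq_symm_apply]
      exact LinearMap.congr_fun hρ.coassoc m
    rw [← galoisInv_galoisMap j hN (tensorOverMap _ _ _ _), h1, map_zero]
  obtain ⟨y, hy⟩ := mem_ker_tensorOverMap j hj (isAction_resAct j hα) (isAction_resAct j hN)
    (coinvDiff j ρ) hd _ h0
  refine ⟨y, ?_⟩
  have h2 := congrArg (galoisMap j hα) hy
  rw [galoisMap_galoisInv] at h2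
  have h3 := LinearMap.congr_fun hρ.counit m
  simp only [LinearMap.comp_apply, h2, LinearEquiv.coe_coe, LinearMap.id_apply] at h3
  rw [← h3]
  generalize LinearMap.lTensor J (LinearMap.ker (coinvDiff j ρ)).subtype y = t
  induction t with
  | zero => simp
  | add x y hx hy => simp only [map_add, hx, hy]
  | tmul a x =>
    rw [galoisMap_mk, TensorProduct.lift.tmul]
    have h4 : ∀ s : J ⊗[k] J, TensorProduct.rid k M (LinearMap.lTensor M Coalgebra.counit
        (TensorProduct.map (α.flip x) (augIdeal j).mkQ s)) =
        α (TensorProduct.rid k J (LinearMap.lTensor J Coalgebra.counit s)) x := fun s ↦ by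
      induction s with
      | zero => simp
      | add x y hx hy => simp only [map_add, hx, hy, LinearMap.add_apply]
      | tmul b c =>
        rw [TensorProduct.map_tmul, LinearMap.lTensor_tmul, counit_quot_mk,
          LinearMap.lTensor_tmul, TensorProduct.rid_tmul, TensorProduct.rid_tmul, map_smul]
        rfl
    rw [h4, Coalgebra.lTensor_counit_comul, TensorProduct.rid_tmul, one_smul]

end HopfModule

/-! ### The iterated coproduct in coordinates -/

section TensorEval

variable {k V C : Type*} [Field k] [AddCommGroup V] [Module k V] [AddCommGroup C] [Module k C]

/-- The linear form `v₁ ⊗ ⋯ ⊗ vₙ ↦ f₁(v₁) ⋯ fₙ(vₙ)` on a tensor power. -/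
noncomputable def tensorEval {n : ℕ} (f : Fin n → Module.Dual k V) : ⨂[k]^n V →ₗ[k] k :=
  PiTensorProduct.lift ((MultilinearMap.mkPiAlgebra k (Fin n) k).compLinearMap f)

theorem tensorEval_tprod {n : ℕ} (f : Fin n → Module.Dual k V) (v : Fin n → V) :
    tensorEval f (PiTensorProduct.tprod k v) = ∏ i, f i (v i) := by
  simp [tensorEval]

/-- The forms `tensorEval f` separate the elements of a tensor power. -/
theorem eq_zero_of_tensorEval {n : ℕ} (t : ⨂[k]^n V)
    (h : ∀ f : Fin n → Module.Dual k V, tensorEval f t = 0) : t = 0 := by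
  let b := Module.Basis.ofVectorSpace k V
  refine (Basis.piTensorProduct fun _ : Fin n ↦ b).ext_elem fun p ↦ ?_
  rw [map_zero, Finsupp.zero_apply, ← h fun i ↦ b.coord (p i)]
  have e : (Basis.piTensorProduct fun _ : Fin n ↦ b).coord p = tensorEval fun i ↦ b.coord (p i) :=
    PiTensorProduct.ext (MultilinearMap.ext fun v ↦ by
      simp [LinearMap.compMultilinearMap_apply, tensorEval_tprod])
  exact LinearMap.congr_fun e t

theorem eq_of_tensorEval {n : ℕ} {s t : ⨂[k]^n V}
    (h : ∀ f : Fin n → Module.Dual k V, tensorEval f s = tensorEval f t) : s = t :=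
  sub_eq_zero.mp (eq_zero_of_tensorEval _ fun f ↦ by rw [map_sub, h, sub_self])

theorem eq_of_tensorEval_map {n : ℕ} {s t : (⨂[k]^n V) ⊗[k] C}
    (h : ∀ (f : Fin n → Module.Dual k V) (g : Module.Dual k C),
      LinearMap.mul' k k (TensorProduct.map (tensorEval f) g s) =
        LinearMap.mul' k k (TensorProduct.map (tensorEval f) g t)) : s = t := by
  refine sub_eq_zero.mp (eq_zero_of_forall_lTensor _ fun g ↦ eq_zero_of_tensorEval _ fun f ↦ ?_)
  have e : ∀ s : (⨂[k]^n V) ⊗[k] C, tensorEval f (TensorProduct.rid k _ (LinearMap.lTensor _ g s)) =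
      LinearMap.mul' k k (TensorProduct.map (tensorEval f) g s) := fun s ↦ by
    induction s with
    | zero => simp
    | add x y hx hy => simp only [map_add, hx, hy]
    | tmul x y => simp [mul_comm]
  rw [map_sub, map_sub, map_sub, e, e, h, sub_self]

theorem tensorEval_mulEquiv {m n : ℕ} (f : Fin m → Module.Dual k V) (g : Fin n → Module.Dual k V)
    (t : (⨂[k]^m V) ⊗[k] (⨂[k]^n V)) : tensorEval (Fin.append f g) (TensorPower.mulEquiv t) =
      LinearMap.mul' k k (TensorProduct.map (tensorEval f) (tensorEval g) t) := by
  induction t with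
  | zero => simp
  | add x y hx hy => simp only [map_add, hx, hy]
  | tmul x y =>
    rw [TensorProduct.map_tmul, LinearMap.mul'_apply]
    induction x using PiTensorProduct.induction_on with
    | add x x' hx hx' => simp only [map_add, TensorProduct.add_tmul, hx, hx', add_mul]
    | smul_tprod r v =>
      induction y using PiTensorProduct.induction_on with
      | add x x' hx hx' => simp only [map_add, TensorProduct.tmul_add, hx, hx', mul_add]
      | smul_tprod s w =>
        have e := TensorPower.tprod_mul_tprod (R := k) v w
        rw [TensorPower.gMul_def] at e
        rw [← TensorProduct.smul_tmul', TensorProduct.tmul_smul, map_smul, map_smul, map_smul,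
          map_smul, e, map_smul, map_smul, tensorEval_tprod, tensorEval_tprod, tensorEval_tprod,
          Fin.prod_univ_add]
        simp only [Fin.append_left, Fin.append_right, smul_eq_mul]
        ring

theorem tensorEval_reindex {n : ℕ} (f : Fin n → Module.Dual k V) (σ : Equiv.Perm (Fin n))
    (t : ⨂[k]^n V) : tensorEval f (PiTensorProduct.reindex k (fun _ ↦ V) σ t) =
      tensorEval (f ∘ σ) t := by
  induction t using PiTensorProduct.induction_on with
  | add x x' hx hx' => simp only [map_add, hx, hx']
  | smul_tprod r v =>
    rw [map_smul, map_smul, map_smul, PiTensorProduct.reindex_tprod, tensorEval_tprod,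
      tensorEval_tprod]
    congr 1
    rw [← Equiv.prod_comp σ]
    exact Finset.prod_congr rfl fun i _ ↦ by rw [Equiv.symm_apply_apply]; rfl

theorem tensorEval_coactAt {n : ℕ} (ρ : V →ₗ[k] V ⊗[k] C) (f : Fin n → Module.Dual k V)
    (g : Module.Dual k C) (i : Fin n) (t : ⨂[k]^n V) :
    LinearMap.mul' k k (TensorProduct.map (tensorEval f) g (coactAt ρ i t)) =
      tensorEval (Function.update f i (LinearMap.mul' k k ∘ₗ TensorProduct.map (f i) g ∘ₗ ρ)) t := by
  induction t using PiTensorProduct.induction_on with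
  | add x x' hx hx' => simp only [map_add, hx, hx']
  | smul_tprod r v =>
    simp only [map_smul]
    congr 1
    rw [coactAt_tprod, tensorEval_tprod]
    have e : ∀ s : V ⊗[k] C, LinearMap.mul' k k (TensorProduct.map (tensorEval f) g
        (LinearMap.rTensor C ((PiTensorProduct.tprod k).toLinearMap v i) s)) =
        LinearMap.mul' k k (TensorProduct.map (f i) g s) * ∏ l ∈ Finset.univ.erase i, f l (v l) :=
      fun s ↦ by
      induction s with
      | zero => simp
      | add x y hx hy => simp only [map_add, hx, hy, add_mul]
      | tmul x y =>
        rw [LinearMap.rTensor_tmul, TensorProduct.map_tmul, TensorProduct.map_tmul,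
          MultilinearMap.toLinearMap_apply, tensorEval_tprod, LinearMap.mul'_apply,
          LinearMap.mul'_apply, ← Finset.mul_prod_erase _ _ (Finset.mem_univ i)]
        have : ∏ l ∈ Finset.univ.erase i, f l (Function.update v i x l) =
            ∏ l ∈ Finset.univ.erase i, f l (v l) := Finset.prod_congr rfl fun l hl ↦ by
          rw [Function.update_of_ne (Finset.ne_of_mem_erase hl)]
        rw [this, Function.update_self]
        ring
    rw [e, ← Finset.mul_prod_erase _ _ (Finset.mem_univ i), Function.update_self]
    congr 1
    exact Finset.prod_congr rfl fun l hl ↦ by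
      rw [Function.update_of_ne (Finset.ne_of_mem_erase hl)]

end TensorEval

section CanonicalEval

variable {k V C E : Type*} [Field k] [AddCommGroup V] [Module k V] [AddCommGroup C] [Module k C]
  [AddCommGroup E] [Module k E] [Coalgebra k E]

/-- The pullback of linear forms along `π : E → V`, with values in the convolution algebra of
`E`. -/
noncomputable def dualConv (π : E →ₗ[k] V) : Module.Dual k V →ₗ[k] WithConv (E →ₗ[k] k) :=
  (WithConv.linearEquiv k (E →ₗ[k] k)).symm.toLinearMap ∘ₗ LinearMap.lcomp k k π

omit [Coalgebra k E] in
theorem dualConv_apply (π : E →ₗ[k] V) (f : Module.Dual k V) (x : E) :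
    dualConv π f x = f (π x) := rfl

theorem convMul_tmul_apply (f g : WithConv (E →ₗ[k] k)) (x : E) :
    (f * g) x = LinearMap.mul' k k (TensorProduct.map f.ofConv g.ofConv
      (Coalgebra.comul (R := k) x)) := LinearMap.convMul_apply f g x

/-- The coordinates of the iterated coproduct are convolution products. -/
theorem tensorEval_canonicalMap (π : E →ₗ[k] V) {n : ℕ} (f : Fin n → Module.Dual k V) (x : E) :
    tensorEval f (canonicalMap π n x) = (List.ofFn fun i ↦ dualConv π (f i)).prod x := by
  induction n generalizing x with
  | zero =>
    rw [List.ofFn_zero, List.prod_nil, LinearMap.convOne_apply, canonicalMap,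
      LinearMap.smulRight_apply, map_smul, tensorEval_tprod]
    simp
  | succ n ih =>
    rw [List.ofFn_succ', List.prod_concat, convMul_tmul_apply, canonicalMap]
    have ef : f = Fin.append (fun i : Fin n ↦ f i.castSucc) (fun _ : Fin 1 ↦ f (Fin.last n)) := by
      rw [Fin.append_right_eq_snoc]
      exact (Fin.snoc_init_self f).symm
    simp only [LinearMap.comp_apply, LinearEquiv.coe_coe]
    nth_rewrite 1 [ef]
    rw [tensorEval_mulEquiv]
    generalize Coalgebra.comul (R := k) x = t
    induction t with
    | zero => simp
    | add x y hx hy => simp only [map_add, hx, hy]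
    | tmul x y =>
      rw [TensorProduct.map_tmul, TensorProduct.map_tmul, TensorProduct.map_tmul, ih]
      congr 2
      change tensorEval _ ((PiTensorProduct.subsingletonEquiv (0 : Fin 1)).symm (π y)) = _
      rw [PiTensorProduct.subsingletonEquiv_symm_apply', tensorEval_tprod]
      simp [dualConv]

/-- The coproduct corresponds to deconcatenation of tensors. -/
theorem mulEquiv_canonicalMap (π : E →ₗ[k] V) (m n : ℕ) (x : E) :
    TensorPower.mulEquiv (TensorProduct.map (canonicalMap π m) (canonicalMap π n)
      (Coalgebra.comul (R := k) x)) = canonicalMap π (m + n) x := by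
  refine eq_of_tensorEval fun f ↦ ?_
  have ef : f = Fin.append (fun i : Fin m ↦ f (i.castAdd n)) (fun i : Fin n ↦ f (i.natAdd m)) :=
    (Fin.append_castAdd_natAdd (f := f)).symm
  rw [tensorEval_canonicalMap, ef, tensorEval_mulEquiv]
  have e : ∀ i, dualConv π (Fin.append (fun i : Fin m ↦ f (i.castAdd n))
      (fun i : Fin n ↦ f (i.natAdd m)) i) =
      Fin.append (fun i : Fin m ↦ dualConv π (f (i.castAdd n)))
        (fun i : Fin n ↦ dualConv π (f (i.natAdd m))) i := fun i ↦ by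
    refine Fin.addCases (fun i ↦ ?_) (fun i ↦ ?_) i
    · rw [Fin.append_left, Fin.append_left]
    · rw [Fin.append_right, Fin.append_right]
  simp only [e]
  rw [List.ofFn_fin_append, List.prod_append, convMul_tmul_apply]
  generalize Coalgebra.comul (R := k) x = t
  induction t with
  | zero => simp
  | add x y hx hy => simp only [map_add, hx, hy]
  | tmul x y =>
    simp only [TensorProduct.map_tmul, tensorEval_canonicalMap]

/-- A factor that commutes with all others can be moved from any position to the end. -/
theorem prod_ofFn_update_mul {A : Type*} [Monoid A] {n : ℕ} (a : Fin n → A) (c : A)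
    (hc : ∀ i, c * a i = a i * c) (i : Fin n) :
    (List.ofFn (Function.update a i (a i * c))).prod = (List.ofFn a).prod * c := by
  induction n with
  | zero => exact i.elim0
  | succ n ih =>
    rw [List.ofFn_succ, List.ofFn_succ, List.prod_cons, List.prod_cons]
    refine Fin.cases ?_ (fun i ↦ ?_) i
    · have h : ∀ l : List A, (∀ b ∈ l, c * b = b * c) → c * l.prod = l.prod * c := fun l ↦ by
        induction l with
        | nil => simp
        | cons b l ih =>
          intro h
          rw [List.prod_cons, ← mul_assoc, h b (by simp), mul_assoc,
            ih fun b hb ↦ h b (by simp [hb]), mul_assoc]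
      rw [Function.update_self, mul_assoc, h _ (by
        intro b hb
        obtain ⟨l, rfl⟩ := (List.mem_ofFn' _ _).mp hb
        simp [hc]), mul_assoc]
      simp
    · rw [Function.update_of_ne (Fin.succ_ne_zero i).symm, mul_assoc,
        ← ih (fun i ↦ a i.succ) (fun i ↦ hc _) i]
      congr 3
      ext l
      by_cases h : l = i
      · subst h; simp
      · rw [Function.update_of_ne h, Function.update_of_ne (by simpa using h)]

/-- The coaction on a tensor factor of the iterated coproduct. -/
theorem coactAt_canonicalMap (ρ : V →ₗ[k] V ⊗[k] C) (ω : E →ₗ[k] C) (π : E →ₗ[k] V)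
    (hπ : ρ ∘ₗ π = LinearMap.rTensor C π ∘ₗ coactionVia ω)
    (hc : ∀ (g : Module.Dual k C) (f : Module.Dual k V),
      dualConv ω g * dualConv π f = dualConv π f * dualConv ω g) (n : ℕ) (i : Fin n) (x : E) :
    TensorProduct.map (canonicalMap π n) ω (Coalgebra.comul (R := k) x) =
      coactAt ρ i (canonicalMap π n x) := by
  refine eq_of_tensorEval_map fun f g ↦ ?_
  rw [tensorEval_coactAt, tensorEval_canonicalMap]
  have e1 : dualConv π (LinearMap.mul' k k ∘ₗ TensorProduct.map (f i) g ∘ₗ ρ) =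
      dualConv π (f i) * dualConv ω g := by
    ext y
    rw [convMul_tmul_apply, dualConv_apply, LinearMap.comp_apply, LinearMap.comp_apply,
      ← LinearMap.comp_apply ρ π, hπ, LinearMap.comp_apply, coactionVia, LinearMap.comp_apply]
    generalize Coalgebra.comul (R := k) y = t
    induction t with
    | zero => simp
    | add x y hx hy => simp only [map_add, hx, hy]
    | tmul x y => rfl
  have e2 : (fun l ↦ dualConv π (Function.update f i
      (LinearMap.mul' k k ∘ₗ TensorProduct.map (f i) g ∘ₗ ρ) l)) =
      Function.update (fun l ↦ dualConv π (f l)) i (dualConv π (f i) * dualConv ω g) := by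
    rw [← e1]
    funext l
    exact Function.apply_update (fun _ ↦ dualConv π) f i _ l
  rw [e2, prod_ofFn_update_mul (fun l ↦ dualConv π (f l)) _ (fun l ↦ hc g (f l)),
    convMul_tmul_apply]
  generalize Coalgebra.comul (R := k) x = t
  induction t with
  | zero => simp
  | add x y hx hy => simp only [map_add, hx, hy]
  | tmul x y =>
    simp only [TensorProduct.map_tmul, tensorEval_canonicalMap]
    rfl

/-- If pullbacks of linear forms along `π` anticommute, they define an algebra map on an exterior
algebra. -/
noncomputable def dualConvExt [NeZero (2 : k)] (π : E →ₗ[k] V)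
    (h : ∀ f g : Module.Dual k V, dualConv π f * dualConv π g = -(dualConv π g * dualConv π f)) :
    ExteriorAlgebra k (Module.Dual k V) →ₐ[k] WithConv (E →ₗ[k] k) :=
  ExteriorAlgebra.lift k ⟨dualConv π, fun f ↦ by
    have h1 := h f f
    have h2 : (2 : k) • (dualConv π f * dualConv π f) = 0 := by
      rw [two_smul]
      nth_rewrite 1 [h1]
      exact neg_add_cancel _
    exact (smul_eq_zero.mp h2).resolve_left (NeZero.ne 2)⟩

/-- The alternating map of coordinates of the iterated coproduct. -/
theorem tensorEval_canonicalMap_eq_ιMulti [NeZero (2 : k)] (π : E →ₗ[k] V)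
    (h : ∀ f g : Module.Dual k V, dualConv π f * dualConv π g = -(dualConv π g * dualConv π f))
    {n : ℕ} (f : Fin n → Module.Dual k V) (x : E) :
    tensorEval f (canonicalMap π n x) = dualConvExt π h (ExteriorAlgebra.ιMulti k n f) x := by
  rw [tensorEval_canonicalMap, ExteriorAlgebra.ιMulti_apply, map_list_prod, List.map_ofFn]
  congr 2
  refine congrArg (fun a ↦ (List.ofFn a).prod) (funext fun i ↦ ?_)
  simp [dualConvExt]

/-- In the presence of signs, the iterated coproduct is antisymmetric. -/
theorem sign_smul_reindex_canonicalMap [NeZero (2 : k)] (π : E →ₗ[k] V)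
    (h : ∀ f g : Module.Dual k V, dualConv π f * dualConv π g = -(dualConv π g * dualConv π f))
    {n : ℕ} (σ : Equiv.Perm (Fin n)) (x : E) :
    ((Equiv.Perm.sign σ : ℤ) : k) • PiTensorProduct.reindex k (fun _ ↦ V) σ (canonicalMap π n x) =
      canonicalMap π n x := by
  refine eq_of_tensorEval fun f ↦ ?_
  rw [map_smul, tensorEval_reindex, tensorEval_canonicalMap_eq_ιMulti π h,
    tensorEval_canonicalMap_eq_ιMulti π h, AlternatingMap.map_perm, Units.smul_def,
    ← Int.cast_smul_eq_zsmul k, map_smul]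
  change ((Equiv.Perm.sign σ : ℤ) : k) * (((Equiv.Perm.sign σ : ℤ) : k) *
    dualConvExt π h (ExteriorAlgebra.ιMulti k n f) x) = _
  rw [← mul_assoc, ← Int.cast_mul, Int.units_coe_mul_self, Int.cast_one, one_mul]

/-- The canonical map takes values in the co-free super-coalgebra. -/
theorem canonicalMap_mem_cofreePart [NeZero (2 : k)] (ρ : V →ₗ[k] V ⊗[k] C) (ω : E →ₗ[k] C)
    (π : E →ₗ[k] V) (hπ : ρ ∘ₗ π = LinearMap.rTensor C π ∘ₗ coactionVia ω)
    (hc : ∀ (g : Module.Dual k C) (f : Module.Dual k V),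
      dualConv ω g * dualConv π f = dualConv π f * dualConv ω g)
    (h : ∀ f g : Module.Dual k V, dualConv π f * dualConv π g = -(dualConv π g * dualConv π f))
    (n : ℕ) (x : E) : canonicalMap π n x ∈ cofreePart ρ n :=
  ⟨fun i j ↦ by rw [← coactAt_canonicalMap ρ ω π hπ hc n i, ← coactAt_canonicalMap ρ ω π hπ hc n j],
    fun σ ↦ sign_smul_reindex_canonicalMap π h σ x⟩

/-- In the absence of signs, the iterated coproduct of a cocommutative coalgebra is symmetric. -/
theorem reindex_canonicalMap [Coalgebra.IsCocomm k E] (π : E →ₗ[k] V) {n : ℕ}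
    (σ : Equiv.Perm (Fin n)) (x : E) :
    PiTensorProduct.reindex k (fun _ ↦ V) σ (canonicalMap π n x) = canonicalMap π n x := by
  refine eq_of_tensorEval fun f ↦ ?_
  rw [tensorEval_reindex, tensorEval_canonicalMap, tensorEval_canonicalMap, List.prod_ofFn,
    List.prod_ofFn]
  congr 2
  exact Equiv.prod_comp σ fun i ↦ dualConv π (f i)

/-- A function of `n` arguments that is unchanged when one argument is replaced by its image under
`T` is unchanged when all of them are. -/
theorem apply_comp_of_update {X M : Type*} {n : ℕ} (A : (Fin n → X) → M) (T : X → X)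
    (h : ∀ f i, A (Function.update f i (T (f i))) = A f) (f : Fin n → X) :
    A (fun i ↦ T (f i)) = A f := by
  have key : ∀ s : Finset (Fin n), A (fun i ↦ if i ∈ s then T (f i) else f i) = A f := fun s ↦ by
    induction s using Finset.induction_on with
    | empty => simp
    | insert a s ha ih =>
      rw [← ih, ← h (fun i ↦ if i ∈ s then T (f i) else f i) a]
      congr 1
      funext i
      by_cases hi : i = a
      · subst hi; simp [ha]
      · rw [Function.update_of_ne hi]
        simp [hi]
  have := key Finset.univ
  simpa using this

/-- An element is annihilated by all but finitely many iterated coproducts in an odd `V`. -/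
theorem exists_canonicalMap_eq_zero [NeZero (2 : k)] (π : E →ₗ[k] V)
    (h : ∀ f g : Module.Dual k V, dualConv π f * dualConv π g = -(dualConv π g * dualConv π f))
    (x : E) : ∃ N, ∀ n, N ≤ n → canonicalMap π n x = 0 := by
  -- `x₁ ⊗ π(x₂)` lies in `E ⊗ W` for a finite-dimensional `W`
  obtain ⟨W, hW, hx⟩ : ∃ W : Submodule k V, FiniteDimensional k W ∧
      LinearMap.lTensor E π (Coalgebra.comul (R := k) x) ∈
        LinearMap.range (LinearMap.lTensor E W.subtype) := by
    generalize Coalgebra.comul (R := k) x = t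
    induction t with
    | zero => exact ⟨⊥, inferInstance, by simp⟩
    | add s t hs ht =>
      obtain ⟨W, hW, hs⟩ := hs
      obtain ⟨W', hW', ht⟩ := ht
      have mono : ∀ {U U' : Submodule k V}, U ≤ U' → LinearMap.range (LinearMap.lTensor E U.subtype) ≤
          LinearMap.range (LinearMap.lTensor E U'.subtype) := fun {U U'} hU ↦ by
        rintro _ ⟨y, rfl⟩
        exact ⟨LinearMap.lTensor E (Submodule.inclusion hU) y, by
          rw [← LinearMap.comp_apply, ← LinearMap.lTensor_comp]; rfl⟩
      exact ⟨W ⊔ W', inferInstance, by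
        rw [map_add]
        exact add_mem (mono le_sup_left hs) (mono le_sup_right ht)⟩
    | tmul a b => exact ⟨k ∙ π b, inferInstance,
        a ⊗ₜ ⟨π b, Submodule.mem_span_singleton_self _⟩, rfl⟩
  -- composing a form with a projection onto `W` does not change its value in the last position, and
  -- by antisymmetry in any other
  obtain ⟨q, hq⟩ := LinearMap.exists_leftInverse_of_injective W.subtype W.ker_subtype
  let T : Module.Dual k V →ₗ[k] Module.Dual k V := q.dualMap ∘ₗ W.subtype.dualMap
  have hlast : ∀ (A : WithConv (E →ₗ[k] k)) (f : Module.Dual k V),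
      (A * dualConv π (T f)) x = (A * dualConv π f) x := fun A f ↦ by
    have e : ∀ (g : Module.Dual k V) (t : E ⊗[k] E), LinearMap.mul' k k
        (TensorProduct.map A.ofConv (dualConv π g).ofConv t) =
        LinearMap.mul' k k (TensorProduct.map A.ofConv g (LinearMap.lTensor E π t)) := fun g t ↦ by
      induction t with
      | zero => simp
      | add x y hx hy => simp only [map_add, hx, hy]
      | tmul x y => rfl
    rw [convMul_tmul_apply, convMul_tmul_apply, e, e]
    obtain ⟨y, hy⟩ := hx
    rw [← hy]
    clear hy
    induction y with
    | zero => simp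
    | add x y hx hy => simp only [map_add, hx, hy]
    | tmul a w =>
      have : q w = w := LinearMap.congr_fun hq w
      simp [T, this]
  have hA : ∀ (n : ℕ) (f : Fin n → Module.Dual k V) (i : Fin n),
      tensorEval (Function.update f i (T (f i))) (canonicalMap π n x) =
        tensorEval f (canonicalMap π n x) := fun n f i ↦ by
    cases n with
    | zero => exact i.elim0
    | succ n =>
      have hl : ∀ f : Fin (n + 1) → Module.Dual k V,
          tensorEval (Function.update f (Fin.last n) (T (f (Fin.last n))))
            (canonicalMap π (n + 1) x) = tensorEval f (canonicalMap π (n + 1) x) := fun f ↦ by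
        rw [tensorEval_canonicalMap, tensorEval_canonicalMap, List.ofFn_succ', List.ofFn_succ',
          List.prod_concat, List.prod_concat, Function.update_self, hlast]
        congr 3
        refine congrArg (fun a ↦ (List.ofFn a).prod) (funext fun i ↦ ?_)
        rw [Function.update_of_ne (Fin.castSucc_lt_last i).ne]
      -- move the `i`-th position to the end
      let σ := Equiv.swap i (Fin.last n)
      have hs : ∀ f : Fin (n + 1) → Module.Dual k V, tensorEval f (canonicalMap π (n + 1) x) =
          ((Equiv.Perm.sign σ : ℤ) : k) • tensorEval (f ∘ σ) (canonicalMap π (n + 1) x) := fun f ↦ by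
        nth_rewrite 1 [← sign_smul_reindex_canonicalMap π h σ x]
        rw [map_smul, tensorEval_reindex]
      have e : Function.update f i (T (f i)) ∘ σ =
          Function.update (f ∘ σ) (Fin.last n) (T ((f ∘ σ) (Fin.last n))) := by
        have : (f ∘ σ) (Fin.last n) = f i := by simp [σ]
        rw [this, Function.update_comp_equiv]
        simp [σ]
      rw [hs, e, hl, ← hs]
  -- the coordinates are alternating in forms on `W`, and more than `dim W` of these are dependent
  refine ⟨Module.finrank k (LinearMap.range T) + 1, fun n hn ↦ eq_zero_of_tensorEval _ fun f ↦ ?_⟩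
  rw [← apply_comp_of_update (fun f ↦ tensorEval f (canonicalMap π n x)) T (hA n) f,
    tensorEval_canonicalMap_eq_ιMulti π h, AlternatingMap.map_linearDependent, map_zero]
  · rfl
  · intro hli
    have hfin : FiniteDimensional k (LinearMap.range T) := by
      have : LinearMap.range T ≤ LinearMap.range q.dualMap := LinearMap.range_comp_le_range _ _
      exact Submodule.finiteDimensional_of_le this
    have h1 : LinearIndependent k fun i ↦ LinearMap.rangeRestrict T (f i) :=
      LinearIndependent.of_comp (LinearMap.range T).subtype hli
    have := h1.fintype_card_le_finrank
    rw [Fintype.card_fin] at this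
    omega

/-- The iterated coproduct vanishes off the degree equal to the number of factors. -/
theorem canonicalMap_eq_zero_of_mem {ι : Type*} [AddCommMonoidWithOne ι]
    (𝒟 : ι → Submodule k E)
    (hΔ : ∀ n, ∀ x ∈ 𝒟 n, Coalgebra.comul (R := k) x ∈ tensorPart 𝒟 n)
    (hε : ∀ n, n ≠ 0 → ∀ x ∈ 𝒟 n, Coalgebra.counit (R := k) x = 0)
    (π : E →ₗ[k] V) (hπ : ∀ n, n ≠ 1 → ∀ x ∈ 𝒟 n, π x = 0) (n : ℕ) (m : ι) (hm : m ≠ n) (x : E)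
    (hx : x ∈ 𝒟 m) : canonicalMap π n x = 0 := by
  induction n generalizing m x with
  | zero =>
    rw [canonicalMap, LinearMap.smulRight_apply, hε m (by simpa using hm) x hx, zero_smul]
  | succ n ih =>
    rw [canonicalMap, LinearMap.comp_apply, LinearMap.comp_apply]
    suffices tensorPart 𝒟 m ≤ LinearMap.ker (TensorProduct.map (canonicalMap π n)
        ((PiTensorProduct.subsingletonEquiv (R := k) (s := fun _ ↦ V)
          (0 : Fin 1)).symm.toLinearMap ∘ₗ π)) by
      rw [LinearMap.mem_ker.mp (this (hΔ m x hx)), map_zero]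
    refine iSup_le fun p ↦ ?_
    rintro _ ⟨t, rfl⟩
    rw [LinearMap.mem_ker]
    induction t with
    | zero => simp
    | add x y hx hy => simp only [map_add, hx, hy, add_zero]
    | tmul a b =>
      rw [TensorProduct.mapIncl, TensorProduct.map_tmul, TensorProduct.map_tmul,
        Submodule.subtype_apply, Submodule.subtype_apply]
      by_cases ha : p.1.1 = n
      · have hb : p.1.2 ≠ 1 := fun hb ↦ hm (by rw [← p.2, ha, hb, Nat.cast_succ])
        rw [LinearMap.comp_apply, hπ _ hb _ b.2, map_zero,
          TensorProduct.tmul_zero]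
      · rw [ih _ ha _ a.2, TensorProduct.zero_tmul]

end CanonicalEval

/-! ### The iterated coproduct of the exterior algebra -/

section ExteriorTensors

variable {k Q : Type*} [Field k] [AddCommGroup Q] [Module k Q]

theorem counit_ι_mul (q : Q) (u : ExteriorAlgebra k Q) :
    Coalgebra.counit (R := k) (ExteriorAlgebra.ι k q * u) = 0 := by
  rw [counit_ext, map_mul]
  simp [ExteriorAlgebra.algebraMapInv]

/-- The part of `q ∧ u` of degree one is the multiple of `q` by the scalar part of `u`. -/
theorem ιInv_ι_mul (q : Q) (u : ExteriorAlgebra k Q) :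
    ExteriorAlgebra.ιInv (ExteriorAlgebra.ι k q * u) = Coalgebra.counit (R := k) u • q := by
  induction u using DirectSum.Decomposition.inductionOn (fun i : ℕ ↦ ⋀[k]^i Q) with
  | zero => simp
  | add a b ha hb => simp only [mul_add, map_add, ha, hb, add_smul]
  | @homogeneous i u =>
    obtain ⟨u, hu⟩ := u
    cases i with
    | zero =>
      obtain ⟨r, rfl⟩ : ∃ r, algebraMap k _ r = u := by
        simpa [Submodule.one_eq_range] using hu
      have h1 : Coalgebra.counit (R := k) (algebraMap k (ExteriorAlgebra k Q) r) = r := by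
        rw [counit_ext]; simp
      change ExteriorAlgebra.ιInv (ExteriorAlgebra.ι k q * algebraMap k _ r) =
        Coalgebra.counit (R := k) (algebraMap k (ExteriorAlgebra k Q) r) • q
      rw [h1, ← Algebra.commutes, ← Algebra.smul_def, map_smul, ExteriorAlgebra.ι_leftInverse q]
    | succ i =>
      have h1 : ExteriorAlgebra.ι k q * u ∈ ⋀[k]^(i + 1 + 1) Q := by
        change _ ∈ LinearMap.range (ExteriorAlgebra.ι k) ^ (i + 1 + 1)
        rw [pow_succ']
        exact Submodule.mul_mem_mul ⟨q, rfl⟩ hu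
      change ExteriorAlgebra.ιInv (ExteriorAlgebra.ι k q * u) = Coalgebra.counit (R := k) u • q
      rw [ιInv_of_mem _ (by omega) _ h1]
      have h2 : u ∈ LinearMap.range (ExteriorAlgebra.ι k) * ⋀[k]^i Q := by
        change u ∈ LinearMap.range (ExteriorAlgebra.ι k) ^ (i + 1) at hu
        rwa [pow_succ'] at hu
      induction h2 using Submodule.mul_induction_on' with
      | mem_mul_mem m hm n hn =>
        obtain ⟨p, rfl⟩ := hm
        rw [counit_ι_mul, zero_smul]
      | add x hx y hy h h' =>
        have hx' : x ∈ ⋀[k]^(i + 1) Q := by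
          change x ∈ LinearMap.range (ExteriorAlgebra.ι k) ^ (i + 1)
          rwa [pow_succ']
        have hy' : y ∈ ⋀[k]^(i + 1) Q := by
          change y ∈ LinearMap.range (ExteriorAlgebra.ι k) ^ (i + 1)
          rwa [pow_succ']
        have hm : ∀ z ∈ ⋀[k]^(i + 1) Q, ExteriorAlgebra.ι k q * z ∈ ⋀[k]^(i + 1 + 1) Q :=
          fun z hz ↦ by
          change _ ∈ LinearMap.range (ExteriorAlgebra.ι k) ^ (i + 1 + 1)
          rw [pow_succ']
          exact Submodule.mul_mem_mul ⟨q, rfl⟩ hz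
        rw [map_add, add_smul, ← h hx' (hm x hx'), ← h' hy' (hm y hy'), add_zero]

theorem ιInv_extSign (u : ExteriorAlgebra k Q) :
    ExteriorAlgebra.ιInv (extSign k Q u) = -ExteriorAlgebra.ιInv u := by
  induction u using DirectSum.Decomposition.inductionOn (fun i : ℕ ↦ ⋀[k]^i Q) with
  | zero => simp
  | add a b ha hb => simp only [map_add, ha, hb, neg_add]
  | @homogeneous i u =>
    rw [extSign_of_mem i (u : ExteriorAlgebra k Q) u.2, map_smul]
    by_cases hi : i = 1
    · subst hi; simp
    · rw [ιInv_of_mem i hi (u : ExteriorAlgebra k Q) u.2]; simp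

theorem convSum_apply {ι E : Type*} [AddCommGroup E] [Module k E] [Coalgebra k E]
    (s : Finset ι) (g : ι → WithConv (E →ₗ[k] k)) (u : E) : (∑ i ∈ s, g i) u = ∑ i ∈ s, g i u := by
  classical
  induction s using Finset.induction_on with
  | empty => rfl
  | insert a s ha ih => rw [Finset.sum_insert ha, Finset.sum_insert ha, ← ih]; rfl

theorem convSMul_apply {E : Type*} [AddCommGroup E] [Module k E] [Coalgebra k E] (r : k)
    (g : WithConv (E →ₗ[k] k)) (u : E) : (r • g) u = r * g u := rfl

/-- Expansion along the first vector: the coordinates of the iterated coproduct of `q ∧ u`. -/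
theorem prod_dualConv_ι_mul {n : ℕ} (f : Fin (n + 1) → Module.Dual k Q) (q : Q)
    (u : ExteriorAlgebra k Q) :
    (List.ofFn fun i ↦ dualConv ExteriorAlgebra.ιInv (f i)).prod (ExteriorAlgebra.ι k q * u) =
      ∑ i : Fin (n + 1), (-1) ^ (i : ℕ) * f i q *
        (List.ofFn fun l ↦ dualConv ExteriorAlgebra.ιInv (f (i.succAbove l))).prod u := by
  have key : ∀ (f : Module.Dual k Q) (R : WithConv (ExteriorAlgebra k Q →ₗ[k] k))
      (u : ExteriorAlgebra k Q), (dualConv ExteriorAlgebra.ιInv f * R) (ExteriorAlgebra.ι k q * u) =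
      f q * R u - (dualConv ExteriorAlgebra.ιInv f *
        .toConv (R.ofConv ∘ₗ LinearMap.mulLeft k (ExteriorAlgebra.ι k q)) :
          WithConv (ExteriorAlgebra k Q →ₗ[k] k)) u := fun f R u ↦ by
    rw [convMul_tmul_apply, convMul_tmul_apply]
    have e : Coalgebra.comul (R := k) (ExteriorAlgebra.ι k q * u) =
        extLeft q (Coalgebra.comul (R := k) u) := extComul_ι_mul q u
    have e2 : f q * R u = f q * R (TensorProduct.lid k _ (LinearMap.rTensor _
        (Coalgebra.counit (R := k)) (Coalgebra.comul (R := k) u))) := by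
      rw [Coalgebra.rTensor_counit_comul, TensorProduct.lid_tmul, one_smul]
    rw [e, e2]
    generalize Coalgebra.comul (R := k) u = t
    induction t with
    | zero => simp
    | add x y hx hy => simp only [map_add, hx, hy, mul_add]; ring
    | tmul a b =>
      simp only [extLeft, LinearMap.add_apply, TensorProduct.map_tmul, map_add,
        LinearMap.mul'_apply, LinearMap.rTensor_tmul, TensorProduct.lid_tmul, map_smul]
      change f (ExteriorAlgebra.ιInv (ExteriorAlgebra.ι k q * a)) * R b +
        f (ExteriorAlgebra.ιInv (extSign k Q a)) * R (ExteriorAlgebra.ι k q * b) =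
        f q * (Coalgebra.counit (R := k) a • R b) -
          f (ExteriorAlgebra.ιInv a) * R (ExteriorAlgebra.ι k q * b)
      rw [ιInv_ι_mul, ιInv_extSign, map_smul, map_neg, smul_eq_mul, smul_eq_mul]
      ring
  induction n generalizing u with
  | zero =>
    rw [List.ofFn_succ, List.prod_cons, List.ofFn_zero, List.prod_nil, key,
      Fin.sum_univ_succ, Finset.univ_eq_empty, Finset.sum_empty, List.ofFn_zero, List.prod_nil]
    have : (WithConv.toConv ((1 : WithConv (ExteriorAlgebra k Q →ₗ[k] k)).ofConv ∘ₗ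
        LinearMap.mulLeft k (ExteriorAlgebra.ι k q)) : WithConv (ExteriorAlgebra k Q →ₗ[k] k)) =
        0 := by
      refine WithConv.ofConv_injective (LinearMap.ext fun v ↦ ?_)
      change (1 : WithConv (ExteriorAlgebra k Q →ₗ[k] k)) (ExteriorAlgebra.ι k q * v) = 0
      rw [LinearMap.convOne_apply, counit_ι_mul, map_zero]
    rw [this, mul_zero]
    change _ - (0 : k) = _
    simp
  | succ n ih =>
    rw [List.ofFn_succ, List.prod_cons, key, Fin.sum_univ_succ]
    have h1 : (WithConv.toConv (((List.ofFn fun i : Fin (n + 1) ↦ dualConv ExteriorAlgebra.ιInv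
        (f i.succ)).prod : WithConv (ExteriorAlgebra k Q →ₗ[k] k)).ofConv ∘ₗ
        LinearMap.mulLeft k (ExteriorAlgebra.ι k q)) : WithConv (ExteriorAlgebra k Q →ₗ[k] k)) =
        ∑ i : Fin (n + 1), ((-1) ^ (i : ℕ) * f i.succ q) • (List.ofFn fun l ↦
          dualConv ExteriorAlgebra.ιInv (f (i.succAbove l).succ)).prod := by
      refine WithConv.ofConv_injective (LinearMap.ext fun v ↦ ?_)
      refine (ih (fun i ↦ f i.succ) v).trans ?_
      rw [convSum_apply]
      rfl
    rw [h1, Finset.mul_sum, convSum_apply, sub_eq_add_neg, ← Finset.sum_neg_distrib]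
    congr 1
    · simp
    · refine Finset.sum_congr rfl fun i _ ↦ ?_
      rw [mul_smul_comm, List.ofFn_succ, List.prod_cons, convSMul_apply]
      simp only [Fin.succ_succAbove_zero, Fin.succ_succAbove_succ, Fin.val_succ]
      ring

/-- The iterated coproduct of an exterior product of `n` vectors is given by determinants. -/
theorem tensorEval_canonicalMap_ιMulti {n : ℕ} (f : Fin n → Module.Dual k Q) (v : Fin n → Q) :
    tensorEval f (canonicalMap ExteriorAlgebra.ιInv n (ExteriorAlgebra.ιMulti k n v)) =
      Matrix.det (Matrix.of fun i l ↦ f l (v i)) := by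
  rw [tensorEval_canonicalMap]
  induction n with
  | zero =>
    rw [List.ofFn_zero, List.prod_nil, LinearMap.convOne_apply, ExteriorAlgebra.ιMulti_zero_apply,
      counit_ext]
    simp
  | succ n ih =>
    rw [ExteriorAlgebra.ιMulti_succ_apply, prod_dualConv_ι_mul, Matrix.det_succ_row_zero]
    refine Finset.sum_congr rfl fun i _ ↦ ?_
    rw [ih]
    rfl

theorem tensorEval_canonicalMap_ext {n : ℕ} (f : Fin n → Module.Dual k Q) (u : ⋀[k]^n Q) :
    tensorEval f (canonicalMap ExteriorAlgebra.ιInv n (u : ExteriorAlgebra k Q)) =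
      exteriorPower.pairingDual k Q n (exteriorPower.ιMulti k n f) u := by
  have e : tensorEval f ∘ₗ canonicalMap ExteriorAlgebra.ιInv n ∘ₗ (⋀[k]^n Q).subtype =
      exteriorPower.pairingDual k Q n (exteriorPower.ιMulti k n f) := by
    refine exteriorPower.linearMap_ext (AlternatingMap.ext fun v ↦ ?_)
    simp only [LinearMap.compAlternatingMap_apply, LinearMap.comp_apply, Submodule.subtype_apply,
      exteriorPower.ιMulti_apply_coe, tensorEval_canonicalMap_ιMulti,
      exteriorPower.pairingDual_ιMulti_ιMulti]
  exact LinearMap.congr_fun e u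

open Module in
/-- The exterior power embeds into the tensor power; the coordinates are minors. -/
theorem canonicalMap_ext_injective {n : ℕ} (u : ⋀[k]^n Q)
    (h : canonicalMap ExteriorAlgebra.ιInv n (u : ExteriorAlgebra k Q) = 0) : u = 0 := by
  classical
  let b := Basis.ofVectorSpace k Q
  let _ : LinearOrder (Basis.ofVectorSpaceIndex k Q) := linearOrderOfSTO WellOrderingRel
  refine (b.exteriorPower n).ext_elem fun s ↦ ?_
  rw [exteriorPower.basis_repr_apply, map_zero, Finsupp.zero_apply, exteriorPower.ιMultiDual]
  refine (tensorEval_canonicalMap_ext _ u).symm.trans ?_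
  rw [h, map_zero]

theorem tensorEval_antisymm {V : Type*} [AddCommGroup V] [Module k V] {n : ℕ} {t : ⨂[k]^n V}
    (ht : ∀ σ : Equiv.Perm (Fin n),
      ((Equiv.Perm.sign σ : ℤ) : k) • PiTensorProduct.reindex k (fun _ ↦ V) σ t = t)
    (f : Fin n → Module.Dual k V) (σ : Equiv.Perm (Fin n)) :
    tensorEval f t = ((Equiv.Perm.sign σ : ℤ) : k) * tensorEval (f ∘ σ) t := by
  nth_rewrite 1 [← ht σ]
  rw [map_smul, tensorEval_reindex, smul_eq_mul]

theorem tensorEval_of_not_injective [NeZero (2 : k)] {V : Type*} [AddCommGroup V] [Module k V]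
    {n : ℕ} {t : ⨂[k]^n V} (ht : ∀ σ : Equiv.Perm (Fin n),
      ((Equiv.Perm.sign σ : ℤ) : k) • PiTensorProduct.reindex k (fun _ ↦ V) σ t = t)
    (f : Fin n → Module.Dual k V) {i l : Fin n} (hil : i ≠ l) (h : f i = f l) :
    tensorEval f t = 0 := by
  have h1 := tensorEval_antisymm ht f (Equiv.swap i l)
  have h2 : f ∘ Equiv.swap i l = f := by
    funext m
    rw [Function.comp_apply, Equiv.swap_apply_def]
    split_ifs with h3 h4
    · rw [h3, h]
    · rw [h4, h]
    · rfl
  rw [h2, Equiv.Perm.sign_swap hil] at h1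
  have h3 : (2 : k) * tensorEval f t = 0 := by
    push_cast at h1
    linear_combination h1
  exact (mul_eq_zero.mp h3).resolve_left (NeZero.ne 2)

open Module in
/-- Every antisymmetric tensor comes from the exterior power. -/
theorem exists_canonicalMap_ext [NeZero (2 : k)] {n : ℕ} (t : ⨂[k]^n Q)
    (ht : ∀ σ : Equiv.Perm (Fin n),
      ((Equiv.Perm.sign σ : ℤ) : k) • PiTensorProduct.reindex k (fun _ ↦ Q) σ t = t) :
    ∃ u : ⋀[k]^n Q, canonicalMap ExteriorAlgebra.ιInv n (u : ExteriorAlgebra k Q) = t := by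
  classical
  let b := Basis.ofVectorSpace k Q
  let _ : LinearOrder (Basis.ofVectorSpaceIndex k Q) := linearOrderOfSTO WellOrderingRel
  let B := Basis.piTensorProduct fun _ : Fin n ↦ b
  have hB : ∀ (s : ⨂[k]^n Q) p, B.repr s p = tensorEval (fun i ↦ b.coord (p i)) s := fun s p ↦ by
    have e : B.coord p = tensorEval fun i ↦ b.coord (p i) :=
      PiTensorProduct.ext (MultilinearMap.ext fun v ↦ by
        simp [B, LinearMap.compMultilinearMap_apply, tensorEval_tprod])
    exact LinearMap.congr_fun e s
  let e : Set.powersetCard (Basis.ofVectorSpaceIndex k Q) n → (Fin n → Basis.ofVectorSpaceIndex k Q) :=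
    fun s ↦ Set.powersetCard.ofFinEmbEquiv.symm s
  have he : Function.Injective e := fun s s' h ↦
    Set.powersetCard.ofFinEmbEquiv.symm.injective (DFunLike.coe_injective h)
  let u : ⋀[k]^n Q := (b.exteriorPower n).repr.symm ((B.repr t).comapDomain e he.injOn)
  have hu : ∀ f : Fin n → Module.Dual k Q,
      tensorEval f (canonicalMap ExteriorAlgebra.ιInv n (u : ExteriorAlgebra k Q)) =
      exteriorPower.pairingDual k Q n (exteriorPower.ιMulti k n f) u :=
    fun f ↦ tensorEval_canonicalMap_ext f u
  refine ⟨u, B.ext_elem fun r ↦ ?_⟩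
  rw [hB, hB, hu]
  by_cases hr : Function.Injective r
  · let σ := Tuple.sort r
    have hmono : StrictMono (r ∘ σ) :=
      (Tuple.monotone_sort r).strictMono_of_injective (hr.comp σ.injective)
    let p : Fin n ↪o Basis.ofVectorSpaceIndex k Q := OrderEmbedding.ofStrictMono (r ∘ σ) hmono
    have h1 : e (Set.powersetCard.ofFinEmbEquiv p) = r ∘ σ := by
      simp only [e, Equiv.symm_apply_apply]
      rfl
    have h2 := exteriorPower.basis_repr_apply k n b u (Set.powersetCard.ofFinEmbEquiv p)
    rw [exteriorPower.ιMultiDual, exteriorPower.ιMulti_family] at h2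
    simp only [u, LinearEquiv.apply_symm_apply, Finsupp.comapDomain_apply, h1, hB,
      Equiv.symm_apply_apply] at h2
    have h3 : (fun i ↦ b.coord (r i)) ∘ σ = b.coord ∘ p := rfl
    rw [tensorEval_antisymm ht _ σ, h3]
    have h4 := AlternatingMap.map_perm (exteriorPower.ιMulti k n (M := Module.Dual k Q))
      (fun i ↦ b.coord (r i)) σ
    rw [h3] at h4
    have h5 : tensorEval (b.coord ∘ p) t = exteriorPower.pairingDual k Q n
      (exteriorPower.ιMulti k n (b.coord ∘ p)) u := h2
    rw [h5, h4, Units.smul_def, ← Int.cast_smul_eq_zsmul k, map_smul, LinearMap.smul_apply,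
      smul_eq_mul, ← mul_assoc, ← Int.cast_mul, Int.units_coe_mul_self, Int.cast_one, one_mul]
  · obtain ⟨i, l, h, hil⟩ : ∃ i l, r i = r l ∧ i ≠ l := by
      simpa [Function.Injective] using hr
    rw [tensorEval_of_not_injective ht (fun i ↦ b.coord (r i)) hil (congrArg b.coord h),
      (exteriorPower.ιMulti k n (M := Module.Dual k Q)).map_eq_zero_of_eq _
        (congrArg b.coord h) hil, map_zero, LinearMap.zero_apply]

end ExteriorTensors

/-! ### Tensor powers and their coinvariants -/

section Snoc

variable {k V W E : Type*} [Field k] [AddCommGroup V] [Module k V] [AddCommGroup W] [Module k W]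
  [AddCommGroup E] [Module k E] [Coalgebra k E]

/-- The isomorphism `V^{⊗n} ⊗ V ≅ V^{⊗(n+1)}`. -/
noncomputable def snocEquiv (k V : Type*) [Field k] [AddCommGroup V] [Module k V] (n : ℕ) :
    (⨂[k]^n V) ⊗[k] V ≃ₗ[k] ⨂[k]^(n + 1) V :=
  (TensorProduct.congr (LinearEquiv.refl k _) (PiTensorProduct.subsingletonEquiv (R := k)
    (s := fun _ ↦ V) (0 : Fin 1)).symm).trans TensorPower.mulEquiv

theorem snocEquiv_tprod {n : ℕ} (v : Fin n → V) (w : V) :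
    snocEquiv k V n (PiTensorProduct.tprod k v ⊗ₜ w) =
      PiTensorProduct.tprod k (Fin.snoc v w : Fin (n + 1) → V) := by
  rw [snocEquiv, LinearEquiv.trans_apply, TensorProduct.congr_tmul,
    PiTensorProduct.subsingletonEquiv_symm_apply', LinearEquiv.refl_apply]
  have e := TensorPower.tprod_mul_tprod (R := k) v (fun _ : Fin 1 ↦ w)
  rw [TensorPower.gMul_def] at e
  rw [e, Fin.append_right_eq_snoc]

theorem canonicalMap_zero (π : E →ₗ[k] V) (x : E) :
    canonicalMap π 0 x = Coalgebra.counit (R := k) x • PiTensorProduct.tprod k Fin.elim0 := rfl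

theorem canonicalMap_succ (π : E →ₗ[k] V) (n : ℕ) (x : E) :
    canonicalMap π (n + 1) x =
      snocEquiv k V n (TensorProduct.map (canonicalMap π n) π (Coalgebra.comul (R := k) x)) := by
  rw [canonicalMap, LinearMap.comp_apply, LinearMap.comp_apply]
  generalize Coalgebra.comul (R := k) x = t
  induction t with
  | zero => simp
  | add x y hx hy => simp only [map_add, hx, hy]
  | tmul x y => rfl

theorem map_snocEquiv (f : V →ₗ[k] W) {n : ℕ} (z : (⨂[k]^n V) ⊗[k] V) :
    PiTensorProduct.map (fun _ ↦ f) (snocEquiv k V n z) =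
      snocEquiv k W n (TensorProduct.map (PiTensorProduct.map fun _ ↦ f) f z) := by
  induction z with
  | zero => simp
  | add x y hx hy => simp only [map_add, hx, hy]
  | tmul s w =>
    induction s using PiTensorProduct.induction_on with
    | add x y hx hy => simp only [TensorProduct.add_tmul, map_add, hx, hy]
    | smul_tprod r v =>
      simp only [← TensorProduct.smul_tmul', map_smul, TensorProduct.map_tmul]
      congr 1
      rw [snocEquiv_tprod, PiTensorProduct.map_tprod, PiTensorProduct.map_tprod, snocEquiv_tprod]
      congr 1
      funext i
      refine Fin.lastCases ?_ (fun i ↦ ?_) i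
      · rw [Fin.snoc_last, Fin.snoc_last]
      · rw [Fin.snoc_castSucc, Fin.snoc_castSucc]

/-- The iterated coproduct is natural in the vector space. -/
theorem canonicalMap_comp_left (f : V →ₗ[k] W) (π : E →ₗ[k] V) (n : ℕ) (x : E) :
    canonicalMap (f ∘ₗ π) n x = PiTensorProduct.map (fun _ ↦ f) (canonicalMap π n x) := by
  induction n generalizing x with
  | zero =>
    rw [canonicalMap_zero, canonicalMap_zero, map_smul, PiTensorProduct.map_tprod]
    congr 2
    funext i
    exact i.elim0
  | succ n ih =>
    rw [canonicalMap_succ, canonicalMap_succ, map_snocEquiv]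
    congr 1
    generalize Coalgebra.comul (R := k) x = t
    induction t with
    | zero => simp
    | add x y hx hy => simp only [map_add, hx, hy]
    | tmul x y => simp only [TensorProduct.map_tmul, ih, LinearMap.comp_apply]

/-- The iterated coproduct is natural in the coalgebra. -/
theorem canonicalMap_comp_right {F : Type*} [AddCommGroup F] [Module k F] [Coalgebra k F]
    (h : F →ₗ[k] E) (hε : ∀ x, Coalgebra.counit (R := k) (h x) = Coalgebra.counit (R := k) x)
    (hΔ : ∀ x, Coalgebra.comul (R := k) (h x) =
      TensorProduct.map h h (Coalgebra.comul (R := k) x)) (π : E →ₗ[k] V) (n : ℕ) (x : F) :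
    canonicalMap π n (h x) = canonicalMap (π ∘ₗ h) n x := by
  induction n generalizing x with
  | zero => rw [canonicalMap_zero, canonicalMap_zero, hε]
  | succ n ih =>
    rw [canonicalMap_succ, canonicalMap_succ, hΔ]
    congr 1
    generalize Coalgebra.comul (R := k) x = t
    induction t with
    | zero => simp
    | add x y hx hy => simp only [map_add, hx, hy]
    | tmul x y => simp only [TensorProduct.map_tmul, ih, LinearMap.comp_apply]

end Snoc

section CoactAt

variable {k V C : Type*} [Field k] [AddCommGroup V] [Module k V] [AddCommGroup C] [Module k C]

theorem coactAt_toLinearMap (ρ : V →ₗ[k] V ⊗[k] C) {n : ℕ} (i : Fin n) (v : Fin n → V) :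
    coactAt ρ i ∘ₗ (PiTensorProduct.tprod k).toLinearMap v i =
      LinearMap.rTensor C ((PiTensorProduct.tprod k).toLinearMap v i) ∘ₗ ρ := by
  ext w
  rw [LinearMap.comp_apply, MultilinearMap.toLinearMap_apply, coactAt_tprod, Function.update_self,
    LinearMap.comp_apply]
  congr 2
  ext w'
  simp

theorem isRightComodule_coactAt [Coalgebra k C] {ρ : V →ₗ[k] V ⊗[k] C} (hρ : IsRightComodule ρ)
    {n : ℕ} (i : Fin n) : IsRightComodule (coactAt ρ i) where
  coassoc := by
    refine PiTensorProduct.ext (MultilinearMap.ext fun v ↦ ?_)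
    simp only [LinearMap.compMultilinearMap_apply, LinearMap.comp_apply, LinearEquiv.coe_coe,
      coactAt_tprod]
    rw [← LinearMap.comp_apply (LinearMap.rTensor C (coactAt ρ i)), ← LinearMap.rTensor_comp,
      coactAt_toLinearMap, LinearMap.rTensor_comp, LinearMap.comp_apply]
    have h := LinearMap.congr_fun hρ.coassoc (v i)
    simp only [LinearMap.comp_apply, LinearEquiv.coe_coe] at h
    have h1 : ∀ (L : V →ₗ[k] ⨂[k]^n V) (t : (V ⊗[k] C) ⊗[k] C),
        TensorProduct.assoc k _ C C (LinearMap.rTensor C (LinearMap.rTensor C L) t) =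
        LinearMap.rTensor _ L (TensorProduct.assoc k V C C t) := fun L t ↦ by
      induction t with
      | zero => simp
      | add x y hx hy => simp only [map_add, hx, hy]
      | tmul s c =>
        induction s with
        | zero => simp
        | add x y hx hy => simp only [TensorProduct.add_tmul, map_add, hx, hy]
        | tmul w d => rfl
    rw [h1, h]
    generalize ρ (v i) = s
    induction s with
    | zero => simp
    | add x y hx hy => simp only [map_add, hx, hy]
    | tmul w c => rfl
  counit := by
    refine PiTensorProduct.ext (MultilinearMap.ext fun v ↦ ?_)
    simp only [LinearMap.compMultilinearMap_apply, LinearMap.comp_apply, LinearEquiv.coe_coe,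
      coactAt_tprod, LinearMap.id_apply]
    have h := LinearMap.congr_fun hρ.counit (v i)
    simp only [LinearMap.comp_apply, LinearEquiv.coe_coe, LinearMap.id_apply] at h
    have h1 : ∀ (L : V →ₗ[k] ⨂[k]^n V) (t : V ⊗[k] C),
        TensorProduct.rid k _ (LinearMap.lTensor _ Coalgebra.counit (LinearMap.rTensor C L t)) =
        L (TensorProduct.rid k V (LinearMap.lTensor V Coalgebra.counit t)) := fun L t ↦ by
      induction t with
      | zero => simp
      | add x y hx hy => simp only [map_add, hx, hy]
      | tmul s c => simp
    rw [h1, h, MultilinearMap.toLinearMap_apply, Function.update_eq_self]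

theorem coactAt_reindex (ρ : V →ₗ[k] V ⊗[k] C) {n : ℕ} (i : Fin n) (σ : Equiv.Perm (Fin n))
    (t : ⨂[k]^n V) : coactAt ρ (σ i) (PiTensorProduct.reindex k (fun _ ↦ V) σ t) =
      LinearMap.rTensor C (PiTensorProduct.reindex k (fun _ ↦ V) σ).toLinearMap
        (coactAt ρ i t) := by
  induction t using PiTensorProduct.induction_on with
  | add x y hx hy => simp only [map_add, hx, hy]
  | smul_tprod r v =>
    simp only [map_smul]
    congr 1
    have e : PiTensorProduct.reindex k (fun _ ↦ V) σ (PiTensorProduct.tprod k v) =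
      PiTensorProduct.tprod k (fun l ↦ v (σ.symm l)) := PiTensorProduct.reindex_tprod _ _
    rw [e, coactAt_tprod, coactAt_tprod, Equiv.symm_apply_apply, ← LinearMap.rTensor_comp_apply]
    congr 2
    ext w
    simp only [LinearMap.comp_apply, MultilinearMap.toLinearMap_apply, LinearEquiv.coe_coe]
    have e2 : PiTensorProduct.reindex k (fun _ ↦ V) σ (PiTensorProduct.tprod k
      (Function.update v i w)) = PiTensorProduct.tprod k (fun l ↦ Function.update v i w (σ.symm l)) :=
        PiTensorProduct.reindex_tprod _ _
    rw [e2]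
    congr 1
    funext l
    by_cases h : l = σ i
    · subst h; simp
    · rw [Function.update_of_ne h, Function.update_of_ne]
      rintro rfl
      exact h (σ.apply_symm_apply l).symm

/-- The co-free component is a subcomodule of the tensor power. -/
theorem coactAt_mem_cofreePart [Coalgebra k C] {ρ : V →ₗ[k] V ⊗[k] C} (hρ : IsRightComodule ρ)
    {n : ℕ} (i : Fin n) (t : ⨂[k]^n V) (ht : t ∈ cofreePart ρ n) :
    coactAt ρ i t ∈ LinearMap.range (LinearMap.rTensor C (cofreePart ρ n).subtype) := by
  refine mem_range_rTensor _ _ fun φ ↦ ⟨fun a b ↦ ?_, fun σ ↦ ?_⟩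
  · have key : ∀ a, coactAt ρ a (TensorProduct.rid k _ (LinearMap.lTensor _ φ (coactAt ρ i t))) =
        TensorProduct.rid k _ (LinearMap.lTensor _ φ ((TensorProduct.assoc k _ C C).symm
          (LinearMap.lTensor _ Coalgebra.comul (coactAt ρ i t)))) := fun a ↦ by
      have h := LinearMap.congr_fun (isRightComodule_coactAt hρ a).coassoc t
      simp only [LinearMap.comp_apply, LinearEquiv.coe_coe] at h
      rw [ht.1 a i] at h
      rw [← h, LinearEquiv.symm_apply_apply]
      generalize coactAt ρ i t = s
      induction s with
      | zero => simp
      | add x y hx hy => simp only [map_add, hx, hy]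
      | tmul x c => simp
    rw [key, key]
  · have h := coactAt_reindex ρ i σ t
    have h2 : ∀ s : (⨂[k]^n V) ⊗[k] C, PiTensorProduct.reindex k (fun _ ↦ V) σ
        (TensorProduct.rid k _ (LinearMap.lTensor _ φ s)) = TensorProduct.rid k _
        (LinearMap.lTensor _ φ (LinearMap.rTensor C
          (PiTensorProduct.reindex k (fun _ ↦ V) σ).toLinearMap s)) := fun s ↦ by
      induction s with
      | zero => simp
      | add x y hx hy => simp only [map_add, hx, hy]
      | tmul x c => simp
    rw [h2, ← h, ← map_smul, ← map_smul, ← map_smul, ht.2, ht.1 (σ i) i]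

/-- Evaluation of `v₁ ⊗ ⋯ ⊗ vₙ ⊗ c` at linear forms, where the form `ψ` is evaluated jointly at the
`i`-th factor and at `c`. -/
noncomputable def jointEval {n : ℕ} (f : Fin n → Module.Dual k V) (i : Fin n)
    (ψ : V ⊗[k] C →ₗ[k] k) : (⨂[k]^n V) ⊗[k] C →ₗ[k] k :=
  TensorProduct.lift ((((TensorPower.multilinearMapToDual k V n).toLinearMap f i) ∘ₗ
    (TensorProduct.curry ψ).flip).flip)

theorem multilinearMapToDual_eq {n : ℕ} (f : Fin n → Module.Dual k V) :
    TensorPower.multilinearMapToDual k V n f = tensorEval f :=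
  PiTensorProduct.ext (MultilinearMap.ext fun v ↦ by
    simp [LinearMap.compMultilinearMap_apply, tensorEval_tprod])

theorem jointEval_tmul {n : ℕ} (f : Fin n → Module.Dual k V) (i : Fin n)
    (ψ : V ⊗[k] C →ₗ[k] k) (t : ⨂[k]^n V) (c : C) : jointEval f i ψ (t ⊗ₜ c) =
      tensorEval (Function.update f i ((TensorProduct.curry ψ).flip c)) t := by
  rw [← multilinearMapToDual_eq]
  rfl

theorem jointEval_coactAt (ρ : V →ₗ[k] V ⊗[k] C) {n : ℕ} (f : Fin n → Module.Dual k V) (i : Fin n)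
    (ψ : V ⊗[k] C →ₗ[k] k) (t : ⨂[k]^n V) :
    jointEval f i ψ (coactAt ρ i t) = tensorEval (Function.update f i (ψ ∘ₗ ρ)) t := by
  induction t using PiTensorProduct.induction_on with
  | add x x' hx hx' => simp only [map_add, hx, hx']
  | smul_tprod r v =>
    simp only [map_smul]
    congr 1
    have h1 : ∀ (g : Module.Dual k V) (w : V), ∏ l, Function.update f i g l
        (Function.update v i w l) = g w * ∏ l ∈ Finset.univ.erase i, f l (v l) := fun g w ↦ by
      rw [← Finset.mul_prod_erase _ _ (Finset.mem_univ i), Function.update_self,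
        Function.update_self]
      congr 1
      exact Finset.prod_congr rfl fun l hl ↦ by
        rw [Function.update_of_ne (Finset.ne_of_mem_erase hl),
          Function.update_of_ne (Finset.ne_of_mem_erase hl)]
    have h2 := h1 (ψ ∘ₗ ρ) (v i)
    rw [Function.update_eq_self] at h2
    rw [coactAt_tprod, tensorEval_tprod, h2, LinearMap.comp_apply]
    generalize ρ (v i) = s
    induction s with
    | zero => simp
    | add x y hx hy => simp only [map_add, hx, hy, add_mul]
    | tmul w c =>
      rw [LinearMap.rTensor_tmul, jointEval_tmul, MultilinearMap.toLinearMap_apply,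
        tensorEval_tprod, h1]
      rfl

/-- A tensor that is coinvariant at every factor is a tensor of coinvariants: `P` is a projection
onto the coinvariants. -/
theorem map_eq_of_coinvariant (ρ : V →ₗ[k] V ⊗[k] C) (e : C) (P : V →ₗ[k] V)
    (hP : ∀ v, ρ v = v ⊗ₜ e → P v = v) {n : ℕ} (t : ⨂[k]^n V)
    (ht : ∀ i, coactAt ρ i t = t ⊗ₜ e) : PiTensorProduct.map (fun _ ↦ P) t = t := by
  let d : V →ₗ[k] V ⊗[k] C := ρ - (TensorProduct.mk k V C).flip e
  obtain ⟨L, hL⟩ : ∃ L : V ⊗[k] C →ₗ[k] V, L ∘ₗ d = LinearMap.id - P := by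
    have hle : LinearMap.ker d ≤ LinearMap.ker (LinearMap.id - P) := fun v hv ↦ by
      have : ρ v = v ⊗ₜ e := sub_eq_zero.mp hv
      rw [LinearMap.mem_ker, LinearMap.sub_apply, LinearMap.id_apply, hP v this, sub_self]
    obtain ⟨g, hg⟩ := LinearMap.exists_leftInverse_of_injective
      ((LinearMap.ker d).liftQ d le_rfl) (Submodule.ker_liftQ_eq_bot _ _ _ le_rfl)
    refine ⟨(LinearMap.ker d).liftQ (LinearMap.id - P) hle ∘ₗ g, LinearMap.ext fun v ↦ ?_⟩
    have h1 : g (d v) = (LinearMap.ker d).mkQ v :=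
      LinearMap.congr_fun hg ((LinearMap.ker d).mkQ v)
    rw [LinearMap.comp_apply, LinearMap.comp_apply, h1]
    rfl
  refine eq_of_tensorEval fun f ↦ ?_
  have h1 : tensorEval f (PiTensorProduct.map (fun _ ↦ P) t) =
      tensorEval (fun i ↦ f i ∘ₗ P) t := by
    rw [← LinearMap.comp_apply]
    congr 1
    exact PiTensorProduct.ext (MultilinearMap.ext fun v ↦ by
      simp [LinearMap.compMultilinearMap_apply, tensorEval_tprod])
  rw [h1]
  refine apply_comp_of_update (fun f ↦ tensorEval f t) (fun g ↦ g ∘ₗ P) (fun f i ↦ ?_) f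
  have h2 := congrArg (jointEval f i (f i ∘ₗ L)) (ht i)
  rw [jointEval_coactAt, jointEval_tmul] at h2
  have h3 : f i ∘ₗ P = f i - ((f i ∘ₗ L) ∘ₗ ρ -
      (TensorProduct.curry (f i ∘ₗ L)).flip e) := by
    ext v
    have h := LinearMap.congr_fun hL v
    simp only [d, LinearMap.comp_apply, LinearMap.sub_apply, LinearMap.id_apply, map_sub,
      LinearMap.flip_apply] at h
    simp only [LinearMap.comp_apply, LinearMap.sub_apply, LinearMap.flip_apply,
      TensorProduct.curry_apply]
    rw [← map_sub (f i)]
    erw [h]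
    rw [map_sub]
    ring
  have h4 : ∀ g, tensorEval (Function.update f i g) t =
      (TensorPower.multilinearMapToDual k V n).toLinearMap f i g t := fun g ↦ by
    rw [← multilinearMapToDual_eq]; rfl
  rw [h4, h4] at h2
  change tensorEval (Function.update f i (f i ∘ₗ P)) t = tensorEval f t
  rw [h4, h3, map_sub, map_sub, LinearMap.sub_apply, LinearMap.sub_apply, h2, sub_self, sub_zero,
    ← h4, Function.update_eq_self]

end CoactAt

/-! ### Diagonal actions on tensor powers -/

section TensorPowerAction

variable {k J K V C E : Type*} [Field k] [Ring J] [HopfAlgebra k J] [Ring K] [HopfAlgebra k K]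
  [AddCommGroup V] [Module k V] [AddCommGroup C] [Module k C]

/-- The diagonal action of `J` on `V^{⊗n}`. -/
noncomputable def powAct (α : J →ₗ[k] V →ₗ[k] V) (n : ℕ) : J →ₗ[k] (⨂[k]^n V) →ₗ[k] ⨂[k]^n V :=
  PiTensorProduct.map₂ (fun _ : Fin n ↦ α) ∘ₗ canonicalMap LinearMap.id n

theorem powAct_apply (α : J →ₗ[k] V →ₗ[k] V) (n : ℕ) (a : J) :
    powAct α n a = PiTensorProduct.map₂ (fun _ : Fin n ↦ α) (canonicalMap LinearMap.id n a) := rfl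

theorem map₂_snocEquiv (α : J →ₗ[k] V →ₗ[k] V) {n : ℕ} (x : (⨂[k]^n J) ⊗[k] J)
    (z : (⨂[k]^n V) ⊗[k] V) : PiTensorProduct.map₂ (fun _ : Fin (n + 1) ↦ α) (snocEquiv k J n x)
      (snocEquiv k V n z) = snocEquiv k V n (TensorProduct.homTensorHomMap (RingHom.id k) _ _ _ _
        (TensorProduct.map (PiTensorProduct.map₂ fun _ : Fin n ↦ α) α x) z) := by
  induction z with
  | zero => simp
  | add z z' h h' => simp only [map_add, h, h']
  | tmul s w =>
    induction x with
    | zero => simp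
    | add z z' h h' => simp only [map_add, LinearMap.add_apply, h, h']
    | tmul x a =>
      induction s using PiTensorProduct.induction_on with
      | add z z' h h' => simp only [TensorProduct.add_tmul, map_add, h, h']
      | smul_tprod r v =>
        induction x using PiTensorProduct.induction_on with
        | add z z' h h' => simp only [TensorProduct.add_tmul, map_add, LinearMap.add_apply, h, h']
        | smul_tprod r' b =>
          simp only [← TensorProduct.smul_tmul', map_smul, LinearMap.smul_apply]
          congr 2
          rw [snocEquiv_tprod, snocEquiv_tprod, PiTensorProduct.map₂_tprod_tprod,
            TensorProduct.map_tmul, TensorProduct.homTensorHomMap_apply, TensorProduct.map_tmul,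
            PiTensorProduct.map₂_tprod_tprod, snocEquiv_tprod]
          congr 1
          funext i
          refine Fin.lastCases ?_ (fun i ↦ ?_) i
          · simp only [Fin.snoc_last]
          · simp only [Fin.snoc_castSucc]

theorem powAct_zero (α : J →ₗ[k] V →ₗ[k] V) (a : J) (t : ⨂[k]^0 V) :
    powAct α 0 a t = Coalgebra.counit (R := k) a • t := by
  rw [powAct_apply, canonicalMap_zero, map_smul, LinearMap.smul_apply]
  congr 1
  induction t using PiTensorProduct.induction_on with
  | add z z' h h' => simp only [map_add, h, h']
  | smul_tprod r v =>
    rw [map_smul, PiTensorProduct.map₂_tprod_tprod]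
    congr 2
    funext i
    exact i.elim0

theorem powAct_succ (α : J →ₗ[k] V →ₗ[k] V) (n : ℕ) (a : J) (z : (⨂[k]^n V) ⊗[k] V) :
    powAct α (n + 1) a (snocEquiv k V n z) = snocEquiv k V n (diagAct (powAct α n) α a z) := by
  rw [powAct_apply, canonicalMap_succ, map₂_snocEquiv, diagAct_apply]
  congr 1
  generalize Coalgebra.comul (R := k) a = s
  induction s with
  | zero => simp
  | add z z' h h' => simp only [map_add, LinearMap.add_apply, h, h']
  | tmul b c => rfl

theorem isAction_powAct {α : J →ₗ[k] V →ₗ[k] V} (hα : IsAction α) (n : ℕ) :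
    IsAction (powAct α n) := by
  induction n with
  | zero =>
    exact ⟨fun t ↦ by rw [powAct_zero, Bialgebra.counit_one, one_smul],
      fun a b t ↦ by rw [powAct_zero, powAct_zero, powAct_zero, Bialgebra.counit_mul, smul_smul]⟩
  | succ n ih =>
    have h := isAction_diagAct ih hα
    refine ⟨fun t ↦ ?_, fun a b t ↦ ?_⟩
    · obtain ⟨z, rfl⟩ := (snocEquiv k V n).surjective t
      rw [powAct_succ, h.one]
    · obtain ⟨z, rfl⟩ := (snocEquiv k V n).surjective t
      rw [powAct_succ, powAct_succ, powAct_succ, h.mul]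

/-- A linear map between modules with compatible actions commutes with iterated coproducts. -/
theorem canonicalMap_act [AddCommGroup E] [Module k E] [Coalgebra k E]
    (β : J →ₗ[k] E →ₗ[k] E) (α : J →ₗ[k] V →ₗ[k] V) (π : E →ₗ[k] V)
    (hε : ∀ a x, Coalgebra.counit (R := k) (β a x) =
      Coalgebra.counit (R := k) a * Coalgebra.counit (R := k) x)
    (hΔ : ∀ a x, Coalgebra.comul (R := k) (β a x) = diagAct β β a (Coalgebra.comul (R := k) x))
    (hπ : ∀ a x, π (β a x) = α a (π x)) (n : ℕ) (a : J) (x : E) :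
    canonicalMap π n (β a x) = powAct α n a (canonicalMap π n x) := by
  induction n generalizing a x with
  | zero => rw [powAct_zero, canonicalMap_zero, canonicalMap_zero, hε, smul_smul]
  | succ n ih =>
    rw [canonicalMap_succ, canonicalMap_succ, powAct_succ, hΔ, diagAct_apply, diagAct_apply]
    congr 1
    generalize Coalgebra.comul (R := k) a = s
    generalize Coalgebra.comul (R := k) x = t
    induction s with
    | zero => simp
    | add z z' h h' => simp only [map_add, LinearMap.add_apply, h, h']
    | tmul b c =>
      induction t with
      | zero => simp
      | add z z' h h' => simp only [map_add, h, h']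
      | tmul x y =>
        rw [tensorAct_tmul, TensorProduct.map_tmul, TensorProduct.map_tmul, tensorAct_tmul, ih, hπ]

theorem reindex_perm_tprod {n : ℕ} (σ : Equiv.Perm (Fin n)) (v : Fin n → V) :
    PiTensorProduct.reindex k (fun _ ↦ V) σ (PiTensorProduct.tprod k v) =
      PiTensorProduct.tprod k (fun l ↦ v (σ.symm l)) := PiTensorProduct.reindex_tprod _ _

theorem reindex_map₂ (α : J →ₗ[k] V →ₗ[k] V) {n : ℕ} (σ : Equiv.Perm (Fin n)) (x : ⨂[k]^n J)
    (t : ⨂[k]^n V) : PiTensorProduct.reindex k (fun _ ↦ V) σ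
      (PiTensorProduct.map₂ (fun _ : Fin n ↦ α) x t) =
      PiTensorProduct.map₂ (fun _ : Fin n ↦ α) (PiTensorProduct.reindex k (fun _ ↦ J) σ x)
        (PiTensorProduct.reindex k (fun _ ↦ V) σ t) := by
  induction t using PiTensorProduct.induction_on with
  | add z z' h h' => simp only [map_add, h, h']
  | smul_tprod r v =>
    induction x using PiTensorProduct.induction_on with
    | add z z' h h' => simp only [map_add, LinearMap.add_apply, h, h']
    | smul_tprod r' b =>
      simp only [map_smul, LinearMap.smul_apply]
      congr 2
      rw [PiTensorProduct.map₂_tprod_tprod, reindex_perm_tprod, reindex_perm_tprod,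
        reindex_perm_tprod, PiTensorProduct.map₂_tprod_tprod]

theorem reindex_powAct [Coalgebra.IsCocomm k J] (α : J →ₗ[k] V →ₗ[k] V) {n : ℕ}
    (σ : Equiv.Perm (Fin n)) (a : J) (t : ⨂[k]^n V) :
    PiTensorProduct.reindex k (fun _ ↦ V) σ (powAct α n a t) =
      powAct α n a (PiTensorProduct.reindex k (fun _ ↦ V) σ t) := by
  rw [powAct_apply, reindex_map₂, reindex_canonicalMap]

theorem coactAt_map₂ (α : J →ₗ[k] V →ₗ[k] V) (β : J →ₗ[k] C →ₗ[k] C) {ρ : V →ₗ[k] V ⊗[k] C}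
    (hαρ : ∀ a v, ρ (α a v) = diagAct α β a (ρ v)) {n : ℕ} (i : Fin n) (x : ⨂[k]^n J)
    (t : ⨂[k]^n V) : coactAt ρ i (PiTensorProduct.map₂ (fun _ : Fin n ↦ α) x t) =
      TensorProduct.homTensorHomMap (RingHom.id k) _ _ _ _
        (TensorProduct.map (PiTensorProduct.map₂ fun _ : Fin n ↦ α) β
          (coactAt (Coalgebra.comul (R := k)) i x)) (coactAt ρ i t) := by
  induction t using PiTensorProduct.induction_on with
  | add z z' h h' => simp only [map_add, h, h']
  | smul_tprod r v =>
    induction x using PiTensorProduct.induction_on with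
    | add z z' h h' => simp only [map_add, LinearMap.add_apply, h, h']
    | smul_tprod r' b =>
      simp only [map_smul, LinearMap.smul_apply]
      congr 2
      rw [PiTensorProduct.map₂_tprod_tprod, coactAt_tprod, coactAt_tprod, coactAt_tprod, hαρ,
        diagAct_apply]
      generalize Coalgebra.comul (R := k) (b i) = s
      generalize ρ (v i) = u
      induction s with
      | zero => simp
      | add z z' h h' => simp only [map_add, LinearMap.add_apply, h, h']
      | tmul c d =>
        induction u with
        | zero => simp
        | add z z' h h' => simp only [map_add, h, h']
        | tmul w e =>
          rw [tensorAct_tmul, LinearMap.rTensor_tmul, LinearMap.rTensor_tmul,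
            LinearMap.rTensor_tmul, TensorProduct.map_tmul, TensorProduct.homTensorHomMap_apply,
            TensorProduct.map_tmul, MultilinearMap.toLinearMap_apply,
            MultilinearMap.toLinearMap_apply, MultilinearMap.toLinearMap_apply,
            PiTensorProduct.map₂_tprod_tprod]
          congr 2
          funext l
          by_cases h : l = i
          · subst h; simp
          · simp [Function.update_of_ne h]

theorem coactAt_powAct [Coalgebra.IsCocomm k J] (α : J →ₗ[k] V →ₗ[k] V) (β : J →ₗ[k] C →ₗ[k] C)
    {ρ : V →ₗ[k] V ⊗[k] C} (hαρ : ∀ a v, ρ (α a v) = diagAct α β a (ρ v)) {n : ℕ} (i : Fin n)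
    (a : J) (t : ⨂[k]^n V) :
    coactAt ρ i (powAct α n a t) = diagAct (powAct α n) β a (coactAt ρ i t) := by
  rw [powAct_apply, coactAt_map₂ α β hαρ,
    ← coactAt_canonicalMap (Coalgebra.comul (R := k) (A := J)) LinearMap.id LinearMap.id
      (by simp [coactionVia]) (fun g f ↦ mul_comm _ _), diagAct_apply]
  generalize Coalgebra.comul (R := k) a = s
  induction s with
  | zero => simp
  | add z z' h h' => simp only [map_add, LinearMap.add_apply, h, h']
  | tmul b c => rfl

theorem powAct_mem_cofreePart [Coalgebra.IsCocomm k J] (α : J →ₗ[k] V →ₗ[k] V)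
    (β : J →ₗ[k] C →ₗ[k] C) {ρ : V →ₗ[k] V ⊗[k] C}
    (hαρ : ∀ a v, ρ (α a v) = diagAct α β a (ρ v)) {n : ℕ} (a : J) (t : ⨂[k]^n V)
    (ht : t ∈ cofreePart ρ n) : powAct α n a t ∈ cofreePart ρ n :=
  ⟨fun i l ↦ by rw [coactAt_powAct α β hαρ, coactAt_powAct α β hαρ, ht.1 i l],
    fun σ ↦ by rw [reindex_powAct, ← map_smul, ht.2]⟩

end TensorPowerAction

section HopfSubmodule

variable {k J K M : Type*} [Field k] [Ring J] [HopfAlgebra k J] [Ring K] [HopfAlgebra k K]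
  [AddCommGroup M] [Module k M] [Coalgebra.IsCocomm k J]

/-- A Hopf submodule of a Hopf module is generated by its coinvariants. -/
theorem exists_eq_lift_coinvariants_of_mem (j : K →ₐc[k] J) (hj : Function.Injective j)
    {α : J →ₗ[k] M →ₗ[k] M} (hα : IsAction α) {ρ : M →ₗ[k] M ⊗[k] HopfQuotient j}
    (hρ : IsRightComodule ρ) (hαρ : ∀ a m, ρ (α a m) = diagAct α (quotAct j) a (ρ m))
    (T : Submodule k M) (hT : ∀ a, ∀ t ∈ T, α a t ∈ T)
    (hTρ : ∀ t ∈ T, ρ t ∈ LinearMap.range (LinearMap.rTensor (HopfQuotient j) T.subtype))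
    (t : M) (ht : t ∈ T) :
    ∃ y : J ⊗[k] (T ⊓ LinearMap.ker (coinvDiff j ρ) : Submodule k M),
      t = TensorProduct.lift α (LinearMap.lTensor J
        (T ⊓ LinearMap.ker (coinvDiff j ρ) : Submodule k M).subtype y) := by
  have hinj : Function.Injective (LinearMap.rTensor (HopfQuotient j) T.subtype) :=
    Module.Flat.rTensor_preserves_injective_linearMap _ T.injective_subtype
  let ρT : T →ₗ[k] T ⊗[k] HopfQuotient j := (LinearEquiv.ofInjective _ hinj).symm.toLinearMap ∘ₗ
    (ρ ∘ₗ T.subtype).codRestrict _ (fun t ↦ hTρ t t.2)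
  have eρ : ∀ t : T, LinearMap.rTensor (HopfQuotient j) T.subtype (ρT t) = ρ t := fun t ↦
    congrArg Subtype.val (LinearEquiv.apply_symm_apply (LinearEquiv.ofInjective _ hinj)
      ((ρ ∘ₗ T.subtype).codRestrict _ (fun t ↦ hTρ t t.2) t))
  let αT : J →ₗ[k] T →ₗ[k] T := LinearMap.mk₂ k (fun a t ↦ ⟨α a t, hT a t t.2⟩)
    (fun a b t ↦ Subtype.ext (by simp)) (fun r a t ↦ Subtype.ext (by simp))
    (fun a s t ↦ Subtype.ext (by simp)) (fun r a t ↦ Subtype.ext (by simp))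
  have eα : ∀ a (t : T), (αT a t : M) = α a t := fun a t ↦ rfl
  have hαT : IsAction αT := ⟨fun m ↦ Subtype.ext (hα.one _), fun a b m ↦ Subtype.ext (hα.mul _ _ _)⟩
  have hρT : IsRightComodule ρT := by
    constructor
    · ext t
      have hinj2 : Function.Injective
          (LinearMap.rTensor (HopfQuotient j ⊗[k] HopfQuotient j) T.subtype) :=
        Module.Flat.rTensor_preserves_injective_linearMap _ T.injective_subtype
      apply hinj2
      have h := LinearMap.congr_fun hρ.coassoc (t : M)
      simp only [LinearMap.comp_apply, LinearEquiv.coe_coe] at h ⊢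
      rw [← eρ] at h
      have h1 : ∀ s : T ⊗[k] HopfQuotient j,
          LinearMap.rTensor (HopfQuotient j ⊗[k] HopfQuotient j) T.subtype
            (TensorProduct.assoc k _ _ _ (LinearMap.rTensor _ ρT s)) =
          TensorProduct.assoc k _ _ _ (LinearMap.rTensor _ ρ (LinearMap.rTensor _ T.subtype s)) :=
        fun s ↦ by
        induction s with
        | zero => simp
        | add x y hx hy => simp only [map_add, hx, hy]
        | tmul x c =>
          rw [LinearMap.rTensor_tmul, LinearMap.rTensor_tmul, LinearMap.rTensor_tmul,
            Submodule.subtype_apply, ← eρ]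
          generalize ρT x = z
          induction z with
          | zero => simp
          | add x y hx hy => simp only [map_add, TensorProduct.add_tmul, hx, hy]
          | tmul x c => rfl
      have h2 : ∀ s : T ⊗[k] HopfQuotient j,
          LinearMap.rTensor (HopfQuotient j ⊗[k] HopfQuotient j) T.subtype
            (LinearMap.lTensor _ Coalgebra.comul s) =
          LinearMap.lTensor _ Coalgebra.comul (LinearMap.rTensor _ T.subtype s) := fun s ↦ by
        induction s with
        | zero => simp
        | add x y hx hy => simp only [map_add, hx, hy]
        | tmul x c => rfl
      rw [h1, h2, h]
    · ext t
      have h := LinearMap.congr_fun hρ.counit (t : M)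
      simp only [LinearMap.comp_apply, LinearEquiv.coe_coe, LinearMap.id_apply] at h ⊢
      rw [← h, ← eρ]
      generalize ρT t = z
      induction z with
      | zero => simp
      | add x y hx hy => simp only [map_add, Submodule.coe_add, hx, hy]
      | tmul x c => simp
  have hαρT : ∀ a m, ρT (αT a m) = diagAct αT (quotAct j) a (ρT m) := fun a m ↦ by
    apply hinj
    rw [eρ, eα, hαρ, ← eρ, diagAct_apply, diagAct_apply]
    generalize Coalgebra.comul (R := k) a = s
    generalize ρT m = z
    induction s with
    | zero => simp
    | add x y hx hy => simp only [map_add, LinearMap.add_apply, hx, hy]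
    | tmul b c =>
      induction z with
      | zero => simp
      | add x y hx hy => simp only [map_add, hx, hy]
      | tmul x d => rfl
  obtain ⟨y, hy⟩ := exists_eq_lift_coinvariants j hj hαT hρT hαρT ⟨t, ht⟩
  have hmem : ∀ x : LinearMap.ker (coinvDiff j ρT), (x : M) ∈ T ⊓ LinearMap.ker (coinvDiff j ρ) :=
    fun x ↦ ⟨x.1.2, by
      have h := (mem_ker_coinvDiff j ρT x.1).mp x.2
      exact (mem_ker_coinvDiff j ρ _).mpr (by
        rw [← eρ, h, LinearMap.rTensor_tmul, Submodule.subtype_apply])⟩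
  refine ⟨LinearMap.lTensor J (LinearMap.codRestrict _ (T.subtype ∘ₗ Submodule.subtype _) hmem) y,
    ?_⟩
  have hy' := congrArg T.subtype hy
  rw [Submodule.subtype_apply, Submodule.subtype_apply] at hy'
  refine hy'.trans ?_
  clear hy hy'
  induction y with
  | zero => simp
  | add x y hx hy => simp only [map_add, Submodule.coe_add, hx, hy]
  | tmul a x => rfl

end HopfSubmodule

/-! ### The exterior algebra as a super-coalgebra with action -/

section GradedTensor

variable {k D : Type*} [Field k] [AddCommGroup D] [Module k D]

theorem tmul_mem_tensorPart {ι : Type*} [Add ι] (𝒟 : ι → Submodule k D) {i j n : ι} (h : i + j = n)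
    {v w : D} (hv : v ∈ 𝒟 i) (hw : w ∈ 𝒟 j) : v ⊗ₜ[k] w ∈ tensorPart 𝒟 n :=
  Submodule.mem_iSup_of_mem (⟨(i, j), h⟩ : {p : ι × ι // p.1 + p.2 = n})
    ⟨⟨v, hv⟩ ⊗ₜ ⟨w, hw⟩, rfl⟩

theorem tensorPart_le {ι : Type*} [Add ι] (𝒟 : ι → Submodule k D) (n : ι)
    (W : Submodule k (D ⊗[k] D))
    (h : ∀ i j, i + j = n → ∀ v ∈ 𝒟 i, ∀ w ∈ 𝒟 j, v ⊗ₜ[k] w ∈ W) : tensorPart 𝒟 n ≤ W := by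
  refine iSup_le ?_
  rintro ⟨⟨i, j⟩, hij⟩ _ ⟨t, rfl⟩
  induction t with
  | zero => simp
  | add x y hx hy => rw [map_add]; exact add_mem hx hy
  | tmul v w => exact h i j hij v v.2 w w.2

theorem tensorPart_le_parityPart (𝒟 : ℕ → Submodule k D) (n : ℕ) :
    tensorPart 𝒟 n ≤ tensorPart (parityPart 𝒟) (n : ZMod 2) := by
  refine tensorPart_le 𝒟 n _ fun i j hij v hv w hw ↦ ?_
  refine tmul_mem_tensorPart (i := (i : ZMod 2)) (j := (j : ZMod 2)) _ (by rw [← hij]; simp) ?_ ?_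
  · exact Submodule.mem_iSup_of_mem (⟨i, rfl⟩ : {m : ℕ // (m : ZMod 2) = (i : ZMod 2)}) hv
  · exact Submodule.mem_iSup_of_mem (⟨j, rfl⟩ : {m : ℕ // (m : ZMod 2) = (j : ZMod 2)}) hw

end GradedTensor

section ExteriorSuper

variable {k Q : Type*} [Field k] [AddCommGroup Q] [Module k Q]

theorem extLeft_mem (q : Q) (n : ℕ) (x : ExteriorAlgebra k Q ⊗[k] ExteriorAlgebra k Q)
    (hx : x ∈ tensorPart (fun i : ℕ ↦ ⋀[k]^i Q) n) :
    extLeft q x ∈ tensorPart (fun i : ℕ ↦ ⋀[k]^i Q) (n + 1) := by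
  have h : ∀ (m : ℕ) (v : ExteriorAlgebra k Q), v ∈ ⋀[k]^m Q →
      ExteriorAlgebra.ι k q * v ∈ ⋀[k]^(m + 1) Q := fun m v hv ↦ by
    change _ ∈ LinearMap.range (ExteriorAlgebra.ι k) ^ (m + 1)
    rw [pow_succ']
    exact Submodule.mul_mem_mul (LinearMap.mem_range_self _ _) hv
  refine tensorPart_le (fun i : ℕ ↦ ⋀[k]^i Q) n ((tensorPart (fun i : ℕ ↦ ⋀[k]^i Q)
    (n + 1)).comap (extLeft q)) (fun i j hij u hu v hv ↦ ?_) hx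
  rw [Submodule.mem_comap, extLeft, LinearMap.add_apply, TensorProduct.map_tmul,
    TensorProduct.map_tmul]
  refine add_mem ?_ ?_
  · exact tmul_mem_tensorPart (fun i : ℕ ↦ ⋀[k]^i Q) (i := i + 1) (j := j) (by omega) (h i u hu) hv
  · refine tmul_mem_tensorPart (fun i : ℕ ↦ ⋀[k]^i Q) (i := i) (j := j + 1) (by omega) ?_ (h j v hv)
    rw [AlgHom.toLinearMap_apply, extSign_of_mem i u hu]
    exact Submodule.smul_mem _ _ hu

theorem extComul_mem (n : ℕ) (u : ExteriorAlgebra k Q) (hu : u ∈ ⋀[k]^n Q) :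
    extComul k Q u ∈ tensorPart (fun i : ℕ ↦ ⋀[k]^i Q) n := by
  induction hu using Submodule.pow_induction_on_left' with
  | algebraMap r =>
    rw [extComul_algebraMap]
    exact tmul_mem_tensorPart (fun i : ℕ ↦ ⋀[k]^i Q) (i := 0) (j := 0) rfl
      (Submodule.algebraMap_mem r) (SetLike.GradedOne.one_mem (A := fun i : ℕ ↦ ⋀[k]^i Q))
  | add x y i _ _ hx hy => rw [map_add]; exact add_mem hx hy
  | mem_mul m hm i x hx ih =>
    obtain ⟨q, rfl⟩ := hm
    rw [extComul_ι_mul]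
    exact extLeft_mem q i _ ih

theorem counit_of_mem_extPow (n : ℕ) (hn : n ≠ 0) (u : ExteriorAlgebra k Q) (hu : u ∈ ⋀[k]^n Q) :
    Coalgebra.counit (R := k) u = 0 := by
  induction hu using Submodule.pow_induction_on_left' with
  | algebraMap r => exact absurd rfl hn
  | add x y i _ _ hx hy => rw [map_add, hx hn, hy hn, add_zero]
  | mem_mul m hm i x hx ih =>
    obtain ⟨q, rfl⟩ := hm
    exact counit_ι_mul q x

theorem extSign_of_mem_evenOdd (i : ZMod 2) (u : ExteriorAlgebra k Q)
    (hu : u ∈ CliffordAlgebra.evenOdd (0 : QuadraticForm k Q) i) :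
    extSign k Q u = (-1 : ℤˣ) ^ i • u := by
  induction hu using Submodule.iSup_induction' with
  | zero => simp
  | add x y _ _ hx hy => rw [map_add, smul_add, hx, hy]
  | mem n x hx =>
    obtain ⟨n, rfl⟩ := n
    rw [extSign_of_mem n x hx, uzpow_natCast, Units.smul_def, ← Int.cast_smul_eq_zsmul k]
    simp

/-- Left multiplication by `Δ(q) = q ⊗ 1 + 1 ⊗ q` commutes with the super-symmetry. -/
theorem superSwap_extLeft (q : Q) (x : ExteriorAlgebra k Q ⊗[k] ExteriorAlgebra k Q) :
    superSwap (CliffordAlgebra.evenOdd (0 : QuadraticForm k Q)) (extLeft q x) =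
      extLeft q (superSwap (CliffordAlgebra.evenOdd (0 : QuadraticForm k Q)) x) := by
  induction x with
  | zero => simp
  | add x y hx hy => simp only [map_add, hx, hy]
  | tmul u v =>
    induction u using DirectSum.Decomposition.inductionOn
      (CliffordAlgebra.evenOdd (0 : QuadraticForm k Q)) with
    | zero => simp
    | add a b ha hb => simp only [TensorProduct.add_tmul, map_add, ha, hb]
    | @homogeneous i u =>
      induction v using DirectSum.Decomposition.inductionOn
        (CliffordAlgebra.evenOdd (0 : QuadraticForm k Q)) with
      | zero => simp
      | add a b ha hb => simp only [TensorProduct.tmul_add, map_add, ha, hb]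
      | @homogeneous l v =>
        obtain ⟨u, hu⟩ := u
        obtain ⟨v, hv⟩ := v
        have hm : ∀ (i : ZMod 2) (w : ExteriorAlgebra k Q),
            w ∈ CliffordAlgebra.evenOdd (0 : QuadraticForm k Q) i →
            ExteriorAlgebra.ι k q * w ∈ CliffordAlgebra.evenOdd (0 : QuadraticForm k Q) (1 + i) :=
          fun i w hw ↦ SetLike.GradedMul.mul_mem (CliffordAlgebra.ι_mem_evenOdd_one _ q) hw
        have hsign : ∀ (a b : ZMod 2) (y : ExteriorAlgebra k Q ⊗[k] ExteriorAlgebra k Q),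
            (-1 : ℤˣ) ^ a • (-1 : ℤˣ) ^ b • y = (-1 : ℤˣ) ^ (a + b) • y := fun a b y ↦ by
          rw [smul_smul, uzpow_add]
        simp only [extLeft, LinearMap.add_apply, TensorProduct.map_tmul,
          LinearMap.mulLeft_apply, LinearMap.id_apply, AlgHom.toLinearMap_apply, map_add]
        rw [superSwap_tmul _ i l u v hu hv, superSwap_tmul _ (1 + i) l _ v (hm i u hu) hv,
          extSign_of_mem_evenOdd i u hu, superSwap_tmul _ i (1 + l) _ _
            (Submodule.smul_of_tower_mem _ _ hu) (hm l v hv)]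
        have e : ∀ (f : ExteriorAlgebra k Q ⊗[k] ExteriorAlgebra k Q →ₗ[k]
            ExteriorAlgebra k Q ⊗[k] ExteriorAlgebra k Q) (a : ZMod 2)
            (y : ExteriorAlgebra k Q ⊗[k] ExteriorAlgebra k Q),
            f ((-1 : ℤˣ) ^ a • y) = (-1 : ℤˣ) ^ a • f y := fun f a y ↦ by
          rw [Units.smul_def, Units.smul_def, map_zsmul]
        rw [e, e]
        simp only [TensorProduct.map_tmul, LinearMap.mulLeft_apply, LinearMap.id_apply,
          AlgHom.toLinearMap_apply, extSign_of_mem_evenOdd l v hv]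
        have e1 : ∀ (a : ZMod 2) (y z : ExteriorAlgebra k Q),
            ((-1 : ℤˣ) ^ a • y) ⊗ₜ[k] z = (-1 : ℤˣ) ^ a • (y ⊗ₜ[k] z) := fun a y z ↦ by
          rw [Units.smul_def, Units.smul_def, TensorProduct.smul_tmul']
        have e2 : ∀ (a : ZMod 2) (y z : ExteriorAlgebra k Q),
            y ⊗ₜ[k] ((-1 : ℤˣ) ^ a • z) = (-1 : ℤˣ) ^ a • (y ⊗ₜ[k] z) := fun a y z ↦ by
          rw [Units.smul_def, Units.smul_def, TensorProduct.tmul_smul]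
        rw [e1, e2, hsign, hsign]
        have c1 : l * (1 + i) = l * i + l := by ring
        have c2 : (1 + l) * i + i = l * i := by
          have : i + i = 0 := CharTwo.add_self_eq_zero i
          linear_combination this
        rw [c1, c2, add_comm]

/-- The exterior algebra is super-cocommutative. -/
theorem superSwap_extComul (u : ExteriorAlgebra k Q) :
    superSwap (CliffordAlgebra.evenOdd (0 : QuadraticForm k Q)) (extComul k Q u) =
      extComul k Q u := by
  induction u using CliffordAlgebra.left_induction with
  | algebraMap r =>
    have h1 : (1 : ExteriorAlgebra k Q) ∈ CliffordAlgebra.evenOdd (0 : QuadraticForm k Q) 0 :=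
      SetLike.GradedOne.one_mem
    have h2 : algebraMap k (ExteriorAlgebra k Q) r ∈
        CliffordAlgebra.evenOdd (0 : QuadraticForm k Q) 0 := by
      rw [Algebra.algebraMap_eq_smul_one]; exact Submodule.smul_mem _ _ h1
    change superSwap _ (extComul k Q (algebraMap k (ExteriorAlgebra k Q) r)) =
      extComul k Q (algebraMap k (ExteriorAlgebra k Q) r)
    rw [extComul_algebraMap, superSwap_tmul _ 0 0 _ _ h2 h1]
    simp [Algebra.algebraMap_eq_smul_one, TensorProduct.smul_tmul]
  | add x y hx hy => simp only [map_add, hx, hy]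
  | ι_mul u q ih =>
    change superSwap _ (extComul k Q (ExteriorAlgebra.ι k q * u)) =
      extComul k Q (ExteriorAlgebra.ι k q * u)
    rw [extComul_ι_mul, superSwap_extLeft, ih]

end ExteriorSuper

section ExteriorAction

variable {k K Q : Type*} [Field k] [NeZero (2 : k)] [Ring K] [Bialgebra k K]
  [Coalgebra.IsCocomm k K] [AddCommGroup Q] [Module k Q]

theorem extAct_mul_right (act : K →ₗ[k] Q →ₗ[k] Q) (c : K) (u v : ExteriorAlgebra k Q) :
    extAct act c (u * v) = LinearMap.mul' k (ExteriorAlgebra k Q)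
      (TensorProduct.map ((extAct act).flip u) ((extAct act).flip v)
        (Coalgebra.comul (R := k) c)) := by
  rw [extAct_apply, map_mul, LinearMap.convMul_apply]
  rfl

theorem isAction_extAct {act : K →ₗ[k] Q →ₗ[k] Q} (h : IsAction act) : IsAction (extAct act) where
  one u := by
    induction u using CliffordAlgebra.left_induction with
    | algebraMap r =>
      refine (extAct_algebraMap act 1 r).trans ?_
      rw [Bialgebra.counit_one, one_smul]
    | add x y hx hy => rw [map_add, hx, hy]
    | ι_mul u q ih =>
      refine (extAct_mul_right act 1 (ExteriorAlgebra.ι k q) u).trans ?_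
      rw [Bialgebra.comul_one, Algebra.TensorProduct.one_def, TensorProduct.map_tmul,
        LinearMap.mul'_apply, LinearMap.flip_apply, LinearMap.flip_apply, ih, extAct_ι, h.one]
  mul a b u := by
    induction u using CliffordAlgebra.left_induction generalizing a b with
    | algebraMap r =>
      refine (extAct_algebraMap act (a * b) r).trans ?_
      refine Eq.trans ?_ (congrArg (extAct act a) (extAct_algebraMap act b r)).symm
      rw [map_smul, extAct_algebraMap, Bialgebra.counit_mul, smul_smul, mul_comm]
    | add x y hx hy => simp only [map_add, hx, hy]
    | ι_mul u q ih =>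
      refine (extAct_mul_right act (a * b) (ExteriorAlgebra.ι k q) u).trans ?_
      refine Eq.trans ?_ (congrArg (extAct act a)
        (extAct_mul_right act b (ExteriorAlgebra.ι k q) u)).symm
      rw [Bialgebra.comul_mul]
      generalize Coalgebra.comul (R := k) b = s
      induction s with
      | zero => simp
      | add x y hx hy => simp only [mul_add, map_add, hx, hy]
      | tmul b₁ b₂ =>
        rw [TensorProduct.map_tmul, LinearMap.mul'_apply, extAct_mul_right]
        generalize Coalgebra.comul (R := k) a = t
        induction t with
        | zero => simp
        | add x y hx hy => simp only [add_mul, map_add, hx, hy]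
        | tmul a₁ a₂ =>
          simp only [Algebra.TensorProduct.tmul_mul_tmul, TensorProduct.map_tmul,
            LinearMap.mul'_apply, LinearMap.flip_apply, ih, extAct_ι, h.mul]

theorem extProj_extAct (act : K →ₗ[k] Q →ₗ[k] Q) (n : ℕ) (c : K) (u : ExteriorAlgebra k Q) :
    GradedAlgebra.proj (fun i : ℕ ↦ ⋀[k]^i Q) n (extAct act c u) =
      extAct act c (GradedAlgebra.proj (fun i : ℕ ↦ ⋀[k]^i Q) n u) := by
  induction u using DirectSum.Decomposition.inductionOn (fun i : ℕ ↦ ⋀[k]^i Q) with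
  | zero => simp
  | add a b ha hb => simp only [map_add, ha, hb]
  | @homogeneous i u =>
    obtain ⟨u, hu⟩ := u
    simp only [GradedAlgebra.proj_apply]
    by_cases hin : i = n
    · subst hin
      rw [DirectSum.decompose_of_mem_same (fun i : ℕ ↦ ⋀[k]^i Q) hu,
        DirectSum.decompose_of_mem_same (fun i : ℕ ↦ ⋀[k]^i Q) (extAct_mem act i u hu c)]
    · rw [DirectSum.decompose_of_mem_ne (fun i : ℕ ↦ ⋀[k]^i Q) hu hin,
        DirectSum.decompose_of_mem_ne (fun i : ℕ ↦ ⋀[k]^i Q) (extAct_mem act i u hu c) hin,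
        map_zero]

/-- The action on the exterior power. -/
noncomputable def extPowAct (act : K →ₗ[k] Q →ₗ[k] Q) (n : ℕ) : K →ₗ[k] ⋀[k]^n Q →ₗ[k] ⋀[k]^n Q :=
  LinearMap.mk₂ k (fun c u ↦ ⟨extAct act c u, extAct_mem act n u u.2 c⟩)
    (fun c d u ↦ Subtype.ext (by simp)) (fun r c u ↦ Subtype.ext (by simp))
    (fun c u v ↦ Subtype.ext (by simp)) (fun r c u ↦ Subtype.ext (by simp))

theorem coe_extPowAct (act : K →ₗ[k] Q →ₗ[k] Q) (n : ℕ) (c : K) (u : ⋀[k]^n Q) :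
    (extPowAct act n c u : ExteriorAlgebra k Q) = extAct act c u := rfl

theorem isAction_extPowAct {act : K →ₗ[k] Q →ₗ[k] Q} (h : IsAction act) (n : ℕ) :
    IsAction (extPowAct act n) where
  one u := Subtype.ext ((isAction_extAct h).one u)
  mul a b u := Subtype.ext ((isAction_extAct h).mul a b u)

end ExteriorAction

/-! ### The super-coalgebra induced from the exterior algebra -/

section TensorExtStructure

variable {k J K Q : Type*} [Field k] [NeZero (2 : k)] [Ring J] [HopfAlgebra k J] [Ring K]
  [HopfAlgebra k K] [Coalgebra.IsCocomm k K] [AddCommGroup Q] [Module k Q]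

theorem comul_tensorExt_mk (j : K →ₐc[k] J) (act : K →ₗ[k] Q →ₗ[k] Q) (a : J)
    (u : ExteriorAlgebra k Q) :
    Coalgebra.comul (R := k) ((balanced j (extAct act)).mkQ (a ⊗ₜ[k] u)) =
      TensorProduct.map (balanced j (extAct act)).mkQ (balanced j (extAct act)).mkQ
        (TensorProduct.tensorTensorTensorComm k J J (ExteriorAlgebra k Q) (ExteriorAlgebra k Q)
          (Coalgebra.comul (R := k) a ⊗ₜ[k] extComul k Q u)) := rfl

theorem counit_tensorExt_mk (j : K →ₐc[k] J) (act : K →ₗ[k] Q →ₗ[k] Q) (a : J)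
    (u : ExteriorAlgebra k Q) :
    Coalgebra.counit (R := k) ((balanced j (extAct act)).mkQ (a ⊗ₜ[k] u)) =
      Coalgebra.counit (R := k) u * Coalgebra.counit (R := k) a := rfl

theorem projZero_mk (j : K →ₐc[k] J) (act : K →ₗ[k] Q →ₗ[k] Q) (a : J)
    (u : ExteriorAlgebra k Q) : projZero j act ((balanced j (extAct act)).mkQ (a ⊗ₜ[k] u)) =
      (augIdeal j).mkQ (Coalgebra.counit (R := k) u • a) := rfl

theorem projOne_mk (j : K →ₐc[k] J) (act : K →ₗ[k] Q →ₗ[k] Q) (a : J)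
    (u : ExteriorAlgebra k Q) : projOne j act ((balanced j (extAct act)).mkQ (a ⊗ₜ[k] u)) =
      (balanced j act).mkQ (a ⊗ₜ[k] ExteriorAlgebra.ιInv u) := rfl

/-- The projection of `J ⊗_K ∧(Q)` onto its component of degree `n`. -/
noncomputable def degreeProj (j : K →ₐc[k] J) (act : K →ₗ[k] Q →ₗ[k] Q) (n : ℕ) :
    TensorExt j act →ₗ[k] TensorExt j act :=
  tensorOverMap j (GradedAlgebra.proj (fun i : ℕ ↦ ⋀[k]^i Q) n) (extProj_extAct act n)

/-- Induction on elements of the component of degree `n`. -/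
theorem degreePart_induction (j : K →ₐc[k] J) (act : K →ₗ[k] Q →ₗ[k] Q) (n : ℕ)
    (W : Submodule k (TensorExt j act)) (h : ∀ a : J, ∀ u ∈ ⋀[k]^n Q,
      (balanced j (extAct act)).mkQ (a ⊗ₜ[k] u) ∈ W) : degreePart j act n ≤ W := by
  rintro _ ⟨_, ⟨y, rfl⟩, rfl⟩
  induction y with
  | zero => simp
  | add y z hy hz => rw [map_add, map_add]; exact add_mem hy hz
  | tmul a u => exact h a u u.2

theorem degreeProj_of_mem (j : K →ₐc[k] J) (act : K →ₗ[k] Q →ₗ[k] Q) (n : ℕ)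
    (x : TensorExt j act) (hx : x ∈ degreePart j act n) : degreeProj j act n x = x := by
  have : degreePart j act n ≤ LinearMap.ker (degreeProj j act n - LinearMap.id) := by
    refine degreePart_induction j act n _ fun a u hu ↦ ?_
    rw [LinearMap.mem_ker, LinearMap.sub_apply, sub_eq_zero]
    refine (tensorOverMap_mk j _ _ _).trans ?_
    rw [LinearMap.lTensor_tmul, GradedAlgebra.proj_apply,
      DirectSum.decompose_of_mem_same (fun i : ℕ ↦ ⋀[k]^i Q) hu]
    rfl
  simpa [sub_eq_zero] using this hx

theorem degreeProj_of_mem_ne (j : K →ₐc[k] J) (act : K →ₗ[k] Q →ₗ[k] Q) {m n : ℕ} (hmn : m ≠ n) :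
    degreePart j act m ≤ LinearMap.ker (degreeProj j act n) := by
  refine degreePart_induction j act m _ fun a u hu ↦ ?_
  rw [LinearMap.mem_ker]
  refine (tensorOverMap_mk j _ _ _).trans ?_
  rw [LinearMap.lTensor_tmul, GradedAlgebra.proj_apply,
    DirectSum.decompose_of_mem_ne (fun i : ℕ ↦ ⋀[k]^i Q) hu hmn]
  simp

theorem isInternal_degreePart (j : K →ₐc[k] J) (act : K →ₗ[k] Q →ₗ[k] Q) :
    DirectSum.IsInternal (degreePart j act) := by
  refine DirectSum.isInternal_submodule_of_iSupIndep_of_iSup_eq_top ?_ (iSup_degreePart j act)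
  rw [iSupIndep_def]
  intro n
  rw [Submodule.disjoint_def]
  intro x hx hx'
  have h : ⨆ m, ⨆ (_ : m ≠ n), degreePart j act m ≤ LinearMap.ker (degreeProj j act n) :=
    iSup₂_le fun m hm ↦ degreeProj_of_mem_ne j act hm
  rw [← degreeProj_of_mem j act n x hx]
  exact h hx'

theorem isGradedCoalgebra_tensorExt (j : K →ₐc[k] J) (act : K →ₗ[k] Q →ₗ[k] Q) :
    IsGradedCoalgebra (degreePart j act) where
  isInternal := isInternal_degreePart j act
  comul_mem n := by
    refine degreePart_induction j act n
      ((tensorPart (degreePart j act) n).comap Coalgebra.comul) fun a u hu ↦ ?_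
    rw [Submodule.mem_comap, comul_tensorExt_mk]
    generalize Coalgebra.comul (R := k) a = s
    have hx := extComul_mem n u hu
    generalize extComul k Q u = x at hx
    induction s with
    | zero => simp
    | add s t hs ht =>
      rw [TensorProduct.add_tmul, map_add, map_add]
      exact add_mem hs ht
    | tmul b c =>
      refine tensorPart_le (fun i : ℕ ↦ ⋀[k]^i Q) n ((tensorPart (degreePart j act) n).comap
        (TensorProduct.map (balanced j (extAct act)).mkQ (balanced j (extAct act)).mkQ ∘ₗ
        (TensorProduct.tensorTensorTensorComm k J J (ExteriorAlgebra k Q)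
          (ExteriorAlgebra k Q)).toLinearMap ∘ₗ TensorProduct.mk k _ _ (b ⊗ₜ c)))
        (fun i l hil v hv w hw ↦ ?_) hx
      exact tmul_mem_tensorPart _ hil (mk_mem_degreePart j act i b v hv)
        (mk_mem_degreePart j act l c w hw)
  counit_eq_zero n hn := by
    refine fun x hx ↦ degreePart_induction j act n (LinearMap.ker Coalgebra.counit)
      (fun a u hu ↦ ?_) hx
    rw [LinearMap.mem_ker, counit_tensorExt_mk, counit_of_mem_extPow n hn u hu, zero_mul]

theorem projZero_of_mem_ne (j : K →ₐc[k] J) (act : K →ₗ[k] Q →ₗ[k] Q) (n : ℕ) (hn : n ≠ 0) :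
    degreePart j act n ≤ LinearMap.ker (projZero j act) :=
  degreePart_induction j act n _ fun a u hu ↦ by
    rw [LinearMap.mem_ker, projZero_mk, counit_of_mem_extPow n hn u hu, zero_smul, map_zero]

theorem projOne_of_mem_ne (j : K →ₐc[k] J) (act : K →ₗ[k] Q →ₗ[k] Q) (n : ℕ) (hn : n ≠ 1) :
    degreePart j act n ≤ LinearMap.ker (projOne j act) :=
  degreePart_induction j act n _ fun a u hu ↦ by
    rw [LinearMap.mem_ker, projOne_mk, ιInv_of_mem n hn u hu, TensorProduct.tmul_zero, map_zero]

theorem mk_mem_parityPart (j : K →ₐc[k] J) (act : K →ₗ[k] Q →ₗ[k] Q) (i : ZMod 2) (a : J)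
    (u : ExteriorAlgebra k Q) (hu : u ∈ CliffordAlgebra.evenOdd (0 : QuadraticForm k Q) i) :
    (balanced j (extAct act)).mkQ (a ⊗ₜ[k] u) ∈ parityPart (degreePart j act) i := by
  induction hu using Submodule.iSup_induction' with
  | zero => simp
  | add x y _ _ hx hy => rw [TensorProduct.tmul_add, map_add]; exact add_mem hx hy
  | mem n x hx => exact Submodule.mem_iSup_of_mem n (mk_mem_degreePart j act n a x hx)

theorem superSwap_tensorExt (j : K →ₐc[k] J) (act : K →ₗ[k] Q →ₗ[k] Q) (s : J ⊗[k] J)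
    (x : ExteriorAlgebra k Q ⊗[k] ExteriorAlgebra k Q) :
    superSwap (parityPart (degreePart j act))
      (TensorProduct.map (balanced j (extAct act)).mkQ (balanced j (extAct act)).mkQ
        (TensorProduct.tensorTensorTensorComm k J J (ExteriorAlgebra k Q) (ExteriorAlgebra k Q)
          (s ⊗ₜ[k] x))) =
      TensorProduct.map (balanced j (extAct act)).mkQ (balanced j (extAct act)).mkQ
        (TensorProduct.tensorTensorTensorComm k J J (ExteriorAlgebra k Q) (ExteriorAlgebra k Q)
          (TensorProduct.comm k J J s ⊗ₜ[k]
            superSwap (CliffordAlgebra.evenOdd (0 : QuadraticForm k Q)) x)) := by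
  induction s with
  | zero => simp
  | add s t hs ht => simp only [TensorProduct.add_tmul, map_add, hs, ht]
  | tmul a b =>
    induction x with
    | zero => simp
    | add x y hx hy => simp only [TensorProduct.tmul_add, map_add, hx, hy]
    | tmul u v =>
      induction u using DirectSum.Decomposition.inductionOn
        (CliffordAlgebra.evenOdd (0 : QuadraticForm k Q)) with
      | zero => simp
      | add u u' hu hu' => simp only [TensorProduct.add_tmul, TensorProduct.tmul_add, map_add, hu, hu']
      | @homogeneous i u =>
        induction v using DirectSum.Decomposition.inductionOn
          (CliffordAlgebra.evenOdd (0 : QuadraticForm k Q)) with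
        | zero => simp
        | add v v' hv hv' => simp only [TensorProduct.tmul_add, map_add, hv, hv']
        | @homogeneous l v =>
          obtain ⟨u, hu⟩ := u
          obtain ⟨v, hv⟩ := v
          rw [TensorProduct.tensorTensorTensorComm_tmul, TensorProduct.map_tmul,
            superSwap_tmul _ i l _ _ (mk_mem_parityPart j act i a u hu)
              (mk_mem_parityPart j act l b v hv), superSwap_tmul _ i l u v hu hv,
            TensorProduct.comm_tmul, Units.smul_def, Units.smul_def]
          rw [← Int.cast_smul_eq_zsmul k, ← Int.cast_smul_eq_zsmul k, TensorProduct.tmul_smul,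
            map_smul, map_smul, TensorProduct.tensorTensorTensorComm_tmul, TensorProduct.map_tmul]

theorem superCoalgebra_tensorExt [Coalgebra.IsCocomm k J] (j : K →ₐc[k] J)
    (act : K →ₗ[k] Q →ₗ[k] Q) : SuperCoalgebra (parityPart (degreePart j act)) where
  comul_mem i := by
    have : parityPart (degreePart j act) i ≤
        (tensorPart (parityPart (degreePart j act)) i).comap Coalgebra.comul := by
      refine iSup_le ?_
      rintro ⟨n, rfl⟩ x hx
      exact tensorPart_le_parityPart _ n ((isGradedCoalgebra_tensorExt j act).comul_mem n x hx)
    exact this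
  counit_odd := by
    have : parityPart (degreePart j act) 1 ≤ LinearMap.ker Coalgebra.counit := by
      refine iSup_le ?_
      rintro ⟨n, hn⟩ x hx
      refine (isGradedCoalgebra_tensorExt j act).counit_eq_zero n ?_ x hx
      rintro rfl
      exact absurd hn (by decide)
    exact this
  superSwap_comul x := by
    obtain ⟨x, rfl⟩ := (balanced j (extAct act)).mkQ_surjective x
    induction x with
    | zero => simp
    | add x y hx hy => simp only [map_add, hx, hy]
    | tmul a u =>
      rw [comul_tensorExt_mk, superSwap_tensorExt, superSwap_extComul, Coalgebra.comm_comul]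

instance isCocomm_hopfQuotient [Coalgebra.IsCocomm k J] (j : K →ₐc[k] J) :
    Coalgebra.IsCocomm k (HopfQuotient j) where
  comm_comp_comul := by
    refine LinearMap.ext fun x ↦ ?_
    obtain ⟨a, rfl⟩ := Submodule.mkQ_surjective _ x
    rw [LinearMap.comp_apply, comul_quot_mk, LinearEquiv.coe_coe]
    conv_rhs => rw [← Coalgebra.comm_comul (R := k) a]
    generalize Coalgebra.comul (R := k) a = t
    induction t with
    | zero => simp
    | add x y hx hy => simp only [map_add, hx, hy]
    | tmul b c => simp

theorem isSuperCoalgebraOn_tensorExt [Coalgebra.IsCocomm k J] (j : K →ₐc[k] J)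
    (act : K →ₗ[k] Q →ₗ[k] Q) : IsSuperCoalgebraOn (coaction j act)
      (parityPart (degreePart j act)) (projZero j act) (projOne j act) where
  superCoalgebra := superCoalgebra_tensorExt j act
  counit_comp := by
    refine tensorOver_hom_ext j fun a u ↦ ?_
    rw [LinearMap.comp_apply, projZero_mk, counit_quot_mk, counit_tensorExt_mk, map_smul,
      smul_eq_mul]
  map_comp_comul := by
    refine tensorOver_hom_ext j fun a u ↦ ?_
    rw [LinearMap.comp_apply, LinearMap.comp_apply, projZero_mk, comul_quot_mk,
      comul_tensorExt_mk]
    have key : ∀ (s : J ⊗[k] J) (x : ExteriorAlgebra k Q ⊗[k] ExteriorAlgebra k Q),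
        TensorProduct.map (projZero j act) (projZero j act)
          (TensorProduct.map (balanced j (extAct act)).mkQ (balanced j (extAct act)).mkQ
            (TensorProduct.tensorTensorTensorComm k J J (ExteriorAlgebra k Q)
              (ExteriorAlgebra k Q) (s ⊗ₜ[k] x))) =
        Coalgebra.counit (R := k) (TensorProduct.rid k _ (LinearMap.lTensor _ Coalgebra.counit x)) •
          TensorProduct.map (augIdeal j).mkQ (augIdeal j).mkQ s := fun s x ↦ by
      induction s with
      | zero => simp
      | add s t hs ht => simp only [TensorProduct.add_tmul, map_add, hs, ht, smul_add]
      | tmul b c =>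
        induction x with
        | zero => simp
        | add x y hx hy => simp only [TensorProduct.tmul_add, map_add, hx, hy, add_smul]
        | tmul v w =>
          rw [TensorProduct.tensorTensorTensorComm_tmul, TensorProduct.map_tmul,
            TensorProduct.map_tmul, projZero_mk, projZero_mk, LinearMap.lTensor_tmul,
            TensorProduct.rid_tmul, TensorProduct.map_tmul, map_smul, map_smul, map_smul,
            TensorProduct.smul_tmul_smul, smul_eq_mul, mul_comm]
    have h := Coalgebra.lTensor_counit_comul (R := k) u
    rw [key]
    refine (congrArg (fun z ↦ Coalgebra.counit (R := k) (TensorProduct.rid k _ z) • _) h).trans ?_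
    rw [TensorProduct.rid_tmul, one_smul, map_smul, map_smul]
  map_odd := by
    have : parityPart (degreePart j act) 1 ≤ LinearMap.ker (projZero j act) := by
      refine iSup_le ?_
      rintro ⟨n, hn⟩
      refine projZero_of_mem_ne j act n ?_
      rintro rfl
      exact absurd hn (by decide)
    exact this
  colinear := by
    refine tensorOver_hom_ext j fun a u ↦ ?_
    rw [LinearMap.comp_apply, LinearMap.comp_apply, projOne_mk, coaction_mk, coactionVia,
      LinearMap.comp_apply, comul_tensorExt_mk]
    have key : ∀ (s : J ⊗[k] J) (x : ExteriorAlgebra k Q ⊗[k] ExteriorAlgebra k Q),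
        LinearMap.rTensor _ (projOne j act) (LinearMap.lTensor _ (projZero j act)
          (TensorProduct.map (balanced j (extAct act)).mkQ (balanced j (extAct act)).mkQ
            (TensorProduct.tensorTensorTensorComm k J J (ExteriorAlgebra k Q)
              (ExteriorAlgebra k Q) (s ⊗ₜ[k] x)))) =
        TensorProduct.map (balanced j act).mkQ (augIdeal j).mkQ
          (TensorProduct.rightComm k J J Q (s ⊗ₜ[k] ExteriorAlgebra.ιInv
            (TensorProduct.rid k _ (LinearMap.lTensor _ Coalgebra.counit x)))) := fun s x ↦ by
      induction s with
      | zero => simp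
      | add s t hs ht => simp only [TensorProduct.add_tmul, map_add, hs, ht]
      | tmul b c =>
        induction x with
        | zero => simp
        | add x y hx hy => simp only [TensorProduct.tmul_add, map_add, hx, hy]
        | tmul v w =>
          rw [TensorProduct.tensorTensorTensorComm_tmul, TensorProduct.map_tmul,
            LinearMap.lTensor_tmul, LinearMap.rTensor_tmul, projZero_mk, projOne_mk,
            LinearMap.lTensor_tmul, TensorProduct.rid_tmul, TensorProduct.rightComm_tmul,
            TensorProduct.map_tmul, map_smul, map_smul, TensorProduct.tmul_smul,
            TensorProduct.tmul_smul, map_smul, TensorProduct.smul_tmul']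
    have h := Coalgebra.lTensor_counit_comul (R := k) u
    rw [key]
    refine Eq.trans ?_ (congrArg (fun z ↦ TensorProduct.map (balanced j act).mkQ (augIdeal j).mkQ
      (TensorProduct.rightComm k J J Q (Coalgebra.comul (R := k) a ⊗ₜ[k] ExteriorAlgebra.ιInv
        (TensorProduct.rid k _ z)))) h).symm
    rw [TensorProduct.rid_tmul, one_smul]
  proj_even := by
    have : parityPart (degreePart j act) 0 ≤ LinearMap.ker (projOne j act) := by
      refine iSup_le ?_
      rintro ⟨n, hn⟩
      refine projOne_of_mem_ne j act n ?_
      rintro rfl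
      exact absurd hn (by decide)
    exact this

theorem counit_leftAct (j : K →ₐc[k] J) (act : K →ₗ[k] Q →ₗ[k] Q) (a : J)
    (x : TensorExt j act) : Coalgebra.counit (R := k) (leftAct j (extAct act) a x) =
      Coalgebra.counit (R := k) a * Coalgebra.counit (R := k) x := by
  obtain ⟨x, rfl⟩ := (balanced j (extAct act)).mkQ_surjective x
  induction x with
  | zero => simp
  | add x y hx hy => simp only [map_add, hx, hy, mul_add]
  | tmul b u =>
    rw [leftAct_mk, counit_tensorExt_mk, counit_tensorExt_mk, Bialgebra.counit_mul]
    ring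

theorem comul_leftAct (j : K →ₐc[k] J) (act : K →ₗ[k] Q →ₗ[k] Q) (a : J) (x : TensorExt j act) :
    Coalgebra.comul (R := k) (leftAct j (extAct act) a x) =
      diagAct (leftAct j (extAct act)) (leftAct j (extAct act)) a
        (Coalgebra.comul (R := k) x) := by
  obtain ⟨x, rfl⟩ := (balanced j (extAct act)).mkQ_surjective x
  induction x with
  | zero => simp
  | add x y hx hy => simp only [map_add, hx, hy]
  | tmul b u =>
    rw [leftAct_mk, comul_tensorExt_mk, comul_tensorExt_mk, Bialgebra.comul_mul, diagAct_apply]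
    generalize Coalgebra.comul (R := k) a = s
    generalize Coalgebra.comul (R := k) b = t
    generalize extComul k Q u = y
    induction s with
    | zero => simp
    | add s s' hs hs' =>
      simp only [add_mul, TensorProduct.add_tmul, map_add, hs, hs', LinearMap.add_apply]
    | tmul a a' =>
      induction t with
      | zero => simp
      | add t t' ht ht' => simp only [mul_add, TensorProduct.add_tmul, map_add, ht, ht']
      | tmul b b' =>
        induction y with
        | zero => simp
        | add y y' hy hy' => simp only [TensorProduct.tmul_add, map_add, hy, hy']
        | tmul v w =>
          rw [Algebra.TensorProduct.tmul_mul_tmul]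
          simp only [TensorProduct.tensorTensorTensorComm_tmul, TensorProduct.map_tmul,
            tensorAct_tmul, leftAct_mk]

theorem projOne_leftAct (j : K →ₐc[k] J) (act : K →ₗ[k] Q →ₗ[k] Q) (a : J) (x : TensorExt j act) :
    projOne j act (leftAct j (extAct act) a x) = leftAct j act a (projOne j act x) := by
  obtain ⟨x, rfl⟩ := (balanced j (extAct act)).mkQ_surjective x
  induction x with
  | zero => simp
  | add x y hx hy => simp only [map_add, hx, hy]
  | tmul b u => rfl

end TensorExtStructure

section SuperCoalgebraOn

variable {k C V D : Type*} [Field k] [AddCommGroup C] [Module k C] [Coalgebra k C]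
  [AddCommGroup V] [Module k V] [AddCommGroup D] [Module k D] [Coalgebra k D]

/-- In a super-coalgebra, linear maps supported in the parities `i` and `l` convolve
supercommutatively. -/
theorem map_comul_superSwap {X Y : Type*} [AddCommGroup X] [Module k X] [AddCommGroup Y]
    [Module k Y] {𝒟 : ZMod 2 → Submodule k D} [DirectSum.Decomposition 𝒟] (h : SuperCoalgebra 𝒟)
    (i l : ZMod 2) (p : D →ₗ[k] X) (q : D →ₗ[k] Y) (hp : ∀ r, r ≠ i → ∀ x ∈ 𝒟 r, p x = 0)
    (hq : ∀ r, r ≠ l → ∀ x ∈ 𝒟 r, q x = 0) (x : D) :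
    TensorProduct.comm k X Y (TensorProduct.map p q (Coalgebra.comul (R := k) x)) =
      (-1 : ℤˣ) ^ (l * i) • TensorProduct.map q p (Coalgebra.comul (R := k) x) := by
  have key : ∀ t : D ⊗[k] D, TensorProduct.map q p (superSwap 𝒟 t) =
      (-1 : ℤˣ) ^ (l * i) • TensorProduct.comm k X Y (TensorProduct.map p q t) := fun t ↦ by
    induction t with
    | zero => simp
    | add s t hs ht => simp only [map_add, hs, ht, smul_add]
    | tmul v w =>
      induction v using DirectSum.Decomposition.inductionOn 𝒟 with
      | zero => simp
      | add a b ha hb => simp only [TensorProduct.add_tmul, map_add, smul_add, ha, hb]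
      | @homogeneous r v =>
        induction w using DirectSum.Decomposition.inductionOn 𝒟 with
        | zero => simp
        | add a b ha hb => simp only [TensorProduct.tmul_add, map_add, smul_add, ha, hb]
        | @homogeneous r' w =>
          obtain ⟨v, hv⟩ := v
          obtain ⟨w, hw⟩ := w
          rw [superSwap_tmul 𝒟 r r' v w hv hw, Units.smul_def, Units.smul_def, map_zsmul,
            TensorProduct.map_tmul, TensorProduct.map_tmul, TensorProduct.comm_tmul]
          by_cases h1 : r = i
          · by_cases h2 : r' = l
            · subst h1 h2
              rfl
            · rw [hq r' h2 w hw]; simp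
          · rw [hp r h1 v hv]; simp
  have h2 := key (Coalgebra.comul (R := k) x)
  rw [h.superSwap_comul] at h2
  rw [h2, smul_smul, ← uzpow_add, CharTwo.add_self_eq_zero, uzpow_zero, one_smul]

variable {ρ : V →ₗ[k] V ⊗[k] C} {𝒟 : ZMod 2 → Submodule k D} [DirectSum.Decomposition 𝒟]
  {ω : D →ₗ[k] C} {π : D →ₗ[k] V}

theorem IsSuperCoalgebraOn.proj_of_ne (h : IsSuperCoalgebraOn ρ 𝒟 ω π) (r : ZMod 2) (hr : r ≠ 1)
    (x : D) (hx : x ∈ 𝒟 r) : π x = 0 := by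
  have e : ∀ r : ZMod 2, r ≠ 1 → r = 0 := by decide
  exact h.proj_even x (e r hr ▸ hx)

theorem IsSuperCoalgebraOn.map_of_ne (h : IsSuperCoalgebraOn ρ 𝒟 ω π) (r : ZMod 2) (hr : r ≠ 0)
    (x : D) (hx : x ∈ 𝒟 r) : ω x = 0 := by
  have e : ∀ r : ZMod 2, r ≠ 0 → r = 1 := by decide
  exact h.map_odd x (e r hr ▸ hx)

/-- As `ω` is even, it is central for the convolution. -/
theorem IsSuperCoalgebraOn.comm_map (h : IsSuperCoalgebraOn ρ 𝒟 ω π) {X : Type*} [AddCommGroup X]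
    [Module k X] (p : D →ₗ[k] X) (x : D) :
    TensorProduct.comm k C X (TensorProduct.map ω p (Coalgebra.comul (R := k) x)) =
      TensorProduct.map p ω (Coalgebra.comul (R := k) x) := by
  have key : ∀ t : D ⊗[k] D, TensorProduct.map p ω (superSwap 𝒟 t) =
      TensorProduct.comm k C X (TensorProduct.map ω p t) := fun t ↦ by
    induction t with
    | zero => simp
    | add s t hs ht => simp only [map_add, hs, ht]
    | tmul v w =>
      induction v using DirectSum.Decomposition.inductionOn 𝒟 with
      | zero => simp
      | add a b ha hb => simp only [TensorProduct.add_tmul, map_add, ha, hb]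
      | @homogeneous r v =>
        induction w using DirectSum.Decomposition.inductionOn 𝒟 with
        | zero => simp
        | add a b ha hb => simp only [TensorProduct.tmul_add, map_add, ha, hb]
        | @homogeneous r' w =>
          obtain ⟨v, hv⟩ := v
          obtain ⟨w, hw⟩ := w
          rw [superSwap_tmul 𝒟 r r' v w hv hw, Units.smul_def, map_zsmul,
            TensorProduct.map_tmul, TensorProduct.map_tmul, TensorProduct.comm_tmul]
          by_cases h1 : r = 0
          · subst h1
            simp
          · rw [h.map_of_ne r h1 v hv]; simp
  rw [← key, h.superCoalgebra.superSwap_comul]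

theorem IsSuperCoalgebraOn.conv_comm (h : IsSuperCoalgebraOn ρ 𝒟 ω π) (g : Module.Dual k C)
    (f : Module.Dual k V) : dualConv ω g * dualConv π f = dualConv π f * dualConv ω g := by
  refine WithConv.ofConv_injective (LinearMap.ext fun x ↦ ?_)
  refine (convMul_tmul_apply _ _ x).trans (Eq.trans ?_ (convMul_tmul_apply _ _ x).symm)
  have h1 := congrArg (fun t ↦ LinearMap.mul' k k (TensorProduct.map f g t)) (h.comm_map π x)
  refine Eq.trans ?_ (h1.trans ?_)
  · generalize Coalgebra.comul (R := k) x = t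
    induction t with
    | zero => simp
    | add s t hs ht => simp only [map_add, hs, ht]
    | tmul v w => exact mul_comm _ _
  · generalize Coalgebra.comul (R := k) x = t
    induction t with
    | zero => simp
    | add s t hs ht => simp only [map_add, hs, ht]
    | tmul v w => rfl

theorem IsSuperCoalgebraOn.conv_anticomm (h : IsSuperCoalgebraOn ρ 𝒟 ω π)
    (f g : Module.Dual k V) : dualConv π f * dualConv π g = -(dualConv π g * dualConv π f) := by
  refine WithConv.ofConv_injective (LinearMap.ext fun x ↦ ?_)
  refine (convMul_tmul_apply _ _ x).trans (Eq.trans ?_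
    (congrArg Neg.neg (convMul_tmul_apply _ _ x)).symm)
  have h1 := congrArg (fun t ↦ LinearMap.mul' k k (TensorProduct.map g f t))
    (map_comul_superSwap h.superCoalgebra 1 1 π π h.proj_of_ne h.proj_of_ne x)
  rw [mul_one, uzpow_one, Units.smul_def, Units.val_neg, Units.val_one, neg_smul, one_smul] at h1
  refine Eq.trans ?_ (h1.trans ?_)
  · generalize Coalgebra.comul (R := k) x = t
    induction t with
    | zero => simp
    | add s t hs ht => simp only [map_add, hs, ht]
    | tmul v w => exact mul_comm _ _
  · rw [map_neg, map_neg]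
    congr 1
    generalize Coalgebra.comul (R := k) x = t
    induction t with
    | zero => simp
    | add s t hs ht => simp only [map_add, hs, ht]
    | tmul v w => rfl

end SuperCoalgebraOn

/-! ### Bijectivity of the canonical map -/

section SuperCoalgebraOnCanonical

variable {k C V D : Type*} [Field k] [AddCommGroup C] [Module k C] [Coalgebra k C]
  [AddCommGroup V] [Module k V] [AddCommGroup D] [Module k D] [Coalgebra k D]
  {ρ : V →ₗ[k] V ⊗[k] C} {𝒟 : ZMod 2 → Submodule k D} [DirectSum.Decomposition 𝒟]
  {ω : D →ₗ[k] C} {π : D →ₗ[k] V}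

theorem IsSuperCoalgebraOn.coactAt_canonicalMap (h : IsSuperCoalgebraOn ρ 𝒟 ω π) (n : ℕ)
    (i : Fin n) (x : D) : TensorProduct.map (canonicalMap π n) ω (Coalgebra.comul (R := k) x) =
      coactAt ρ i (canonicalMap π n x) :=
  SuperFormal.coactAt_canonicalMap ρ ω π h.colinear h.conv_comm n i x

theorem IsSuperCoalgebraOn.comm_coactAt_canonicalMap (h : IsSuperCoalgebraOn ρ 𝒟 ω π) (n : ℕ)
    (i : Fin n) (x : D) : TensorProduct.map ω (canonicalMap π n) (Coalgebra.comul (R := k) x) =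
      TensorProduct.comm k _ _ (coactAt ρ i (canonicalMap π n x)) := by
  rw [← h.coactAt_canonicalMap, ← h.comm_map, TensorProduct.comm_comm]

theorem IsSuperCoalgebraOn.canonicalMap_mem [NeZero (2 : k)] (h : IsSuperCoalgebraOn ρ 𝒟 ω π)
    (n : ℕ) (x : D) : canonicalMap π n x ∈ cofreePart ρ n :=
  canonicalMap_mem_cofreePart ρ ω π h.colinear h.conv_comm h.conv_anticomm n x

theorem IsSuperCoalgebraOn.canonicalMap_of_ne (h : IsSuperCoalgebraOn ρ 𝒟 ω π) (n : ℕ)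
    (i : ZMod 2) (hi : i ≠ n) (x : D) (hx : x ∈ 𝒟 i) : canonicalMap π n x = 0 := by
  refine canonicalMap_eq_zero_of_mem 𝒟 h.superCoalgebra.comul_mem (fun i hi x hx ↦ ?_) π
    h.proj_of_ne n i hi x hx
  have e : ∀ r : ZMod 2, r ≠ 0 → r = 1 := by decide
  exact h.superCoalgebra.counit_odd x (e i hi ▸ hx)

end SuperCoalgebraOnCanonical

section Unit

variable {k J K M : Type*} [Field k] [Ring J] [HopfAlgebra k J] [Ring K] [HopfAlgebra k K]
  [AddCommGroup M] [Module k M]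

/-- The map `m ↦ 1 ⊗ m` from `M` to `J ⊗_K M`. -/
noncomputable def oneTmul (j : K →ₐc[k] J) (act : K →ₗ[k] M →ₗ[k] M) : M →ₗ[k] TensorOver j act :=
  (balanced j act).mkQ ∘ₗ TensorProduct.mk k J M 1

theorem oneTmul_apply (j : K →ₐc[k] J) (act : K →ₗ[k] M →ₗ[k] M) (m : M) :
    oneTmul j act m = (balanced j act).mkQ (1 ⊗ₜ m) := rfl

theorem oneTmul_act (j : K →ₐc[k] J) (act : K →ₗ[k] M →ₗ[k] M) (c : K) (m : M) :
    oneTmul j act (act c m) = leftAct j act (j c) (oneTmul j act m) := by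
  rw [oneTmul_apply, oneTmul_apply, leftAct_mk, ← mk_balanced, one_mul, mul_one]

theorem leftAct_oneTmul (j : K →ₐc[k] J) (act : K →ₗ[k] M →ₗ[k] M) (a : J) (m : M) :
    leftAct j act a (oneTmul j act m) = (balanced j act).mkQ (a ⊗ₜ m) := by
  rw [oneTmul_apply, leftAct_mk, mul_one]

theorem oneTmul_injective [Coalgebra.IsCocomm k J] (j : K →ₐc[k] J) (hj : Function.Injective j)
    {act : K →ₗ[k] M →ₗ[k] M} (h : IsAction act) : Function.Injective (oneTmul j act) :=
  (injective_iff_map_eq_zero _).mpr fun m hm ↦ one_tmul_injective j hj h m hm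

end Unit

section Iso

-- The additive monoid of the quotient module `J ⊗_K M` is not syntactically that of its additive
-- group, so that instance search does not find this group structure.
noncomputable instance tensorPowerAddCommGroup {k J K M : Type*} [Field k] [Ring J] [HopfAlgebra k J]
    [Ring K] [HopfAlgebra k K] [AddCommGroup M] [Module k M] (j : K →ₐc[k] J)
    (act : K →ₗ[k] M →ₗ[k] M) (n : ℕ) : AddCommGroup (⨂[k]^n (TensorOver j act)) :=
  Module.addCommMonoidToAddCommGroup k

variable {k J K Q : Type*} [Field k] [NeZero (2 : k)] [Ring J] [HopfAlgebra k J]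
  [Coalgebra.IsCocomm k J] [Ring K] [HopfAlgebra k K] [Coalgebra.IsCocomm k K]
  [AddCommGroup Q] [Module k Q]

omit [Coalgebra.IsCocomm k J] in
theorem comul_oneTmul (j : K →ₐc[k] J) (act : K →ₗ[k] Q →ₗ[k] Q) (u : ExteriorAlgebra k Q) :
    Coalgebra.comul (R := k) (oneTmul j (extAct act) u) =
      TensorProduct.map (oneTmul j (extAct act)) (oneTmul j (extAct act)) (extComul k Q u) := by
  rw [oneTmul_apply, comul_tensorExt_mk, Bialgebra.comul_one, Algebra.TensorProduct.one_def]
  generalize extComul k Q u = x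
  induction x with
  | zero => simp
  | add x y hx hy => simp only [TensorProduct.tmul_add, map_add, hx, hy]
  | tmul v w => rfl

omit [Coalgebra.IsCocomm k J] in
theorem counit_oneTmul (j : K →ₐc[k] J) (act : K →ₗ[k] Q →ₗ[k] Q) (u : ExteriorAlgebra k Q) :
    Coalgebra.counit (R := k) (oneTmul j (extAct act) u) = Coalgebra.counit (R := k) u := by
  rw [oneTmul_apply, counit_tensorExt_mk, Bialgebra.counit_one, mul_one]

omit [Coalgebra.IsCocomm k J] in
theorem canonicalMap_oneTmul (j : K →ₐc[k] J) (act : K →ₗ[k] Q →ₗ[k] Q) (n : ℕ)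
    (u : ExteriorAlgebra k Q) : canonicalMap (projOne j act) n (oneTmul j (extAct act) u) =
      PiTensorProduct.map (fun _ ↦ oneTmul j act) (canonicalMap ExteriorAlgebra.ιInv n u) := by
  rw [canonicalMap_comp_right (oneTmul j (extAct act)) (counit_oneTmul j act)
    (comul_oneTmul j act), ← canonicalMap_comp_left]
  rfl

theorem coactAt_canonicalMap_oneTmul (j : K →ₐc[k] J) (act : K →ₗ[k] Q →ₗ[k] Q) (n : ℕ)
    (i : Fin n) (u : ExteriorAlgebra k Q) :
    coactAt (coaction j act) i (canonicalMap (projOne j act) n (oneTmul j (extAct act) u)) =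
      canonicalMap (projOne j act) n (oneTmul j (extAct act) u) ⊗ₜ (augIdeal j).mkQ 1 := by
  rw [← (isSuperCoalgebraOn_tensorExt j act).coactAt_canonicalMap, comul_oneTmul]
  have key : ∀ x : ExteriorAlgebra k Q ⊗[k] ExteriorAlgebra k Q,
      TensorProduct.map (canonicalMap (projOne j act) n) (projZero j act)
        (TensorProduct.map (oneTmul j (extAct act)) (oneTmul j (extAct act)) x) =
      canonicalMap (projOne j act) n (oneTmul j (extAct act) (TensorProduct.rid k _
        (LinearMap.lTensor _ Coalgebra.counit x))) ⊗ₜ (augIdeal j).mkQ 1 := fun x ↦ by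
    induction x with
    | zero => simp
    | add x y hx hy => simp only [map_add, hx, hy, TensorProduct.add_tmul]
    | tmul v w =>
      rw [TensorProduct.map_tmul, TensorProduct.map_tmul, LinearMap.lTensor_tmul,
        TensorProduct.rid_tmul, map_smul, map_smul, ← TensorProduct.smul_tmul', oneTmul_apply j _ w,
        projZero_mk, map_smul, TensorProduct.tmul_smul]
  rw [key]
  have h := Coalgebra.lTensor_counit_comul (R := k) u
  refine (congrArg (fun z ↦ canonicalMap (projOne j act) n (oneTmul j (extAct act)
    (TensorProduct.rid k _ z)) ⊗ₜ (augIdeal j).mkQ 1) h).trans ?_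
  rw [TensorProduct.rid_tmul, one_smul]

omit [Coalgebra.IsCocomm k J] in
theorem canonicalMap_leftAct (j : K →ₐc[k] J) (act : K →ₗ[k] Q →ₗ[k] Q) (n : ℕ) (a : J)
    (x : TensorExt j act) : canonicalMap (projOne j act) n (leftAct j (extAct act) a x) =
      powAct (leftAct j act) n a (canonicalMap (projOne j act) n x) :=
  canonicalMap_act (leftAct j (extAct act)) (leftAct j act) (projOne j act)
    (counit_leftAct j act) (comul_leftAct j act) (projOne_leftAct j act) n a x

omit [NeZero (2 : k)] [Coalgebra.IsCocomm k K] in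
theorem map_oneTmul_injective (j : K →ₐc[k] J) (hj : Function.Injective j)
    {act : K →ₗ[k] Q →ₗ[k] Q} (h : IsAction act) (n : ℕ) :
    Function.Injective (PiTensorProduct.map (R := k) (fun _ : Fin n ↦ oneTmul j act)) := by
  obtain ⟨p, hp⟩ := LinearMap.exists_leftInverse_of_injective (oneTmul j act)
    (LinearMap.ker_eq_bot.mpr (oneTmul_injective j hj h))
  refine Function.LeftInverse.injective (g := PiTensorProduct.map (fun _ ↦ p)) fun t ↦ ?_
  rw [← LinearMap.comp_apply, ← PiTensorProduct.map_comp, hp, PiTensorProduct.map_id,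
    LinearMap.id_apply]

/-- The canonical map is injective in positive degree: it is induced by the embedding of `∧ⁿ(Q)` into
the coinvariants. -/
theorem canonicalMap_injOn (j : K →ₐc[k] J) (hj : Function.Injective j)
    {act : K →ₗ[k] Q →ₗ[k] Q} (h : IsAction act) (n : ℕ) (hn : n ≠ 0) (x : TensorExt j act)
    (hx : x ∈ degreePart j act n) (hx0 : canonicalMap (projOne j act) n x = 0) : x = 0 := by
  have hα := isAction_powAct (isAction_leftAct j act) n
  let f : ⋀[k]^n Q →ₗ[k] ⨂[k]^n (TensorOver j act) :=
    canonicalMap (projOne j act) n ∘ₗ oneTmul j (extAct act) ∘ₗ (⋀[k]^n Q).subtype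
  have hf : ∀ c r, f (extPowAct act n c r) = resAct j (powAct (leftAct j act) n) c (f r) :=
    fun c r ↦ by
      rw [resAct_apply]
      exact (congrArg _ (oneTmul_act j (extAct act) c r)).trans (canonicalMap_leftAct j act n _ _)
  have hfi : Function.Injective f := by
    refine (injective_iff_map_eq_zero _).mpr fun u hu ↦ canonicalMap_ext_injective u ?_
    refine map_oneTmul_injective j hj h n ?_
    rw [map_zero, ← canonicalMap_oneTmul]
    exact hu
  have hinj := inducedMap_injective j hj hα (isAction_extPowAct h n) f hf hfi
    (ρ := coactAt (coaction j act) ⟨0, Nat.pos_of_ne_zero hn⟩)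
    (coactAt_powAct (leftAct j act) (quotAct j) (coaction_leftAct j act) _)
    fun r ↦ coactAt_canonicalMap_oneTmul j act n _ r
  obtain ⟨_, ⟨y, rfl⟩, rfl⟩ := hx
  have e : ∀ y, inducedMap j hα f hf ((balanced j (extPowAct act n)).mkQ y) =
      canonicalMap (projOne j act) n ((balanced j (extAct act)).mkQ
        (LinearMap.lTensor J (⋀[k]^n Q).subtype y)) := fun y ↦ by
    induction y with
    | zero => simp
    | add y z hy hz => simp only [map_add, hy, hz]
    | tmul a u =>
      rw [inducedMap_mk, LinearMap.lTensor_tmul, ← leftAct_oneTmul, canonicalMap_leftAct]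
      rfl
  have h0 : (balanced j (extPowAct act n)).mkQ y = 0 := hinj (by rw [e, hx0, map_zero])
  have h1 := congrArg (tensorOverMap j (⋀[k]^n Q).subtype (actM := extPowAct act n)
    (actN := extAct act)
    (fun c u ↦ coe_extPowAct act n c u)) h0
  exact (tensorOverMap_mk j _ _ y).symm.trans (h1.trans (map_zero _))

/-- The canonical map is surjective in positive degree: the cotensor power is generated by its
coinvariants, which are the antisymmetric tensors in `Q`. -/
theorem exists_canonicalMap_eq (j : K →ₐc[k] J) (hj : Function.Injective j)
    {act : K →ₗ[k] Q →ₗ[k] Q} (h : IsAction act) (n : ℕ) (hn : n ≠ 0)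
    (t : ⨂[k]^n (TensorOver j act)) (ht : t ∈ cofreePart (coaction j act) n) :
    ∃ x ∈ degreePart j act n, canonicalMap (projOne j act) n x = t := by
  let i : Fin n := ⟨0, Nat.pos_of_ne_zero hn⟩
  have hα := isAction_powAct (isAction_leftAct j act) n
  obtain ⟨p, hp⟩ := LinearMap.exists_leftInverse_of_injective (oneTmul j act)
    (LinearMap.ker_eq_bot.mpr (oneTmul_injective j hj h))
  -- the coinvariants come from the exterior power
  have hco : ∀ m ∈ cofreePart (coaction j act) n ⊓ LinearMap.ker (coinvDiff j
      (coactAt (coaction j act) i)), ∃ u : ⋀[k]^n Q,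
      canonicalMap (projOne j act) n (oneTmul j (extAct act) u) = m := by
    rintro m ⟨hm, hm'⟩
    have hmi := (mem_ker_coinvDiff j _ m).mp hm'
    have h1 : PiTensorProduct.map (fun _ ↦ oneTmul j act ∘ₗ p) m = m := by
      refine map_eq_of_coinvariant (coaction j act) ((augIdeal j).mkQ 1) _ (fun v hv ↦ ?_) m
        fun l ↦ by rw [hm.1 l i, hmi]
      obtain ⟨q, rfl⟩ := exists_one_tmul_of_coinvariant j hj h v hv
      rw [← oneTmul_apply, LinearMap.comp_apply]
      exact congrArg _ (LinearMap.congr_fun hp q)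
    obtain ⟨u, hu⟩ := exists_canonicalMap_ext (PiTensorProduct.map (fun _ ↦ p) m) fun σ ↦ by
      have h2 := congrArg (PiTensorProduct.map (fun _ ↦ p)) (hm.2 σ)
      rw [map_smul] at h2
      refine Eq.trans ?_ h2
      congr 1
      exact (PiTensorProduct.map_reindex (fun _ : Fin n ↦ p) σ m).symm
    refine ⟨u, ?_⟩
    rw [canonicalMap_oneTmul, hu, ← LinearMap.comp_apply, ← PiTensorProduct.map_comp, h1]
  obtain ⟨y, rfl⟩ := exists_eq_lift_coinvariants_of_mem j hj hα
    (isRightComodule_coactAt (isRightComodule_coaction j act) i)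
    (coactAt_powAct (leftAct j act) (quotAct j) (coaction_leftAct j act) i)
    (cofreePart (coaction j act) n)
    (fun a t ↦ powAct_mem_cofreePart (leftAct j act) (quotAct j) (coaction_leftAct j act) a t)
    (coactAt_mem_cofreePart (isRightComodule_coaction j act) i) t ht
  clear ht
  induction y with
  | zero => exact ⟨0, zero_mem _, by simp⟩
  | add y z hy hz =>
    obtain ⟨x, hx, hx'⟩ := hy
    obtain ⟨x₂, hx₂, hx₂'⟩ := hz
    exact ⟨x + x₂, add_mem hx hx₂, by rw [map_add, hx', hx₂', map_add, map_add]⟩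
  | tmul a m =>
    obtain ⟨u, hu⟩ := hco m m.2
    refine ⟨_, mk_mem_degreePart j act n a u u.2, ?_⟩
    rw [← leftAct_oneTmul, canonicalMap_leftAct, hu]
    rfl

/-- The section `a ↦ a ⊗ 1` of the projection onto `J // K`. -/
noncomputable def zeroSection (j : K →ₐc[k] J) (act : K →ₗ[k] Q →ₗ[k] Q) :
    HopfQuotient j →ₗ[k] TensorExt j act :=
  (augIdeal j).liftQ ((balanced j (extAct act)).mkQ ∘ₗ
    (TensorProduct.mk k J (ExteriorAlgebra k Q)).flip 1) (by
      refine Submodule.span_le.mpr ?_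
      rintro _ ⟨a, c, hc, rfl⟩
      change (balanced j (extAct act)).mkQ ((a * j c) ⊗ₜ 1) = 0
      have := extAct_algebraMap act c 1
      rw [map_one, hc, zero_smul] at this
      rw [mk_balanced, this, TensorProduct.tmul_zero, map_zero])

omit [Coalgebra.IsCocomm k J] in
theorem zeroSection_mk (j : K →ₐc[k] J) (act : K →ₗ[k] Q →ₗ[k] Q) (a : J) :
    zeroSection j act ((augIdeal j).mkQ a) = (balanced j (extAct act)).mkQ (a ⊗ₜ 1) := rfl

omit [Coalgebra.IsCocomm k J] in
theorem zeroSection_mem (j : K →ₐc[k] J) (act : K →ₗ[k] Q →ₗ[k] Q) (y : HopfQuotient j) :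
    zeroSection j act y ∈ degreePart j act 0 := by
  obtain ⟨a, rfl⟩ := Submodule.mkQ_surjective _ y
  exact mk_mem_degreePart j act 0 a 1 (SetLike.GradedOne.one_mem (A := fun i : ℕ ↦ ⋀[k]^i Q))

omit [Coalgebra.IsCocomm k J] in
theorem projZero_zeroSection (j : K →ₐc[k] J) (act : K →ₗ[k] Q →ₗ[k] Q) (y : HopfQuotient j) :
    projZero j act (zeroSection j act y) = y := by
  obtain ⟨a, rfl⟩ := Submodule.mkQ_surjective _ y
  rw [zeroSection_mk, projZero_mk, counit_ext, map_one, one_smul]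

omit [Coalgebra.IsCocomm k J] in
theorem zeroSection_projZero (j : K →ₐc[k] J) (act : K →ₗ[k] Q →ₗ[k] Q) (x : TensorExt j act)
    (hx : x ∈ degreePart j act 0) : zeroSection j act (projZero j act x) = x := by
  have : degreePart j act 0 ≤ LinearMap.ker (zeroSection j act ∘ₗ projZero j act - LinearMap.id) := by
    refine degreePart_induction j act 0 _ fun a u hu ↦ ?_
    rw [LinearMap.mem_ker, LinearMap.sub_apply, sub_eq_zero, LinearMap.comp_apply, projZero_mk,
      zeroSection_mk, LinearMap.id_apply]
    obtain ⟨r, rfl⟩ : ∃ r, algebraMap k (ExteriorAlgebra k Q) r = u := by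
      have hu' : u ∈ LinearMap.range (ExteriorAlgebra.ι k (M := Q)) ^ 0 := hu
      rw [pow_zero] at hu'
      exact Submodule.mem_one.mp hu'
    rw [counit_ext, AlgHom.commutes, Algebra.algebraMap_eq_smul_one (A := ExteriorAlgebra k Q),
      TensorProduct.smul_tmul]
    rfl
  simpa [sub_eq_zero] using this hx

/-- The canonical map from `J ⊗_K ∧(Q)` to `coF(J ⊗_K Q)` is an isomorphism, for an arbitrary
`K`-module `Q`. -/
theorem isCanonicalIso_tensorExt (j : K →ₐc[k] J) (hj : Function.Injective j)
    {act : K →ₗ[k] Q →ₗ[k] Q} (h : IsAction act) :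
    IsCanonicalIso (coaction j act) (degreePart j act) (projZero j act) (projOne j act) where
  bijOn_zero := ⟨fun _ _ ↦ Set.mem_univ _,
    Set.LeftInvOn.injOn (f₁' := zeroSection j act) fun x hx ↦ zeroSection_projZero j act x hx,
    fun y _ ↦ ⟨zeroSection j act y, zeroSection_mem j act y, projZero_zeroSection j act y⟩⟩
  zero_of_ne n hn x hx := projZero_of_mem_ne j act n hn hx
  bijOn n hn := ⟨fun x _ ↦ (isSuperCoalgebraOn_tensorExt j act).canonicalMap_mem n x,
    fun x hx y hy hxy ↦ sub_eq_zero.mp (canonicalMap_injOn j hj h n hn _ (sub_mem hx hy)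
      (by rw [map_sub, hxy, sub_self])),
    fun t ht ↦ exists_canonicalMap_eq j hj h n hn t ht⟩
  canonicalMap_of_ne n _ m hmn x hx := canonicalMap_eq_zero_of_mem (degreePart j act)
    (isGradedCoalgebra_tensorExt j act).comul_mem (isGradedCoalgebra_tensorExt j act).counit_eq_zero
    (projOne j act) (fun i hi y hy ↦ projOne_of_mem_ne j act i hi hy) n m (by simpa using hmn) x hx
  counit_zero x := LinearMap.congr_fun (isSuperCoalgebraOn_tensorExt j act).counit_comp x
  comul_zero_zero x := LinearMap.congr_fun (isSuperCoalgebraOn_tensorExt j act).map_comp_comul x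
  comul m n _ _ x := mulEquiv_canonicalMap (projOne j act) m n x
  comul_right n i x := (isSuperCoalgebraOn_tensorExt j act).coactAt_canonicalMap n i x
  comul_left n i x := (isSuperCoalgebraOn_tensorExt j act).comm_coactAt_canonicalMap n i x

end Iso

/-! ### Cofreeness -/

section Separation

variable {k D : Type*} [Field k] [AddCommGroup D] [Module k D]

/-- If a set of linear forms separates the points of `D`, then the products of two of them separate
the points of `D ⊗ D`. -/
theorem eq_zero_of_forall_map_dual {S : Set (Module.Dual k D)}
    (hS : ∀ d, (∀ φ ∈ S, φ d = 0) → d = 0) (t : D ⊗[k] D)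
    (ht : ∀ φ ∈ S, ∀ ψ ∈ S, TensorProduct.map φ ψ t = 0) : t = 0 := by
  have h1 : ∀ φ ∈ S, LinearMap.rTensor D φ t = 0 := fun φ hφ ↦ by
    refine (TensorProduct.lid k D).injective ?_
    rw [map_zero]
    refine hS _ fun ψ hψ ↦ ?_
    have h2 := congrArg (TensorProduct.lid k k) (ht φ hφ ψ hψ)
    rw [map_zero] at h2
    rw [← h2]
    clear h2 ht
    induction t with
    | zero => simp
    | add x y hx hy => simp only [map_add, hx, hy]
    | tmul x y => simp
  refine eq_zero_of_forall_lTensor t fun χ ↦ ?_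
  refine hS _ fun φ hφ ↦ ?_
  have h2 := congrArg (fun z ↦ χ (TensorProduct.lid k D z)) (h1 φ hφ)
  simp only [map_zero] at h2
  rw [← h2]
  clear h2 ht h1
  induction t with
  | zero => simp
  | add x y hx hy => simp only [map_add, hx, hy]
  | tmul x y => simp [mul_comm]

/-- Lifting along a linear map that restricts to a bijection between submodules. -/
theorem exists_lift_of_bijOn {E X : Type*} [AddCommGroup E] [Module k E] [AddCommMonoid X]
    [Module k X] (f : D →ₗ[k] X) (W : Submodule k D) (T : Submodule k X)
    (hf : Set.BijOn f W T) (e : E →ₗ[k] X) (he : ∀ x, e x ∈ T) :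
    ∃ g : E →ₗ[k] D, ∀ x, g x ∈ W ∧ f (g x) = e x := by
  choose g hg hfg using fun x ↦ hf.surjOn (he x)
  refine ⟨{ toFun := g, map_add' := fun x y ↦ ?_, map_smul' := fun r x ↦ ?_ },
    fun x ↦ ⟨hg x, hfg x⟩⟩
  · refine hf.injOn (hg _) (add_mem (hg x) (hg y)) ?_
    rw [hfg, map_add, map_add, hfg, hfg]
  · refine hf.injOn (hg _) (W.smul_mem r (hg x)) ?_
    rw [hfg, RingHom.id_apply, map_smul, map_smul, hfg]

/-- The sum of a pointwise finite family of linear maps. -/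
noncomputable def finsumLinear {E : Type*} [AddCommGroup E] [Module k E] (g : ℕ → E →ₗ[k] D)
    (hg : ∀ x, (Function.support fun n ↦ g n x).Finite) : E →ₗ[k] D where
  toFun x := ∑ᶠ n, g n x
  map_add' x y := by simp only [map_add]; exact finsum_add_distrib (hg x) (hg y)
  map_smul' r x := by simp only [map_smul, RingHom.id_apply]; exact (smul_finsum' r (hg x)).symm

theorem finsumLinear_apply_eq {E X : Type*} [AddCommGroup E] [Module k E] [AddCommMonoid X]
    [Module k X] (g : ℕ → E →ₗ[k] D) (hg : ∀ x, (Function.support fun n ↦ g n x).Finite)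
    (f : D →ₗ[k] X) (n : ℕ) (x : E) (hf : ∀ m, m ≠ n → f (g m x) = 0) :
    f (finsumLinear g hg x) = f (g n x) := by
  change f (∑ᶠ n, g n x) = _
  have := f.toAddMonoidHom.map_finsum (hg x)
  refine this.trans (finsum_eq_single _ n hf)

end Separation

section Cofree

variable {k C V D E : Type*} [Field k] [AddCommGroup C] [Module k C]
  [Coalgebra k C] [AddCommGroup V] [Module k V] [AddCommGroup D] [Module k D] [Coalgebra k D]
  [AddCommGroup E] [Module k E] [Coalgebra k E]
  {ρ : V →ₗ[k] V ⊗[k] C} {𝒟 : ℕ → Submodule k D} {ω : D →ₗ[k] C} {π : D →ₗ[k] V}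

/-- The components of the canonical map separate the points. -/
theorem IsCanonicalIso.eq_zero (h : IsCanonicalIso ρ 𝒟 ω π) (h𝒟 : ⨆ n, 𝒟 n = ⊤) (d : D)
    (h0 : ω d = 0) (hn : ∀ n, n ≠ 0 → canonicalMap π n d = 0) : d = 0 := by
  have hd : d ∈ ⨆ n, 𝒟 n := h𝒟 ▸ Submodule.mem_top
  obtain ⟨f, hf, rfl⟩ := (Submodule.mem_iSup_iff_exists_finsupp _ _).mp hd
  have hz : ∀ n, f n = 0 := fun n ↦ by
    by_cases hn0 : n = 0
    · subst hn0
      refine h.bijOn_zero.injOn (hf 0) (zero_mem _) ?_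
      rw [map_zero ω, ← h0, map_finsuppSum, Finsupp.sum,
        Finset.sum_eq_single 0 (fun m _ hm ↦ h.zero_of_ne m hm _ (hf m))]
      intro h1
      rw [Finsupp.notMem_support_iff.mp h1, map_zero]
    · refine (h.bijOn n hn0).injOn (hf n) (zero_mem _) ?_
      rw [map_zero, ← hn n hn0, map_finsuppSum, Finsupp.sum,
        Finset.sum_eq_single n (fun m _ hm ↦ h.canonicalMap_of_ne n hn0 m hm _ (hf m))]
      intro h1
      rw [Finsupp.notMem_support_iff.mp h1, map_zero]
  exact Finset.sum_eq_zero fun n _ ↦ hz n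

/-- The linear forms factoring through a component of the canonical map. -/
def componentForms (ω : D →ₗ[k] C) (π : D →ₗ[k] V) : Set (Module.Dual k D) :=
  {φ | (∃ g : Module.Dual k C, φ = g ∘ₗ ω) ∨
    ∃ n, n ≠ 0 ∧ ∃ f : Module.Dual k (⨂[k]^n V), φ = f ∘ₗ canonicalMap π n}

theorem IsCanonicalIso.eq_zero_of_componentForms (h : IsCanonicalIso ρ 𝒟 ω π)
    (h𝒟 : ⨆ n, 𝒟 n = ⊤) (d : D) (hd : ∀ φ ∈ componentForms ω π, φ d = 0) : d = 0 :=
  h.eq_zero h𝒟 d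
    ((Module.forall_dual_apply_eq_zero_iff k _).mp fun g ↦ hd _ (Or.inl ⟨g, rfl⟩))
    fun n hn ↦ (Module.forall_dual_apply_eq_zero_iff k _).mp fun f ↦
      hd _ (Or.inr ⟨n, hn, f, rfl⟩)

theorem eq_of_canonicalMap_one {π : D →ₗ[k] V} {π' : E →ₗ[k] V} {d : D} {x : E}
    (h : canonicalMap π 1 d = canonicalMap π' 1 x) : π d = π' x := by
  rw [← sub_eq_zero]
  refine (Module.forall_dual_apply_eq_zero_iff k _).mp fun f ↦ ?_
  have h1 := congrArg (tensorEval fun _ ↦ f) h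
  rw [tensorEval_canonicalMap, tensorEval_canonicalMap, List.ofFn_succ, List.ofFn_zero,
    List.prod_singleton, List.ofFn_succ, List.ofFn_zero, List.prod_singleton] at h1
  rw [map_sub, sub_eq_zero]
  exact h1

variable [NeZero (2 : k)]

/-- The linear map into the co-free super-coalgebra with given components. -/
theorem IsCanonicalIso.exists_linearMap (h : IsCanonicalIso ρ 𝒟 ω π)
    {ℰ : ZMod 2 → Submodule k E} [DirectSum.Decomposition ℰ] {ωE : E →ₗ[k] C} {πE : E →ₗ[k] V}
    (hE : IsSuperCoalgebraOn ρ ℰ ωE πE) :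
    ∃ G : E →ₗ[k] D, (∀ x, ω (G x) = ωE x) ∧
      (∀ n, n ≠ 0 → ∀ x, canonicalMap π n (G x) = canonicalMap πE n x) ∧
      ∀ i, ∀ x ∈ ℰ i, G x ∈ parityPart 𝒟 i := by
  obtain ⟨g₀, hg₀⟩ := exists_lift_of_bijOn ω (𝒟 0) ⊤ h.bijOn_zero ωE fun _ ↦ trivial
  choose g' hg' using fun n : {n : ℕ // n ≠ 0} ↦ exists_lift_of_bijOn (canonicalMap π n.1) (𝒟 n.1)
    (cofreePart ρ n.1) (h.bijOn n.1 n.2) (canonicalMap πE n.1) (hE.canonicalMap_mem n.1)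
  let g : ℕ → E →ₗ[k] D := fun n ↦ if hn : n = 0 then g₀ else g' ⟨n, hn⟩
  have g0 : g 0 = g₀ := rfl
  have gn : ∀ n (hn : n ≠ 0), g n = g' ⟨n, hn⟩ := fun n hn ↦ dif_neg hn
  have hgm : ∀ n x, g n x ∈ 𝒟 n := fun n x ↦ by
    by_cases hn : n = 0
    · subst hn; exact (hg₀ x).1
    · rw [gn n hn]; exact (hg' ⟨n, hn⟩ x).1
  have hgc : ∀ n, n ≠ 0 → ∀ x, canonicalMap π n (g n x) = canonicalMap πE n x := fun n hn x ↦ by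
    rw [gn n hn]; exact (hg' ⟨n, hn⟩ x).2
  have hgz : ∀ n, n ≠ 0 → ∀ x, canonicalMap πE n x = 0 → g n x = 0 := fun n hn x hx ↦
    (h.bijOn n hn).injOn (hgm n x) (zero_mem _) (by rw [hgc n hn, hx, map_zero])
  have hfin : ∀ x, (Function.support fun n ↦ g n x).Finite := fun x ↦ by
    obtain ⟨N, hN⟩ := exists_canonicalMap_eq_zero πE hE.conv_anticomm x
    refine (Set.finite_lt_nat (N + 1)).subset fun n hn ↦ ?_
    by_contra hlt
    have hlt' : N + 1 ≤ n := not_lt.mp hlt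
    exact hn (hgz n (by omega) x (hN n (by omega)))
  refine ⟨finsumLinear g hfin, fun x ↦ ?_, fun n hn x ↦ ?_, fun i x hx ↦ ?_⟩
  · rw [finsumLinear_apply_eq g hfin ω 0 x fun m hm ↦ h.zero_of_ne m hm _ (hgm m x), g0]
    exact (hg₀ x).2
  · rw [finsumLinear_apply_eq g hfin (canonicalMap π n) n x
      fun m hm ↦ h.canonicalMap_of_ne n hn m hm _ (hgm m x), hgc n hn]
  -- the component of degree `n` vanishes on elements whose parity is not that of `n`
  · refine finsum_induction (· ∈ parityPart 𝒟 i) (zero_mem _) (fun _ _ ↦ add_mem) fun n ↦ ?_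
    by_cases hin : (n : ZMod 2) = i
    · exact Submodule.mem_iSup_of_mem (⟨n, hin⟩ : {n : ℕ // (n : ZMod 2) = i}) (hgm n x)
    · have : g n x = 0 := by
        by_cases hn : n = 0
        · subst hn
          refine h.bijOn_zero.injOn (hgm 0 x) (zero_mem _) ?_
          rw [map_zero, g0, (hg₀ x).2, hE.map_of_ne i (fun hi ↦ hin (by simp [hi])) x hx]
        · exact hgz n hn x (hE.canonicalMap_of_ne n i (Ne.symm hin) x hx)
      rw [this]
      exact zero_mem _

omit [NeZero (2 : k)] in
theorem map_dual_sub_eq_zero {X Y : Type*} [AddCommGroup X] [Module k X] [AddCommGroup Y]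
    [Module k Y] (G : E →ₗ[k] D) (p : D →ₗ[k] X) (q : D →ₗ[k] Y) (φ : Module.Dual k X)
    (ψ : Module.Dual k Y) (x : E)
    (hpq : TensorProduct.map (p ∘ₗ G) (q ∘ₗ G) (Coalgebra.comul (R := k) x) =
      TensorProduct.map p q (Coalgebra.comul (R := k) (G x))) :
    TensorProduct.map (φ ∘ₗ p) (ψ ∘ₗ q) (TensorProduct.map G G (Coalgebra.comul (R := k) x) -
      Coalgebra.comul (R := k) (G x)) = 0 := by
  rw [TensorProduct.map_comp, LinearMap.comp_apply, map_sub, ← LinearMap.comp_apply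
    (TensorProduct.map p q), ← TensorProduct.map_comp, hpq, sub_self, map_zero]

omit [NeZero (2 : k)] in
/-- A linear map compatible with the components of the canonical maps is a coalgebra map. -/
theorem IsCanonicalIso.map_comul (h : IsCanonicalIso ρ 𝒟 ω π) (h𝒟 : ⨆ n, 𝒟 n = ⊤)
    {ℰ : ZMod 2 → Submodule k E} [DirectSum.Decomposition ℰ] {ωE : E →ₗ[k] C} {πE : E →ₗ[k] V}
    (hE : IsSuperCoalgebraOn ρ ℰ ωE πE) (G : E →ₗ[k] D) (hω : ∀ x, ω (G x) = ωE x)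
    (hG : ∀ n, n ≠ 0 → ∀ x, canonicalMap π n (G x) = canonicalMap πE n x) (x : E) :
    TensorProduct.map G G (Coalgebra.comul (R := k) x) = Coalgebra.comul (R := k) (G x) := by
  have hω' : ω ∘ₗ G = ωE := LinearMap.ext hω
  have hG' : ∀ n, n ≠ 0 → canonicalMap π n ∘ₗ G = canonicalMap πE n := fun n hn ↦
    LinearMap.ext (hG n hn)
  rw [← sub_eq_zero]
  -- compare the images under pairs of components, which are given by the coactions and by
  -- deconcatenation
  refine eq_zero_of_forall_map_dual (h.eq_zero_of_componentForms h𝒟) _ ?_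
  rintro φ (⟨φ, rfl⟩ | ⟨m, hm, φ, rfl⟩) ψ (⟨ψ, rfl⟩ | ⟨n, hn, ψ, rfl⟩)
  · refine map_dual_sub_eq_zero G ω ω φ ψ x ?_
    rw [hω', h.comul_zero_zero, hω]
    exact LinearMap.congr_fun hE.map_comp_comul x
  · refine map_dual_sub_eq_zero G ω (canonicalMap π n) φ ψ x ?_
    rw [hω', hG' n hn, h.comul_left n ⟨0, Nat.pos_of_ne_zero hn⟩, hG n hn]
    exact hE.comm_coactAt_canonicalMap n _ x
  · refine map_dual_sub_eq_zero G (canonicalMap π m) ω φ ψ x ?_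
    rw [hω', hG' m hm, h.comul_right m ⟨0, Nat.pos_of_ne_zero hm⟩, hG m hm]
    exact hE.coactAt_canonicalMap m _ x
  · refine map_dual_sub_eq_zero G (canonicalMap π m) (canonicalMap π n) φ ψ x ?_
    refine TensorPower.mulEquiv.injective ?_
    rw [hG' m hm, hG' n hn, h.comul m n hm hn, mulEquiv_canonicalMap, hG (m + n) (by omega)]

omit [Coalgebra k C] [NeZero (2 : k)] in
/-- Colinear coalgebra maps commute with the maps to `C`. -/
theorem IsMorphismOn.map_comp {ℰ : ZMod 2 → Submodule k E} {ωE : E →ₗ[k] C} {πE : E →ₗ[k] V}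
    {𝒟' : ZMod 2 → Submodule k D} {f : E →ₗc[k] D} (hf : IsMorphismOn ℰ ωE πE 𝒟' ω π f) (x : E) :
    ω (f x) = ωE x := by
  have h1 := congrArg (fun t ↦ TensorProduct.lid k C (LinearMap.rTensor C Coalgebra.counit t))
    (LinearMap.congr_fun hf.colinear x)
  have e1 : TensorProduct.lid k C (LinearMap.rTensor C Coalgebra.counit
      (coactionVia ω (f x))) = ω (f x) := by
    have h2 := Coalgebra.rTensor_counit_comul (R := k) (f x)
    rw [coactionVia, LinearMap.comp_apply, ← LinearMap.comp_apply (LinearMap.rTensor C _),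
      LinearMap.rTensor_comp_lTensor, ← LinearMap.lTensor_comp_rTensor, LinearMap.comp_apply, h2]
    simp
  have e2 : TensorProduct.lid k C (LinearMap.rTensor C Coalgebra.counit
      (LinearMap.rTensor C f.toLinearMap (coactionVia ωE x))) = ωE x := by
    have h2 := Coalgebra.rTensor_counit_comul (R := k) x
    rw [← LinearMap.comp_apply (LinearMap.rTensor C _), ← LinearMap.rTensor_comp, f.counit_comp,
      coactionVia, LinearMap.comp_apply, ← LinearMap.comp_apply (LinearMap.rTensor C _),
      LinearMap.rTensor_comp_lTensor, ← LinearMap.lTensor_comp_rTensor, LinearMap.comp_apply, h2]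
    simp
  exact e1.symm.trans (h1.trans e2)

/-- A graded coalgebra that the canonical map identifies with `coF(V)` is co-free. -/
theorem IsCanonicalIso.existsUnique_morphism (h : IsCanonicalIso ρ 𝒟 ω π) (h𝒟 : ⨆ n, 𝒟 n = ⊤)
    {ℰ : ZMod 2 → Submodule k E} [DirectSum.Decomposition ℰ] {ωE : E →ₗ[k] C} {πE : E →ₗ[k] V}
    (hE : IsSuperCoalgebraOn ρ ℰ ωE πE) :
    ∃! f : E →ₗc[k] D, IsMorphismOn ℰ ωE πE (parityPart 𝒟) ω π f := by
  obtain ⟨G, hω, hG, hpar⟩ := h.exists_linearMap hE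
  have hΔ := h.map_comul h𝒟 hE G hω hG
  refine ⟨{ G with
    counit_comp := LinearMap.ext fun x ↦ ?_
    map_comp_comul := LinearMap.ext hΔ }, ⟨hpar, ?_, ?_⟩, fun f hf ↦ ?_⟩
  · rw [LinearMap.comp_apply, ← h.counit_zero]
    exact (congrArg _ (hω x)).trans (LinearMap.congr_fun hE.counit_comp x)
  · refine LinearMap.ext fun x ↦ ?_
    change LinearMap.lTensor D ω (Coalgebra.comul (R := k) (G x)) =
      LinearMap.rTensor C G (LinearMap.lTensor E ωE (Coalgebra.comul (R := k) x))
    rw [← hΔ, ← (LinearMap.ext hω : ω ∘ₗ G = ωE)]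
    generalize Coalgebra.comul (R := k) x = t
    induction t with
    | zero => simp
    | add y z hy hz => simp only [map_add, hy, hz]
    | tmul y z => simp
  · refine LinearMap.ext fun x ↦ ?_
    have h1 : π (G x) = πE x := eq_of_canonicalMap_one (hG 1 one_ne_zero x)
    exact h1
  · refine CoalgHom.ext fun x ↦ ?_
    change f x = G x
    rw [← sub_eq_zero]
    refine h.eq_zero h𝒟 _ ?_ fun n hn ↦ ?_
    · rw [map_sub, hf.map_comp, hω, sub_self]
    · rw [map_sub, hG n hn, sub_eq_zero]
      refine (canonicalMap_comp_right f.toLinearMap (fun x ↦ CoalgHomClass.counit_comp_apply f x)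
        (fun x ↦ (CoalgHomClass.map_comp_comul_apply f x).symm) π n x).trans ?_
      rw [hf.proj_comp]

end Cofree

/-! ### The Hopf algebra of the even part -/

section EvenHopf

variable {k A : Type*} [Field k] [Ring A] [Algebra k A] [Coalgebra k A]
  {𝒜 : ZMod 2 → Submodule k A} [GradedAlgebra 𝒜] [HopfSuperalgebra 𝒜]

/-- The antipode is a coalgebra map on the even part. -/
theorem comul_antipode (H : HopfSubSuperalgebra 𝒜) (a : A) (ha : a ∈ H.evenPart) :
    Coalgebra.comul (R := k) (HopfSuperalgebra.antipode 𝒜 a) = TensorProduct.map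
      (HopfSuperalgebra.antipode 𝒜) (HopfSuperalgebra.antipode 𝒜)
        (Coalgebra.comul (R := k) a) := by
  let E := H.evenPart
  let Δ : A →ₐ[k] GradedTensorProduct k 𝒜 𝒜 := AlgHom.ofLinearMap
    ((GradedTensorProduct.of k 𝒜 𝒜).toLinearMap ∘ₗ Coalgebra.comul (R := k))
    (congrArg (GradedTensorProduct.of k 𝒜 𝒜) (HopfSuperalgebra.comul_one (𝒜 := 𝒜)))
    (HopfSuperalgebra.comul_mul (𝒜 := 𝒜))
  -- `Δ S` and `S ⊗ S` are both inverse to `Δ` in the convolution algebra of maps from the even part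
  -- to the graded tensor square
  let L := convPost E (GradedTensorProduct.includeLeft 𝒜 𝒜)
  let R := convPost E (GradedTensorProduct.includeRight 𝒜 𝒜)
  let D := convPost E Δ
  let i : WithConv (E →ₗ[k] A) := .toConv E.val.toLinearMap
  let S : WithConv (E →ₗ[k] A) := .toConv (HopfSuperalgebra.antipode 𝒜 ∘ₗ E.val.toLinearMap)
  have hS0 : ∀ x : E, S x ∈ 𝒜 0 := fun x ↦
    HopfSuperalgebra.antipode_mem 0 _ (H.evenPart_le_zero x x.2)
  have conv (x : E) (g h : A →ₗ[k] A) : (WithConv.toConv (g ∘ₗ E.val.toLinearMap) *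
      WithConv.toConv (h ∘ₗ E.val.toLinearMap) : WithConv (E →ₗ[k] A)) x =
      LinearMap.mul' k A (TensorProduct.map g h (Coalgebra.comul (R := k) (x : A))) := by
    rw [LinearMap.convMul_apply, ← H.map_val_comul, ← LinearMap.comp_apply (TensorProduct.map g h),
      ← TensorProduct.map_comp]
  have hiS : i * S = 1 := by
    ext x
    refine (conv x LinearMap.id _).trans ?_
    refine (HopfSuperalgebra.mul_antipode_lTensor_comul (𝒜 := 𝒜) (x : A)).trans ?_
    rw [LinearMap.convOne_apply]; rfl
  have hSi : S * i = 1 := by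
    ext x
    refine (conv x _ LinearMap.id).trans ?_
    refine (HopfSuperalgebra.mul_antipode_rTensor_comul (𝒜 := 𝒜) (x : A)).trans ?_
    rw [LinearMap.convOne_apply]; rfl
  have hDi : D i = L i * R i := by
    ext x
    rw [LinearMap.convMul_apply]
    change GradedTensorProduct.of k 𝒜 𝒜 (Coalgebra.comul (R := k) (x : A)) = _
    rw [← H.map_val_comul]
    generalize Coalgebra.comul (R := k) x = t
    induction t with
    | zero => simp
    | add x y hx hy => simp only [map_add, hx, hy]
    | tmul a b =>
      exact (GradedTensorProduct.tmul_one_mul_one_tmul (R := k) 𝒜 𝒜 (a : A) (b : A)).symm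
  have c1 : R S * L S = L S * R S := by
    have := conv_comm (L S) (R S) (1 : k)
      (fun x y ↦ include_comm 𝒜 0 0 rfl (S x) (S y) (hS0 x) (hS0 y))
    rw [one_smul] at this
    exact this.symm
  have hDS : D S = L S * R S := by
    have e1 : D S * D i = 1 := by rw [← map_mul, hSi, map_one]
    have e2 : D i * (L S * R S) = 1 := by
      rw [hDi, ← c1, mul_assoc, ← mul_assoc (R i), ← map_mul R, hiS, map_one,
        one_mul, ← map_mul, hiS, map_one]
    calc D S = D S * (D i * (L S * R S)) := by rw [e2, mul_one]
      _ = L S * R S := by rw [← mul_assoc, e1, one_mul]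
  have h := congrArg (fun g : WithConv (E →ₗ[k] GradedTensorProduct k 𝒜 𝒜) ↦ g ⟨a, ha⟩) hDS
  have h' : GradedTensorProduct.of k 𝒜 𝒜 (Coalgebra.comul (R := k)
      (HopfSuperalgebra.antipode 𝒜 a)) = (L S * R S) ⟨a, ha⟩ := h
  apply (GradedTensorProduct.of k 𝒜 𝒜).injective
  refine h'.trans ?_
  rw [LinearMap.convMul_apply]
  have e : Coalgebra.comul (R := k) a = _ := (H.map_val_comul ⟨a, ha⟩).symm
  rw [e]
  generalize Coalgebra.comul (R := k) (⟨a, ha⟩ : E) = t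
  induction t with
  | zero => simp
  | add x y hx hy => simp only [map_add, hx, hy]
  | tmul b c => exact GradedTensorProduct.tmul_one_mul_one_tmul (R := k) 𝒜 𝒜 (S b) (S c)

theorem antipode_mem_evenPart (H : HopfSubSuperalgebra 𝒜) (a : A) (ha : a ∈ H.evenPart) :
    HopfSuperalgebra.antipode 𝒜 a ∈ H.evenPart := by
  refine ⟨H.antipode_mem a ha.1, ?_⟩
  rw [comul_antipode H a ha]
  obtain ⟨t, ht⟩ := ha.2
  rw [← ht]
  clear ht
  induction t with
  | zero => simp
  | add x y hx hy => simp only [map_add]; exact add_mem hx hy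
  | tmul b c =>
    exact ⟨⟨_, H.antipode_mem _ b.2.1, HopfSuperalgebra.antipode_mem 0 _ b.2.2⟩ ⊗ₜ[k]
      ⟨_, H.antipode_mem _ c.2.1, HopfSuperalgebra.antipode_mem 0 _ c.2.2⟩, rfl⟩

/-- The antipode of the even part. -/
noncomputable def evenAntipode (H : HopfSubSuperalgebra 𝒜) : H.evenPart →ₗ[k] H.evenPart where
  toFun a := ⟨HopfSuperalgebra.antipode 𝒜 (a : A), antipode_mem_evenPart H a a.2⟩
  map_add' a b := Subtype.ext (by simp)
  map_smul' r a := Subtype.ext (by simp)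

/-- The even part of a Hopf sub-superalgebra is a Hopf algebra. -/
noncomputable instance evenPartHopfAlgebra (H : HopfSubSuperalgebra 𝒜) :
    HopfAlgebra k H.evenPart where
  toBialgebra := evenPartBialgebra H
  antipode := evenAntipode H
  mul_antipode_rTensor_comul := by
    refine LinearMap.ext fun x ↦ Subtype.ext ?_
    refine Eq.trans ?_ (HopfSuperalgebra.mul_antipode_rTensor_comul (𝒜 := 𝒜) (x : A))
    rw [← H.map_val_comul, LinearMap.comp_apply, LinearMap.comp_apply]
    generalize Coalgebra.comul (R := k) x = t
    induction t with
    | zero => simp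
    | add x y hx hy => simp only [map_add, Subalgebra.coe_add, hx, hy]
    | tmul b c => rfl
  mul_antipode_lTensor_comul := by
    refine LinearMap.ext fun x ↦ Subtype.ext ?_
    refine Eq.trans ?_ (HopfSuperalgebra.mul_antipode_lTensor_comul (𝒜 := 𝒜) (x : A))
    rw [← H.map_val_comul, LinearMap.comp_apply, LinearMap.comp_apply]
    generalize Coalgebra.comul (R := k) x = t
    induction t with
    | zero => simp
    | add x y hx hy => simp only [map_add, Subalgebra.coe_add, hx, hy]
    | tmul b c => rfl

theorem HopfSubSuperalgebra.evenIncl_injective (H : HopfSubSuperalgebra 𝒜) :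
    Function.Injective H.evenIncl := fun _ _ h ↦
  Subtype.ext (congrArg (fun x : (fullSub 𝒜).evenPart ↦ (x : A)) h)

theorem adjoint_one (v : A) : adjoint 𝒜 (1 : A) v = v := by
  have h := HopfSuperalgebra.mul_antipode_lTensor_comul (𝒜 := 𝒜) (1 : A)
  rw [HopfSuperalgebra.comul_one (𝒜 := 𝒜), HopfSuperalgebra.counit_one (𝒜 := 𝒜), map_one,
    LinearMap.lTensor_tmul, LinearMap.mul'_apply, one_mul] at h
  rw [adjoint_apply, HopfSuperalgebra.comul_one (𝒜 := 𝒜), TensorProduct.map_tmul,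
    LinearMap.mul'_apply, h, mul_one, LinearMap.mulRight_apply, one_mul]

/-- The adjoint action is multiplicative on the even part, where the antipode reverses products. -/
theorem adjoint_mul (H : HopfSubSuperalgebra 𝒜) (a b : H.evenPart) (v : A) :
    adjoint 𝒜 ((a * b : H.evenPart) : A) v = adjoint 𝒜 (a : A) (adjoint 𝒜 (b : A) v) := by
  let P : H.evenPart ⊗[k] H.evenPart →ₗ[k] A →ₗ[k] A := TensorProduct.lift
    ((LinearMap.mul k (Module.End k A)).compl₁₂ (LinearMap.mul k A ∘ₗ H.evenPart.val.toLinearMap)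
    ((LinearMap.mul k A).flip ∘ₗ HopfSuperalgebra.antipode 𝒜 ∘ₗ H.evenPart.val.toLinearMap))
  have hPt : ∀ (x y : H.evenPart) (v : A), P (x ⊗ₜ y) v =
      (x : A) * (v * HopfSuperalgebra.antipode 𝒜 (y : A)) := fun x y v ↦ rfl
  have hP : ∀ (a : H.evenPart) (v : A), adjoint 𝒜 (a : A) v =
      P (Coalgebra.comul (R := k) a) v := fun a v ↦ by
    rw [adjoint_apply, ← H.map_val_comul]
    generalize Coalgebra.comul (R := k) a = t
    induction t with
    | zero => simp
    | add x y hx hy => simp only [map_add, LinearMap.add_apply, hx, hy]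
    | tmul x y => rw [hPt]; exact mul_assoc _ _ _
  rw [hP, hP, hP, Bialgebra.comul_mul]
  generalize Coalgebra.comul (R := k) a = s
  generalize Coalgebra.comul (R := k) b = t
  induction s with
  | zero => simp
  | add x y hx hy => simp only [map_add, add_mul, LinearMap.add_apply, hx, hy]
  | tmul x y =>
    induction t with
    | zero => simp
    | add z w hz hw => simp only [map_add, mul_add, LinearMap.add_apply, hz, hw]
    | tmul z w =>
      have h : HopfSuperalgebra.antipode 𝒜 ((y * w : H.evenPart) : A) =
          HopfSuperalgebra.antipode 𝒜 (w : A) * HopfSuperalgebra.antipode 𝒜 (y : A) := by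
        have := congrArg (fun x : H.evenPart ↦ (x : A))
          (HopfAlgebra.antipode_mul_antidistrib (R := k) y w)
        exact this
      rw [Algebra.TensorProduct.tmul_mul_tmul, hPt, hPt, hPt, h]
      simp only [Subalgebra.coe_mul, mul_assoc]

theorem isAction_oddAct (H : HopfSubSuperalgebra 𝒜) : IsAction H.oddAct where
  one m := by
    obtain ⟨v, rfl⟩ := Submodule.mkQ_surjective _ m
    exact congrArg Submodule.Quotient.mk (Subtype.ext (adjoint_one (v : A)))
  mul a b m := by
    obtain ⟨v, rfl⟩ := Submodule.mkQ_surjective _ m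
    exact congrArg Submodule.Quotient.mk (Subtype.ext (adjoint_mul H a b (v : A)))

end EvenHopf

end SuperFormal

theorem proposition4p3 {k : Type u} [Field k] [NeZero (2 : k)]
    {A : Type v} [Ring A] [Algebra k A] [Coalgebra k A]
    (𝒜 : ZMod 2 → Submodule k A) [GradedAlgebra 𝒜] [SuperFormal.HopfSuperalgebra 𝒜]
    (H : SuperFormal.HopfSubSuperalgebra 𝒜) :
    Coalgebra.IsCocomm k (SuperFormal.HopfQuotient H.evenIncl) ∧
    SuperFormal.IsRightComodule (SuperFormal.coaction H.evenIncl H.oddAct) ∧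
    SuperFormal.IsGradedCoalgebra (SuperFormal.degreePart H.evenIncl H.oddAct) ∧
    SuperFormal.IsCofree.{w} (SuperFormal.coaction H.evenIncl H.oddAct)
      (SuperFormal.parityPart (SuperFormal.degreePart H.evenIncl H.oddAct))
      (SuperFormal.projZero H.evenIncl H.oddAct) (SuperFormal.projOne H.evenIncl H.oddAct) ∧
    SuperFormal.IsCanonicalIso (SuperFormal.coaction H.evenIncl H.oddAct)
      (SuperFormal.degreePart H.evenIncl H.oddAct)
      (SuperFormal.projZero H.evenIncl H.oddAct) (SuperFormal.projOne H.evenIncl H.oddAct) := by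
  have hiso := SuperFormal.isCanonicalIso_tensorExt H.evenIncl H.evenIncl_injective
    (SuperFormal.isAction_oddAct H)
  refine ⟨SuperFormal.isCocomm_hopfQuotient H.evenIncl,
    SuperFormal.isRightComodule_coaction H.evenIncl H.oddAct,
    SuperFormal.isGradedCoalgebra_tensorExt H.evenIncl H.oddAct,
    ⟨SuperFormal.isSuperCoalgebraOn_tensorExt H.evenIncl H.oddAct, ?_⟩, hiso⟩
  intro E _ _ _ ℰ _ ωE πE hE
  exact hiso.existsUnique_morphism (SuperFormal.iSup_degreePart H.evenIncl H.oddAct) hE
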